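/- Consider five-dimensional Einstein–Maxwell theory without cosmological constant and without Chern–Simons term, that is $$R_{\mu\nu}=T_{\mu\nu}-\tfrac13 g^{\rho\sigma}T_{\rho\sigma}\,g_{\mu\nu},\qquad T_{\mu\nu}=2\big(\mathcal F_{\mu\rho}\mathcal F_\nu{}^{\rho}-\tfrac14\mathcal F^2 g_{\mu\nu}\big),\qquad d\mathcal F=0,\quad d\star\mathcal F=0 .$$ A near-horizon geometry over a three-manifold $H$ is the spacetime $\mathbb R_v\times\mathbb R_r\times H$ with $$g=2\,dv\,\big(dr+r\,h+\tfrac12 r^2F\,dv\big)+\gamma,\qquad \mathcal F=d(r\Delta\,dv)+B,$$ where $\gamma$ is a Riemannian metric, $F,\Delta$ are functions, $h$ is a one-form and $B$ a two-form on $H$, all smooth. It is homogeneous if the isometries of $(H,\gamma)$ that leave $F,h,\Delta,B$ invariant act transitively on $H$; $H$ need not be compact. It is trivial if $h$, $\Delta$ and $B$ vanish identically (then $\mathcal F=0$, and the equations make $g$ flat). **Corollary.** Every homogeneous, nontrivial near-horizon geometry that solves these equations is locally isometric, Maxwell field included and with the same constants at all points, to a member of one of the following families, in coordinates $(v,r,\psi,\theta,\phi)$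 with $0<\theta<\pi$, for some choice of the sign $\pm$: (i) with real constants $(k,q)\neq(0,0)$ and $\lambda=\tfrac12k^2+2q^2$, $$g=-\lambda r^2dv^2+2\,dv\,dr+\Big(d\psi+\frac{k\cos\theta\,d\phi}{\lambda}+k\,r\,dv\Big)^2+\frac{d\theta^2+\sin^2\theta\,d\phi^2}{\lambda},\qquad \mathcal F=\pm q\,dr\wedge dv+\frac{q\sin\theta\,d\theta\wedge d\phi}{\lambda};$$ (ii) with real constants $(\Delta,q)\neq(0,0)$ and $\lambda=\Delta^2+\tfrac43q^2$, $$g=-\lambda r^2dv^2+2\,dv\,dr+\Big(d\psi+\frac{\Delta\cos\theta\,d\phi}{\lambda}\pm\tfrac{2}{\sqrt3}q\,r\,dv\Big)^2+\frac{d\theta^2+\sin^2\theta\,d\phi^2}{\lambda},\qquad \mathcal F=\tfrac{\sqrt3}{2}\Delta\,dr\wedge dv+\frac{q\sin\theta\,d\theta\wedge d\phi}{\lambda}.$$ In both families $g=\omega^2+\bar g$, where $\omega=d\psi+\cdots$ is the one-form in the large bracket, a connection of a (local) $U(1)$-bundle, and where $(\bar g,\mathcal F)$ is locally the pull-back from $\mathrm{AdS}_2\times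 S^2$, both factors of radius $\lambda^{-1/2}$, of the product metric and of $e\,\mathrm{vol}(\mathrm{AdS}_2)+q\,\mathrm{vol}(S^2)$ with $e$ the coefficient of $dr\wedge dv$ in $\mathcal F$. Special cases, up to local isometry, are: * (i) with $k=0$, $q\ne0$: the dyonic $\mathrm{AdS}_2\times S^1\times S^2$, with $\mathrm{AdS}_2$ and $S^2$ of radius $1/(\sqrt2|q|)$, a circle of any radius, and $\mathcal F=\pm q\,\mathrm{vol}(\mathrm{AdS}_2)+q\,\mathrm{vol}(S^2)$; * (ii) with $\Delta=0$, $q\neq0$: $\mathrm{AdS}_3\times S^2$ with radii $\sqrt3/|q|$ and $\sqrt3/(2|q|)$ and $\mathcal F=q\,\mathrm{vol}(S^2)$; * (ii) with $q=0$, $\Delta\ne0$: $\mathrm{AdS}_2\times S^3$ with radii $1/|\Delta|$ and $2/|\Delta|$ and $\mathcal F=\tfrac{\sqrt3}{2}\Delta\,\mathrm{vol}(\mathrm{AdS}_2)$. -/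

import Mathlib

open scoped Manifold ContDiff

noncomputable section

namespace NearHorizon

/-! ### Coordinate tensor calculus on `ℝⁿ` -/

/-- The coordinate space `ℝⁿ`. -/
abbrev Euc (n : ℕ) := EuclideanSpace ℝ (Fin n)

/-- The coordinate vector `∂_i`. -/
def coordVec {n : ℕ} (i : Fin n) : Euc n := EuclideanSpace.single i 1

/-- The partial derivative `∂_i f` at `x`. -/
def pd {n : ℕ} (i : Fin n) (f : Euc n → ℝ) (x : Euc n) : ℝ :=
  fderiv ℝ f x (coordVec i)

/-- A field of bilinear forms on `ℝⁿ`: the value at the point `x` on the tangent vectors `X`, `Y`. -/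
abbrev BilinField (n : ℕ) := Euc n → Euc n → Euc n → ℝ

/-- The component `T_{ij}`. -/
def comp {n : ℕ} (T : BilinField n) (i j : Fin n) (x : Euc n) : ℝ :=
  T x (coordVec i) (coordVec j)

/-- The matrix `(g_{ij})`. -/
def gMat {n : ℕ} (g : BilinField n) (x : Euc n) : Matrix (Fin n) (Fin n) ℝ :=
  Matrix.of fun i j => comp g i j x

/-- The inverse metric `g^{ij}`. -/
def gInv {n : ℕ} (g : BilinField n) (i j : Fin n) (x : Euc n) : ℝ :=
  (gMat g x)⁻¹ i j

/-- The Christoffel symbol `Γ^k_{ij}`. -/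
def christoffel {n : ℕ} (g : BilinField n) (k i j : Fin n) (x : Euc n) : ℝ :=
  (1 / 2) * ∑ l, gInv g k l x *
    (pd i (comp g j l) x + pd j (comp g i l) x - pd l (comp g i j) x)

/-- The Ricci tensor
`R_{ij} = ∂_k Γ^k_{ij} - ∂_j Γ^k_{ik} + Γ^k_{kl} Γ^l_{ij} - Γ^k_{jl} Γ^l_{ik}`. -/
def ricci {n : ℕ} (g : BilinField n) (i j : Fin n) (x : Euc n) : ℝ :=
  ∑ k, (pd k (christoffel g k i j) x - pd j (christoffel g k i k) x
    + ∑ l, (christoffel g k k l x * christoffel g l i j x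
      - christoffel g k j l x * christoffel g l i k x))

/-- `A^{ij} = g^{ia} g^{jb} A_{ab}`. -/
def raise {n : ℕ} (g A : BilinField n) (i j : Fin n) (x : Euc n) : ℝ :=
  ∑ a, ∑ b, gInv g i a x * gInv g j b x * comp A a b x

/-! ### Five-dimensional Einstein–Maxwell theory -/

/-- A metric and a Maxwell two-form, as bilinear fields on (a region of) `ℝ⁵`. -/
structure EMFields where
  metric : BilinField 5
  maxwell : BilinField 5

/-- `A² = A_{ij} A^{ij}`. -/
def normSq (g A : BilinField 5) (x : Euc 5) : ℝ :=
  ∑ i, ∑ j, comp A i j x * raise g A i j x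

/-- The energy-momentum tensor
`T_{ij} = 2 (A_{ia} A_j^a - (1/4) A² g_{ij})` of the Maxwell field `A`. -/
def stress (g A : BilinField 5) (i j : Fin 5) (x : Euc 5) : ℝ :=
  2 * ((∑ a, ∑ b, gInv g a b x * comp A i a x * comp A j b x)
    - (1 / 4) * normSq g A x * comp g i j x)

/-- The Einstein–Maxwell equations with zero cosmological constant and no Chern–Simons term on the
region `U`: `R_{ij} = T_{ij} - (1/3) T^k_k g_{ij}`, the Bianchi identity `dA = 0`, and
`d⋆A = 0`, which in components reads `∂_i (√|det g| A^{ij}) = 0`. -/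
def SolvesEinsteinMaxwell (M : EMFields) (U : Set (Euc 5)) : Prop :=
  ∀ x ∈ U,
    (∀ i j, ricci M.metric i j x = stress M.metric M.maxwell i j x
      - (1 / 3) * (∑ k, ∑ l, gInv M.metric k l x * stress M.metric M.maxwell k l x)
        * comp M.metric i j x) ∧
    (∀ i j k, pd i (comp M.maxwell j k) x + pd j (comp M.maxwell k i) x
      + pd k (comp M.maxwell i j) x = 0) ∧
    (∀ j, ∑ i, pd i (fun y => √|(gMat M.metric y).det| * raise M.metric M.maxwell i j y) x = 0)

/-- Every point of `U` has an open neighbourhood in `U` that a diffeomorphism onto an open subset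
of `V` identifies with the latter, metric and Maxwell field included. -/
def LocallyIsometric (M : EMFields) (U : Set (Euc 5)) (N : EMFields) (V : Set (Euc 5)) : Prop :=
  ∀ x ∈ U, ∃ Φ : OpenPartialHomeomorph (Euc 5) (Euc 5),
    x ∈ Φ.source ∧ Φ.source ⊆ U ∧ Φ.target ⊆ V ∧
    ContDiffOn ℝ ∞ Φ Φ.source ∧ ContDiffOn ℝ ∞ Φ.symm Φ.target ∧
    ∀ y ∈ Φ.source, ∀ X Y : Euc 5,
      N.metric (Φ y) (fderiv ℝ Φ y X) (fderiv ℝ Φ y Y) = M.metric y X Y ∧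
      N.maxwell (Φ y) (fderiv ℝ Φ y X) (fderiv ℝ Φ y Y) = M.maxwell y X Y

/-! ### Near-horizon geometries over a three-manifold `H` -/

section Horizon

variable (H : Type*) [TopologicalSpace H] [ChartedSpace (Euc 3) H] [IsManifold (𝓡 3) ∞ H]

/-- Near-horizon data on a three-manifold `H`: a Riemannian metric `γ`, a function `F`,
a one-form `h`, a function `Δ` and a two-form `B`, all smooth. -/
structure Data where
  γ : Bundle.ContMDiffRiemannianMetric (𝓡 3) ∞ (Euc 3) (fun p : H => TangentSpace (𝓡 3) p)
  F : H → ℝ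
  F_smooth : ContMDiff (𝓡 3) 𝓘(ℝ) ∞ F
  h : (p : H) → TangentSpace (𝓡 3) p →L[ℝ] ℝ
  h_smooth : ContMDiff (𝓡 3) ((𝓡 3).prod 𝓘(ℝ, Euc 3 →L[ℝ] ℝ)) ∞
    (fun p => Bundle.TotalSpace.mk' (Euc 3 →L[ℝ] ℝ)
      (E := fun p : H => TangentSpace (𝓡 3) p →L[ℝ] ℝ) p (h p))
  Δ : H → ℝ
  Δ_smooth : ContMDiff (𝓡 3) 𝓘(ℝ) ∞ Δ
  B : (p : H) → TangentSpace (𝓡 3) p →L[ℝ] TangentSpace (𝓡 3) p →L[ℝ] ℝ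
  B_alt : ∀ p (X : TangentSpace (𝓡 3) p), B p X X = 0
  B_smooth : ContMDiff (𝓡 3) ((𝓡 3).prod 𝓘(ℝ, Euc 3 →L[ℝ] Euc 3 →L[ℝ] ℝ)) ∞
    (fun p => Bundle.TotalSpace.mk' (Euc 3 →L[ℝ] Euc 3 →L[ℝ] ℝ)
      (E := fun p : H => TangentSpace (𝓡 3) p →L[ℝ] TangentSpace (𝓡 3) p →L[ℝ] ℝ) p (B p))

variable {H}

/-- The part `(x², x³, x⁴)` of `x = (v, r, x², x³, x⁴)`, for points as for tangent vectors. -/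
def hor (x : Euc 5) : Euc 3 := WithLp.toLp 2 ![x 2, x 3, x 4]

/-- The part of the spacetime `ℝ × ℝ × H` with coordinates `(v, r)` and a chart `e` of `H`. -/
def dom (e : OpenPartialHomeomorph H (Euc 3)) : Set (Euc 5) := {x | hor x ∈ e.target}

/-- The point of `H` under the coordinate point `x`. -/
def pt (e : OpenPartialHomeomorph H (Euc 3)) (x : Euc 5) : H := e.symm (hor x)

/-- The tangent vector of `H` with the coordinates `hor X` at the coordinate point `x`. -/
def tan (e : OpenPartialHomeomorph H (Euc 3)) (x X : Euc 5) : TangentSpace (𝓡 3) (pt e x) :=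
  mfderiv (𝓡 3) (𝓡 3) e.symm (hor x) (hor X)

/-- The near-horizon geometry of the data, in the coordinates `(v, r)` and a chart `e` of `H`:
`g = 2 dv (dr + r h + (1/2) r² F dv) + γ` and `𝓕 = d (r Δ dv) + B`. -/
def Data.spacetime (D : Data H) (e : OpenPartialHomeomorph H (Euc 3)) : EMFields where
  metric x X Y :=
    X 0 * Y 1 + X 1 * Y 0
      + x 1 * (X 0 * D.h (pt e x) (tan e x Y) + Y 0 * D.h (pt e x) (tan e x X))
      + (x 1) ^ 2 * D.F (pt e x) * (X 0 * Y 0)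
      + D.γ.inner (pt e x) (tan e x X) (tan e x Y)
  maxwell x X Y :=
    let dΔ : Euc 5 → ℝ := fun Z => mfderiv (𝓡 3) 𝓘(ℝ) D.Δ (pt e x) (tan e x Z)
    D.Δ (pt e x) * (X 1 * Y 0 - X 0 * Y 1)
      + x 1 * (dΔ X * Y 0 - X 0 * dΔ Y)
      + D.B (pt e x) (tan e x X) (tan e x Y)

/-- The near-horizon geometry solves the Einstein–Maxwell equations (in all charts). -/
def Data.IsEinsteinMaxwell (D : Data H) : Prop :=
  ∀ e ∈ atlas (Euc 3) H, SolvesEinsteinMaxwell (D.spacetime e) (dom e)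

/-- The diffeomorphism `f` is an isometry of `(H, γ)` that leaves `F`, `h`, `Δ`, `B` invariant.
These diffeomorphisms form a group. -/
def Data.IsSymmetry (D : Data H) (f : Diffeomorph (𝓡 3) (𝓡 3) H H ∞) : Prop :=
  ∀ p : H, D.F (f p) = D.F p ∧ D.Δ (f p) = D.Δ p ∧
    (∀ X : TangentSpace (𝓡 3) p, D.h (f p) (mfderiv (𝓡 3) (𝓡 3) f p X) = D.h p X) ∧
    ∀ X Y : TangentSpace (𝓡 3) p,
      D.γ.inner (f p) (mfderiv (𝓡 3) (𝓡 3) f p X) (mfderiv (𝓡 3) (𝓡 3) f p Y)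
        = D.γ.inner p X Y ∧
      D.B (f p) (mfderiv (𝓡 3) (𝓡 3) f p X) (mfderiv (𝓡 3) (𝓡 3) f p Y) = D.B p X Y

/-- Homogeneous data: the symmetry group acts transitively on `H`. -/
def Data.IsHomogeneous (D : Data H) : Prop :=
  ∀ p q : H, ∃ f : Diffeomorph (𝓡 3) (𝓡 3) H H ∞, D.IsSymmetry f ∧ f p = q

/-- The trivial data: `h`, `Δ` and `B` vanish identically. -/
def Data.IsTrivial (D : Data H) : Prop :=
  ∀ p : H, D.h p = 0 ∧ D.Δ p = 0 ∧ D.B p = 0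

/-- The near-horizon geometry is locally isometric to `(N, V)`, at each of its points. -/
def Data.LocallyIsometricTo (D : Data H) (N : EMFields) (V : Set (Euc 5)) : Prop :=
  ∀ e ∈ atlas (Euc 3) H, LocallyIsometric (D.spacetime e) (dom e) N V

end Horizon

/-! ### The explicit families, in the coordinates `(v, r, ψ, θ, φ)` -/

/-- The coordinate domain `0 < θ < π`. -/
def modelDom : Set (Euc 5) := {x | 0 < x 3 ∧ x 3 < Real.pi}

/-- The one-form `ω = dψ + (c / lam) cos θ dφ + κ r dv`. -/
def connection (lam c κ : ℝ) (x X : Euc 5) : ℝ :=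
  X 2 + c / lam * Real.cos (x 3) * X 4 + κ * x 1 * X 0

/-- `-lam r² dv² + 2 dv dr + (dθ² + sin² θ dφ²) / lam`. -/
def baseMetric (lam : ℝ) : BilinField 5 := fun x X Y =>
  -lam * (x 1) ^ 2 * (X 0 * Y 0) + (X 0 * Y 1 + X 1 * Y 0)
    + (X 3 * Y 3 + Real.sin (x 3) ^ 2 * (X 4 * Y 4)) / lam

/-- `g = ω² + baseMetric` and `𝓕 = ε dr ∧ dv + (q / lam) sin θ dθ ∧ dφ`. -/
def bundleFields (lam c κ ε q : ℝ) : EMFields where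
  metric x X Y := baseMetric lam x X Y + connection lam c κ x X * connection lam c κ x Y
  maxwell x X Y := ε * (X 1 * Y 0 - X 0 * Y 1)
    + q / lam * Real.sin (x 3) * (X 3 * Y 4 - X 4 * Y 3)

/-- Family (i); `σ = ±1`. -/
def familyI (σ k q : ℝ) : EMFields :=
  bundleFields (k ^ 2 / 2 + 2 * q ^ 2) k k (σ * q) q

/-- Family (ii); `σ = ±1`. -/
def familyII (σ Δ q : ℝ) : EMFields :=
  bundleFields (Δ ^ 2 + 4 / 3 * q ^ 2) Δ (σ * (2 / √3) * q) (√3 / 2 * Δ) q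

/-! ### Spheres and anti-de Sitter spaces as quadrics

A smooth map from a region of `ℝⁿ` to a product of such quadrics, with factors of total dimension
`n`, that pulls the induced metric back to a nondegenerate metric `g` is a local isometry from `g`
to that product. -/

/-- The flat form `-X₀Y₀ - X₁Y₁ + X₂Y₂ + ⋯`. -/
def adsForm {n : ℕ} (X Y : Euc n) : ℝ :=
  ∑ i : Fin n, (if i.val < 2 then -1 else 1) * (X i * Y i)

/-- Anti-de Sitter space of dimension `n` and radius `ℓ`, with the metric induced by `adsForm`. -/
def AdS (n : ℕ) (ℓ : ℝ) : Set (Euc (n + 1)) := {X | adsForm X X = -ℓ ^ 2}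

/-- The round sphere of dimension `n` and radius `R`. -/
def Sph (n : ℕ) (R : ℝ) : Set (Euc (n + 1)) := Metric.sphere 0 R

/-- The area form at `P` of the surface `AdS 2 R` or `Sph 2 R`. -/
def areaForm (R : ℝ) (P X Y : Euc 3) : ℝ :=
  (Matrix.of ![(P : Fin 3 → ℝ), X, Y]).det / R

/-- On `U`, `T` and `A` are locally pulled back from `AdS₂ × S²` with radii `ℓ`, `R`,
from its metric and from `ε vol(AdS₂) + q vol(S²)`. -/
def PulledBackFromAdS2S2 (T A : BilinField 5) (U : Set (Euc 5)) (ℓ R ε q : ℝ) : Prop :=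
  ∀ x ∈ U, ∃ V : Set (Euc 5), IsOpen V ∧ x ∈ V ∧ ∃ (a : Euc 5 → Euc 3) (s : Euc 5 → Euc 3),
    ContDiffOn ℝ ∞ a V ∧ ContDiffOn ℝ ∞ s V ∧ ∀ y ∈ V, a y ∈ AdS 2 ℓ ∧ s y ∈ Sph 2 R ∧
    ∀ X Y : Euc 5,
      T y X Y = adsForm (fderiv ℝ a y X) (fderiv ℝ a y Y)
        + inner ℝ (fderiv ℝ s y X) (fderiv ℝ s y Y) ∧
      A y X Y = ε * areaForm ℓ (a y) (fderiv ℝ a y X) (fderiv ℝ a y Y)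
        + q * areaForm R (s y) (fderiv ℝ s y X) (fderiv ℝ s y Y)

/-- Local isometry to `AdS₂ × S¹ × S²` (radii `ℓ`, `ρ`, `R`) with Maxwell field
`ε vol(AdS₂) + q vol(S²)`. -/
def IsLocallyAdS2S1S2 (M : EMFields) (U : Set (Euc 5)) (ℓ ρ R ε q : ℝ) : Prop :=
  ∀ x ∈ U, ∃ V : Set (Euc 5), IsOpen V ∧ x ∈ V ∧
    ∃ (a : Euc 5 → Euc 3) (c : Euc 5 → Euc 2) (s : Euc 5 → Euc 3),
    ContDiffOn ℝ ∞ a V ∧ ContDiffOn ℝ ∞ c V ∧ ContDiffOn ℝ ∞ s V ∧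
    ∀ y ∈ V, a y ∈ AdS 2 ℓ ∧ c y ∈ Sph 1 ρ ∧ s y ∈ Sph 2 R ∧
    ∀ X Y : Euc 5,
      M.metric y X Y = adsForm (fderiv ℝ a y X) (fderiv ℝ a y Y)
        + inner ℝ (fderiv ℝ c y X) (fderiv ℝ c y Y)
        + inner ℝ (fderiv ℝ s y X) (fderiv ℝ s y Y) ∧
      M.maxwell y X Y = ε * areaForm ℓ (a y) (fderiv ℝ a y X) (fderiv ℝ a y Y)
        + q * areaForm R (s y) (fderiv ℝ s y X) (fderiv ℝ s y Y)

/-- Local isometry to `AdS₃ × S²` (radii `ℓ`, `R`) with Maxwell field `q vol(S²)`. -/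
def IsLocallyAdS3S2 (M : EMFields) (U : Set (Euc 5)) (ℓ R q : ℝ) : Prop :=
  ∀ x ∈ U, ∃ V : Set (Euc 5), IsOpen V ∧ x ∈ V ∧ ∃ (a : Euc 5 → Euc 4) (s : Euc 5 → Euc 3),
    ContDiffOn ℝ ∞ a V ∧ ContDiffOn ℝ ∞ s V ∧ ∀ y ∈ V, a y ∈ AdS 3 ℓ ∧ s y ∈ Sph 2 R ∧
    ∀ X Y : Euc 5,
      M.metric y X Y = adsForm (fderiv ℝ a y X) (fderiv ℝ a y Y)
        + inner ℝ (fderiv ℝ s y X) (fderiv ℝ s y Y) ∧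
      M.maxwell y X Y = q * areaForm R (s y) (fderiv ℝ s y X) (fderiv ℝ s y Y)

/-- Local isometry to `AdS₂ × S³` (radii `ℓ`, `R`) with Maxwell field `ε vol(AdS₂)`. -/
def IsLocallyAdS2S3 (M : EMFields) (U : Set (Euc 5)) (ℓ R ε : ℝ) : Prop :=
  ∀ x ∈ U, ∃ V : Set (Euc 5), IsOpen V ∧ x ∈ V ∧ ∃ (a : Euc 5 → Euc 3) (s : Euc 5 → Euc 4),
    ContDiffOn ℝ ∞ a V ∧ ContDiffOn ℝ ∞ s V ∧ ∀ y ∈ V, a y ∈ AdS 2 ℓ ∧ s y ∈ Sph 3 R ∧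
    ∀ X Y : Euc 5,
      M.metric y X Y = adsForm (fderiv ℝ a y X) (fderiv ℝ a y Y)
        + inner ℝ (fderiv ℝ s y X) (fderiv ℝ s y Y) ∧
      M.maxwell y X Y = ε * areaForm ℓ (a y) (fderiv ℝ a y X) (fderiv ℝ a y Y)

end NearHorizon

end

set_option linter.unusedSectionVars false
set_option linter.unusedSimpArgs false

noncomputable section

namespace NearHorizon

open Matrix

/-! Homogeneity makes `F` and `Δ` constant, and what remains is a local problem on the
three-manifold. At `r = 0` the Einstein equations become, in an orthonormal frame, an equation for
the Ricci tensor of `γ` and a formula for `F` (`horizon_einstein`). The Maxwell equations become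
`div b = 0` and a curl equation for the one-form `b` dual to `B` (`horizon_maxwell`). `FrameEqs`
collects them for frames in which `h` and `b` have constant components.

The first step is that the contractions of `h` with `B` and with `dh` vanish
(`LocalSolution.contr_eq_zero`). If one of them did not, then it and `h` would be two orthogonal
invariant one-forms of constant norm. They would fix an orthonormal frame up to a sign, all
structure functions would be constant, and the solution would be left-invariant on a local Lie
group. There a Bochner argument for the trace form shows that the group is unimodular
(`FrameEqs.unimodular`), and the Einstein equation contracted with the symmetrized derivative of `h`
shows that `h` is Killing and parallel to `b` (`FrameEqs.rigid`), which is a contradiction.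

So, where `h` or `B` is nonzero, there is a unit axis `e_0` with `h = H θ^0`, `B = b θ^1 ∧ θ^2`,
`dθ^0 = n θ^1 ∧ θ^2` and constants `H`, `b`, `n` (`LocalSolution.exists_axial`). The pair `e_1`,
`e_2` is defined only up to rotation, so the other structure functions need not be constant, and the
expansion and shear of the axis are removed by differential identities. Raychaudhuri's equation
excludes expansion (`AxialFrame.expansion`). For the shear, either its evolution along the axis
contradicts its constant norm, or it yields a parallel frame in a plane of positive curvature
(`AxialFrame.shear`). Where `h` and `B` vanish no direction is preferred, but `γ` has constant
curvature, and a flat modification of the Levi-Civita connection supplies an axis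
(`LocalSolution.exists_axial_of_zero`).

Now `e_0` is a Killing field and `γ` is locally a circle bundle over a surface of constant curvature
`lam` (`AxialFrame.bundleFrame`). The equations leave `b n = Δ H` and `n² = H² - (4/3) b² + (4/3)
Δ²`. Eliminating `n` gives `(b² - Δ²) (H² - (4/3) b²) = 0`, and the two factors are the two families
(`LocalSolution.exists_adapted`).

The polar coordinates of the base come from a parallel section of a flat `SO(3)` connection
(`BundleFrame.exists_coords`), whose existence is the Frobenius theorem for linear systems, proved
by integration along rays (`exists_flat`). With `v` and `r` unchanged these coordinates give a local
isometry (`Adapted.exists_isometry`), and the symmetries transport it to every point with the same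
constants (`Data.classification`). The bundle structure over `AdS₂ × S²` and the special cases are
verified with explicit embeddings into quadrics. -/

/-! ### Moving frames and the Ricci tensor -/

/-- The exterior derivative of a one-form. -/
def dForm {n : ℕ} (α : Euc n → Euc n →L[ℝ] ℝ) (x X Y : Euc n) : ℝ :=
  fderiv ℝ α x X Y - fderiv ℝ α x Y X

/-- The derivative of `f` along the vector field `V`. -/
def dirD {n : ℕ} (f : Euc n → ℝ) (V : Euc n → Euc n) (x : Euc n) : ℝ := fderiv ℝ f x (V x)

/-- A smooth frame on the open set `U` and its dual coframe. -/
structure IsFrame {n : ℕ} {ι : Type*} [Fintype ι] [DecidableEq ι] (U : Set (Euc n))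
    (e : ι → Euc n → Euc n) (θ : ι → Euc n → Euc n →L[ℝ] ℝ) : Prop where
  isOpen : IsOpen U
  e_smooth : ∀ i, ContDiffOn ℝ ∞ (e i) U
  θ_smooth : ∀ i, ContDiffOn ℝ ∞ (θ i) U
  dual : ∀ x ∈ U, ∀ i j, θ i x (e j x) = if i = j then 1 else 0
  expand : ∀ x ∈ U, ∀ X, ∑ i, θ i x X • e i x = X

/-- The Ricci tensor in a frame, `R_{ab} = Ω^c_a(e_c, e_b)`, for the connection forms
`ω^a_b(e_c) = G a b c`. -/
def frameRicci {n : ℕ} {ι : Type*} [Fintype ι] (e : ι → Euc n → Euc n)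
    (θ : ι → Euc n → Euc n →L[ℝ] ℝ) (G : ι → ι → ι → Euc n → ℝ) (a b : ι) (x : Euc n) : ℝ :=
  ∑ c, (dirD (G c a b) (e c) x - dirD (G c a c) (e b) x
    + ∑ d, (G c a d x * dForm (θ d) x (e c x) (e b x)
      + G c d c x * G d a b x - G c d b x * G d a c x))

/-! ### Matrix-valued functions and the matrices of a frame, a coframe and a connection. -/

section Coordinates

variable {n : ℕ} {ι κ μ : Type*} [Fintype ι] [Fintype κ] [Fintype μ] [DecidableEq ι]

lemma sum_coord (X : Euc n) : ∑ i, X i • coordVec i = X := by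
  ext j
  simp [coordVec, Pi.single_apply]

lemma clm_eq_sum_coord {F : Type*} [NormedAddCommGroup F] [NormedSpace ℝ F]
    (L : Euc n →L[ℝ] F) (X : Euc n) : L X = ∑ i, X i • L (coordVec i) := by
  conv_lhs => rw [← sum_coord X]
  simp

/-- Entrywise partial derivative of a matrix-valued function. -/
def pdM (i : Fin n) (A : Euc n → Matrix ι κ ℝ) (x : Euc n) : Matrix ι κ ℝ :=
  Matrix.of fun a b => pd i (fun y => A y a b) x

/-- Entrywise smoothness of a matrix-valued function. -/
def SmoothM (U : Set (Euc n)) (A : Euc n → Matrix ι κ ℝ) : Prop :=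
  ∀ a b, ContDiffOn ℝ ∞ (fun y => A y a b) U

lemma pd_congr {f g : Euc n → ℝ} {U : Set (Euc n)} (hU : IsOpen U) (h : ∀ y ∈ U, f y = g y)
    {x : Euc n} (hx : x ∈ U) (i : Fin n) : pd i f x = pd i g x := by
  unfold pd
  have : f =ᶠ[nhds x] g := Filter.eventuallyEq_of_mem (hU.mem_nhds hx) h
  rw [this.fderiv_eq]

lemma pdM_congr {A B : Euc n → Matrix ι κ ℝ} {U : Set (Euc n)} (hU : IsOpen U)
    (h : ∀ y ∈ U, A y = B y) {x : Euc n} (hx : x ∈ U) (i : Fin n) : pdM i A x = pdM i B x := by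
  ext a b
  exact pd_congr hU (fun y hy => by rw [h y hy]) hx i

lemma diffAt_of_contDiffOn {E F : Type*} [NormedAddCommGroup E] [NormedSpace ℝ E]
    [NormedAddCommGroup F] [NormedSpace ℝ F] {f : E → F} {U : Set E} (hU : IsOpen U)
    (h : ContDiffOn ℝ ∞ f U) {x : E} (hx : x ∈ U) : DifferentiableAt ℝ f x :=
  (h.contDiffAt (hU.mem_nhds hx)).differentiableAt (by simp)

lemma contDiffOn_fderiv {E F : Type*} [NormedAddCommGroup E] [NormedSpace ℝ E]
    [NormedAddCommGroup F] [NormedSpace ℝ F] {f : E → F} {U : Set E} (hU : IsOpen U)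
    (h : ContDiffOn ℝ ∞ f U) : ContDiffOn ℝ ∞ (fun x => fderiv ℝ f x) U :=
  h.fderiv_of_isOpen hU (by simp)

lemma contDiffOn_pd {f : Euc n → ℝ} {U : Set (Euc n)} (hU : IsOpen U)
    (h : ContDiffOn ℝ ∞ f U) (i : Fin n) : ContDiffOn ℝ ∞ (pd i f) U :=
  (contDiffOn_fderiv hU h).clm_apply contDiffOn_const

lemma SmoothM.mul {U : Set (Euc n)} {A : Euc n → Matrix ι κ ℝ} {B : Euc n → Matrix κ μ ℝ}
    (hA : SmoothM U A) (hB : SmoothM U B) : SmoothM U (fun y => A y * B y) := by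
  intro a b
  simp only [Matrix.mul_apply]
  exact ContDiffOn.sum fun c _ => (hA a c).mul (hB c b)

lemma SmoothM.add {U : Set (Euc n)} {A B : Euc n → Matrix ι κ ℝ}
    (hA : SmoothM U A) (hB : SmoothM U B) : SmoothM U (fun y => A y + B y) :=
  fun a b => (hA a b).add (hB a b)

lemma SmoothM.pdM {U : Set (Euc n)} (hU : IsOpen U) {A : Euc n → Matrix ι κ ℝ}
    (hA : SmoothM U A) (i : Fin n) : SmoothM U (pdM i A) :=
  fun a b => contDiffOn_pd hU (hA a b) i

lemma pdM_mul {U : Set (Euc n)} (hU : IsOpen U) {A : Euc n → Matrix ι κ ℝ}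
    {B : Euc n → Matrix κ μ ℝ} (hA : SmoothM U A) (hB : SmoothM U B) {x : Euc n} (hx : x ∈ U)
    (i : Fin n) : pdM i (fun y => A y * B y) x = pdM i A x * B x + A x * pdM i B x := by
  ext a b
  simp only [pdM, pd, Matrix.of_apply, Matrix.add_apply, Matrix.mul_apply]
  rw [fderiv_fun_sum (A := fun c y => A y a c * B y c b) fun c _ => ((diffAt_of_contDiffOn hU (hA a c) hx).mul
    (diffAt_of_contDiffOn hU (hB c b) hx))]
  rw [_root_.sum_apply, ← Finset.sum_add_distrib]
  refine Finset.sum_congr rfl fun c _ => ?_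
  rw [fderiv_fun_mul (diffAt_of_contDiffOn hU (hA a c) hx) (diffAt_of_contDiffOn hU (hB c b) hx)]
  simp
  ring

lemma pdM_add {U : Set (Euc n)} (hU : IsOpen U) {A B : Euc n → Matrix ι κ ℝ}
    (hA : SmoothM U A) (hB : SmoothM U B) {x : Euc n} (hx : x ∈ U)
    (i : Fin n) : pdM i (fun y => A y + B y) x = pdM i A x + pdM i B x := by
  ext a b
  simp only [pdM, pd, Matrix.of_apply, Matrix.add_apply]
  rw [fderiv_fun_add (diffAt_of_contDiffOn hU (hA a b) hx) (diffAt_of_contDiffOn hU (hB a b) hx)]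
  simp

lemma pd_comm {f : Euc n → ℝ} {U : Set (Euc n)} (hU : IsOpen U) (hf : ContDiffOn ℝ ∞ f U)
    {x : Euc n} (hx : x ∈ U) (i j : Fin n) : pd i (pd j f) x = pd j (pd i f) x := by
  have h := contDiffOn_fderiv hU hf
  have hd := diffAt_of_contDiffOn hU h hx
  have key : ∀ k l : Fin n, pd k (pd l f) x = fderiv ℝ (fderiv ℝ f) x (coordVec k) (coordVec l) := by
    intro k l
    unfold pd
    rw [fderiv_clm_apply hd (differentiableAt_const _)]
    simp
  rw [key, key]
  have : IsSymmSndFDerivAt ℝ f x :=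
    (hf.contDiffAt (hU.mem_nhds hx)).isSymmSndFDerivAt
      (by simpa using WithTop.coe_le_coe.2 (le_top : (2 : ℕ∞) ≤ ⊤))
  exact this _ _

lemma pdM_comm {A : Euc n → Matrix ι κ ℝ} {U : Set (Euc n)} (hU : IsOpen U) (hA : SmoothM U A)
    {x : Euc n} (hx : x ∈ U) (i j : Fin n) : pdM i (pdM j A) x = pdM j (pdM i A) x := by
  ext a b
  exact pd_comm hU (hA a b) hx i j

lemma dirD_eq_sum (f : Euc n → ℝ) (V : Euc n → Euc n) (x : Euc n) :
    dirD f V x = ∑ i, V x i * pd i f x := by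
  unfold dirD pd
  rw [clm_eq_sum_coord]
  simp

/-- The matrix of a coframe. -/
def thM (θ : ι → Euc n → Euc n →L[ℝ] ℝ) (x : Euc n) : Matrix ι (Fin n) ℝ :=
  Matrix.of fun a i => θ a x (coordVec i)

/-- The matrix of a frame. -/
def eM (e : ι → Euc n → Euc n) (x : Euc n) : Matrix (Fin n) ι ℝ :=
  Matrix.of fun i a => e a x i

/-- The connection matrices. -/
def omM (θ : ι → Euc n → Euc n →L[ℝ] ℝ) (G : ι → ι → ι → Euc n → ℝ) (i : Fin n) (x : Euc n) :
    Matrix ι ι ℝ :=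
  Matrix.of fun a b => ∑ c, G a b c x * θ c x (coordVec i)

variable {U : Set (Euc n)} {e : ι → Euc n → Euc n} {θ : ι → Euc n → Euc n →L[ℝ] ℝ}

lemma IsFrame.thM_mul_eM (hF : IsFrame U e θ) {x : Euc n} (hx : x ∈ U) :
    thM θ x * eM e x = 1 := by
  ext a b
  have := hF.dual x hx a b
  rw [clm_eq_sum_coord] at this
  simp only [Matrix.mul_apply, thM, eM, Matrix.of_apply, Matrix.one_apply]
  rw [← this]
  exact Finset.sum_congr rfl fun i _ => by simp [mul_comm]

lemma IsFrame.eM_mul_thM (hF : IsFrame U e θ) {x : Euc n} (hx : x ∈ U) :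
    eM e x * thM θ x = 1 := by
  ext i j
  have := congrArg (fun v : Euc n => v i) (hF.expand x hx (coordVec j))
  simp only [Matrix.mul_apply, thM, eM, Matrix.of_apply, Matrix.one_apply]
  simp [coordVec] at this
  rw [← this]
  exact Finset.sum_congr rfl fun i _ => by simp [mul_comm, coordVec]

lemma IsFrame.smooth_thM (hF : IsFrame U e θ) : SmoothM U (thM θ) :=
  fun a _ => (hF.θ_smooth a).clm_apply contDiffOn_const

lemma IsFrame.smooth_eM (hF : IsFrame U e θ) : SmoothM U (eM e) := by
  intro i a
  exact (contDiffOn_euclidean.1 (hF.e_smooth a)) i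

lemma IsFrame.smooth_omM (hF : IsFrame U e θ) {G : ι → ι → ι → Euc n → ℝ}
    (hG : ∀ a b c, ContDiffOn ℝ ∞ (G a b c) U) (i : Fin n) : SmoothM U (omM θ G i) := by
  intro a b
  exact ContDiffOn.sum fun c _ => (hG a b c).mul ((hF.θ_smooth c).clm_apply contDiffOn_const)

lemma pd_form (hU : IsOpen U) {α : Euc n → Euc n →L[ℝ] ℝ} (hα : ContDiffOn ℝ ∞ α U) {x : Euc n}
    (hx : x ∈ U) (i : Fin n) (Y : Euc n) :
    pd i (fun y => α y Y) x = fderiv ℝ α x (coordVec i) Y := by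
  unfold pd
  rw [fderiv_clm_apply (diffAt_of_contDiffOn hU hα hx) (differentiableAt_const _)]
  simp

lemma dForm_eq_sum (hU : IsOpen U) {α : Euc n → Euc n →L[ℝ] ℝ} (hα : ContDiffOn ℝ ∞ α U)
    {x : Euc n} (hx : x ∈ U) (X Y : Euc n) :
    dForm α x X Y = ∑ i, ∑ j, X i * Y j *
      (pd i (fun y => α y (coordVec j)) x - pd j (fun y => α y (coordVec i)) x) := by
  have key : ∀ X Y : Euc n, fderiv ℝ α x X Y =
      ∑ i, ∑ j, X i * Y j * pd i (fun y => α y (coordVec j)) x := by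
    intro X Y
    rw [clm_eq_sum_coord (fderiv ℝ α x) X, _root_.sum_apply]
    refine Finset.sum_congr rfl fun i _ => ?_
    rw [_root_.smul_apply, clm_eq_sum_coord _ Y, Finset.smul_sum]
    refine Finset.sum_congr rfl fun j _ => ?_
    rw [pd_form hU hα hx]
    simp; ring
  rw [dForm, key, key Y X, Finset.sum_comm (f := fun i j => Y i * X j * _),
    ← Finset.sum_sub_distrib]
  refine Finset.sum_congr rfl fun i _ => ?_
  rw [← Finset.sum_sub_distrib]
  exact Finset.sum_congr rfl fun j _ => by ring

end Coordinates

open Matrix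

/-! ### Cartan's structure equations for frames with constant metric components. -/

section Cartan

variable {n : ℕ} {ι : Type*} [Fintype ι] [DecidableEq ι]
  {U : Set (Euc n)} {e : ι → Euc n → Euc n} {θ : ι → Euc n → Euc n →L[ℝ] ℝ}
  {η : Matrix ι ι ℝ} {g : BilinField n} {G : ι → ι → ι → Euc n → ℝ}

/-- `g` is the metric with the constant components `η` in the frame. -/
def FrameMetric (U : Set (Euc n)) (θ : ι → Euc n → Euc n →L[ℝ] ℝ) (η : Matrix ι ι ℝ)
    (g : BilinField n) : Prop :=
  ∀ x ∈ U, ∀ X Y, g x X Y = ∑ a, ∑ b, η a b * (θ a x X * θ b x Y)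

lemma FrameMetric.gMat_eq (hg : FrameMetric U θ η g) {x : Euc n} (hx : x ∈ U) :
    gMat g x = (thM θ x)ᵀ * η * thM θ x := by
  ext i j
  simp only [gMat, comp, Matrix.of_apply, hg x hx, Matrix.mul_apply, thM, Matrix.transpose_apply,
    Finset.sum_mul]
  rw [Finset.sum_comm]
  exact Finset.sum_congr rfl fun a _ => Finset.sum_congr rfl fun b _ => by ring

lemma FrameMetric.inv_gMat (hF : IsFrame U e θ) (hη : η * η = 1) (hg : FrameMetric U θ η g)
    {x : Euc n} (hx : x ∈ U) : (gMat g x)⁻¹ = eM e x * η * (eM e x)ᵀ := by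
  apply Matrix.inv_eq_right_inv
  have h1 := hF.thM_mul_eM hx
  have h2 : (thM θ x)ᵀ * (eM e x)ᵀ = 1 := by
    rw [← Matrix.transpose_mul, hF.eM_mul_thM hx, Matrix.transpose_one]
  rw [hg.gMat_eq hx]
  calc _ = (thM θ x)ᵀ * (η * ((thM θ x * eM e x) * η)) * (eM e x)ᵀ := by
        simp only [Matrix.mul_assoc]
    _ = 1 := by rw [h1, Matrix.one_mul, hη, Matrix.mul_one, h2]

/-- Contractions with the inverse metric become sums over frame indices. As `η² = 1`, the inverse
frame metric is `η` itself. -/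
lemma FrameMetric.sum_gInv (hF : IsFrame U e θ) (hη : η * η = 1) (hg : FrameMetric U θ η g)
    {x : Euc n} (hx : x ∈ U) (f : Fin n → Fin n → ℝ) :
    ∑ i, ∑ j, gInv g i j x * f i j
      = ∑ a, ∑ b, η a b * ∑ i, ∑ j, e a x i * e b x j * f i j := by
  have : ∀ i j, gInv g i j x = ∑ a, ∑ b, η a b * (e a x i * e b x j) := by
    intro i j
    rw [gInv, hg.inv_gMat hF hη hx]
    simp only [Matrix.mul_apply, eM, Matrix.of_apply, Matrix.transpose_apply, Finset.sum_mul]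
    rw [Finset.sum_comm]
    exact Finset.sum_congr rfl fun a _ => Finset.sum_congr rfl fun b _ => by ring
  simp only [this, Finset.sum_mul, Finset.mul_sum]
  rw [Finset.sum_congr rfl fun i _ => Finset.sum_comm]
  rw [Finset.sum_comm]
  refine Finset.sum_congr rfl fun a _ => ?_
  rw [Finset.sum_congr rfl fun i _ => Finset.sum_comm]
  rw [Finset.sum_comm]
  refine Finset.sum_congr rfl fun b _ => ?_
  exact Finset.sum_congr rfl fun i _ => Finset.sum_congr rfl fun j _ => by ring

/-- The covariant derivative of the coframe, `∂_i θ^a_j + ω^a_b(∂_i) θ^b_j`. -/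
def covM (θ : ι → Euc n → Euc n →L[ℝ] ℝ) (G : ι → ι → ι → Euc n → ℝ) (i : Fin n) (x : Euc n) :
    Matrix ι (Fin n) ℝ := pdM i (thM θ) x + omM θ G i x * thM θ x

lemma SmoothM.const (A : Matrix ι ι ℝ) : SmoothM U (fun _ : Euc n => A) :=
  fun _ _ => contDiffOn_const

lemma pdM_const (A : Matrix ι ι ℝ) (i : Fin n) (x : Euc n) : pdM i (fun _ => A) x = 0 := by
  ext a b; simp [pdM, pd]

lemma pdM_transpose {κ : Type*} (A : Euc n → Matrix ι κ ℝ) (i : Fin n) (x : Euc n) :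
    pdM i (fun y => (A y)ᵀ) x = (pdM i A x)ᵀ := rfl

/-- Metric compatibility: lowering an index with `η` makes the connection matrix skew, so in the
derivative of `Tᵗ η T` each `∂_i T` may be replaced by `∂_i T + ω_i T`. -/
lemma FrameMetric.pd_comp (hF : IsFrame U e θ) (hη' : ηᵀ = η)
    (hg : FrameMetric U θ η g)
    (hG : ∀ x ∈ U, ∀ a b c, ∑ d, η a d * G d b c x = - ∑ d, η b d * G d a c x)
    {x : Euc n} (hx : x ∈ U) (i j l : Fin n) :
    pd i (comp g j l) x = ((thM θ x)ᵀ * η * covM θ G i x) l j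
      + ((thM θ x)ᵀ * η * covM θ G i x) j l := by
  have hT := hF.smooth_thM
  have hTt : SmoothM U (fun y => (thM θ y)ᵀ) := fun a b => hT b a
  have h1 : pd i (comp g j l) x = pdM i (fun y => (thM θ y)ᵀ * η * thM θ y) x j l := by
    rw [pdM, Matrix.of_apply]
    refine pd_congr hF.isOpen (fun y hy => ?_) hx i
    rw [← hg.gMat_eq hy]; rfl
  have hskew : (omM θ G i x)ᵀ * η + η * omM θ G i x = 0 := by
    ext a b
    simp only [Matrix.add_apply, Matrix.mul_apply, Matrix.transpose_apply, omM, Matrix.of_apply,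
      Matrix.zero_apply, Finset.sum_mul, Finset.mul_sum]
    rw [Finset.sum_comm, Finset.sum_comm (f := fun x_1 i_1 => η a x_1 * _),
      ← Finset.sum_add_distrib]
    refine Finset.sum_eq_zero fun c _ => ?_
    have := hG x hx a b c
    have e1 : ∑ d, G d a c x * θ c x (coordVec i) * η d b
        = (∑ d, η b d * G d a c x) * θ c x (coordVec i) := by
      rw [Finset.sum_mul]
      refine Finset.sum_congr rfl fun d _ => ?_
      have : η d b = η b d := by conv_lhs => rw [← hη', Matrix.transpose_apply]
      rw [this]; ring
    have e2 : ∑ d, η a d * (G d b c x * θ c x (coordVec i))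
        = (∑ d, η a d * G d b c x) * θ c x (coordVec i) := by
      rw [Finset.sum_mul]
      exact Finset.sum_congr rfl fun d _ => by ring
    rw [e1, e2, this]; ring
  rw [h1, pdM_mul hF.isOpen (hTt.mul (SmoothM.const η)) hT hx,
    pdM_mul hF.isOpen hTt (SmoothM.const η) hx, pdM_const, pdM_transpose, Matrix.mul_zero,
    add_zero]
  have h2 : ((thM θ x)ᵀ * η * covM θ G i x)ᵀ = (covM θ G i x)ᵀ * η * thM θ x := by
    simp [Matrix.transpose_mul, hη', Matrix.mul_assoc]
  have h2 : ((thM θ x)ᵀ * η * covM θ G i x) l j = ((covM θ G i x)ᵀ * η * thM θ x) j l := by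
    rw [← h2, Matrix.transpose_apply]
  rw [h2, ← Matrix.add_apply]
  have : (covM θ G i x)ᵀ * η * thM θ x + (thM θ x)ᵀ * η * covM θ G i x
      = (pdM i (thM θ) x)ᵀ * η * thM θ x + (thM θ x)ᵀ * η * pdM i (thM θ) x
        + (thM θ x)ᵀ * ((omM θ G i x)ᵀ * η + η * omM θ G i x) * thM θ x := by
    simp only [covM, Matrix.transpose_add, Matrix.transpose_mul, Matrix.add_mul, Matrix.mul_add,
      Matrix.mul_assoc]
    abel
  rw [this, hskew]
  simp

/-- This is the uniqueness argument for the Levi-Civita connection: by the symmetry of `covM`, four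
of the six terms from the derivatives of `g` cancel. The result says that the Christoffel matrices
are the gauge transform of `ω` by the coframe matrix. -/
lemma FrameMetric.christoffel_eq (hF : IsFrame U e θ) (hη : η * η = 1) (hη' : ηᵀ = η)
    (hg : FrameMetric U θ η g)
    (hG : ∀ x ∈ U, ∀ a b c, ∑ d, η a d * G d b c x = - ∑ d, η b d * G d a c x)
    (hsym : ∀ x ∈ U, ∀ a i j, covM θ G i x a j = covM θ G j x a i)
    {x : Euc n} (hx : x ∈ U) (k i j : Fin n) :
    christoffel g k i j x = (eM e x * covM θ G i x) k j := by
  have hs : ∀ i j l, ((thM θ x)ᵀ * η * covM θ G i x) l j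
      = ((thM θ x)ᵀ * η * covM θ G j x) l i := by
    intro i j l
    simp only [Matrix.mul_apply (M := (thM θ x)ᵀ * η)]
    exact Finset.sum_congr rfl fun a _ => by rw [hsym x hx]
  have h2 : (eM e x * η * (eM e x)ᵀ) * ((thM θ x)ᵀ * η * covM θ G i x)
      = eM e x * covM θ G i x := by
    have h2 : (eM e x)ᵀ * (thM θ x)ᵀ = 1 := by
      rw [← Matrix.transpose_mul, hF.thM_mul_eM hx, Matrix.transpose_one]
    calc _ = eM e x * (η * ((eM e x)ᵀ * (thM θ x)ᵀ) * η) * covM θ G i x := by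
          simp only [Matrix.mul_assoc]
      _ = _ := by rw [h2, Matrix.mul_one, hη, Matrix.mul_one]
  rw [christoffel, ← h2, ← hg.inv_gMat hF hη hx, Matrix.mul_apply, Finset.mul_sum]
  refine Finset.sum_congr rfl fun l _ => ?_
  rw [hg.pd_comp hF hη' hG hx, hg.pd_comp hF hη' hG hx, hg.pd_comp hF hη' hG hx,
    hs j i l, hs l j i, hs l i j, gInv]
  ring

/-- The matrix of the curvature, `∂_i Γ_j - ∂_j Γ_i + [Γ_i, Γ_j]`. -/
def curvM {κ : Type*} [Fintype κ] (A : Fin n → Euc n → Matrix κ κ ℝ) (i j : Fin n) (x : Euc n) :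
    Matrix κ κ ℝ :=
  pdM i (A j) x - pdM j (A i) x + A i x * A j x - A j x * A i x

/-- The symmetry of `Γ` in its lower indices allows them to be arranged so that the Ricci tensor is
a trace of a matrix curvature, to which gauge covariance applies. -/
lemma ricci_eq_curvM (hU : IsOpen U) {A : Fin n → Euc n → Matrix (Fin n) (Fin n) ℝ}
    (h : ∀ x ∈ U, ∀ i j k, christoffel g k i j x = A i x k j)
    (hs : ∀ x ∈ U, ∀ i j k, A i x k j = A j x k i) {x : Euc n} (hx : x ∈ U) (i j : Fin n) :
    ricci g i j x = ∑ k, curvM A k j x k i := by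
  unfold ricci
  refine Finset.sum_congr rfl fun k _ => ?_
  simp only [curvM, Matrix.sub_apply, Matrix.add_apply, Matrix.mul_apply, pdM, Matrix.of_apply]
  rw [pd_congr hU (fun y hy => (h y hy i j k).trans (hs y hy i j k)) hx k,
    pd_congr hU (fun y hy => (h y hy i k k).trans (hs y hy i k k)) hx j, add_sub_assoc,
    ← Finset.sum_sub_distrib]
  congr 1
  refine Finset.sum_congr rfl fun l _ => ?_
  rw [h x hx, h x hx, h x hx, h x hx, hs x hx i j l, hs x hx i k l, hs x hx k l k]

lemma sum_sum_mul_sum {κ : Type*} [Fintype κ] (u w : κ → ℝ) (A B : κ → ι → ℝ) :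
    ∑ k, ∑ j, u k * w j * ∑ d, A k d * B j d = ∑ d, (∑ k, u k * A k d) * ∑ j, w j * B j d := by
  simp only [Finset.mul_sum, Finset.sum_mul]
  rw [Finset.sum_comm (s := (Finset.univ : Finset ι)), Finset.sum_comm]
  refine Finset.sum_congr rfl fun k _ => ?_
  rw [Finset.sum_comm (s := (Finset.univ : Finset ι))]
  exact Finset.sum_congr rfl fun j _ => Finset.sum_congr rfl fun d _ => by ring

/-- Cartan's structure equations: a connection without torsion that preserves the metric computes
the Ricci tensor. -/
theorem FrameMetric.ricci_eq (hF : IsFrame U e θ) (hη : η * η = 1) (hη' : ηᵀ = η)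
    (hg : FrameMetric U θ η g) (hGs : ∀ a b c, ContDiffOn ℝ ∞ (G a b c) U)
    (hG : ∀ x ∈ U, ∀ a b c, ∑ d, η a d * G d b c x = - ∑ d, η b d * G d a c x)
    (htor : ∀ x ∈ U, ∀ a b c, dForm (θ a) x (e b x) (e c x) = G a b c x - G a c b x)
    {x : Euc n} (hx : x ∈ U) (a b : ι) :
    ∑ i, ∑ j, e a x i * e b x j * ricci g i j x = frameRicci e θ G a b x := by
  have hU := hF.isOpen
  have hT := hF.smooth_thM
  have hE := hF.smooth_eM
  have hO := fun i => hF.smooth_omM hGs i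
  -- Vanishing torsion, read in coordinates.
  have hsym : ∀ x ∈ U, ∀ a i j, covM θ G i x a j = covM θ G j x a i := by
    intro x hx a i j
    have key : ∀ i j, pd i (fun y => θ a y (coordVec j)) x - pd j (fun y => θ a y (coordVec i)) x
        = dForm (θ a) x (coordVec i) (coordVec j) := by
      intro i j
      rw [pd_form hU (hF.θ_smooth a) hx, pd_form hU (hF.θ_smooth a) hx, dForm]
    have key2 : dForm (θ a) x (coordVec i) (coordVec j) = ∑ b, ∑ c,
        θ b x (coordVec i) * θ c x (coordVec j) * (G a b c x - G a c b x) := by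
      simp only [← htor x hx]
      conv_lhs => rw [← hF.expand x hx (coordVec i), ← hF.expand x hx (coordVec j)]
      simp only [dForm, map_sum, map_smul, _root_.sum_apply, _root_.smul_apply, smul_eq_mul]
      simp only [Finset.mul_sum]
      rw [Finset.sum_comm]
      simp only [← Finset.sum_sub_distrib]
      exact Finset.sum_congr rfl fun b _ => Finset.sum_congr rfl fun c _ => by ring
    rw [← sub_eq_zero]
    have h3 : covM θ G i x a j - covM θ G j x a i
        = (pd i (fun y => θ a y (coordVec j)) x - pd j (fun y => θ a y (coordVec i)) x)
          + ((omM θ G i x * thM θ x) a j - (omM θ G j x * thM θ x) a i) := by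
      simp only [covM, Matrix.add_apply, pdM, thM, Matrix.of_apply]
      ring
    rw [h3, key, key2]
    simp only [Matrix.mul_apply, omM, thM, Matrix.of_apply, Finset.sum_mul]
    rw [Finset.sum_comm (f := fun b c => G a b c x * θ c x (coordVec i) * θ b x (coordVec j))]
    simp only [← Finset.sum_sub_distrib, ← Finset.sum_add_distrib]
    exact Finset.sum_eq_zero fun b _ => Finset.sum_eq_zero fun c _ => by ring
  have hdE : ∀ i, pdM i (eM e) x = - (eM e x * pdM i (thM θ) x * eM e x) := by
    intro i
    have h1 : pdM i (fun y => eM e y * thM θ y) x = 0 := by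
      rw [pdM_congr hU (B := fun _ => 1) (fun y hy => hF.eM_mul_thM hy) hx, pdM_const]
    rw [pdM_mul hU hE hT hx] at h1
    have h2 := congrArg (· * eM e x) h1
    simp only [Matrix.add_mul, Matrix.mul_assoc, hF.thM_mul_eM hx, Matrix.mul_one,
      Matrix.zero_mul] at h2
    rw [Matrix.mul_assoc]
    exact eq_neg_of_add_eq_zero_left h2
  -- `Γ_i = E (∂_i + ω_i) T` with `E = T⁻¹`: the curvature of a gauge-transformed connection is
  -- conjugated.
  have hcurv : ∀ i j, curvM (fun i y => eM e y * covM θ G i y) i j x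
      = eM e x * curvM (omM θ G) i j x * thM θ x := by
    intro i j
    have hc : ∀ i j, pdM i (fun y => eM e y * covM θ G j y) x
        = pdM i (eM e) x * covM θ G j x + eM e x * (pdM i (pdM j (thM θ)) x
          + (pdM i (omM θ G j) x * thM θ x + omM θ G j x * pdM i (thM θ) x)) := by
      intro i j
      have hc : SmoothM U (covM θ G j) := (hT.pdM hU j).add ((hO j).mul hT)
      rw [pdM_mul hU hE hc hx]
      congr 2
      change pdM i (fun y => pdM j (thM θ) y + omM θ G j y * thM θ y) x = _
      rw [pdM_add hU (hT.pdM hU j) ((hO j).mul hT) hx, pdM_mul hU (hO j) hT hx]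
    have h1 : ∀ M : Matrix ι (Fin n) ℝ, thM θ x * (eM e x * M) = M := fun M => by
      rw [← Matrix.mul_assoc, hF.thM_mul_eM hx, Matrix.one_mul]
    unfold curvM
    rw [hc, hc, hdE, hdE, pdM_comm hU hT hx i j]
    simp only [covM, Matrix.add_mul, Matrix.mul_add, Matrix.sub_mul, Matrix.mul_sub,
      Matrix.neg_mul, Matrix.mul_assoc, h1]
    abel
  have hric : ∀ i j, ricci g i j x
      = ∑ k, (eM e x * curvM (omM θ G) k j x * thM θ x) k i := by
    intro i j
    rw [ricci_eq_curvM (A := fun i y => eM e y * covM θ G i y) hU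
      (fun y hy i j k => hg.christoffel_eq hF hη hη' hG hsym hy k i j) ?_ hx]
    · simp only [hcurv]
    · intro y hy i j k
      simp only [Matrix.mul_apply]
      exact Finset.sum_congr rfl fun a _ => by rw [hsym y hy]
  have step : ∑ i, ∑ j, e a x i * e b x j * ricci g i j x
      = ∑ c, ∑ k, ∑ j, e c x k * e b x j * curvM (omM θ G) k j x c a := by
    have h1 : ∀ j, ∑ i, e a x i * ricci g i j x
        = ∑ k, (eM e x * curvM (omM θ G) k j x) k a := by
      intro j
      simp only [hric, Finset.mul_sum]
      rw [Finset.sum_comm]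
      refine Finset.sum_congr rfl fun k _ => ?_
      have : eM e x * curvM (omM θ G) k j x
          = eM e x * curvM (omM θ G) k j x * thM θ x * eM e x := by
        rw [Matrix.mul_assoc (eM e x * curvM (omM θ G) k j x), hF.thM_mul_eM hx, Matrix.mul_one]
      conv_rhs => rw [this, Matrix.mul_apply (N := eM e x)]
      refine Finset.sum_congr rfl fun i _ => ?_
      simp only [eM, Matrix.of_apply]
      rw [mul_comm]
    calc _ = ∑ j, e b x j * ∑ i, e a x i * ricci g i j x := by
          rw [Finset.sum_comm]
          refine Finset.sum_congr rfl fun j _ => ?_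
          rw [Finset.mul_sum]
          exact Finset.sum_congr rfl fun i _ => by ring
      _ = ∑ j, ∑ k, ∑ c, e c x k * e b x j * curvM (omM θ G) k j x c a := by
          simp only [h1, Matrix.mul_apply, Finset.mul_sum]
          refine Finset.sum_congr rfl fun j _ => Finset.sum_congr rfl fun k _ =>
            Finset.sum_congr rfl fun c _ => ?_
          simp only [eM, Matrix.of_apply]
          ring
      _ = _ := by
          rw [Finset.sum_comm]
          rw [Finset.sum_congr rfl fun k _ => Finset.sum_comm]
          rw [Finset.sum_comm]
  rw [step, frameRicci]
  refine Finset.sum_congr rfl fun c _ => ?_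
  have hom : ∀ d f : ι, ∀ b, ∑ j, e b x j * omM θ G j x d f = G d f b x := by
    intro d f b
    simp only [omM, Matrix.of_apply, Finset.mul_sum]
    rw [Finset.sum_comm]
    have : ∀ l, ∑ j, e b x j * (G d f l x * θ l x (coordVec j)) = G d f l x * θ l x (e b x) := by
      intro l
      rw [clm_eq_sum_coord (θ l x) (e b x), Finset.mul_sum]
      exact Finset.sum_congr rfl fun j _ => by simp; ring
    simp only [this, hF.dual x hx]
    simp
  have hdom : ∀ k j, pdM k (omM θ G j) x c a = ∑ f, (pd k (G c a f) x * θ f x (coordVec j)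
      + G c a f x * pd k (fun y => θ f y (coordVec j)) x) := by
    intro k j
    simp only [pdM, Matrix.of_apply, omM, pd]
    have hd : ∀ f, DifferentiableAt ℝ (fun y => θ f y (coordVec j)) x := fun f =>
      diffAt_of_contDiffOn hU ((hF.θ_smooth f).clm_apply contDiffOn_const) hx
    have hd' : ∀ f, DifferentiableAt ℝ (G c a f) x := fun f =>
      diffAt_of_contDiffOn hU (hGs c a f) hx
    rw [fderiv_fun_sum (A := fun f y => G c a f y * θ f y (coordVec j))
      fun f _ => (hd' f).mul (hd f), _root_.sum_apply]
    refine Finset.sum_congr rfl fun f _ => ?_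
    rw [fderiv_fun_mul (hd' f) (hd f)]
    simp
    ring
  have part1 : ∑ k, ∑ j, e c x k * e b x j * (pdM k (omM θ G j) x c a - pdM j (omM θ G k) x c a)
      = dirD (G c a b) (e c) x - dirD (G c a c) (e b) x
        + ∑ f, G c a f x * dForm (θ f) x (e c x) (e b x) := by
    have h1 : ∀ f, ∑ k, ∑ j, e c x k * e b x j * (pd k (G c a f) x * θ f x (coordVec j))
        = dirD (G c a f) (e c) x * (if f = b then 1 else 0) := by
      intro f
      rw [← hF.dual x hx, dirD_eq_sum, clm_eq_sum_coord (θ f x) (e b x), Finset.sum_mul_sum]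
      exact Finset.sum_congr rfl fun k _ => Finset.sum_congr rfl fun j _ => by simp; ring
    have h2 : ∀ f, ∑ k, ∑ j, e c x k * e b x j * (pd j (G c a f) x * θ f x (coordVec k))
        = dirD (G c a f) (e b) x * (if f = c then 1 else 0) := by
      intro f
      rw [← hF.dual x hx, dirD_eq_sum, clm_eq_sum_coord (θ f x) (e c x), mul_comm,
        Finset.sum_mul_sum]
      exact Finset.sum_congr rfl fun k _ => Finset.sum_congr rfl fun j _ => by simp; ring
    have h3 : ∀ f, ∑ k, ∑ j, e c x k * e b x j * (G c a f x *
        (pd k (fun y => θ f y (coordVec j)) x - pd j (fun y => θ f y (coordVec k)) x))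
        = G c a f x * dForm (θ f) x (e c x) (e b x) := by
      intro f
      rw [dForm_eq_sum hU (hF.θ_smooth f) hx, Finset.mul_sum]
      refine Finset.sum_congr rfl fun k _ => ?_
      rw [Finset.mul_sum]
      exact Finset.sum_congr rfl fun j _ => by ring
    calc _ = ∑ f, (∑ k, ∑ j, e c x k * e b x j * (pd k (G c a f) x * θ f x (coordVec j))
          - ∑ k, ∑ j, e c x k * e b x j * (pd j (G c a f) x * θ f x (coordVec k))
          + ∑ k, ∑ j, e c x k * e b x j * (G c a f x *
            (pd k (fun y => θ f y (coordVec j)) x - pd j (fun y => θ f y (coordVec k)) x))) := by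
          simp only [← Finset.sum_sub_distrib, ← Finset.sum_add_distrib]
          rw [Finset.sum_comm (s := (Finset.univ : Finset ι))]
          refine Finset.sum_congr rfl fun k _ => ?_
          rw [Finset.sum_comm (s := (Finset.univ : Finset ι))]
          refine Finset.sum_congr rfl fun j _ => ?_
          rw [hdom, hdom, ← Finset.sum_sub_distrib, Finset.mul_sum]
          exact Finset.sum_congr rfl fun f _ => by ring
      _ = _ := by
          simp only [h1, h2, h3, Finset.sum_add_distrib, Finset.sum_sub_distrib]
          simp
  have prod1 : ∑ k, ∑ j, e c x k * e b x j * (omM θ G k x * omM θ G j x) c a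
      = ∑ d, G c d c x * G d a b x := by
    simp only [Matrix.mul_apply]
    rw [sum_sum_mul_sum (A := fun k d => omM θ G k x c d) (B := fun j d => omM θ G j x d a)]
    simp only [hom]
  have prod2 : ∑ k, ∑ j, e c x k * e b x j * (omM θ G j x * omM θ G k x) c a
      = ∑ d, G c d b x * G d a c x := by
    simp only [Matrix.mul_apply]
    rw [Finset.sum_comm]
    simp only [mul_comm (e c x _)]
    rw [sum_sum_mul_sum (A := fun k d => omM θ G k x c d) (B := fun j d => omM θ G j x d a)]
    simp only [hom]
  calc _ = ∑ k, ∑ j, e c x k * e b x j * (pdM k (omM θ G j) x c a - pdM j (omM θ G k) x c a)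
        + (∑ k, ∑ j, e c x k * e b x j * (omM θ G k x * omM θ G j x) c a
        - ∑ k, ∑ j, e c x k * e b x j * (omM θ G j x * omM θ G k x) c a) := by
        simp only [← Finset.sum_sub_distrib, ← Finset.sum_add_distrib, curvM, Matrix.sub_apply,
          Matrix.add_apply]
        exact Finset.sum_congr rfl fun k _ => Finset.sum_congr rfl fun j _ => by ring
    _ = _ := by
        rw [part1, prod1, prod2, ← Finset.sum_sub_distrib, add_assoc, ← Finset.sum_add_distrib]
        congr 1
        exact Finset.sum_congr rfl fun d _ => by ring

end Cartan

/-! ### The near-horizon metric in a null frame -/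

/-- The components of the Levi-Civita connection of an orthonormal frame, `ω^i_j(e_k)`. -/
def conn {n : ℕ} {ι : Type*} (e : ι → Euc n → Euc n) (θ : ι → Euc n → Euc n →L[ℝ] ℝ)
    (i j k : ι) (x : Euc n) : ℝ :=
  (1 / 2) * (dForm (θ j) x (e i x) (e k x) * (-1) + dForm (θ k) x (e j x) (e i x)
    + dForm (θ i) x (e j x) (e k x))

lemma dForm_swap {n : ℕ} (α : Euc n → Euc n →L[ℝ] ℝ) (x X Y : Euc n) :
    dForm α x X Y = - dForm α x Y X := by
  simp [dForm]

lemma dForm_self {n : ℕ} (α : Euc n → Euc n →L[ℝ] ℝ) (x X : Euc n) : dForm α x X X = 0 := by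
  simp [dForm]

lemma conn_antisymm {n : ℕ} {ι : Type*} (e : ι → Euc n → Euc n)
    (θ : ι → Euc n → Euc n →L[ℝ] ℝ) (i j k : ι) (x : Euc n) :
    conn e θ i j k x = - conn e θ j i k x := by
  unfold conn
  rw [dForm_swap (θ k) x (e j x)]
  ring

lemma conn_torsion {n : ℕ} {ι : Type*} (e : ι → Euc n → Euc n)
    (θ : ι → Euc n → Euc n →L[ℝ] ℝ) (i j k : ι) (x : Euc n) :
    dForm (θ i) x (e j x) (e k x) = conn e θ i j k x - conn e θ i k j x := by
  unfold conn
  rw [dForm_swap (θ j) x (e k x), dForm_swap (θ k) x (e i x), dForm_swap (θ i) x (e k x)]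
  ring_nf

@[simp] lemma dForm_zero_left {n : ℕ} (α : Euc n → Euc n →L[ℝ] ℝ) (x X : Euc n) :
    dForm α x 0 X = 0 := by
  simp [dForm]

@[simp] lemma dForm_zero_right {n : ℕ} (α : Euc n → Euc n →L[ℝ] ℝ) (x X : Euc n) :
    dForm α x X 0 = 0 := by
  simp [dForm]

lemma contDiffOn_dForm {n : ℕ} {U : Set (Euc n)} (hU : IsOpen U) {α : Euc n → Euc n →L[ℝ] ℝ}
    (hα : ContDiffOn ℝ ∞ α U) {X Y : Euc n → Euc n} (hX : ContDiffOn ℝ ∞ X U)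
    (hY : ContDiffOn ℝ ∞ Y U) : ContDiffOn ℝ ∞ (fun x => dForm α x (X x) (Y x)) U :=
  (((contDiffOn_fderiv hU hα).clm_apply hX).clm_apply hY).sub
    (((contDiffOn_fderiv hU hα).clm_apply hY).clm_apply hX)

lemma contDiffOn_conn {n : ℕ} {ι : Type*} [Fintype ι] [DecidableEq ι] {U : Set (Euc n)}
    {e : ι → Euc n → Euc n} {θ : ι → Euc n → Euc n →L[ℝ] ℝ} (hF : IsFrame U e θ) (i j k : ι) :
    ContDiffOn ℝ ∞ (conn e θ i j k) U :=
  contDiffOn_const.mul ((((contDiffOn_dForm hF.isOpen (hF.θ_smooth j) (hF.e_smooth i)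
    (hF.e_smooth k)).mul contDiffOn_const).add (contDiffOn_dForm hF.isOpen (hF.θ_smooth k)
    (hF.e_smooth j) (hF.e_smooth i))).add (contDiffOn_dForm hF.isOpen (hF.θ_smooth i)
    (hF.e_smooth j) (hF.e_smooth k)))

/-- The `i`-th coordinate as a linear map. -/
def coordL {n : ℕ} (i : Fin n) : Euc n →L[ℝ] ℝ := EuclideanSpace.proj i

@[simp] lemma coordL_apply {n : ℕ} (i : Fin n) (x : Euc n) : coordL i x = x i := rfl

/-- The projection `(v, r, x) ↦ x` as a linear map. -/
def horL : Euc 5 →L[ℝ] Euc 3 :=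
  LinearMap.toContinuousLinearMap
    { toFun := hor
      map_add' := fun x y => by ext i; fin_cases i <;> simp [hor]
      map_smul' := fun c x => by ext i; fin_cases i <;> simp [hor] }

@[simp] lemma horL_apply (x : Euc 5) : horL x = hor x := rfl

/-- The inclusion `x ↦ (0, 0, x)`. -/
def liftL : Euc 3 →L[ℝ] Euc 5 :=
  LinearMap.toContinuousLinearMap
    { toFun := fun x => WithLp.toLp 2 ![0, 0, x 0, x 1, x 2]
      map_add' := fun x y => by ext i; fin_cases i <;> simp
      map_smul' := fun c x => by ext i; fin_cases i <;> simp }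

lemma liftL_apply (x : Euc 3) : liftL x = WithLp.toLp 2 ![0, 0, x 0, x 1, x 2] := rfl

@[simp] lemma hor_liftL (x : Euc 3) : hor (liftL x) = x := by
  ext i; fin_cases i <;> simp [hor, liftL_apply]

@[simp] lemma liftL_zero (x : Euc 3) : liftL x 0 = 0 := by simp [liftL_apply]
@[simp] lemma liftL_one (x : Euc 3) : liftL x 1 = 0 := by simp [liftL_apply]
@[simp] lemma hor_add (x y : Euc 5) : hor (x + y) = hor x + hor y := horL.map_add x y
@[simp] lemma hor_sub (x y : Euc 5) : hor (x - y) = hor x - hor y := horL.map_sub x y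
@[simp] lemma hor_smul (c : ℝ) (x : Euc 5) : hor (c • x) = c • hor x := horL.map_smul c x
@[simp] lemma hor_coordVec_zero : hor (coordVec 0) = 0 := by
  ext i; fin_cases i <;> simp [hor, coordVec]
@[simp] lemma hor_coordVec_one : hor (coordVec 1) = 0 := by
  ext i; fin_cases i <;> simp [hor, coordVec]

@[simp] lemma coordVec_apply {n : ℕ} (i j : Fin n) :
    (coordVec i : Euc n) j = if j = i then 1 else 0 := by
  simp [coordVec]

lemma eq_coordVec_add_liftL (x : Euc 5) :
    x = x 0 • coordVec 0 + x 1 • coordVec 1 + liftL (hor x) := by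
  ext i; fin_cases i <;> simp [hor, coordVec, liftL_apply]

/-- The near-horizon fields with constant `F`, `Δ`, in coordinates. -/
def localFields (γ : Euc 3 → Euc 3 → Euc 3 → ℝ) (h : Euc 3 → Euc 3 →L[ℝ] ℝ) (F Δ : ℝ)
    (B : Euc 3 → Euc 3 →L[ℝ] Euc 3 →L[ℝ] ℝ) : EMFields where
  metric x X Y := X 0 * Y 1 + X 1 * Y 0
      + x 1 * (X 0 * h (hor x) (hor Y) + Y 0 * h (hor x) (hor X))
      + (x 1) ^ 2 * F * (X 0 * Y 0) + γ (hor x) (hor X) (hor Y)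
  maxwell x X Y := Δ * (X 1 * Y 0 - X 0 * Y 1) + B (hor x) (hor X) (hor Y)

/-- Indices `+`, `-`, `i` of a null frame. -/
abbrev NullIdx := Option (Option (Fin 3))

/-- The null frame. -/
def nullE (e : Fin 3 → Euc 3 → Euc 3) (h : Euc 3 → Euc 3 →L[ℝ] ℝ) (F : ℝ) :
    NullIdx → Euc 5 → Euc 5
  | none => fun x => coordVec 0 - ((1 / 2) * (x 1) ^ 2 * F) • coordVec 1
  | some none => fun _ => coordVec 1
  | some (some i) => fun x => liftL (e i (hor x))
      - (x 1 * h (hor x) (e i (hor x))) • coordVec 1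

/-- The null coframe. -/
def nullTh (θ : Fin 3 → Euc 3 → Euc 3 →L[ℝ] ℝ) (h : Euc 3 → Euc 3 →L[ℝ] ℝ) (F : ℝ) :
    NullIdx → Euc 5 → Euc 5 →L[ℝ] ℝ
  | none => fun _ => coordL 0
  | some none => fun x => coordL 1 + x 1 • (h (hor x)).comp horL
      + ((1 / 2) * (x 1) ^ 2 * F) • coordL 0
  | some (some i) => fun x => (θ i (hor x)).comp horL

/-- The constant metric of a null frame. -/
def nullEta : Matrix NullIdx NullIdx ℝ := Matrix.of fun a b =>
  match a, b with
  | none, some none => 1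
  | some none, none => 1
  | some (some i), some (some j) => if i = j then 1 else 0
  | _, _ => 0

/-- The connection of the near-horizon metric in the null frame. -/
def nullG (e : Fin 3 → Euc 3 → Euc 3) (θ : Fin 3 → Euc 3 → Euc 3 →L[ℝ] ℝ)
    (h : Euc 3 → Euc 3 →L[ℝ] ℝ) (F : ℝ) : NullIdx → NullIdx → NullIdx → Euc 5 → ℝ
  | none, none, none => fun x => (-F) * x 1
  | none, none, some (some i) => fun x => (-1 / 2) * h (hor x) (e i (hor x))
  | none, some (some i), none => fun x => (-1 / 2) * h (hor x) (e i (hor x))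
  | some none, some none, none => fun x => F * x 1
  | some none, some none, some (some i) => fun x => (1 / 2) * h (hor x) (e i (hor x))
  | some none, some (some i), none => fun x =>
      (-F / 2) * ((x 1) ^ 2 * h (hor x) (e i (hor x)))
  | some none, some (some i), some none => fun x => (-1 / 2) * h (hor x) (e i (hor x))
  | some none, some (some i), some (some j) => fun x =>
      (1 / 2) * (x 1 * dForm h (hor x) (e i (hor x)) (e j (hor x)))
  | some (some i), none, none => fun x =>
      (F / 2) * ((x 1) ^ 2 * h (hor x) (e i (hor x)))
  | some (some i), none, some none => fun x => (1 / 2) * h (hor x) (e i (hor x))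
  | some (some i), none, some (some j) => fun x =>
      (-1 / 2) * (x 1 * dForm h (hor x) (e i (hor x)) (e j (hor x)))
  | some (some i), some none, none => fun x => (1 / 2) * h (hor x) (e i (hor x))
  | some (some i), some (some j), none => fun x =>
      (-1 / 2) * (x 1 * dForm h (hor x) (e i (hor x)) (e j (hor x)))
  | some (some i), some (some j), some (some k) => fun x => conn e θ i j k (hor x)
  | _, _, _ => fun _ => 0

lemma nullEta_mul_self : nullEta * nullEta = 1 := by
  ext a b
  rcases a with _ | _ | i <;> rcases b with _ | _ | j <;>
    simp [Matrix.mul_apply, nullEta, Matrix.one_apply, Fintype.sum_option]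

lemma nullEta_transpose : nullEta.transpose = nullEta := by
  ext a b
  rcases a with _ | _ | i <;> rcases b with _ | _ | j <;>
    simp [Matrix.transpose_apply, nullEta, eq_comm]

section

variable {U : Set (Euc 3)} {e : Fin 3 → Euc 3 → Euc 3} {θ : Fin 3 → Euc 3 → Euc 3 →L[ℝ] ℝ}
  {h : Euc 3 → Euc 3 →L[ℝ] ℝ} {F Δ : ℝ} {B : Euc 3 → Euc 3 →L[ℝ] Euc 3 →L[ℝ] ℝ}
  {γ : Euc 3 → Euc 3 → Euc 3 → ℝ}

lemma contDiffOn_comp_hor {E : Type*} [NormedAddCommGroup E] [NormedSpace ℝ E] {f : Euc 3 → E}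
    (hf : ContDiffOn ℝ ∞ f U) : ContDiffOn ℝ ∞ (fun x => f (hor x)) (hor ⁻¹' U) :=
  hf.comp (horL.contDiff.contDiffOn) (fun _ hx => hx)

lemma contDiff_coord {n : ℕ} (i : Fin n) : ContDiff ℝ (F := ℝ) ∞ (fun x : Euc n => x i) :=
  (coordL i : Euc n →L[ℝ] ℝ).contDiff

lemma isFrame_null (hF : IsFrame U e θ) (hh : ContDiffOn ℝ ∞ h U) :
    IsFrame (hor ⁻¹' U) (nullE e h F) (nullTh θ h F) where
  isOpen := hF.isOpen.preimage horL.continuous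
  e_smooth := by
    have hr : ContDiffOn ℝ (F := ℝ) ∞ (fun x : Euc 5 => x 1) (hor ⁻¹' U) := (contDiff_coord 1).contDiffOn
    rintro (_ | _ | i)
    · exact contDiffOn_const.sub (((contDiffOn_const.mul (hr.pow 2)).mul contDiffOn_const).smul
        contDiffOn_const)
    · exact contDiffOn_const
    · exact (liftL.contDiff.comp_contDiffOn (contDiffOn_comp_hor (hF.e_smooth i))).sub
        ((hr.mul (contDiffOn_comp_hor (hh.clm_apply (hF.e_smooth i)))).smul contDiffOn_const)
  θ_smooth := by
    have hr : ContDiffOn ℝ (F := ℝ) ∞ (fun x : Euc 5 => x 1) (hor ⁻¹' U) := (contDiff_coord 1).contDiffOn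
    rintro (_ | _ | i)
    · exact contDiffOn_const
    · exact (contDiffOn_const.add (hr.smul ((contDiffOn_comp_hor hh).clm_comp
        contDiffOn_const))).add
        (((contDiffOn_const.mul (hr.pow 2)).mul contDiffOn_const).smul contDiffOn_const)
    · exact (contDiffOn_comp_hor (hF.θ_smooth i)).clm_comp contDiffOn_const
  dual := by
    intro x hx a b
    rcases a with _ | _ | i <;> rcases b with _ | _ | j <;>
      simp [nullE, nullTh, hF.dual (hor x) hx]
  expand := by
    intro x hx X
    have := hF.expand (hor x) hx (hor X)
    have h2 : h (hor x) (hor X) = ∑ i, θ i (hor x) (hor X) * h (hor x) (e i (hor x)) := by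
      conv_lhs => rw [← this]
      simp
    have h3 : liftL (hor X) = ∑ i, θ i (hor x) (hor X) • liftL (e i (hor x)) := by
      conv_lhs => rw [← this]
      simp
    conv_rhs => rw [eq_coordVec_add_liftL X, h3]
    simp only [Fintype.sum_option, nullE, nullTh]
    simp [smul_sub, Finset.sum_sub_distrib, h2, add_smul, smul_smul]
    have h4 : ∑ i, θ i (hor x) (hor X) * (x 1 * h (hor x) (e i (hor x)))
        = x 1 * ∑ i, θ i (hor x) (hor X) * h (hor x) (e i (hor x)) := by
      rw [Finset.mul_sum]
      exact Finset.sum_congr rfl fun i _ => by ring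
    rw [← Finset.sum_smul, h4]
    module

lemma frameMetric_null (hγ : ∀ x ∈ U, ∀ X Y, γ x X Y = ∑ i, θ i x X * θ i x Y) :
    FrameMetric (hor ⁻¹' U) (nullTh θ h F) nullEta (localFields γ h F Δ B).metric := by
  intro x hx X Y
  simp [localFields, hγ (hor x) hx, Fintype.sum_option, nullTh, nullEta]
  ring

lemma nullEta_sum_p (f : NullIdx → ℝ) : ∑ d, nullEta none d * f d = f (some none) := by
  simp [Fintype.sum_option, nullEta]

lemma nullEta_sum_m (f : NullIdx → ℝ) : ∑ d, nullEta (some none) d * f d = f none := by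
  simp [Fintype.sum_option, nullEta]

lemma nullEta_sum_s (i : Fin 3) (f : NullIdx → ℝ) :
    ∑ d, nullEta (some (some i)) d * f d = f (some (some i)) := by
  simp [Fintype.sum_option, nullEta]

lemma nullG_skew (a b c : NullIdx) (x : Euc 5) :
    ∑ d, nullEta a d * nullG e θ h F d b c x = - ∑ d, nullEta b d * nullG e θ h F d a c x := by
  rcases a with _ | _ | i <;> rcases b with _ | _ | j <;>
    simp only [nullEta_sum_p, nullEta_sum_m, nullEta_sum_s] <;>
    rcases c with _ | _ | k <;> simp only [nullG] <;> try ring1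
  · rw [dForm_swap h]; ring
  · rw [conn_antisymm]

lemma contDiffOn_nullG (hF : IsFrame U e θ) (hh : ContDiffOn ℝ ∞ h U) (a b c : NullIdx) :
    ContDiffOn ℝ ∞ (nullG e θ h F a b c) (hor ⁻¹' U) := by
  have hr : ContDiffOn ℝ (F := ℝ) ∞ (fun x : Euc 5 => x 1) (hor ⁻¹' U) := (contDiff_coord 1).contDiffOn
  have hi := fun i => contDiffOn_comp_hor (hh.clm_apply (hF.e_smooth i))
  have hd := fun i j => contDiffOn_comp_hor
    (contDiffOn_dForm hF.isOpen hh (hF.e_smooth i) (hF.e_smooth j))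
  have hc := fun i j k => contDiffOn_comp_hor (contDiffOn_conn hF i j k)
  rcases a with _ | _ | i <;> rcases b with _ | _ | j <;> rcases c with _ | _ | k <;>
    simp only [nullG] <;>
    first
    | exact contDiffOn_const
    | exact hc _ _ _
    | exact contDiffOn_const.mul hr
    | exact contDiffOn_const.mul (hi _)
    | exact contDiffOn_const.mul ((hr.pow 2).mul (hi _))
    | exact contDiffOn_const.mul (hr.mul (hd _ _))

lemma hasFDerivAt_comp_hor {E : Type*} [NormedAddCommGroup E] [NormedSpace ℝ E] {f : Euc 3 → E}
    {x : Euc 5} (hf : DifferentiableAt ℝ f (hor x)) :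
    HasFDerivAt (fun y => f (hor y)) ((fderiv ℝ f (hor x)).comp horL) x :=
  HasFDerivAt.comp x (g := f) (f := hor) hf.hasFDerivAt horL.hasFDerivAt

lemma hasFDerivAt_coord {n : ℕ} (i : Fin n) (x : Euc n) :
    HasFDerivAt (F := ℝ) (fun y : Euc n => y i) (coordL i : Euc n →L[ℝ] ℝ) x :=
  (coordL i : Euc n →L[ℝ] ℝ).hasFDerivAt

lemma dForm_nullTh_p (x X Y : Euc 5) : dForm (nullTh θ h F none) x X Y = 0 := by
  simp [dForm, nullTh]

lemma dForm_nullTh_s (hF : IsFrame U e θ) {x : Euc 5} (hx : hor x ∈ U) (i : Fin 3) (X Y : Euc 5) :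
    dForm (nullTh θ h F (some (some i))) x X Y = dForm (θ i) (hor x) (hor X) (hor Y) := by
  have h1 : HasFDerivAt (nullTh θ h F (some (some i))) _ x :=
    (hasFDerivAt_comp_hor (diffAt_of_contDiffOn hF.isOpen (hF.θ_smooth i) hx)).clm_comp
      (hasFDerivAt_const horL x)
  rw [dForm, h1.fderiv]
  simp [dForm]

/-- This is `dr ∧ h + r dh + r F dr ∧ dv`; a varying `F` would add a term `(1/2) r² dF ∧ dv`. -/
lemma dForm_nullTh_m (hU : IsOpen U) (hh : ContDiffOn ℝ ∞ h U) {x : Euc 5} (hx : hor x ∈ U)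
    (X Y : Euc 5) :
    dForm (nullTh θ h F (some none)) x X Y
      = X 1 * h (hor x) (hor Y) - Y 1 * h (hor x) (hor X)
        + x 1 * dForm h (hor x) (hor X) (hor Y) + x 1 * F * (X 1 * Y 0 - Y 1 * X 0) := by
  have h1 := (hasFDerivAt_comp_hor (diffAt_of_contDiffOn hU hh hx)).clm_comp
      (hasFDerivAt_const horL x)
  have hr := hasFDerivAt_coord 1 x
  have h2 : HasFDerivAt (nullTh θ h F (some none)) _ x :=
    ((hasFDerivAt_const (coordL 1 : Euc 5 →L[ℝ] ℝ) x).add (hr.smul h1)).add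
      ((((hr.pow 2).const_mul (1 / 2)).mul_const F).smul
        (hasFDerivAt_const (coordL 0 : Euc 5 →L[ℝ] ℝ) x))
  rw [dForm, h2.fderiv]
  simp [dForm]
  ring

@[simp] lemma nullE_p_zero (x : Euc 5) : nullE e h F none x 0 = 1 := by simp [nullE]
@[simp] lemma nullE_p_one (x : Euc 5) : nullE e h F none x 1 = -(1 / 2) * (x 1) ^ 2 * F := by
  simp [nullE]
@[simp] lemma hor_nullE_p (x : Euc 5) : hor (nullE e h F none x) = 0 := by simp [nullE]
@[simp] lemma nullE_m_zero (x : Euc 5) : nullE e h F (some none) x 0 = 0 := by simp [nullE]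
@[simp] lemma nullE_m_one (x : Euc 5) : nullE e h F (some none) x 1 = 1 := by simp [nullE]
@[simp] lemma hor_nullE_m (x : Euc 5) : hor (nullE e h F (some none) x) = 0 := by simp [nullE]
@[simp] lemma nullE_s_zero (i : Fin 3) (x : Euc 5) : nullE e h F (some (some i)) x 0 = 0 := by
  simp [nullE]
@[simp] lemma nullE_s_one (i : Fin 3) (x : Euc 5) :
    nullE e h F (some (some i)) x 1 = -(x 1 * h (hor x) (e i (hor x))) := by
  simp [nullE]
@[simp] lemma hor_nullE_s (i : Fin 3) (x : Euc 5) :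
    hor (nullE e h F (some (some i)) x) = e i (hor x) := by simp [nullE]

/-- Together with `nullG_skew` this identifies the guessed coefficients `nullG` as the Levi-Civita
connection. The mixed coefficients come from the derivative of the second null form; the purely
horizontal ones are those of `γ`. -/
lemma nullG_torsion (hF : IsFrame U e θ) (hh : ContDiffOn ℝ ∞ h U) {x : Euc 5} (hx : hor x ∈ U)
    (a b c : NullIdx) :
    dForm (nullTh θ h F a) x (nullE e h F b x) (nullE e h F c x)
      = nullG e θ h F a b c x - nullG e θ h F a c b x := by
  rcases a with _ | _ | i
  · rw [dForm_nullTh_p]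
    rcases b with _ | _ | j <;> rcases c with _ | _ | k <;> simp only [nullG] <;> ring
  · rw [dForm_nullTh_m hF.isOpen hh hx]
    rcases b with _ | _ | j <;> rcases c with _ | _ | k <;>
      simp only [nullG, nullE_p_zero, nullE_p_one, hor_nullE_p, nullE_m_zero, nullE_m_one,
        hor_nullE_m, nullE_s_zero, nullE_s_one, hor_nullE_s, dForm_zero_left, dForm_zero_right,
        map_zero, dForm_self] <;> try ring1
    rw [dForm_swap h (hor x) (e k (hor x))]
    ring
  · rw [dForm_nullTh_s hF hx]
    rcases b with _ | _ | j <;> rcases c with _ | _ | k <;>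
      simp only [nullG, hor_nullE_p, hor_nullE_m, hor_nullE_s, dForm_zero_left, dForm_zero_right,
        dForm_self] <;> try ring1
    exact conn_torsion e θ _ _ _ _

lemma dirD_const {n : ℕ} (c : ℝ) (V : Euc n → Euc n) (x : Euc n) :
    dirD (fun _ => c) V x = 0 := by
  simp [dirD]

lemma dirD_const_mul {n : ℕ} {f : Euc n → ℝ} {V : Euc n → Euc n} {x : Euc n} (c : ℝ)
    (hf : DifferentiableAt ℝ f x) : dirD (fun y => c * f y) V x = c * dirD f V x := by
  simp [dirD, fderiv_const_mul hf]

lemma dirD_comp_hor {f : Euc 3 → ℝ} {V : Euc 5 → Euc 5} {x : Euc 5}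
    (hf : DifferentiableAt ℝ f (hor x)) :
    dirD (fun y => f (hor y)) V x = fderiv ℝ f (hor x) (hor (V x)) := by
  rw [dirD, (hasFDerivAt_comp_hor hf).fderiv]
  simp

lemma dirD_mul_comp_hor {f : Euc 3 → ℝ} {V : Euc 5 → Euc 5} {x : Euc 5} (c : ℝ)
    (hf : DifferentiableAt ℝ f (hor x)) :
    dirD (fun y => c * f (hor y)) V x = c * fderiv ℝ f (hor x) (hor (V x)) := by
  rw [dirD, ((hasFDerivAt_comp_hor hf).const_mul c).fderiv]
  simp

lemma dirD_mul_r_comp_hor {f : Euc 3 → ℝ} {V : Euc 5 → Euc 5} {x : Euc 5} (c : ℝ)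
    (hf : DifferentiableAt ℝ f (hor x)) (hr : x 1 = 0) :
    dirD (fun y => c * (y 1 * f (hor y))) V x = c * (V x 1 * f (hor x)) := by
  have h1 : HasFDerivAt (fun y : Euc 5 => c * (y 1 * f (hor y))) _ x :=
    ((hasFDerivAt_coord 1 x).mul (hasFDerivAt_comp_hor hf)).const_mul c
  rw [dirD, h1.fderiv]
  simp [hr, mul_comm (f (hor x))]

lemma dirD_mul_r {V : Euc 5 → Euc 5} {x : Euc 5} (c : ℝ) :
    dirD (fun y : Euc 5 => c * y 1) V x = c * V x 1 := by
  rw [dirD, ((hasFDerivAt_coord 1 x).const_mul c).fderiv]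
  simp

end

/-! ### The Einstein equations on the horizon. -/

section

variable {U : Set (Euc 3)} {e : Fin 3 → Euc 3 → Euc 3} {θ : Fin 3 → Euc 3 → Euc 3 →L[ℝ] ℝ}
  {h : Euc 3 → Euc 3 →L[ℝ] ℝ} {F Δ : ℝ} {B : Euc 3 → Euc 3 →L[ℝ] Euc 3 →L[ℝ] ℝ}
  {γ : Euc 3 → Euc 3 → Euc 3 → ℝ}

/-- The covariant derivative `h_{i;j}` in an orthonormal frame. -/
def covD (e : Fin 3 → Euc 3 → Euc 3) (θ : Fin 3 → Euc 3 → Euc 3 →L[ℝ] ℝ)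
    (h : Euc 3 → Euc 3 →L[ℝ] ℝ) (i j : Fin 3) (x : Euc 3) : ℝ :=
  dirD (fun y => h y (e i y)) (e j) x - ∑ k, conn e θ k i j x * h x (e k x)

/-- At `r = 0` the connection coefficients linear in `r` matter only through their `r`-derivatives.
The last two terms add up to the symmetrized covariant derivative of `h`, since `dForm h` is its
antisymmetrization. -/
lemma frameRicci_null_ss (hF : IsFrame U e θ) (hh : ContDiffOn ℝ ∞ h U) {x : Euc 5}
    (hx : hor x ∈ U) (hr : x 1 = 0) (i j : Fin 3) :
    frameRicci (nullE e h F) (nullTh θ h F) (nullG e θ h F) (some (some i)) (some (some j)) x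
      = frameRicci e θ (conn e θ) i j (hor x)
        - (1 / 2) * (h (hor x) (e i (hor x)) * h (hor x) (e j (hor x)))
        + covD e θ h i j (hor x) + (1 / 2) * dForm h (hor x) (e i (hor x)) (e j (hor x)) := by
  have hi := fun i => diffAt_of_contDiffOn hF.isOpen (hh.clm_apply (hF.e_smooth i)) hx
  have hd := fun i j => diffAt_of_contDiffOn hF.isOpen
    (contDiffOn_dForm hF.isOpen hh (hF.e_smooth i) (hF.e_smooth j)) hx
  have hc := fun i j k => diffAt_of_contDiffOn hF.isOpen (contDiffOn_conn hF i j k) hx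
  have hm := fun V c i => dirD_mul_comp_hor (V := V) c (hi i)
  have hm1 := fun V c i j => dirD_mul_r_comp_hor (V := V) c (hd i j) hr
  have hm3 := fun V i j k => dirD_comp_hor (V := V) (hc i j k)
  simp only [frameRicci, Fintype.sum_option, nullG_torsion hF hh hx]
  simp only [nullG, dirD_const, hm, hm1, hm3]
  have h1 : ∑ k, (-1 / 2) * h (hor x) (e k (hor x)) * conn e θ k i j (hor x)
      = -(1 / 2) * ∑ k, conn e θ k i j (hor x) * h (hor x) (e k (hor x)) := by
    rw [Finset.mul_sum]
    exact Finset.sum_congr rfl fun k _ => by ring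
  simp only [conn_torsion e θ, covD, dirD]
  simp [h1, hr]
  ring

/-- This component contains `F`, from the `r`-derivative of the coefficient `F r`, and so it
determines `F`. -/
lemma frameRicci_null_mp (hF : IsFrame U e θ) (hh : ContDiffOn ℝ ∞ h U) {x : Euc 5}
    (hx : hor x ∈ U) (hr : x 1 = 0) :
    frameRicci (nullE e h F) (nullTh θ h F) (nullG e θ h F) (some none) none x
      = F - (1 / 2) * ∑ i, (h (hor x) (e i (hor x))) ^ 2
        + (1 / 2) * ∑ i, covD e θ h i i (hor x) := by
  have hi := fun i => diffAt_of_contDiffOn hF.isOpen (hh.clm_apply (hF.e_smooth i)) hx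
  have hm := fun V c i => dirD_mul_comp_hor (V := V) c (hi i)
  simp only [frameRicci, Fintype.sum_option, nullG_torsion hF hh hx]
  simp only [nullG, dirD_const, hm, dirD_mul_r]
  have h1 : ∀ a b, conn e θ a b a (hor x) = - conn e θ b a a (hor x) :=
    fun a b => conn_antisymm e θ a b a _
  simp only [covD, dirD, h1]
  simp [hr, Fin.sum_univ_three]
  ring

lemma bilin_expand {n : ℕ} {T : Euc n → Euc n → ℝ}
    (h1 : ∀ Y, ∃ L : Euc n →L[ℝ] ℝ, ∀ X, T X Y = L X)
    (h2 : ∀ X, ∃ L : Euc n →L[ℝ] ℝ, ∀ Y, T X Y = L Y) (X Y : Euc n) :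
    T X Y = ∑ i, ∑ j, X i * Y j * T (coordVec i) (coordVec j) := by
  obtain ⟨L, hL⟩ := h1 Y
  rw [hL, clm_eq_sum_coord L X]
  refine Finset.sum_congr rfl fun i _ => ?_
  obtain ⟨L', hL'⟩ := h2 (coordVec i)
  rw [← hL, hL', clm_eq_sum_coord L' Y, smul_eq_mul, Finset.mul_sum]
  exact Finset.sum_congr rfl fun j _ => by rw [hL']; simp; ring

lemma sum_pair_mul {κ κ' : Type*} [Fintype κ] [Fintype κ'] (X u : κ → ℝ) (Y v : κ' → ℝ) :
    ∑ i, ∑ j, X i * Y j * (u i * v j) = (∑ i, X i * u i) * ∑ j, Y j * v j := by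
  rw [Finset.sum_mul_sum]
  exact Finset.sum_congr rfl fun i _ => Finset.sum_congr rfl fun j _ => by ring

lemma sum_comm_pair {κ κ' κ₁ κ₂ : Type*} [Fintype κ] [Fintype κ'] [Fintype κ₁] [Fintype κ₂]
    (f : κ → κ' → κ₁ → κ₂ → ℝ) :
    ∑ i, ∑ j, ∑ c, ∑ d, f i j c d = ∑ c, ∑ d, ∑ i, ∑ j, f i j c d :=
  (Finset.sum_congr rfl fun _ _ => Finset.sum_comm).trans (Finset.sum_comm.trans
    (Finset.sum_congr rfl fun _ _ =>
      (Finset.sum_congr rfl fun _ _ => Finset.sum_comm).trans Finset.sum_comm))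

/-- The frame components of the metric. -/
lemma FrameMetric.sum_comp {ι : Type*} [Fintype ι] [DecidableEq ι] {n : ℕ} {W : Set (Euc n)}
    {E : ι → Euc n → Euc n} {Θ : ι → Euc n → Euc n →L[ℝ] ℝ} {η : Matrix ι ι ℝ}
    {g : BilinField n} (hF : IsFrame W E Θ)
    (hg : FrameMetric W Θ η g) {x : Euc n} (hx : x ∈ W) (a b : ι) :
    ∑ i, ∑ j, E a x i * E b x j * comp g i j x = η a b := by
  unfold comp
  rw [← bilin_expand (T := g x), hg x hx]
  · simp [hF.dual x hx]
  · intro Y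
    exact ⟨∑ a, ∑ b, (η a b * Θ b x Y) • Θ a x, fun X => by
      rw [hg x hx]
      simp only [_root_.sum_apply, _root_.smul_apply, smul_eq_mul]
      exact Finset.sum_congr rfl fun i _ => Finset.sum_congr rfl fun j _ => by ring⟩
  · intro X
    exact ⟨∑ a, ∑ b, (η a b * Θ a x X) • Θ b x, fun Y => by
      rw [hg x hx]
      simp only [_root_.sum_apply, _root_.smul_apply, smul_eq_mul]
      exact Finset.sum_congr rfl fun i _ => Finset.sum_congr rfl fun j _ => by ring⟩

/-- The frame components of the energy-momentum tensor. -/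
lemma FrameMetric.sum_stress {ι : Type*} [Fintype ι] [DecidableEq ι] {W : Set (Euc 5)}
    {E : ι → Euc 5 → Euc 5} {Θ : ι → Euc 5 → Euc 5 →L[ℝ] ℝ} {η : Matrix ι ι ℝ}
    {g A : BilinField 5} (hF : IsFrame W E Θ) (hη : η * η = 1)
    (hg : FrameMetric W Θ η g) {x : Euc 5} (hx : x ∈ W)
    (hA : ∀ X Y, A x X Y = ∑ i, ∑ j, X i * Y j * comp A i j x) (a b : ι) :
    ∑ i, ∑ j, E a x i * E b x j * stress g A i j x
      = 2 * ((∑ c, ∑ d, η c d * (A x (E a x) (E c x) * A x (E b x) (E d x)))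
        - (1 / 4) * (∑ c, ∑ d, η c d * ∑ c', ∑ d', η c' d' *
          (A x (E c x) (E c' x) * A x (E d x) (E d' x))) * η a b) := by
  have hAr : ∀ i (Y : Euc 5), ∑ j, Y j * comp A i j x = A x (coordVec i) Y := by
    intro i Y
    rw [hA (coordVec i) Y]
    simp
  have hAl : ∀ (X Y : Euc 5), ∑ i, X i * A x (coordVec i) Y = A x X Y := by
    intro X Y
    rw [hA X Y]
    simp only [← hAr, Finset.mul_sum]
    exact Finset.sum_congr rfl fun i _ => Finset.sum_congr rfl fun j _ => by ring
  have h1 : ∀ i j, ∑ k, ∑ l, gInv g k l x * (comp A i k x * comp A j l x)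
      = ∑ c, ∑ d, η c d * (A x (coordVec i) (E c x) * A x (coordVec j) (E d x)) := by
    intro i j
    rw [hg.sum_gInv hF hη hx]
    simp only [sum_pair_mul, hAr]
  have h2 : ∀ X Y : Euc 5, ∑ i, ∑ j, X i * Y j *
      ∑ c, ∑ d, η c d * (A x (coordVec i) (E c x) * A x (coordVec j) (E d x))
      = ∑ c, ∑ d, η c d * (A x X (E c x) * A x Y (E d x)) := by
    intro X Y
    simp only [Finset.mul_sum]
    rw [sum_comm_pair]
    refine Finset.sum_congr rfl fun c _ => Finset.sum_congr rfl fun d _ => ?_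
    rw [← hAl X, ← hAl Y, Finset.sum_mul_sum, Finset.mul_sum]
    refine Finset.sum_congr rfl fun i _ => ?_
    rw [Finset.mul_sum]
    exact Finset.sum_congr rfl fun j _ => by ring
  have h3 : normSq g A x = ∑ c, ∑ d, η c d * ∑ c', ∑ d', η c' d' *
          (A x (E c x) (E c' x) * A x (E d x) (E d' x)) := by
    have : normSq g A x = ∑ i, ∑ a, gInv g i a x *
        ∑ j, ∑ b, gInv g j b x * (comp A i j x * comp A a b x) := by
      unfold normSq raise
      simp only [Finset.mul_sum]
      refine Finset.sum_congr rfl fun i _ => ?_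
      rw [Finset.sum_comm]
      exact Finset.sum_congr rfl fun a _ => Finset.sum_congr rfl fun j _ =>
        Finset.sum_congr rfl fun b _ => by ring
    rw [this]
    simp only [h1]
    rw [hg.sum_gInv hF hη hx]
    simp only [h2]
  have h4 : ∀ i j, E a x i * E b x j * stress g A i j x
      = 2 * (E a x i * E b x j * ∑ k, ∑ l, gInv g k l x * (comp A i k x * comp A j l x))
        - (1 / 2) * normSq g A x * (E a x i * E b x j * comp g i j x) := by
    intro i j
    simp only [stress, mul_assoc (gInv g _ _ x)]
    ring
  simp only [h4, Finset.sum_sub_distrib, ← Finset.mul_sum]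
  rw [hg.sum_comp hF hx]
  simp only [h1]
  rw [h2, h3]
  ring

/-- The Einstein equations in a frame. -/
lemma FrameMetric.einstein_frame {ι : Type*} [Fintype ι] [DecidableEq ι] {W : Set (Euc 5)}
    {E : ι → Euc 5 → Euc 5} {Θ : ι → Euc 5 → Euc 5 →L[ℝ] ℝ} {η : Matrix ι ι ℝ}
    {g A : BilinField 5} (hF : IsFrame W E Θ) (hη : η * η = 1)
    (hg : FrameMetric W Θ η g) {x : Euc 5} (hx : x ∈ W)
    (hE : ∀ i j, ricci g i j x = stress g A i j x
      - (1 / 3) * (∑ k, ∑ l, gInv g k l x * stress g A k l x) * comp g i j x) (a b : ι) :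
    ∑ i, ∑ j, E a x i * E b x j * ricci g i j x
      = ∑ i, ∑ j, E a x i * E b x j * stress g A i j x - (1 / 3) *
        (∑ c, ∑ d, η c d * ∑ i, ∑ j, E c x i * E d x j * stress g A i j x) * η a b := by
  rw [← hg.sum_gInv hF hη hx, ← hg.sum_comp hF hx a b]
  set t := ∑ k, ∑ l, gInv g k l x * stress g A k l x
  have h1 : (1 / 3) * t * ∑ i, ∑ j, E a x i * E b x j * comp g i j x
      = ∑ i, ∑ j, E a x i * E b x j * ((1 / 3) * t * comp g i j x) := by
    simp only [Finset.mul_sum]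
    exact Finset.sum_congr rfl fun i _ => Finset.sum_congr rfl fun j _ => by ring
  rw [h1]
  simp only [hE, mul_sub, Finset.sum_sub_distrib]

lemma maxwell_expand (x X Y : Euc 5) : (localFields γ h F Δ B).maxwell x X Y
    = ∑ i, ∑ j, X i * Y j * comp (localFields γ h F Δ B).maxwell i j x := by
  refine bilin_expand (T := (localFields γ h F Δ B).maxwell x) (fun Y => ?_) (fun X => ?_) X Y
  · exact ⟨(Δ * Y 0) • coordL 1 - (Δ * Y 1) • coordL 0 + ((B (hor x)).flip (hor Y)).comp horL,
      fun X => by simp [localFields]; ring⟩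
  · exact ⟨(Δ * X 1) • coordL 0 - (Δ * X 0) • coordL 1 + (B (hor x) (hor X)).comp horL,
      fun X => by simp [localFields]; ring⟩

lemma sum_nullEta (f : NullIdx → NullIdx → ℝ) : ∑ c, ∑ d, nullEta c d * f c d
    = f none (some none) + f (some none) none + ∑ i, f (some (some i)) (some (some i)) := by
  simp [Fintype.sum_option, nullEta]
  ring

/-- The horizon Einstein equations in an orthonormal frame. -/
theorem horizon_einstein (hF : IsFrame U e θ) (hh : ContDiffOn ℝ ∞ h U)
    (hγ : ∀ x ∈ U, ∀ X Y, γ x X Y = ∑ i, θ i x X * θ i x Y)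
    (hE : SolvesEinsteinMaxwell (localFields γ h F Δ B) (hor ⁻¹' U)) {x : Euc 3} (hx : x ∈ U) :
    (∀ i j, frameRicci e θ (conn e θ) i j x
      = (1 / 2) * (h x (e i x) * h x (e j x)) - covD e θ h i j x
        - (1 / 2) * dForm h x (e i x) (e j x) + 2 * ∑ k, B x (e i x) (e k x) * B x (e j x) (e k x)
        - (1 / 3) * (∑ k, ∑ l, (B x (e k x) (e l x)) ^ 2 - 2 * Δ ^ 2) * if i = j then 1 else 0) ∧
    F = (1 / 2) * ∑ i, (h x (e i x)) ^ 2 - (1 / 2) * ∑ i, covD e θ h i i x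
        - (4 / 3) * Δ ^ 2 - (1 / 3) * ∑ k, ∑ l, (B x (e k x) (e l x)) ^ 2 := by
  -- The point over `x` with `v = r = 0`; the equations there are all that is used.
  set y : Euc 5 := liftL x with hy
  have hyx : hor y = x := by simp [hy]
  have hr : y 1 = 0 := by simp [hy]
  have hyU : y ∈ hor ⁻¹' U := by simpa [hy] using hx
  have hN := isFrame_null (F := F) hF hh
  have hg := frameMetric_null (h := h) (F := F) (Δ := Δ) (B := B) hγ
  have key : ∀ a b, frameRicci (nullE e h F) (nullTh θ h F) (nullG e θ h F) a b y = _ :=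
    fun a b => (hg.ricci_eq hN nullEta_mul_self nullEta_transpose (contDiffOn_nullG hF hh)
      (fun x _ a b c => nullG_skew a b c x) (fun x hx a b c => nullG_torsion hF hh hx a b c)
      hyU a b).symm.trans (hg.einstein_frame hN nullEta_mul_self hyU (hE y hyU).1 a b)
  simp only [hg.sum_stress hN nullEta_mul_self hyU (maxwell_expand y)] at key
  simp only [sum_nullEta] at key
  constructor
  · intro i j
    have h1 := key (some (some i)) (some (some j))
    rw [frameRicci_null_ss hF hh (by rwa [hyx]) hr] at h1
    simp only [localFields, nullEta] at h1
    by_cases hij : i = j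
    · subst hij
      simp [hr, hyx] at h1 ⊢
      simp only [Fin.sum_univ_three] at h1 ⊢
      linear_combination h1
    · simp [hr, hyx, hij] at h1 ⊢
      simp only [Fin.sum_univ_three] at h1 ⊢
      linear_combination h1
  · have h1 := key (some none) none
    rw [frameRicci_null_mp hF hh (by rwa [hyx]) hr] at h1
    simp [localFields, hr, hyx, nullEta] at h1
    simp only [Fin.sum_univ_three] at h1 ⊢
    linear_combination h1

end

/-! ### The Maxwell equations on the horizon. -/

section

variable {U : Set (Euc 3)} {e : Fin 3 → Euc 3 → Euc 3} {θ : Fin 3 → Euc 3 → Euc 3 →L[ℝ] ℝ}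
  {h : Euc 3 → Euc 3 →L[ℝ] ℝ} {F Δ : ℝ} {B : Euc 3 → Euc 3 →L[ℝ] Euc 3 →L[ℝ] ℝ}
  {γ : Euc 3 → Euc 3 → Euc 3 → ℝ}

/-- The contravariant components of a two-form in a frame. -/
lemma FrameMetric.raise_eq {ι : Type*} [Fintype ι] [DecidableEq ι] {W : Set (Euc 5)}
    {E : ι → Euc 5 → Euc 5} {Θ : ι → Euc 5 → Euc 5 →L[ℝ] ℝ} {η : Matrix ι ι ℝ}
    {g A : BilinField 5} (hF : IsFrame W E Θ) (hη : η * η = 1)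
    (hg : FrameMetric W Θ η g) {x : Euc 5} (hx : x ∈ W)
    (hA : ∀ X Y, A x X Y = ∑ i, ∑ j, X i * Y j * comp A i j x) (i j : Fin 5) :
    raise g A i j x = ∑ c, ∑ d, η c d * (E c x i * ∑ c', ∑ d', η c' d' *
      (E c' x j * A x (E d x) (E d' x))) := by
  have key : ∀ i a, gInv g i a x = ∑ c, ∑ d, η c d * (E c x i * E d x a) := by
    intro i a
    rw [gInv, hg.inv_gMat hF hη hx]
    simp only [Matrix.mul_apply, eM, Matrix.of_apply, Matrix.transpose_apply, Finset.sum_mul]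
    rw [Finset.sum_comm]
    exact Finset.sum_congr rfl fun a _ => Finset.sum_congr rfl fun b _ => by ring
  have h1 : ∀ a b, gInv g i a x * gInv g j b x * comp A a b x
      = ∑ c, ∑ d, ∑ c', ∑ d', η c d * (E c x i * (η c' d' *
        (E c' x j * (E d x a * E d' x b * comp A a b x)))) := by
    intro a b
    rw [key, key, Finset.sum_mul, Finset.sum_mul]
    refine Finset.sum_congr rfl fun c _ => ?_
    rw [Finset.sum_mul, Finset.sum_mul]
    refine Finset.sum_congr rfl fun d _ => ?_
    rw [Finset.mul_sum, Finset.sum_mul]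
    refine Finset.sum_congr rfl fun c' _ => ?_
    rw [Finset.mul_sum, Finset.sum_mul]
    exact Finset.sum_congr rfl fun d' _ => by ring
  unfold raise
  simp only [h1]
  rw [sum_comm_pair]
  refine Finset.sum_congr rfl fun c _ => Finset.sum_congr rfl fun d _ => ?_
  rw [sum_comm_pair]
  simp only [hA, Finset.mul_sum]

/-- The one-form dual to a two-form. -/
def dualForm (e : Fin 3 → Euc 3 → Euc 3) (θ : Fin 3 → Euc 3 → Euc 3 →L[ℝ] ℝ)
    (B : Euc 3 → Euc 3 →L[ℝ] Euc 3 →L[ℝ] ℝ) (x : Euc 3) : Euc 3 →L[ℝ] ℝ :=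
  B x (e 1 x) (e 2 x) • θ 0 x + B x (e 2 x) (e 0 x) • θ 1 x + B x (e 0 x) (e 1 x) • θ 2 x

lemma contDiffOn_dualForm (hF : IsFrame U e θ) (hB : ContDiffOn ℝ ∞ B U) :
    ContDiffOn ℝ ∞ (dualForm e θ B) U := by
  have h1 := fun i j => (hB.clm_apply (hF.e_smooth i)).clm_apply (hF.e_smooth j)
  exact (((h1 1 2).smul (hF.θ_smooth 0)).add ((h1 2 0).smul (hF.θ_smooth 1))).add
    ((h1 0 1).smul (hF.θ_smooth 2))

/-- A three-form in three dimensions is a multiple of the determinant, so one coordinate triple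
decides. -/
lemma closed_expand {B : Euc 3 → Euc 3 →L[ℝ] Euc 3 →L[ℝ] ℝ} {x : Euc 3}
    (hBs : ∀ X Y Z, fderiv ℝ B x X Y Z = - fderiv ℝ B x X Z Y)
    (h : fderiv ℝ B x (coordVec 0) (coordVec 1) (coordVec 2)
      + fderiv ℝ B x (coordVec 1) (coordVec 2) (coordVec 0)
      + fderiv ℝ B x (coordVec 2) (coordVec 0) (coordVec 1) = 0) (X Y Z : Euc 3) :
    fderiv ℝ B x X Y Z + fderiv ℝ B x Y Z X + fderiv ℝ B x Z X Y = 0 := by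
  have key : ∀ X Y Z : Euc 3, fderiv ℝ B x X Y Z
      = ∑ i, X i * ∑ j, Y j * ∑ k, Z k *
        fderiv ℝ B x (coordVec i) (coordVec j) (coordVec k) := by
    intro X Y Z
    rw [clm_eq_sum_coord (fderiv ℝ B x) X, _root_.sum_apply, _root_.sum_apply]
    refine Finset.sum_congr rfl fun i _ => ?_
    rw [_root_.smul_apply, _root_.smul_apply, clm_eq_sum_coord _ Y, _root_.sum_apply, smul_eq_mul]
    congr 1
    refine Finset.sum_congr rfl fun j _ => ?_
    rw [_root_.smul_apply, clm_eq_sum_coord _ Z, smul_eq_mul]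
    rfl
  have h0 : ∀ X Y, fderiv ℝ B x X Y Y = 0 := fun X Y => by linarith [hBs X Y Y]
  rw [key, key Y, key Z]
  simp only [Fin.sum_univ_three, h0]
  have s10 := fun i : Fin 3 => hBs (coordVec i) (coordVec 1) (coordVec 0)
  have s20 := fun i : Fin 3 => hBs (coordVec i) (coordVec 2) (coordVec 0)
  have s21 := fun i : Fin 3 => hBs (coordVec i) (coordVec 2) (coordVec 1)
  simp only [s10, s20, s21] at h ⊢
  linear_combination (X 0 * (Y 1 * Z 2 - Y 2 * Z 1) - X 1 * (Y 0 * Z 2 - Y 2 * Z 0)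
    + X 2 * (Y 0 * Z 1 - Y 1 * Z 0)) * h

lemma dualForm_apply (hF : IsFrame U e θ) {x : Euc 3} (hx : x ∈ U) :
    dualForm e θ B x (e 0 x) = B x (e 1 x) (e 2 x) ∧
    dualForm e θ B x (e 1 x) = B x (e 2 x) (e 0 x) ∧
    dualForm e θ B x (e 2 x) = B x (e 0 x) (e 1 x) := by
  simp [dualForm, hF.dual x hx]

/-- The dual of a closed two-form is divergence free. -/
lemma div_dualForm (hF : IsFrame U e θ) (hB : ContDiffOn ℝ ∞ B U)
    (hBa : ∀ x ∈ U, ∀ X, B x X X = 0) {x : Euc 3} (hx : x ∈ U)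
    (hc : ∀ X Y Z, fderiv ℝ B x X Y Z + fderiv ℝ B x Y Z X + fderiv ℝ B x Z X Y = 0) :
    ∑ i, covD e θ (dualForm e θ B) i i x = 0 := by
  have hsk : ∀ X Y, B x X Y = - B x Y X := by
    intro X Y
    have := hBa x hx (X + Y)
    simp [hBa x hx] at this
    linarith
  have hdB := diffAt_of_contDiffOn hF.isOpen hB hx
  have hde := fun i => diffAt_of_contDiffOn hF.isOpen (hF.e_smooth i) hx
  have hD : ∀ i j k, dirD (fun y => B y (e i y) (e j y)) (e k) x
      = fderiv ℝ B x (e k x) (e i x) (e j x) + B x (fderiv ℝ (e i) x (e k x)) (e j x)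
        + B x (e i x) (fderiv ℝ (e j) x (e k x)) := by
    intro i j k
    rw [dirD, ((hdB.hasFDerivAt.clm_apply (hde i).hasFDerivAt).clm_apply
      (hde j).hasFDerivAt).fderiv]
    simp
    ring
  -- The difference of derivatives is `-[e_i, e_j]`. Its frame components are `dθ^l (e_i, e_j)`,
  -- because the pairings `θ^l (e_a)` are constant.
  have hbr : ∀ i j k, B x (fderiv ℝ (e i) x (e j x) - fderiv ℝ (e j) x (e i x)) (e k x)
      = ∑ l, dForm (θ l) x (e i x) (e j x) * B x (e l x) (e k x) := by
    intro i j k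
    have h1 : fderiv ℝ (e i) x (e j x) - fderiv ℝ (e j) x (e i x)
        = ∑ l, dForm (θ l) x (e i x) (e j x) • e l x := by
      rw [← hF.expand x hx (fderiv ℝ (e i) x (e j x) - fderiv ℝ (e j) x (e i x))]
      refine Finset.sum_congr rfl fun l _ => ?_
      congr 1
      have h2 : ∀ a b, fderiv ℝ (θ l) x (e b x) (e a x) + θ l x (fderiv ℝ (e a) x (e b x)) = 0 := by
        intro a b
        have h3 : fderiv ℝ (fun y => θ l y (e a y)) x (e b x) = 0 := by
          have : (fun y => θ l y (e a y)) =ᶠ[nhds x] fun _ => if l = a then 1 else 0 :=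
            Filter.eventuallyEq_of_mem (hF.isOpen.mem_nhds hx) fun y hy => hF.dual y hy l a
          rw [this.fderiv_eq]; simp
        rw [((diffAt_of_contDiffOn hF.isOpen (hF.θ_smooth l) hx).hasFDerivAt.clm_apply
          (hde a).hasFDerivAt).fderiv] at h3
        simpa [add_comm] using h3
      rw [dForm, map_sub]
      linarith [h2 i j, h2 j i]
    rw [h1]
    simp
  have hb : ∀ i k, dirD (fun y => dualForm e θ B y (e i y)) (e k) x
      = dirD (fun y => (![fun y => B y (e 1 y) (e 2 y), fun y => B y (e 2 y) (e 0 y),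
        fun y => B y (e 0 y) (e 1 y)] : Fin 3 → Euc 3 → ℝ) i y) (e k) x := by
    intro i k
    unfold dirD
    congr 1
    refine Filter.EventuallyEq.fderiv_eq
      (Filter.eventuallyEq_of_mem (hF.isOpen.mem_nhds hx) fun y hy => ?_)
    have := dualForm_apply (B := B) hF hy
    fin_cases i <;> simp [this]
  obtain ⟨b0, b1, b2⟩ := dualForm_apply (B := B) hF hx
  simp only [covD, Fin.sum_univ_three, hb, b0, b1, b2]
  have k1 := hbr 0 1 2
  have k2 := hbr 1 2 0
  have k3 := hbr 2 0 1
  have hs : ∀ X, B x X X = 0 := hBa x hx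
  simp only [Fin.sum_univ_three, hs, conn_torsion e θ, map_sub, _root_.sub_apply] at k1 k2 k3
  simp only [Matrix.cons_val_zero, Matrix.cons_val_one, Matrix.cons_val, hD]
  have k0 := hc (e 0 x) (e 1 x) (e 2 x)
  rw [hsk (e 1 x) (fderiv ℝ (e 2) x (e 0 x)), hsk (e 2 x) (fderiv ℝ (e 0) x (e 1 x)),
    hsk (e 0 x) (fderiv ℝ (e 1) x (e 2 x))]
  have a0 : ∀ i k, conn e θ i i k x = 0 := fun i k => by linarith [conn_antisymm e θ i i k x]
  have a1 := fun k => conn_antisymm e θ 1 0 k x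
  have a2 := fun k => conn_antisymm e θ 2 0 k x
  have a3 := fun k => conn_antisymm e θ 2 1 k x
  simp only [a0, a1, a2, a3, hsk (e 1 x) (e 0 x), hsk (e 2 x) (e 1 x), hsk (e 0 x) (e 2 x)] at *
  -- `k0` is `dB (e_0, e_1, e_2) = 0`; the others are the bracket terms that turn it into the
  -- divergence of the dual.
  linear_combination k0 - k1 - k2 - k3

/-- The matrices of frame and coframe are inverse to each other, and an inverse is the adjugate
divided by the determinant. Thus the coframe consists of cross products of frame vectors. -/
lemma detT_mul_cofactor (hF : IsFrame U e θ) {x : Euc 3} (hx : x ∈ U) :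
    (thM θ x).det • (eM e x).adjugate = thM θ x := by
  have h1 := hF.thM_mul_eM hx
  have h2 : (thM θ x).det * (eM e x).det = 1 := by rw [← Matrix.det_mul, h1, Matrix.det_one]
  calc (thM θ x).det • (eM e x).adjugate
      = (thM θ x).det • (thM θ x * eM e x * (eM e x).adjugate) := by rw [h1, Matrix.one_mul]
    _ = thM θ x := by
      rw [Matrix.mul_assoc, Matrix.mul_adjugate, Matrix.mul_smul, Matrix.mul_one, smul_smul, h2,
        one_smul]

/-- The only nonzero entry of the `∂_r` row is `g_{rv} = 1`, so the determinant is `-det γ`, and `γ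
= Tᵗ T`. -/
lemma det_localFields (hγ : ∀ x ∈ U, ∀ X Y, γ x X Y = ∑ i, θ i x X * θ i x Y) {x : Euc 5}
    (hx : hor x ∈ U) :
    |(gMat (localFields γ h F Δ B).metric x).det| = (thM θ (hor x)).det ^ 2 := by
  have h1 : (thM θ (hor x)).det ^ 2
      = (Matrix.of fun i j => γ (hor x) (coordVec i) (coordVec j)).det := by
    have h2 : (Matrix.of fun i j => γ (hor x) (coordVec i) (coordVec j))
        = (thM θ (hor x)).transpose * thM θ (hor x) := by
      ext i j
      simp [Matrix.mul_apply, thM, hγ _ hx]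
    rw [h2, Matrix.det_mul, Matrix.det_transpose, sq]
  have hv2 : hor (coordVec 2) = coordVec 0 := by ext i; fin_cases i <;> simp [hor]
  have hv3 : hor (coordVec 3) = coordVec 1 := by ext i; fin_cases i <;> simp [hor]
  have hv4 : hor (coordVec 4) = coordVec 2 := by ext i; fin_cases i <;> simp [hor]
  have g0 : ∀ X, γ (hor x) 0 X = 0 := fun X => by rw [hγ _ hx]; simp
  have g1 : ∀ X, γ (hor x) X 0 = 0 := fun X => by rw [hγ _ hx]; simp
  rw [← abs_of_nonneg (sq_nonneg (thM θ (hor x)).det), h1, ← abs_neg]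
  congr 1
  rw [Matrix.det_fin_three]
  simp only [Matrix.det_succ_row_zero (n := 4), Matrix.det_succ_row_zero (n := 3),
    Matrix.det_fin_three, Fin.sum_univ_succ]
  simp [gMat, comp, localFields, Fin.succAbove, g0, g1, hv2, hv3, hv4]

/-- In the null frame `h` enters only through the shift `-r h_i ∂_r` of the horizontal vectors.
Hence the `∂_r` components are linear in `r`; their `r`-derivative is the source in the horizon
equation. -/
lemma raise_localFields (hF : IsFrame U e θ) (hh : ContDiffOn ℝ ∞ h U)
    (hγ : ∀ x ∈ U, ∀ X Y, γ x X Y = ∑ i, θ i x X * θ i x Y) {y : Euc 5} (hy : hor y ∈ U)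
    (j : Fin 3) :
    raise (localFields γ h F Δ B).metric (localFields γ h F Δ B).maxwell 0 (![2, 3, 4] j) y = 0 ∧
    raise (localFields γ h F Δ B).metric (localFields γ h F Δ B).maxwell 1 (![2, 3, 4] j) y
      = y 1 * ∑ l, (Δ * h (hor y) (e l (hor y)) - ∑ k, h (hor y) (e k (hor y)) *
        B (hor y) (e k (hor y)) (e l (hor y))) * e l (hor y) j ∧
    ∀ i : Fin 3, raise (localFields γ h F Δ B).metric (localFields γ h F Δ B).maxwell
      (![2, 3, 4] i) (![2, 3, 4] j) y
      = ∑ k, ∑ l, B (hor y) (e k (hor y)) (e l (hor y)) * (e k (hor y) i * e l (hor y) j) := by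
  have hN := isFrame_null (F := F) hF hh
  have hg := frameMetric_null (h := h) (F := F) (Δ := Δ) (B := B) hγ
  have hl : ∀ (X : Euc 3) (j : Fin 3), liftL X (![2, 3, 4] j) = X j := by
    intro X j; fin_cases j <;> simp [liftL_apply]
  have h0 : ∀ j : Fin 3, (![2, 3, 4] j : Fin 5) ≠ 0 ∧ (![2, 3, 4] j : Fin 5) ≠ 1 := by decide
  refine ⟨?_, ?_, fun i => ?_⟩ <;>
  · rw [hg.raise_eq hN nullEta_mul_self hy (maxwell_expand y)]
    simp only [sum_nullEta]
    simp [nullE, localFields, hl, h0, Fin.sum_univ_three]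
    try ring

/-- With the volume density included, raising both indices of `B` gives `ε^{ijm} b_m`, whose
divergence is the curl of the dual one-form. -/
lemma detT_mul_bivector (hF : IsFrame U e θ) (hBa : ∀ x ∈ U, ∀ X, B x X X = 0) {x : Euc 3}
    (hx : x ∈ U) (i j : Fin 3) :
    (thM θ x).det * ∑ k, ∑ l, B x (e k x) (e l x) * (e k x i * e l x j)
      = (![![0, dualForm e θ B x (coordVec 2), -dualForm e θ B x (coordVec 1)],
          ![-dualForm e θ B x (coordVec 2), 0, dualForm e θ B x (coordVec 0)],
          ![dualForm e θ B x (coordVec 1), -dualForm e θ B x (coordVec 0), 0]] :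
            Fin 3 → Fin 3 → ℝ) i j := by
  have hsk : ∀ X Y, B x X Y = - B x Y X := by
    intro X Y
    have := hBa x hx (X + Y)
    simp [hBa x hx] at this
    linarith
  have h1 := detT_mul_cofactor hF hx
  have hT : ∀ a i, θ a x (coordVec i) = (thM θ x).det * (eM e x).adjugate a i := by
    intro a i
    rw [← smul_eq_mul, ← Matrix.smul_apply, h1]; rfl
  simp only [dualForm, _root_.add_apply, _root_.smul_apply, smul_eq_mul, hT,
    Matrix.adjugate_fin_three]
  generalize (thM θ x).det = t
  simp only [Fin.sum_univ_three, hBa x hx, hsk (e 1 x) (e 0 x), hsk (e 2 x) (e 1 x),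
    hsk (e 0 x) (e 2 x)]
  fin_cases i <;> fin_cases j <;> simp [eM] <;> first | ring1 | (right; ring1)

/-- The horizon Maxwell equations in an orthonormal frame. -/
theorem horizon_maxwell (hF : IsFrame U e θ) (hh : ContDiffOn ℝ ∞ h U) (hB : ContDiffOn ℝ ∞ B U)
    (hBa : ∀ x ∈ U, ∀ X, B x X X = 0)
    (hγ : ∀ x ∈ U, ∀ X Y, γ x X Y = ∑ i, θ i x X * θ i x Y)
    (hE : SolvesEinsteinMaxwell (localFields γ h F Δ B) (hor ⁻¹' U)) {x : Euc 3} (hx : x ∈ U) :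
    (dForm (dualForm e θ B) x (e 1 x) (e 2 x)
        = Δ * h x (e 0 x) - ∑ k, h x (e k x) * B x (e k x) (e 0 x)) ∧
    (dForm (dualForm e θ B) x (e 2 x) (e 0 x)
        = Δ * h x (e 1 x) - ∑ k, h x (e k x) * B x (e k x) (e 1 x)) ∧
    (dForm (dualForm e θ B) x (e 0 x) (e 1 x)
        = Δ * h x (e 2 x) - ∑ k, h x (e k x) * B x (e k x) (e 2 x)) ∧
    ∑ i, covD e θ (dualForm e θ B) i i x = 0 := by
  set y : Euc 5 := liftL x with hy
  have hyx : hor y = x := by simp [hy]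
  have hr : y 1 = 0 := by simp [hy]
  have hyU : y ∈ hor ⁻¹' U := by simpa [hy] using hx
  have hv : ∀ i : Fin 3, hor (coordVec (![2, 3, 4] i)) = coordVec i := by
    intro i; ext j; fin_cases i <;> fin_cases j <;> simp [hor]
  have hpd : ∀ {f : Euc 3 → ℝ} (i : Fin 3), DifferentiableAt ℝ f x →
      pd (![2, 3, 4] i) (fun z => f (hor z)) y = pd i f x := by
    intro f i hf
    rw [← hyx] at hf
    have := dirD_comp_hor (V := fun _ => coordVec (![2, 3, 4] i)) hf
    rw [dirD] at this
    rw [pd, this, hv, hyx, pd]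
  obtain ⟨-, hcl, hdiv⟩ := hE y hyU
  have hUn : hor ⁻¹' U ∈ nhds y := (hF.isOpen.preimage horL.continuous).mem_nhds hyU
  set b := dualForm e θ B with hb
  have hbs : ContDiffOn ℝ ∞ b U := contDiffOn_dualForm hF hB
  have hbd := fun i : Fin 3 => diffAt_of_contDiffOn hF.isOpen
    (hbs.clm_apply (contDiffOn_const (c := (coordVec i : Euc 3)))) hx
  have hTs : ContDiffOn ℝ ∞ (fun z => (thM θ z).det) U := by
    have := hF.smooth_thM
    simp only [Matrix.det_fin_three]
    exact (((((((this 0 0).mul (this 1 1)).mul (this 2 2)).sub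
      (((this 0 0).mul (this 1 2)).mul (this 2 1))).sub
      (((this 0 1).mul (this 1 0)).mul (this 2 2))).add
      (((this 0 1).mul (this 1 2)).mul (this 2 0))).add
      (((this 0 2).mul (this 1 0)).mul (this 2 1))).sub
      (((this 0 2).mul (this 1 1)).mul (this 2 0))
  have hTE : (thM θ x).det * (eM e x).det = 1 := by
    rw [← Matrix.det_mul, hF.thM_mul_eM hx, Matrix.det_one]
  have hT0 : (thM θ x).det ≠ 0 := left_ne_zero_of_mul_eq_one hTE
  -- The volume density is `|det T|`. Near `y` the sign of `det T` is a constant `s`, which can be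
  -- cancelled.
  obtain ⟨s, hs0, hs⟩ : ∃ s : ℝ, s ≠ 0 ∧ ∀ᶠ z in nhds y,
      √|(gMat (localFields γ h F Δ B).metric z).det| = s * (thM θ (hor z)).det := by
    have hc : ContinuousAt (fun z : Euc 5 => (thM θ (hor z)).det) y :=
      (diffAt_of_contDiffOn (hF.isOpen.preimage horL.continuous)
        (contDiffOn_comp_hor hTs) hyU).continuousAt
    rcases lt_or_gt_of_ne hT0 with h0 | h0
    · refine ⟨-1, by norm_num, ?_⟩
      filter_upwards [hUn, hc.eventually_lt_const (by simpa [hyx] using h0)] with z hz hz0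
      rw [det_localFields hγ hz, Real.sqrt_sq_eq_abs, abs_of_neg hz0]; ring
    · refine ⟨1, by norm_num, ?_⟩
      filter_upwards [hUn, hc.eventually_const_lt (by simpa [hyx] using h0)] with z hz hz0
      rw [det_localFields hγ hz, Real.sqrt_sq_eq_abs, abs_of_pos hz0]; ring
  have hpc : ∀ {f g : Euc 5 → ℝ} (i : Fin 5), f =ᶠ[nhds y] g → pd i f y = pd i g y :=
    fun i hfg => by rw [pd, hfg.fderiv_eq, pd]
  obtain ⟨c, hc⟩ : ∃ c : Fin 3 → ℝ, ∀ l, c l = Δ * h x (e l x)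
      - ∑ k, h x (e k x) * B x (e k x) (e l x) := ⟨_, fun _ => rfl⟩
  have hcs : ∀ j : Fin 3, DifferentiableAt ℝ (fun z => (thM θ z).det * ∑ l, (Δ * h z (e l z)
      - ∑ k, h z (e k z) * B z (e k z) (e l z)) * e l z j) x := by
    intro j
    have h1 := fun l => hh.clm_apply (hF.e_smooth l)
    have h2 := fun k l => (hB.clm_apply (hF.e_smooth k)).clm_apply (hF.e_smooth l)
    refine diffAt_of_contDiffOn hF.isOpen (hTs.mul (ContDiffOn.sum fun l _ =>
      ((contDiffOn_const.mul (h1 l)).sub (ContDiffOn.sum fun k _ => (h1 k).mul (h2 k l))).mul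
      (hF.smooth_eM j l))) hx
  -- The divergence splits: the `v` term vanishes, the `r` term gives the source, and the horizontal
  -- terms give the curl of `b`.
  have heq : ∀ j : Fin 3, (thM θ x).det * ∑ l, c l * e l x j
      + ∑ i, pd i (fun z => (![![0, b z (coordVec 2), -b z (coordVec 1)],
          ![-b z (coordVec 2), 0, b z (coordVec 0)],
          ![b z (coordVec 1), -b z (coordVec 0), 0]] : Fin 3 → Fin 3 → ℝ) i j) x = 0 := by
    intro j
    have h1 := hdiv (![2, 3, 4] j)
    have e0 : pd 0 (fun z => √|(gMat (localFields γ h F Δ B).metric z).det| *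
        raise (localFields γ h F Δ B).metric (localFields γ h F Δ B).maxwell 0 (![2, 3, 4] j) z) y
        = 0 := by
      rw [hpc 0 (g := fun _ => 0)]
      · simp [pd]
      · filter_upwards [hUn] with z hz
        rw [(raise_localFields hF hh hγ hz j).1, mul_zero]
    have e1 : pd 1 (fun z => √|(gMat (localFields γ h F Δ B).metric z).det| *
        raise (localFields γ h F Δ B).metric (localFields γ h F Δ B).maxwell 1 (![2, 3, 4] j) z) y
        = s * ((thM θ x).det * ∑ l, c l * e l x j) := by
      rw [hpc 1 (g := fun z => s * (z 1 * ((thM θ (hor z)).det * ∑ l, (Δ * h (hor z) (e l (hor z))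
        - ∑ k, h (hor z) (e k (hor z)) * B (hor z) (e k (hor z)) (e l (hor z))) *
          e l (hor z) j)))]
      · have := hcs j
        rw [← hyx] at this
        have := dirD_mul_r_comp_hor (V := fun _ => coordVec 1) s this hr
        rw [dirD] at this
        rw [pd, this, hyx]
        simp [hc]
      · filter_upwards [hUn, hs] with z hz hz1
        rw [(raise_localFields hF hh hγ hz j).2.1, hz1]
        ring
    have e2 : ∀ i : Fin 3, pd (![2, 3, 4] i) (fun z =>
        √|(gMat (localFields γ h F Δ B).metric z).det| *
        raise (localFields γ h F Δ B).metric (localFields γ h F Δ B).maxwell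
          (![2, 3, 4] i) (![2, 3, 4] j) z) y
        = s * pd i (fun z => (![![0, b z (coordVec 2), -b z (coordVec 1)],
          ![-b z (coordVec 2), 0, b z (coordVec 0)],
          ![b z (coordVec 1), -b z (coordVec 0), 0]] : Fin 3 → Fin 3 → ℝ) i j) x := by
      intro i
      have hd : DifferentiableAt ℝ (fun z => (![![0, b z (coordVec 2), -b z (coordVec 1)],
          ![-b z (coordVec 2), 0, b z (coordVec 0)],
          ![b z (coordVec 1), -b z (coordVec 0), 0]] : Fin 3 → Fin 3 → ℝ) i j) x := by
        fin_cases i <;> fin_cases j <;> simp only [Fin.zero_eta, Fin.mk_one, Fin.reduceFinMk,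
          Matrix.cons_val] <;>
          first | exact differentiableAt_const _ | exact hbd _ | exact (hbd _).neg
      rw [hpc _ (g := fun z => (fun w => s * (![![0, b w (coordVec 2), -b w (coordVec 1)],
          ![-b w (coordVec 2), 0, b w (coordVec 0)],
          ![b w (coordVec 1), -b w (coordVec 0), 0]] : Fin 3 → Fin 3 → ℝ) i j) (hor z)),
        hpd (f := fun w => s * _) i (hd.const_mul s)]
      · rw [pd, fderiv_const_mul hd]; rfl
      · filter_upwards [hUn, hs] with z hz hz1
        rw [(raise_localFields hF hh hγ hz j).2.2 i, hz1, mul_assoc, detT_mul_bivector hF hBa hz]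
    rw [Fin.sum_univ_five, e0, e1] at h1
    have e20 := e2 0
    have e21 := e2 1
    have e22 := e2 2
    simp only [Matrix.cons_val] at e20 e21 e22
    rw [e20, e21, e22] at h1
    refine (mul_eq_zero.1 ?_).resolve_left hs0
    simp only [Fin.sum_univ_three, Matrix.cons_val] at h1 ⊢
    linear_combination h1
  have hneg : ∀ i m : Fin 3, pd i (fun z => -b z (coordVec m)) x
      = - pd i (fun z => b z (coordVec m)) x := by
    intro i m; simp [pd]
  have hz : ∀ i : Fin 3, pd i (fun _ => (0 : ℝ)) x = 0 := by intro i; simp [pd]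
  have q0 := heq 0
  have q1 := heq 1
  have q2 := heq 2
  simp only [Fin.sum_univ_three, Matrix.cons_val, hneg, hz] at q0 q1 q2
  have hcl0 := hcl 2 3 4
  have hE3 := hTE
  rw [Matrix.det_fin_three (eM e x)] at hE3
  simp only [eM, Matrix.of_apply] at hE3
  have hdf := fun i j => dForm_eq_sum hF.isOpen hbs hx (e i x) (e j x)
  rw [← hc 0, ← hc 1, ← hc 2]
  simp only [hdf, Fin.sum_univ_three]
  refine ⟨?_, ?_, ?_, ?_⟩
  -- The coordinate curl equations are contracted with the cross product of two frame vectors; `hE3`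
  -- removes the product of the two determinants.
  · linear_combination -(e 1 x 1 * e 2 x 2 - e 1 x 2 * e 2 x 1) * q0
      - (e 1 x 2 * e 2 x 0 - e 1 x 0 * e 2 x 2) * q1
      - (e 1 x 0 * e 2 x 1 - e 1 x 1 * e 2 x 0) * q2 + c 0 * hE3
  · linear_combination -(e 2 x 1 * e 0 x 2 - e 2 x 2 * e 0 x 1) * q0
      - (e 2 x 2 * e 0 x 0 - e 2 x 0 * e 0 x 2) * q1
      - (e 2 x 0 * e 0 x 1 - e 2 x 1 * e 0 x 0) * q2 + c 1 * hE3
  · linear_combination -(e 0 x 1 * e 1 x 2 - e 0 x 2 * e 1 x 1) * q0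
      - (e 0 x 2 * e 1 x 0 - e 0 x 0 * e 1 x 2) * q1
      - (e 0 x 0 * e 1 x 1 - e 0 x 1 * e 1 x 0) * q2 + c 2 * hE3
  · have hsum := div_dualForm hF hB hBa hx
    rw [Fin.sum_univ_three] at hsum
    refine hsum (closed_expand ?_ ?_)
    · intro X Y Z
      have hd := (diffAt_of_contDiffOn hF.isOpen hB hx).hasFDerivAt
      have hY : ∀ Y Z, fderiv ℝ (fun z => B z Y Z) x X = fderiv ℝ B x X Y Z := by
        intro Y Z
        rw [((hd.clm_apply (hasFDerivAt_const Y x)).clm_apply (hasFDerivAt_const Z x)).fderiv]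
        simp
      rw [← hY, ← hY]
      have : (fun z => B z Y Z) =ᶠ[nhds x] fun z => - B z Z Y := by
        filter_upwards [hF.isOpen.mem_nhds hx] with z hz
        have := hBa z hz (Y + Z)
        simp [hBa z hz] at this
        linarith
      rw [this.fderiv_eq]
      simp
    · have hcp : ∀ i j k : Fin 3, pd (![2, 3, 4] i)
          (comp (localFields γ h F Δ B).maxwell (![2, 3, 4] j) (![2, 3, 4] k)) y
          = fderiv ℝ B x (coordVec i) (coordVec j) (coordVec k) := by
        intro i j k
        have h0 : ∀ j : Fin 3, (![2, 3, 4] j : Fin 5) ≠ 0 ∧ (![2, 3, 4] j : Fin 5) ≠ 1 := by decide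
        have h1 : comp (localFields γ h F Δ B).maxwell (![2, 3, 4] j) (![2, 3, 4] k)
            = fun z => B (hor z) (coordVec j) (coordVec k) := by
          funext z
          simp only [comp, localFields, hv]
          simp [fun j => ((h0 j).1).symm, fun j => ((h0 j).2).symm]
        have hd := (diffAt_of_contDiffOn hF.isOpen hB hx)
        rw [h1, hpd (f := fun w => B w (coordVec j) (coordVec k)) i
          ((hd.clm_apply (differentiableAt_const _)).clm_apply (differentiableAt_const _)), pd,
          ((hd.hasFDerivAt.clm_apply (hasFDerivAt_const _ x)).clm_apply
            (hasFDerivAt_const _ x)).fderiv]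
        simp
      have c0 := hcp 0 1 2
      have c1 := hcp 1 2 0
      have c2 := hcp 2 0 1
      simp only [Matrix.cons_val] at c0 c1 c2
      rw [← c0, ← c1, ← c2]
      exact hcl 2 3 4

end

/-! ### Structure functions of an orthonormal frame -/

/-- The structure functions `dθ^i(e_j, e_k)`. -/
def strC (e : Fin 3 → Euc 3 → Euc 3) (θ : Fin 3 → Euc 3 → Euc 3 →L[ℝ] ℝ) (i j k : Fin 3)
    (x : Euc 3) : ℝ := dForm (θ i) x (e j x) (e k x)

/-- The Levi-Civita connection in terms of structure functions. -/
def connC (C : Fin 3 → Fin 3 → Fin 3 → ℝ) (i j k : Fin 3) : ℝ :=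
  (1 / 2) * (C j i k * (-1) + C k j i + C i j k)

/-- The Ricci tensor in terms of structure functions and their derivatives. -/
def ricC (C : Fin 3 → Fin 3 → Fin 3 → ℝ) (DC : Fin 3 → Fin 3 → Fin 3 → Fin 3 → ℝ)
    (a b : Fin 3) : ℝ :=
  ∑ c, (connC (DC c) c a b - connC (DC b) c a c + ∑ d, (connC C c a d * C d c b
    + connC C c d c * connC C d a b - connC C c d b * connC C d a c))

section

variable {U : Set (Euc 3)} {e : Fin 3 → Euc 3 → Euc 3} {θ : Fin 3 → Euc 3 → Euc 3 →L[ℝ] ℝ}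
  {h : Euc 3 → Euc 3 →L[ℝ] ℝ} {F Δ : ℝ} {B : Euc 3 → Euc 3 →L[ℝ] Euc 3 →L[ℝ] ℝ}
  {γ : Euc 3 → Euc 3 → Euc 3 → ℝ}

lemma strC_swap (i j k : Fin 3) : strC e θ i j k = fun x => - strC e θ i k j x :=
  funext fun x => dForm_swap (θ i) x _ _

lemma strC_self (i j : Fin 3) (x : Euc 3) : strC e θ i j j x = 0 := dForm_self _ _ _

lemma contDiffOn_strC (hF : IsFrame U e θ) (i j k : Fin 3) :
    ContDiffOn ℝ ∞ (strC e θ i j k) U :=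
  contDiffOn_dForm hF.isOpen (hF.θ_smooth i) (hF.e_smooth j) (hF.e_smooth k)

/-- The derivatives of the structure functions. -/
def strD (e : Fin 3 → Euc 3 → Euc 3) (θ : Fin 3 → Euc 3 → Euc 3 →L[ℝ] ℝ) (l i j k : Fin 3)
    (x : Euc 3) : ℝ := dirD (strC e θ i j k) (e l) x

lemma strD_swap (l i j k : Fin 3) (x : Euc 3) : strD e θ l i j k x = - strD e θ l i k j x := by
  simp [strD, dirD, strC_swap i j k]

lemma strD_self (l i j : Fin 3) (x : Euc 3) : strD e θ l i j j x = 0 := by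
  have : strC e θ i j j = fun _ => 0 := funext (strC_self i j)
  simp [strD, dirD, this]

lemma conn_eq (i j k : Fin 3) (x : Euc 3) :
    conn e θ i j k x = connC (fun i j k => strC e θ i j k x) i j k := rfl

lemma dirD_conn (hF : IsFrame U e θ) {x : Euc 3} (hx : x ∈ U) (l i j k : Fin 3) :
    dirD (conn e θ i j k) (e l) x = connC (fun i j k => strD e θ l i j k x) i j k := by
  have hd := fun i j k => (diffAt_of_contDiffOn hF.isOpen
    (contDiffOn_strC hF i j k) hx).hasFDerivAt
  have h1 := ((((hd j i k).mul_const (-1)).add (hd k j i)).add (hd i j k)).const_mul (1 / 2)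
  have h2 : fderiv ℝ (conn e θ i j k) x = _ := HasFDerivAt.fderiv h1
  rw [dirD, h2]
  simp [connC, strD, dirD]
  ring

lemma frameRicci_conn (hF : IsFrame U e θ) {x : Euc 3} (hx : x ∈ U) (a b : Fin 3) :
    frameRicci e θ (conn e θ) a b x
      = ricC (fun i j k => strC e θ i j k x) (fun l i j k => strD e θ l i j k x) a b := by
  simp only [frameRicci, ricC, dirD_conn hF hx, conn_eq, strC]

lemma fderiv_dual (hF : IsFrame U e θ) {x : Euc 3} (hx : x ∈ U) (l a : Fin 3) (X : Euc 3) :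
    fderiv ℝ (θ l) x X (e a x) + θ l x (fderiv ℝ (e a) x X) = 0 := by
  have h3 : fderiv ℝ (fun y => θ l y (e a y)) x X = 0 := by
    have : (fun y => θ l y (e a y)) =ᶠ[nhds x] fun _ => if l = a then 1 else 0 :=
      Filter.eventuallyEq_of_mem (hF.isOpen.mem_nhds hx) fun y hy => hF.dual y hy l a
    rw [this.fderiv_eq]; simp
  rw [((diffAt_of_contDiffOn hF.isOpen (hF.θ_smooth l) hx).hasFDerivAt.clm_apply
    (diffAt_of_contDiffOn hF.isOpen (hF.e_smooth a) hx).hasFDerivAt).fderiv] at h3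
  simpa [add_comm] using h3

/-- The exterior derivative of a one-form in a frame. -/
lemma dForm_frame (hF : IsFrame U e θ) {α : Euc 3 → Euc 3 →L[ℝ] ℝ} (hα : ContDiffOn ℝ ∞ α U)
    {x : Euc 3} (hx : x ∈ U) (i j : Fin 3) :
    dForm α x (e i x) (e j x) = dirD (fun y => α y (e j y)) (e i) x
      - dirD (fun y => α y (e i y)) (e j) x + ∑ k, α x (e k x) * strC e θ k i j x := by
  have hd : ∀ i X, fderiv ℝ (fun y => α y (e i y)) x X
      = fderiv ℝ α x X (e i x) + α x (fderiv ℝ (e i) x X) := by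
    intro i X
    rw [((diffAt_of_contDiffOn hF.isOpen hα hx).hasFDerivAt.clm_apply
      (diffAt_of_contDiffOn hF.isOpen (hF.e_smooth i) hx).hasFDerivAt).fderiv]
    simp [add_comm]
  have h1 : α x (fderiv ℝ (e i) x (e j x) - fderiv ℝ (e j) x (e i x))
      = ∑ k, α x (e k x) * strC e θ k i j x := by
    rw [← hF.expand x hx (fderiv ℝ (e i) x (e j x) - fderiv ℝ (e j) x (e i x)), map_sum]
    refine Finset.sum_congr rfl fun k _ => ?_
    rw [map_smul, smul_eq_mul, mul_comm]
    congr 1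
    rw [map_sub, strC, dForm]
    linarith [fderiv_dual hF hx k i (e j x), fderiv_dual hF hx k j (e i x)]
  rw [dForm, dirD, dirD, hd, hd, ← h1, map_sub]
  ring

lemma dirD_eqOn (hU : IsOpen U) {f : Euc 3 → ℝ} {c : ℝ} (hf : ∀ y ∈ U, f y = c)
    {V : Euc 3 → Euc 3} {x : Euc 3} (hx : x ∈ U) : dirD f V x = 0 := by
  have : f =ᶠ[nhds x] fun _ => c := Filter.eventuallyEq_of_mem (hU.mem_nhds hx) hf
  rw [dirD, this.fderiv_eq]
  simp

/-- The Einstein–Maxwell equations for a one-form `H_i θ^i` and a two-form with dual `b_i θ^i`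
in an orthonormal frame with structure functions `C`. -/
structure FrameEqs (C : Fin 3 → Fin 3 → Fin 3 → ℝ) (DC : Fin 3 → Fin 3 → Fin 3 → Fin 3 → ℝ)
    (H b : Fin 3 → ℝ) (F Δ : ℝ) : Prop where
  ric : ∀ i j, ricC C DC i j = (1 / 2) * (H i * H j) + ∑ k, connC C k i j * H k
    - (1 / 2) * ∑ k, H k * C k i j - 2 * (b i * b j)
    + ((4 / 3) * ∑ k, b k ^ 2 + (2 / 3) * Δ ^ 2) * if i = j then 1 else 0
  F_eq : F = (1 / 2) * ∑ i, H i ^ 2 + (1 / 2) * ∑ i, ∑ k, connC C k i i * H k - (4 / 3) * Δ ^ 2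
    - (2 / 3) * ∑ k, b k ^ 2
  max0 : ∑ k, b k * C k 1 2 = Δ * H 0 + (H 1 * b 2 - H 2 * b 1)
  max1 : ∑ k, b k * C k 2 0 = Δ * H 1 + (H 2 * b 0 - H 0 * b 2)
  max2 : ∑ k, b k * C k 0 1 = Δ * H 2 + (H 0 * b 1 - H 1 * b 0)
  div : ∑ i, ∑ k, connC C k i i * b k = 0
  swap : ∀ i j k, C i j k = - C i k j

/-- For constant frame components the covariant derivatives reduce to connection terms, so that
derivatives occur only in the structure functions inside the Ricci tensor. -/
lemma frameEqs (hF : IsFrame U e θ) (hh : ContDiffOn ℝ ∞ h U) (hB : ContDiffOn ℝ ∞ B U)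
    (hBa : ∀ x ∈ U, ∀ X, B x X X = 0)
    (hγ : ∀ x ∈ U, ∀ X Y, γ x X Y = ∑ i, θ i x X * θ i x Y)
    (hE : SolvesEinsteinMaxwell (localFields γ h F Δ B) (hor ⁻¹' U))
    {H b : Fin 3 → ℝ} (hH : ∀ x ∈ U, ∀ i, h x (e i x) = H i)
    (hb : ∀ x ∈ U, ∀ i, dualForm e θ B x (e i x) = b i) {x : Euc 3} (hx : x ∈ U) :
    FrameEqs (fun i j k => strC e θ i j k x) (fun l i j k => strD e θ l i j k x) H b F Δ := by
  obtain ⟨h1, h2⟩ := horizon_einstein hF hh hγ hE hx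
  obtain ⟨m0, m1, m2, dv⟩ := horizon_maxwell hF hh hB hBa hγ hE hx
  have hbs := contDiffOn_dualForm hF hB
  obtain ⟨b0, b1, b2⟩ := dualForm_apply (B := B) hF hx
  rw [hb x hx] at b0 b1 b2
  have hDH : ∀ i j, dirD (fun y => h y (e i y)) (e j) x = 0 :=
    fun i j => dirD_eqOn hF.isOpen (fun y hy => hH y hy i) hx
  have hDb : ∀ i j, dirD (fun y => dualForm e θ B y (e i y)) (e j) x = 0 :=
    fun i j => dirD_eqOn hF.isOpen (fun y hy => hb y hy i) hx
  have hdh := fun i j => dForm_frame hF hh hx i j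
  have hdb := fun i j => dForm_frame hF hbs hx i j
  have hsk : ∀ X Y, B x X Y = - B x Y X := by
    intro X Y
    have := hBa x hx (X + Y)
    simp [hBa x hx] at this
    linarith
  have B12 := hsk (e 2 x) (e 1 x)
  have B20 := hsk (e 0 x) (e 2 x)
  have B01 := hsk (e 1 x) (e 0 x)
  have Bii := fun i => hBa x hx (e i x)
  rw [← b0] at B12
  rw [← b1] at B20
  rw [← b2] at B01
  refine ⟨?_, ?_, ?_, ?_, ?_, ?_, fun i j k => congrFun (strC_swap i j k) x⟩
  · intro i j
    rw [← frameRicci_conn hF hx, h1 i j, hdh]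
    simp only [covD, hDH, hDb, hH x hx, conn_eq]
    fin_cases i <;> fin_cases j <;>
      simp [Fin.sum_univ_three, B12, B20, B01, Bii, ← b0, ← b1, ← b2] <;> ring
  · rw [h2]
    simp only [covD, hDH, hH x hx, conn_eq]
    simp [Fin.sum_univ_three, B12, B20, B01, Bii, ← b0, ← b1, ← b2]
    ring
  · rw [hdb] at m0
    simp only [hDb, hb x hx, hH x hx, Fin.sum_univ_three, B12, B20, B01, Bii, ← b0, ← b1, ← b2]
      at m0 ⊢
    linear_combination m0
  · rw [hdb] at m1
    simp only [hDb, hb x hx, hH x hx, Fin.sum_univ_three, B12, B20, B01, Bii, ← b0, ← b1, ← b2]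
      at m1 ⊢
    linear_combination m1
  · rw [hdb] at m2
    simp only [hDb, hb x hx, hH x hx, Fin.sum_univ_three, B12, B20, B01, Bii, ← b0, ← b1, ← b2]
      at m2 ⊢
    linear_combination m2
  · simp only [covD, hDb, hb x hx, conn_eq] at dv
    simp only [zero_sub, Finset.sum_neg_distrib, neg_eq_zero] at dv
    exact dv

end

/-! ### Solutions with constant structure functions: left-invariant geometry on local Lie groups. -/

lemma ricC_const (C : Fin 3 → Fin 3 → Fin 3 → ℝ) (a b : Fin 3) :
    ricC C (fun _ _ _ _ => 0) a b = ∑ c, ∑ d, (connC C c a d * C d c b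
    + connC C c d c * connC C d a b - connC C c d b * connC C d a c) := by
  simp [ricC, connC]

/-- The Jacobi identity, as the antisymmetric part of the Ricci tensor. -/
lemma FrameEqs.jacobi {C : Fin 3 → Fin 3 → Fin 3 → ℝ} {H b : Fin 3 → ℝ} {F Δ : ℝ}
    (hE : FrameEqs C (fun _ _ _ _ => 0) H b F Δ) (i : Fin 3) :
    (C 1 0 1 - C 2 2 0) * C i 1 2 + (C 2 1 2 - C 0 0 1) * C i 2 0
      + (C 0 2 0 - C 1 1 2) * C i 0 1 = 0 := by
  have hd : ∀ i j, C i j j = 0 := fun i j => by linarith [hE.swap i j j]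
  have s1 := fun i => hE.swap i 1 0
  have s2 := fun i => hE.swap i 2 1
  have s3 := fun i => hE.swap i 0 2
  have h := hE.ric
  simp only [ricC_const, Fin.sum_univ_three, connC] at h
  -- The right-hand side of the Einstein equation is symmetric, because `Γ^k_{ij} - (1/2) C^k_{ij}`
  -- is. So the Ricci expression has no antisymmetric part.
  fin_cases i
  · have h1 := h 1 2
    have h2 := h 2 1
    simp [hd, s1, s2, s3] at h1 h2 ⊢
    linear_combination h1 - h2
  · have h1 := h 2 0
    have h2 := h 0 2
    simp [hd, s1, s2, s3] at h1 h2 ⊢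
    linear_combination h1 - h2
  · have h1 := h 0 1
    have h2 := h 1 0
    simp [hd, s1, s2, s3] at h1 h2 ⊢
    linear_combination h1 - h2

/-- The Bochner formula for the closed one-form `Z_i = C^k_{ki}`. -/
lemma ricC_trace_trace {C : Fin 3 → Fin 3 → Fin 3 → ℝ} (hs : ∀ i j k, C i j k = - C i k j) (Z : Fin 3 → ℝ)
  (h0 : Z 0 = C 1 0 1 - C 2 2 0) (h1 : Z 1 = C 2 1 2 - C 0 0 1) (h2 : Z 2 = C 0 2 0 - C 1 1 2)
  (hJ : ∀ i, Z 0 * C i 1 2 + Z 1 * C i 2 0 + Z 2 * C i 0 1 = 0) :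
   ∑ i, ∑ j, Z i * Z j * ricC C (fun _ _ _ _ => 0) i j = - ∑ i, ∑ j, (∑ k, connC C k i j * Z k) ^ 2 := by
  have hd : ∀ i j, C i j j = 0 := fun i j => by linarith [hs i j j]
  have s1 := fun i => hs i 1 0
  have s2 := fun i => hs i 2 1
  have s3 := fun i => hs i 0 2
  have j0 := hJ 0
  have j1 := hJ 1
  have j2 := hJ 2
  simp only [ricC_const, Fin.sum_univ_three, connC, hd, s1, s2, s3, h0, h1, h2] at j0 j1 j2 ⊢
  clear s1 s2 s3 hd h0 h1 h2 hJ hs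
  generalize C 0 1 2 = x0 at *
  generalize C 1 1 2 = x1 at *
  generalize C 2 1 2 = x2 at *
  generalize C 0 2 0 = y0 at *
  generalize C 1 2 0 = y1 at *
  generalize C 2 2 0 = y2 at *
  generalize C 0 0 1 = z0 at *
  generalize C 1 0 1 = z1 at *
  generalize C 2 0 1 = z2 at *
  -- A polynomial identity in the nine structure constants, modulo the Jacobi relations `j0`, `j1`,
  -- `j2`.
  grind
/-- A solution with constant components lives on a unimodular Lie group. -/
lemma FrameEqs.unimodular {C : Fin 3 → Fin 3 → Fin 3 → ℝ} {H b : Fin 3 → ℝ} {F Δ : ℝ}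
    (hE : FrameEqs C (fun _ _ _ _ => 0) H b F Δ) :
    C 1 0 1 = C 2 2 0 ∧ C 2 1 2 = C 0 0 1 ∧ C 0 2 0 = C 1 1 2 := by
  obtain ⟨Z, h0, h1, h2⟩ : ∃ Z : Fin 3 → ℝ, Z 0 = C 1 0 1 - C 2 2 0 ∧ Z 1 = C 2 1 2 - C 0 0 1 ∧
      Z 2 = C 0 2 0 - C 1 1 2 :=
    ⟨![C 1 0 1 - C 2 2 0, C 2 1 2 - C 0 0 1, C 0 2 0 - C 1 1 2], rfl, rfl, rfl⟩
  have hJ : ∀ i, Z 0 * C i 1 2 + Z 1 * C i 2 0 + Z 2 * C i 0 1 = 0 := by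
    intro i; rw [h0, h1, h2]; exact hE.jacobi i
  have hd : ∀ i j, C i j j = 0 := fun i j => by linarith [hE.swap i j j]
  have s1 := fun i => hE.swap i 1 0
  have s2 := fun i => hE.swap i 2 1
  have s3 := fun i => hE.swap i 0 2
  have hZZ := ricC_trace_trace hE.swap Z h0 h1 h2 hJ
  have hdiv := hE.div
  -- The divergence of a left-invariant field is, up to sign, its product with the trace form `Z`.
  have hbZ : ∑ i, b i * Z i = 0 := by
    simp only [Fin.sum_univ_three, connC, hd, s1, s2, s3] at hdiv ⊢
    rw [h0, h1, h2]
    linear_combination -hdiv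
  have hHZ : ∑ i, ∑ j, Z i * Z j * ((1 / 2) * (H i * H j) + ∑ k, connC C k i j * H k
      - (1 / 2) * ∑ k, H k * C k i j - 2 * (b i * b j)
      + ((4 / 3) * ∑ k, b k ^ 2 + (2 / 3) * Δ ^ 2) * if i = j then 1 else 0)
      = (1 / 2) * (∑ i, H i * Z i) ^ 2 - 2 * (∑ i, b i * Z i) ^ 2
        + ((4 / 3) * ∑ k, b k ^ 2 + (2 / 3) * Δ ^ 2) * ∑ i, Z i ^ 2 := by
    -- The `C` term drops out by antisymmetry, and `∇_Z Z = 0` because `Z` is closed and of constant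
    -- length.
    have hk : ∀ k, ∑ i, ∑ j, Z i * Z j * (connC C k i j - (1 / 2) * C k i j) = 0 := by
      have j0 := hJ 0
      have j1 := hJ 1
      have j2 := hJ 2
      intro k
      fin_cases k <;> simp only [Fin.sum_univ_three, connC, hd, s1, s2, s3, Fin.zero_eta,
        Fin.mk_one, Fin.reduceFinMk] <;> grind
    have k0 := hk 0
    have k1 := hk 1
    have k2 := hk 2
    simp only [Fin.sum_univ_three] at k0 k1 k2 ⊢
    simp
    linear_combination H 0 * k0 + H 1 * k1 + H 2 * k2
  simp only [hE.ric] at hZZ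
  rw [hHZ, hbZ] at hZZ
  -- The Einstein equation makes `Ric(Z, Z)` nonnegative, as `b` is orthogonal to `Z`, while
  -- Bochner's formula makes it `-|∇Z|²`. Hence `Z` is parallel.
  have hc : 0 ≤ ((4 / 3) * ∑ k, b k ^ 2 + (2 / 3) * Δ ^ 2) * ∑ i, Z i ^ 2 := by positivity
  have hn : ∑ i, ∑ j, (∑ k, connC C k i j * Z k) ^ 2 = 0 := by
    refine le_antisymm ?_ (by positivity)
    nlinarith [sq_nonneg (∑ i, H i * Z i)]
  have hn' : ∀ i j, ∑ k, connC C k i j * Z k = 0 := by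
    intro i j
    have h3 := (Finset.sum_eq_zero_iff_of_nonneg (fun i _ => by positivity)).1 hn i
      (Finset.mem_univ _)
    exact pow_eq_zero_iff (two_ne_zero) |>.1
      ((Finset.sum_eq_zero_iff_of_nonneg (fun j _ => by positivity)).1 h3 j (Finset.mem_univ _))
  have t0 := hn' 0 0
  have t1 := hn' 1 1
  have t2 := hn' 2 2
  simp only [Fin.sum_univ_three, connC, hd, s1, s2, s3] at t0 t1 t2
  -- A parallel form is divergence free, and the divergence of `Z` is `|Z|²` up to sign.
  have hZ : Z 0 ^ 2 + Z 1 ^ 2 + Z 2 ^ 2 = 0 := by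
    rw [h0, h1, h2] at *
    linear_combination -t0 - t1 - t2
  have z0 : Z 0 = 0 := pow_eq_zero_iff two_ne_zero |>.1
    (by linarith [sq_nonneg (Z 0), sq_nonneg (Z 1), sq_nonneg (Z 2)])
  have z1 : Z 1 = 0 := pow_eq_zero_iff two_ne_zero |>.1
    (by linarith [sq_nonneg (Z 0), sq_nonneg (Z 1), sq_nonneg (Z 2)])
  have z2 : Z 2 = 0 := pow_eq_zero_iff two_ne_zero |>.1
    (by linarith [sq_nonneg (Z 0), sq_nonneg (Z 1), sq_nonneg (Z 2)])
  exact ⟨by linarith, by linarith, by linarith⟩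

/-- In a solution with constant components, `h` is a Killing field parallel to `b`. -/
lemma FrameEqs.rigid {C : Fin 3 → Fin 3 → Fin 3 → ℝ} {H b : Fin 3 → ℝ} {F Δ : ℝ}
    (hE : FrameEqs C (fun _ _ _ _ => 0) H b F Δ) (h0 : H 0 ≠ 0) (h1 : H 1 = 0) (h2 : H 2 = 0) :
    b 1 = 0 ∧ b 2 = 0 ∧ C 0 0 1 = 0 ∧ C 0 2 0 = 0 := by
  obtain ⟨u0, u1, u2⟩ := hE.unimodular
  have hd : ∀ i j, C i j j = 0 := fun i j => by linarith [hE.swap i j j]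
  have s1 := fun i => hE.swap i 1 0
  have s2 := fun i => hE.swap i 2 1
  have s3 := fun i => hE.swap i 0 2
  have h := hE.ric
  simp only [ricC_const, Fin.sum_univ_three, connC, h1, h2] at h
  have e11 := h 1 1
  have e22 := h 2 2
  have e12 := h 1 2
  have e01 := h 0 1
  have e02 := h 0 2
  have m1 := hE.max1
  have m2 := hE.max2
  simp [hd, s1, s2, s3, h1, h2, Fin.sum_univ_three, ← u0, u1, u2] at e11 e22 e12 e01 e02 m1 m2
  -- The Einstein equation is contracted with the symmetrized `∇h`. On a unimodular group
  -- divergences of invariant fields vanish, so the Ricci term, the `h h` term and the trace term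
  -- drop out. There remain the square of the symmetrized `∇h` and a term `2 b_i b_j ∇_i h_j`, which
  -- `m1` and `m2` convert into `2 |h × b|²`: a sum of squares that vanishes.
  have key : H 0 ^ 2 * ((C 2 0 1 - C 1 2 0) ^ 2 / 2 + 2 * (C 1 0 1) ^ 2 + C 0 0 1 ^ 2 / 2
      + C 1 1 2 ^ 2 / 2) + 2 * H 0 ^ 2 * (b 1 ^ 2 + b 2 ^ 2) = 0 := by
    clear h s1 s2 s3 hd hE
    linear_combination H 0 * C 1 0 1 * (e11 - e22) + H 0 * (C 2 0 1 - C 1 2 0) * e12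
      + H 0 * C 0 0 1 * e01 - H 0 * C 1 1 2 * e02 + 2 * H 0 * (b 2 * m1 - b 1 * m2)
  have hp : 0 < H 0 ^ 2 := by positivity
  have key2 : (C 2 0 1 - C 1 2 0) ^ 2 / 2 + 2 * (C 1 0 1) ^ 2 + C 0 0 1 ^ 2 / 2
      + C 1 1 2 ^ 2 / 2 + 2 * (b 1 ^ 2 + b 2 ^ 2) = 0 := by
    refine (mul_eq_zero.1 ?_).resolve_left hp.ne'
    linear_combination key
  have p0 := sq_nonneg (C 2 0 1 - C 1 2 0)
  have p1 := sq_nonneg (C 1 0 1)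
  have p2 := sq_nonneg (C 0 0 1)
  have p3 := sq_nonneg (C 1 1 2)
  have p4 := sq_nonneg (b 1)
  have p5 := sq_nonneg (b 2)
  refine ⟨?_, ?_, ?_, ?_⟩ <;> refine pow_eq_zero_iff two_ne_zero |>.1 ?_
  · linarith
  · linarith
  · linarith
  · rw [u2]; linarith

/-! ### Solutions with parallel `h` and `b` -/

/-- A frame in which `h = H θ^0`, `B = b θ^1 ∧ θ^2` and `dθ^0 = n θ^1 ∧ θ^2`. -/
structure AxialFrame (U : Set (Euc 3)) (e : Fin 3 → Euc 3 → Euc 3)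
    (θ : Fin 3 → Euc 3 → Euc 3 →L[ℝ] ℝ) (H b n F Δ : ℝ) : Prop where
  frame : IsFrame U e θ
  eqs : ∀ x ∈ U, FrameEqs (fun i j k => strC e θ i j k x) (fun l i j k => strD e θ l i j k x)
    ![H, 0, 0] ![b, 0, 0] F Δ
  c01 : ∀ x ∈ U, strC e θ 0 0 1 x = 0
  c20 : ∀ x ∈ U, strC e θ 0 2 0 x = 0
  c12 : ∀ x ∈ U, strC e θ 0 1 2 x = n

section

variable {U : Set (Euc 3)} {e : Fin 3 → Euc 3 → Euc 3} {θ : Fin 3 → Euc 3 → Euc 3 →L[ℝ] ℝ}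
  {H b n F Δ : ℝ}

lemma AxialFrame.strD_zero (hA : AxialFrame U e θ H b n F Δ) {x : Euc 3} (hx : x ∈ U) (l : Fin 3) :
    strD e θ l 0 0 1 x = 0 ∧ strD e θ l 0 2 0 x = 0 ∧ strD e θ l 0 1 2 x = 0 :=
  ⟨dirD_eqOn hA.frame.isOpen hA.c01 hx, dirD_eqOn hA.frame.isOpen hA.c20 hx,
    dirD_eqOn hA.frame.isOpen hA.c12 hx⟩

/-- The equations of an axial frame, written out. -/
lemma AxialFrame.equations (hA : AxialFrame U e θ H b n F Δ) {x : Euc 3} (hx : x ∈ U)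
    (a d p q u v : ℝ) (Da Dd Dp Dq Du Dv : Fin 3 → ℝ) 
    (ha : strC e θ 1 0 1 x = a) (hp : strC e θ 1 2 0 x = -p) (hq : strC e θ 2 0 1 x = q)
    (hd : strC e θ 2 2 0 x = -d) (hu : strC e θ 1 1 2 x = u) (hv : strC e θ 2 1 2 x = v)
    (hDa : ∀ l, strD e θ l 1 0 1 x = Da l) (hDp : ∀ l, strD e θ l 1 2 0 x = -Dp l)
    (hDq : ∀ l, strD e θ l 2 0 1 x = Dq l) (hDd : ∀ l, strD e θ l 2 2 0 x = -Dd l)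
    (hDu : ∀ l, strD e θ l 1 1 2 x = Du l) (hDv : ∀ l, strD e θ l 2 1 2 x = Dv l) :
    n * (a + d) = 0 ∧ b * (a + d) = 0 ∧ F = H ^ 2 / 2 - H * (a + d) / 2 - 4 / 3 * Δ ^ 2
      - 2 / 3 * b ^ 2 ∧ b * n = Δ * H ∧
    -(Da 0 + Dd 0) - a ^ 2 - d ^ 2 - (p + q) ^ 2 / 2 + n ^ 2 / 2
      = H ^ 2 / 2 - 2 / 3 * b ^ 2 + 2 / 3 * Δ ^ 2 ∧
    -Da 0 - a * d - a ^ 2 + n * q - n ^ 2 / 2 - q ^ 2 / 2 + p ^ 2 / 2 - u ^ 2 - v ^ 2 + Du 2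
      - Dv 1 = -(a * H) + 4 / 3 * b ^ 2 + 2 / 3 * Δ ^ 2 ∧
    -Dd 0 - a * d - d ^ 2 - n * p - n ^ 2 / 2 + q ^ 2 / 2 - p ^ 2 / 2 - u ^ 2 - v ^ 2 + Du 2
      - Dv 1 = -(d * H) + 4 / 3 * b ^ 2 + 2 / 3 * Δ ^ 2 ∧
    n * (d - a) - 2 * a * p - 2 * q * d - (Dp 0 + Dq 0) = -((p + q) * H) ∧
    (a - d) * v - (p + q) * u + (Dp 2 + Dq 2) / 2 - Dd 1 = 0 ∧
    (a - d) * u + (p + q) * v + (Dp 1 + Dq 1) / 2 - Da 2 = 0 ∧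
    -(p * u) - d * v + (Dp 2 - Dq 2) / 2 - Dv 0 = 0 ∧
    a * u + q * v + (Dq 1 - Dp 1) / 2 + Du 0 = 0 := by
  have hD := hA.strD_zero hx
  have hE := hA.eqs x hx
  have r := hE.ric
  have hdi := hE.div
  have hFe := hE.F_eq
  have m0 := hE.max0
  have s0 := fun i j => strC_self (e := e) (θ := θ) i j x
  have s1 := fun i => congrFun (strC_swap (e := e) (θ := θ) i 1 0) x
  have s2 := fun i => congrFun (strC_swap (e := e) (θ := θ) i 2 1) x
  have s3 := fun i => congrFun (strC_swap (e := e) (θ := θ) i 0 2) x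
  have t0 := fun l i j => strD_self (e := e) (θ := θ) l i j x
  have t1 := fun l i => strD_swap (e := e) (θ := θ) l i 1 0 x
  have t2 := fun l i => strD_swap (e := e) (θ := θ) l i 2 1 x
  have t3 := fun l i => strD_swap (e := e) (θ := θ) l i 0 2 x
  have c01 := hA.c01 x hx
  have c20 := hA.c20 x hx
  have c12 := hA.c12 x hx
  have r00 := r 0 0
  have r12 := r 1 2
  have r11 := r 1 1
  have r22 := r 2 2
  have r01 := r 0 1
  have r02 := r 0 2
  have r10 := r 1 0
  have r20 := r 2 0
  have r21 := r 2 1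
  simp only [ricC, connC, Fin.sum_univ_three, Matrix.cons_val, s0, s1, s2, s3, t0, t1, t2, t3,
    (hD _).1, (hD _).2.1, (hD _).2.2, c01, c20, c12, ha, hp, hq, hd, hu, hv, hDa, hDp, hDq, hDd,
    hDu, hDv] at r00 r12 r21 r11 r22 r01 r02 r10 r20 hdi hFe m0
  simp at r00 r12 r21 r11 r22 r01 r02 r10 r20
  refine ⟨?_, ?_, ?_, ?_, ?_, ?_, ?_, ?_, ?_, ?_, ?_, ?_⟩
  -- The antisymmetric part of the Ricci expression is a Jacobi identity; this one is `d²θ^0 = 0`.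
  · linear_combination r12 - r21
  · linear_combination -hdi
  · linear_combination hFe
  · linear_combination m0
  · linear_combination r00
  · linear_combination r11
  · linear_combination r22
  · linear_combination r12 + r21
  · linear_combination r01
  · linear_combination r02
  · linear_combination r10
  · linear_combination r20

lemma dirD_congr (hU : IsOpen U) {f g : Euc 3 → ℝ} (hf : ∀ y ∈ U, f y = g y)
    {V : Euc 3 → Euc 3} {x : Euc 3} (hx : x ∈ U) : dirD f V x = dirD g V x := by
  have : f =ᶠ[nhds x] g := Filter.eventuallyEq_of_mem (hU.mem_nhds hx) hf
  rw [dirD, this.fderiv_eq, dirD]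

/-- The expansion of the axis vanishes. -/
lemma AxialFrame.expansion (hA : AxialFrame U e θ H b n F Δ) (h0 : ¬ (H = 0 ∧ b = 0)) {x : Euc 3}
    (hx : x ∈ U) : strC e θ 1 0 1 x = strC e θ 2 2 0 x := by
  have hE := fun y hy => hA.equations (x := y) hy _ _ _ _ _ _ _ _ _ _ _ _ rfl (neg_neg _).symm rfl
    (neg_neg _).symm rfl rfl (fun _ => rfl) (fun _ => (neg_neg _).symm) (fun _ => rfl)
    (fun _ => (neg_neg _).symm) (fun _ => rfl) (fun _ => rfl)
  obtain ⟨e1, e2, e3, -, e5, -⟩ := hE x hx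
  -- If `n` or `b` is nonzero, `d²θ^0 = 0` or `div b = 0` gives the claim. Otherwise `H ≠ 0`, and
  -- the formula for `F` makes the expansion constant; then Raychaudhuri's equation `e5` equates a
  -- nonpositive number with a positive one.
  by_cases hb : b = 0
  · have hH : H ≠ 0 := fun h => h0 ⟨h, hb⟩
    by_cases hn : n = 0
    · have hc : ∀ y ∈ U, strC e θ 1 0 1 y = strC e θ 2 2 0 y
          + (strC e θ 1 0 1 x - strC e θ 2 2 0 x) := by
        intro y hy
        obtain ⟨-, -, e3', -⟩ := hE y hy
        have : H * (strC e θ 1 0 1 y - strC e θ 2 2 0 y)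
            = H * (strC e θ 1 0 1 x - strC e θ 2 2 0 x) := by linarith
        linarith [mul_left_cancel₀ hH this]
      have hD : strD e θ 0 1 0 1 x = strD e θ 0 2 2 0 x := by
        rw [strD, dirD_congr hA.frame.isOpen hc hx, strD, dirD, dirD, fderiv_add_const]
      rw [hD, hn, hb] at e5
      have : 0 < H ^ 2 := by positivity
      nlinarith [sq_nonneg (strC e θ 1 0 1 x), sq_nonneg (-strC e θ 2 2 0 x), sq_nonneg Δ,
        sq_nonneg (-strC e θ 1 2 0 x + strC e θ 2 0 1 x)]
    · linarith [(mul_eq_zero.1 e1).resolve_left hn]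
  · linarith [(mul_eq_zero.1 e2).resolve_left hb]

/-- The one-form `f dg - g df`. -/
def angleForm (f g : Euc 3 → ℝ) (x : Euc 3) : Euc 3 →L[ℝ] ℝ :=
  f x • fderiv ℝ g x - g x • fderiv ℝ f x

lemma contDiffOn_angleForm (hU : IsOpen U) {f g : Euc 3 → ℝ} (hf : ContDiffOn ℝ ∞ f U)
    (hg : ContDiffOn ℝ ∞ g U) : ContDiffOn ℝ ∞ (angleForm f g) U :=
  (hf.smul (contDiffOn_fderiv hU hg)).sub (hg.smul (contDiffOn_fderiv hU hf))

lemma dForm_angleForm (hU : IsOpen U) {f g : Euc 3 → ℝ} (hf : ContDiffOn ℝ ∞ f U)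
    (hg : ContDiffOn ℝ ∞ g U) {x : Euc 3} (hx : x ∈ U) (X Y : Euc 3) :
    dForm (angleForm f g) x X Y
      = 2 * (fderiv ℝ f x X * fderiv ℝ g x Y - fderiv ℝ f x Y * fderiv ℝ g x X) := by
  have hs : ∀ {f : Euc 3 → ℝ}, ContDiffOn ℝ ∞ f U →
      ∀ X Y, fderiv ℝ (fderiv ℝ f) x X Y = fderiv ℝ (fderiv ℝ f) x Y X := by
    intro f hf X Y
    have : IsSymmSndFDerivAt ℝ f x := (hf.contDiffAt (hU.mem_nhds hx)).isSymmSndFDerivAt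
      (by simpa using WithTop.coe_le_coe.2 (le_top : (2 : ℕ∞) ≤ ⊤))
    exact this X Y
  have h1 : HasFDerivAt (angleForm f g) _ x := ((diffAt_of_contDiffOn hU hf hx).hasFDerivAt.smul
    (diffAt_of_contDiffOn hU (contDiffOn_fderiv hU hg) hx).hasFDerivAt).sub
    ((diffAt_of_contDiffOn hU hg hx).hasFDerivAt.smul
    (diffAt_of_contDiffOn hU (contDiffOn_fderiv hU hf) hx).hasFDerivAt)
  rw [dForm, h1.fderiv]
  simp
  rw [hs hf X Y, hs hg X Y]
  ring

/-- The shear of the axis vanishes. -/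
lemma AxialFrame.shear (hA : AxialFrame U e θ H b n F Δ) (h0 : ¬ (H = 0 ∧ b = 0)) {x : Euc 3}
    (hx : x ∈ U) : strC e θ 1 0 1 x = 0 ∧ strC e θ 2 0 1 x = strC e θ 1 2 0 x := by
  have hU := hA.frame.isOpen
  have hE := fun y hy => hA.equations (x := y) hy _ _ _ _ _ _ _ _ _ _ _ _ rfl (neg_neg _).symm rfl
    (neg_neg _).symm rfl rfl (fun _ => rfl) (fun _ => (neg_neg _).symm) (fun _ => rfl)
    (fun _ => (neg_neg _).symm) (fun _ => rfl) (fun _ => rfl)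
  have hex := fun y hy => hA.expansion h0 (x := y) hy
  have hDex : ∀ y ∈ U, ∀ l, strD e θ l 2 2 0 y = strD e θ l 1 0 1 y :=
    fun y hy l => (dirD_congr hU hex hy).symm
  have hsm := fun i j k => contDiffOn_strC hA.frame i j k
  -- `f` and `g` are the two components of the trace-free symmetric part of the derivative of the
  -- axis.
  obtain ⟨f, hf⟩ : ∃ f, f = strC e θ 1 0 1 := ⟨_, rfl⟩
  obtain ⟨g, hg⟩ : ∃ g : Euc 3 → ℝ, g = fun y => (strC e θ 2 0 1 y - strC e θ 1 2 0 y) / 2 :=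
    ⟨_, rfl⟩
  have hfs : ContDiffOn ℝ ∞ f U := hf ▸ hsm 1 0 1
  have hgs : ContDiffOn ℝ ∞ g U := hg ▸ ((hsm 2 0 1).sub (hsm 1 2 0)).div_const 2
  have hDg : ∀ y ∈ U, ∀ l, dirD g (e l) y = (strD e θ l 2 0 1 y - strD e θ l 1 2 0 y) / 2 := by
    intro y hy l
    have h1 := ((diffAt_of_contDiffOn hU (hsm 2 0 1) hy).hasFDerivAt.sub
      (diffAt_of_contDiffOn hU (hsm 1 2 0) hy).hasFDerivAt).mul_const (2⁻¹ : ℝ)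
    have h2 : g = fun z => (strC e θ 2 0 1 - strC e θ 1 2 0) z * 2⁻¹ := by
      rw [hg]; rfl
    rw [dirD, h2, h1.fderiv]
    simp [strD, dirD]
    ring
  have hDf : ∀ y l, dirD f (e l) y = strD e θ l 1 0 1 y := fun y l => by rw [hf, strD]
  -- Without expansion, Raychaudhuri's equation says that the shear has constant norm; `m` is the
  -- constant value of `f² + g²`.
  obtain ⟨m, hm⟩ : ∃ m, m = (n ^ 2 / 2 - (H ^ 2 / 2 - 2 / 3 * b ^ 2 + 2 / 3 * Δ ^ 2)) / 2 :=
    ⟨_, rfl⟩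
  have hfg : ∀ y ∈ U, f y ^ 2 + g y ^ 2 = m := by
    intro y hy
    obtain ⟨-, -, -, -, e5, -⟩ := hE y hy
    rw [hDex y hy, ← hex y hy] at e5
    rw [hf, hg, hm]
    simp only
    linear_combination -e5 / 2
  have hort : ∀ y ∈ U, ∀ l, f y * dirD f (e l) y + g y * dirD g (e l) y = 0 := by
    intro y hy l
    have h1 := dirD_eqOn (V := e l) hU hfg hy
    have h2 := ((diffAt_of_contDiffOn hU hfs hy).hasFDerivAt.pow 2).add
      ((diffAt_of_contDiffOn hU hgs hy).hasFDerivAt.pow 2)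
    have h3 : HasFDerivAt (fun y => f y ^ 2 + g y ^ 2) _ y := h2
    rw [dirD, h3.fderiv] at h1
    simp at h1
    rw [dirD, dirD]
    linarith
  suffices hz : f x ^ 2 + g x ^ 2 = 0 by
    have h1 : f x = 0 := pow_eq_zero_iff two_ne_zero |>.1
      (by linarith [sq_nonneg (f x), sq_nonneg (g x)])
    have h2 : g x = 0 := pow_eq_zero_iff two_ne_zero |>.1
      (by linarith [sq_nonneg (f x), sq_nonneg (g x)])
    rw [hf] at h1
    rw [hg] at h2
    simp only at h2
    exact ⟨h1, by linarith⟩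
  -- The evolution of the shear along the axis, followed by the Codazzi equations in the transverse
  -- directions.
  have hdat : ∀ y ∈ U, -2 * dirD f (e 0) y + 2 * n * g y
      - 2 * g y * (strC e θ 1 2 0 y + strC e θ 2 0 1 y) = -2 * f y * H ∧
      2 * f y * (strC e θ 1 2 0 y + strC e θ 2 0 1 y) - 2 * n * f y - 2 * dirD g (e 0) y
        = -2 * g y * H ∧
      2 * f y * strC e θ 2 1 2 y - 2 * g y * strC e θ 1 1 2 y + dirD g (e 2) y
        + dirD f (e 1) y = 0 ∧
      2 * f y * strC e θ 1 1 2 y + 2 * g y * strC e θ 2 1 2 y + dirD g (e 1) y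
        - dirD f (e 2) y = 0 := by
    intro y hy
    obtain ⟨-, -, -, -, -, e6, e7, e8, e9, e10, -⟩ := hE y hy
    rw [hDg y hy, hDg y hy, hDg y hy]
    simp only [hDf]
    rw [hf, hg]
    simp only [hDex y hy, ← hex y hy] at e6 e7 e8 e9 e10 ⊢
    refine ⟨?_, ?_, ?_, ?_⟩
    · linear_combination e6 - e7
    · linear_combination e8
    · linear_combination e9
    · linear_combination e10
  -- For `H ≠ 0` the evolution gives `e_0 (f² + g²) = 2 H (f² + g²)`, and the left side is zero. For
  -- `H = 0` the twist `n` vanishes and the obstruction is the curvature of the plane of `e_1` and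
  -- `e_2`.
  by_cases hH : H = 0
  · have hb : b ≠ 0 := fun h => h0 ⟨hH, h⟩
    have hn : n = 0 := by
      obtain ⟨-, -, -, e4, -⟩ := hE x hx
      rw [hH, mul_zero] at e4
      exact (mul_eq_zero.1 e4).resolve_left hb
    by_contra hne
    rw [hfg x hx] at hne
    -- `f dg - g df` turns out to be `2 m` times the rotation connection of `e_1`, `e_2`: an
    -- eigenframe of the shear is parallel for it. Its exterior derivative on `e_1`, `e_2` must then
    -- vanish, although the curvature there is `(4/3) b² + (2/3) Δ²`.
    have hA0 : ∀ y ∈ U, angleForm f g y (e 0 y)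
        = m * (strC e θ 1 2 0 y + strC e θ 2 0 1 y) := by
      intro y hy
      obtain ⟨d1, d2, d3, d4⟩ := hdat y hy
      rw [hn, hH] at d1 d2
      have := hfg y hy
      change f y * dirD g (e 0) y - g y * dirD f (e 0) y = _
      linear_combination (-f y / 2) * d2 + (g y / 2) * d1
        + (strC e θ 1 2 0 y + strC e θ 2 0 1 y) * this
    have hA1 : ∀ y ∈ U, angleForm f g y (e 1 y) = -2 * m * strC e θ 1 1 2 y := by
      intro y hy
      obtain ⟨d1, d2, d3, d4⟩ := hdat y hy
      have := hfg y hy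
      change f y * dirD g (e 1) y - g y * dirD f (e 1) y = _
      linear_combination f y * d4 - g y * d3 + hort y hy 2 - 2 * strC e θ 1 1 2 y * this
    have hA2 : ∀ y ∈ U, angleForm f g y (e 2 y) = -2 * m * strC e θ 2 1 2 y := by
      intro y hy
      obtain ⟨d1, d2, d3, d4⟩ := hdat y hy
      have := hfg y hy
      change f y * dirD g (e 2) y - g y * dirD f (e 2) y = _
      linear_combination f y * d3 + g y * d4 - hort y hy 1 - 2 * strC e θ 2 1 2 y * this
    have hd := dForm_frame hA.frame (contDiffOn_angleForm hU hfs hgs) hx 1 2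
    have hcm : ∀ (c : ℝ) i j k l, dirD (fun y => c * strC e θ i j k y) (e l) x
        = c * strD e θ l i j k x := fun c i j k l =>
      dirD_const_mul c (diffAt_of_contDiffOn hU (hsm i j k) hx)
    have hdet : dirD f (e 1) x * dirD g (e 2) x - dirD f (e 2) x * dirD g (e 1) x = 0 := by
      have o1 := hort x hx 1
      have o2 := hort x hx 2
      have k1 : f x * (dirD f (e 1) x * dirD g (e 2) x - dirD f (e 2) x * dirD g (e 1) x) = 0 := by
        linear_combination dirD g (e 2) x * o1 - dirD g (e 1) x * o2
      have k2 : g x * (dirD f (e 1) x * dirD g (e 2) x - dirD f (e 2) x * dirD g (e 1) x) = 0 := by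
        linear_combination dirD f (e 1) x * o2 - dirD f (e 2) x * o1
      have := hfg x hx
      refine (mul_eq_zero.1 ?_).resolve_left hne
      linear_combination f x * k1 + g x * k2
        - (dirD f (e 1) x * dirD g (e 2) x - dirD f (e 2) x * dirD g (e 1) x) * this
    rw [dForm_angleForm hU hfs hgs hx, dirD_congr hU hA2 hx, dirD_congr hU hA1 hx, hcm, hcm,
      Fin.sum_univ_three, hA0 x hx, hA1 x hx, hA2 x hx, hA.c12 x hx, hn] at hd
    rw [dirD, dirD, dirD, dirD] at hdet
    obtain ⟨-, -, -, -, -, e6, e7, -⟩ := hE x hx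
    rw [hDex x hx, ← hex x hx, hn, hH] at e7
    rw [← hex x hx, hn, hH] at e6
    have hfin : m * (4 / 3 * b ^ 2 + 2 / 3 * Δ ^ 2) = 0 := by
      linear_combination (-m / 2) * (e6 + e7) - hd / 2 + hdet
    have : 0 < 4 / 3 * b ^ 2 + 2 / 3 * Δ ^ 2 := by positivity
    exact hne ((mul_eq_zero.1 hfin).resolve_right this.ne')
  · obtain ⟨d1, d2, -⟩ := hdat x hx
    refine (mul_eq_zero.1 ?_).resolve_left hH
    linear_combination hort x hx 0 + (f x / 2) * d1 + (g x / 2) * d2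

/-- The expansion of a two-form in a frame. -/
lemma dForm_expand (hF : IsFrame U e θ) (α : Euc 3 → Euc 3 →L[ℝ] ℝ) {x : Euc 3} (hx : x ∈ U)
    (X Y : Euc 3) : dForm α x X Y
      = dForm α x (e 0 x) (e 1 x) * (θ 0 x X * θ 1 x Y - θ 0 x Y * θ 1 x X)
      + dForm α x (e 1 x) (e 2 x) * (θ 1 x X * θ 2 x Y - θ 1 x Y * θ 2 x X)
      + dForm α x (e 2 x) (e 0 x) * (θ 2 x X * θ 0 x Y - θ 2 x Y * θ 0 x X) := by
  have hX := hF.expand x hx X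
  have hY := hF.expand x hx Y
  rw [Fin.sum_univ_three] at hX hY
  conv_lhs => rw [← hX, ← hY]
  simp [dForm]
  ring

/-- A frame in which the geometry is a circle bundle over a sphere. -/
structure BundleFrame (U : Set (Euc 3)) (e : Fin 3 → Euc 3 → Euc 3)
    (θ : Fin 3 → Euc 3 → Euc 3 →L[ℝ] ℝ) (τ : Euc 3 → Euc 3 →L[ℝ] ℝ) (c lam : ℝ) : Prop where
  frame : IsFrame U e θ
  τ_smooth : ContDiffOn ℝ ∞ τ U
  d0 : ∀ x ∈ U, ∀ X Y, dForm (θ 0) x X Y = -c * (θ 1 x X * θ 2 x Y - θ 1 x Y * θ 2 x X)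
  d1 : ∀ x ∈ U, ∀ X Y, dForm (θ 1) x X Y = -(τ x X * θ 2 x Y - τ x Y * θ 2 x X)
  d2 : ∀ x ∈ U, ∀ X Y, dForm (θ 2) x X Y = τ x X * θ 1 x Y - τ x Y * θ 1 x X
  dτ : ∀ x ∈ U, ∀ X Y, dForm τ x X Y = lam * (θ 1 x X * θ 2 x Y - θ 1 x Y * θ 2 x X)

/-- An axial frame without expansion and shear is a bundle frame. -/
lemma AxialFrame.bundleFrame (hA : AxialFrame U e θ H b n F Δ)
    (hx1 : ∀ x ∈ U, strC e θ 1 0 1 x = strC e θ 2 2 0 x)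
    (hx2 : ∀ x ∈ U, strC e θ 1 0 1 x = 0 ∧ strC e θ 2 0 1 x = strC e θ 1 2 0 x)
    (hU : U.Nonempty) :
    ∃ τ, BundleFrame U e θ τ (-n) (H ^ 2 / 2 + 2 / 3 * b ^ 2 + 4 / 3 * Δ ^ 2) ∧
      F = H ^ 2 - (H ^ 2 / 2 + 2 / 3 * b ^ 2 + 4 / 3 * Δ ^ 2) ∧ b * n = Δ * H ∧
      n ^ 2 = H ^ 2 - 4 / 3 * b ^ 2 + 4 / 3 * Δ ^ 2 := by
  have hF := hA.frame
  have hE := fun y hy => hA.equations (x := y) hy _ _ _ _ _ _ _ _ _ _ _ _ rfl (neg_neg _).symm rfl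
    (neg_neg _).symm rfl rfl (fun _ => rfl) (fun _ => (neg_neg _).symm) (fun _ => rfl)
    (fun _ => (neg_neg _).symm) (fun _ => rfl) (fun _ => rfl)
  have hsm := fun i j k => contDiffOn_strC hA.frame i j k
  have z1 : ∀ y ∈ U, strC e θ 1 0 1 y = 0 := fun y hy => (hx2 y hy).1
  have z2 : ∀ y ∈ U, strC e θ 2 2 0 y = 0 := fun y hy => by rw [← hx1 y hy, z1 y hy]
  have z3 : ∀ y ∈ U, strC e θ 1 2 0 y = strC e θ 2 0 1 y := fun y hy => (hx2 y hy).2.symm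
  have w1 : ∀ y ∈ U, ∀ l, strD e θ l 1 0 1 y = 0 := fun y hy l => dirD_eqOn hF.isOpen z1 hy
  have w2 : ∀ y ∈ U, ∀ l, strD e θ l 2 2 0 y = 0 := fun y hy l => dirD_eqOn hF.isOpen z2 hy
  have w3 : ∀ y ∈ U, ∀ l, strD e θ l 1 2 0 y = strD e θ l 2 0 1 y :=
    fun y hy l => dirD_congr hF.isOpen z3 hy
  have hE' : ∀ y ∈ U, _ := fun y hy => by
    have := hE y hy
    rw [z1 y hy, z2 y hy, z3 y hy] at this
    simp only [w1 y hy, w2 y hy, w3 y hy] at this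
    exact this
  -- The connection form of the rotations of `θ^1`, `θ^2`. Its `θ^0` component allows this pair to
  -- turn along the axis.
  set τ : Euc 3 → Euc 3 →L[ℝ] ℝ := fun y => strC e θ 2 0 1 y • θ 0 y
    - strC e θ 1 1 2 y • θ 1 y - strC e θ 2 1 2 y • θ 2 y with hτ
  have hτs : ContDiffOn ℝ ∞ τ U := (((hsm 2 0 1).smul (hF.θ_smooth 0)).sub
    ((hsm 1 1 2).smul (hF.θ_smooth 1))).sub ((hsm 2 1 2).smul (hF.θ_smooth 2))
  have o0 : ∀ y ∈ U, τ y (e 0 y) = strC e θ 2 0 1 y := fun y hy => by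
    simp [hτ, hF.dual y hy]
  have o1 : ∀ y ∈ U, τ y (e 1 y) = -strC e θ 1 1 2 y := fun y hy => by
    simp [hτ, hF.dual y hy]
  have o2 : ∀ y ∈ U, τ y (e 2 y) = -strC e θ 2 1 2 y := fun y hy => by
    simp [hτ, hF.dual y hy]
  have hneg : ∀ i j k l y, dirD (fun y => -strC e θ i j k y) (e l) y = -strD e θ l i j k y := by
    intro i j k l y
    simp [strD, dirD]
  have s0 := fun i j x => strC_self (e := e) (θ := θ) i j x
  have s1 := fun i x => congrFun (strC_swap (e := e) (θ := θ) i 1 0) x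
  have s2 := fun i x => congrFun (strC_swap (e := e) (θ := θ) i 2 1) x
  have s3 := fun i x => congrFun (strC_swap (e := e) (θ := θ) i 0 2) x
  obtain ⟨x0, hx0⟩ := hU
  refine ⟨τ, ⟨hF, hτs, ?_, ?_, ?_, ?_⟩, ?_, ?_, ?_⟩
  · intro x hx X Y
    rw [dForm_expand hF _ hx]
    have c0 := hA.c01 x hx
    have c1 := hA.c12 x hx
    have c2 := hA.c20 x hx
    rw [strC] at c0 c1 c2
    rw [c0, c1, c2]
    ring
  · intro x hx X Y
    rw [dForm_expand hF _ hx]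
    have c0 := z1 x hx
    have c2 := z3 x hx
    rw [strC] at c0 c2
    rw [c0, c2, hτ, strC]
    simp [strC]
    ring
  · intro x hx X Y
    rw [dForm_expand hF _ hx]
    have c2 := z2 x hx
    rw [strC] at c2
    rw [c2, hτ]
    simp [strC]
    ring
  · intro x hx X Y
    obtain ⟨-, -, -, -, e5, e6, -, -, -, -, e11, e12⟩ := hE' x hx
    have c0 := hA.c01 x hx
    have c1 := hA.c12 x hx
    have c2 := hA.c20 x hx
    rw [dForm_expand hF _ hx, dForm_frame hF hτs hx, dForm_frame hF hτs hx,
      dForm_frame hF hτs hx]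
    simp only [dirD_congr hF.isOpen o0 hx, dirD_congr hF.isOpen o1 hx,
      dirD_congr hF.isOpen o2 hx, hneg, Fin.sum_univ_three, o0 x hx, o1 x hx, o2 x hx, c0, c1, c2,
      z1 x hx, z2 x hx, z3 x hx]
    have f0 : dirD (strC e θ 2 0 1) (e 1) x = strD e θ 1 2 0 1 x := rfl
    have f1 : dirD (strC e θ 2 0 1) (e 2) x = strD e θ 2 2 0 1 x := rfl
    rw [f0, f1]
    -- `e5 + e6` gives the curvature of the base, while `e11` and `e12` say that `dτ` has no
    -- component along the axis.
    linear_combination (θ 1 x X * θ 2 x Y - θ 1 x Y * θ 2 x X) * (e6 + e5)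
      - (θ 0 x X * θ 1 x Y - θ 0 x Y * θ 1 x X) * e12
      - (θ 2 x X * θ 0 x Y - θ 2 x Y * θ 0 x X) * e11
  · obtain ⟨-, -, e3, -⟩ := hE' x0 hx0
    linear_combination e3
  · exact (hE' x0 hx0).2.2.2.1
  · obtain ⟨-, -, -, -, e5, -⟩ := hE' x0 hx0
    linear_combination 2 * e5

/-- Exchange of the second and third frame vector. -/
lemma BundleFrame.swap {τ : Euc 3 → Euc 3 →L[ℝ] ℝ} {c lam : ℝ}
    (hB : BundleFrame U e θ τ c lam) :
    BundleFrame U ![e 0, e 2, e 1] ![θ 0, θ 2, θ 1] (fun x => -τ x) (-c) lam where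
  frame :=
    { isOpen := hB.frame.isOpen
      e_smooth := by
        intro i; fin_cases i
        exacts [hB.frame.e_smooth 0, hB.frame.e_smooth 2, hB.frame.e_smooth 1]
      θ_smooth := by
        intro i; fin_cases i
        exacts [hB.frame.θ_smooth 0, hB.frame.θ_smooth 2, hB.frame.θ_smooth 1]
      dual := by
        intro x hx i j
        have := hB.frame.dual x hx
        fin_cases i <;> fin_cases j <;> simp [this]
      expand := by
        intro x hx X
        refine Eq.trans ?_ (hB.frame.expand x hx X)
        simp [Fin.sum_univ_three]
        abel }
  τ_smooth := hB.τ_smooth.neg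
  d0 := fun x hx X Y => by
    have := hB.d0 x hx X Y
    simp
    rw [this]; ring
  d1 := fun x hx X Y => by
    have := hB.d2 x hx X Y
    simp
    rw [this]; ring
  d2 := fun x hx X Y => by
    have := hB.d1 x hx X Y
    simp
    rw [this]; ring
  dτ := fun x hx X Y => by
    have h1 : dForm (fun x => -τ x) x X Y = -dForm τ x X Y := by
      simp only [dForm, fderiv_fun_neg, _root_.neg_apply]
      ring
    rw [h1, hB.dτ x hx X Y]
    simp
    ring

end

/-! ### Adapted frames -/

/-- A smooth Riemannian metric on an open set of `ℝ³`. -/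
structure IsRiem (U : Set (Euc 3)) (γ : Euc 3 → Euc 3 →L[ℝ] Euc 3 →L[ℝ] ℝ) : Prop where
  isOpen : IsOpen U
  smooth : ContDiffOn ℝ ∞ γ U
  symm : ∀ x ∈ U, ∀ X Y, γ x X Y = γ x Y X
  pos : ∀ x ∈ U, ∀ X, X ≠ 0 → 0 < γ x X X

section

variable {U V : Set (Euc 3)} {e : Fin 3 → Euc 3 → Euc 3} {θ : Fin 3 → Euc 3 → Euc 3 →L[ℝ] ℝ}
  {γ : Euc 3 → Euc 3 →L[ℝ] Euc 3 →L[ℝ] ℝ}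

lemma IsRiem.mono (hγ : IsRiem U γ) (hV : IsOpen V) (hVU : V ⊆ U) : IsRiem V γ :=
  ⟨hV, hγ.smooth.mono hVU, fun x hx => hγ.symm x (hVU hx), fun x hx => hγ.pos x (hVU hx)⟩

lemma IsFrame.mono (hF : IsFrame U e θ) (hV : IsOpen V) (hVU : V ⊆ U) : IsFrame V e θ :=
  ⟨hV, fun i => (hF.e_smooth i).mono hVU, fun i => (hF.θ_smooth i).mono hVU,
    fun x hx => hF.dual x (hVU hx), fun x hx => hF.expand x (hVU hx)⟩

lemma IsRiem.normalize (hγ : IsRiem U γ) {X : Euc 3 → Euc 3} (hX : ContDiffOn ℝ ∞ X U)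
    (h0 : ∀ x ∈ U, X x ≠ 0) : ∃ u : Euc 3 → Euc 3, ContDiffOn ℝ ∞ u U ∧
      ∃ a : Euc 3 → ℝ, (∀ x ∈ U, 0 < a x) ∧ (∀ x ∈ U, X x = a x • u x) ∧
        ∀ x ∈ U, γ x (u x) (u x) = 1 := by
  have hs : ContDiffOn ℝ ∞ (fun x => γ x (X x) (X x)) U := (hγ.smooth.clm_apply hX).clm_apply hX
  have hp : ∀ x ∈ U, 0 < γ x (X x) (X x) := fun x hx => hγ.pos x hx _ (h0 x hx)
  have hq : ∀ x ∈ U, 0 < √(γ x (X x) (X x)) := fun x hx => Real.sqrt_pos.2 (hp x hx)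
  refine ⟨fun x => (√(γ x (X x) (X x)))⁻¹ • X x,
    ((hs.sqrt fun x hx => (hp x hx).ne').inv fun x hx => (hq x hx).ne').smul hX,
    fun x => √(γ x (X x) (X x)), hq, fun x hx => ?_, fun x hx => ?_⟩
  · rw [smul_smul, mul_inv_cancel₀ (hq x hx).ne', one_smul]
  · have := Real.mul_self_sqrt (hp x hx).le
    have h2 := (hq x hx).ne'
    simp only [map_smul, _root_.smul_apply, smul_eq_mul]
    field_simp
    rw [sq, this]

/-- Three orthonormal vector fields form a frame. -/
lemma IsRiem.isFrame (hγ : IsRiem U γ) (he : ∀ i, ContDiffOn ℝ ∞ (e i) U)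
    (ho : ∀ x ∈ U, ∀ i j, γ x (e i x) (e j x) = if i = j then 1 else 0) :
    IsFrame U e (fun i x => γ x (e i x)) ∧
      ∀ x ∈ U, ∀ X Y, γ x X Y = ∑ i, γ x (e i x) X * γ x (e i x) Y := by
  have hexp : ∀ x ∈ U, ∀ X, ∑ i, γ x (e i x) X • e i x = X := by
    intro x hx X
    have h1 : thM (fun i x => γ x (e i x)) x * eM e x = 1 := by
      ext a b
      have := ho x hx a b
      rw [clm_eq_sum_coord] at this
      simp only [Matrix.mul_apply, thM, eM, Matrix.of_apply, Matrix.one_apply]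
      rw [← this]
      exact Finset.sum_congr rfl fun i _ => by simp [mul_comm]
    -- Orthonormality is a one-sided inverse; for square matrices it is two-sided, so the vectors
    -- span.
    have h2 := mul_eq_one_comm.1 h1
    ext j
    have h3 := congrFun (congrArg (fun M : Matrix (Fin 3) (Fin 3) ℝ => M.mulVec X) h2) j
    simp only [Matrix.one_mulVec, ← Matrix.mulVec_mulVec] at h3
    rw [← h3]
    simp only [Matrix.mulVec, dotProduct, eM, thM, Matrix.of_apply]
    simp only [WithLp.ofLp_sum, Finset.sum_apply, WithLp.ofLp_smul, Pi.smul_apply, smul_eq_mul]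
    refine Finset.sum_congr rfl fun i _ => ?_
    rw [mul_comm, clm_eq_sum_coord (γ x (e i x)) X]
    congr 1
    exact Finset.sum_congr rfl fun i _ => by simp [mul_comm]
  refine ⟨⟨hγ.isOpen, he, fun i => hγ.smooth.clm_apply (he i), ho, hexp⟩, fun x hx X Y => ?_⟩
  conv_lhs => rw [← hexp x hx X]
  simp

/-- Gram–Schmidt orthonormalization of vector fields. -/
lemma IsRiem.gramSchmidt (hγ : IsRiem U γ) {X : Fin 3 → Euc 3 → Euc 3}
    (hX : ∀ i, ContDiffOn ℝ ∞ (X i) U) (hl : ∀ x ∈ U, LinearIndependent ℝ fun i => X i x) :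
    ∃ e : Fin 3 → Euc 3 → Euc 3, IsFrame U e (fun i x => γ x (e i x)) ∧
      (∀ x ∈ U, ∀ X Y, γ x X Y = ∑ i, γ x (e i x) X * γ x (e i x) Y) ∧
      (∃ a : Euc 3 → ℝ, (∀ x ∈ U, 0 < a x) ∧ ∀ x ∈ U, X 0 x = a x • e 0 x) ∧
      ∃ b c : Euc 3 → ℝ, (∀ x ∈ U, 0 < c x) ∧ ∀ x ∈ U, X 1 x = b x • e 0 x + c x • e 1 x := by
  have hl' : ∀ x ∈ U, ∀ r : Fin 3 → ℝ, r 0 • X 0 x + r 1 • X 1 x + r 2 • X 2 x = 0 →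
      r = 0 := by
    intro x hx r hr
    have := Fintype.linearIndependent_iff.1 (hl x hx) r (by rw [Fin.sum_univ_three]; exact hr)
    exact funext this
  obtain ⟨u, hu, a, ha, hau, huu⟩ := hγ.normalize (hX 0) fun x hx h => by
    have := congrFun (hl' x hx ![1, 0, 0] (by simp [h])) 0
    simp at this
  have hXu := fun x hx => hau x hx
  have hui : ∀ x ∈ U, u x = (a x)⁻¹ • X 0 x := fun x hx => by
    rw [hau x hx, smul_smul, inv_mul_cancel₀ (ha x hx).ne', one_smul]
  have hY : ContDiffOn ℝ ∞ (fun x => X 1 x - γ x (u x) (X 1 x) • u x) U :=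
    (hX 1).sub (((hγ.smooth.clm_apply hu).clm_apply (hX 1)).smul hu)
  obtain ⟨v, hv, c, hc, hcv, hvv⟩ := hγ.normalize hY fun x hx h => by
    rw [hui x hx] at h
    have := congrFun (hl' x hx ![-(γ x ((a x)⁻¹ • X 0 x) (X 1 x) * (a x)⁻¹), 1, 0] (by
      simp only [Matrix.cons_val, zero_smul, add_zero, one_smul]
      rw [← h]; module)) 1
    simp at this
  have hvi : ∀ x ∈ U, v x = (c x)⁻¹ • (X 1 x - γ x (u x) (X 1 x) • u x) := fun x hx => by
    rw [hcv x hx, smul_smul, inv_mul_cancel₀ (hc x hx).ne', one_smul]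
  have huv : ∀ x ∈ U, γ x (u x) (v x) = 0 := fun x hx => by
    rw [hvi x hx]
    simp [huu x hx]
  have hZ : ContDiffOn ℝ ∞ (fun x => X 2 x - γ x (u x) (X 2 x) • u x - γ x (v x) (X 2 x) • v x) U :=
    ((hX 2).sub (((hγ.smooth.clm_apply hu).clm_apply (hX 2)).smul hu)).sub
      (((hγ.smooth.clm_apply hv).clm_apply (hX 2)).smul hv)
  obtain ⟨w, hw, d, hd, hdw, hww⟩ := hγ.normalize hZ fun x hx h => by
    obtain ⟨s, hs⟩ : ∃ s, s = γ x (u x) (X 2 x) := ⟨_, rfl⟩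
    obtain ⟨t, ht⟩ : ∃ s, s = γ x (v x) (X 2 x) := ⟨_, rfl⟩
    obtain ⟨k, hk⟩ : ∃ s, s = γ x (u x) (X 1 x) := ⟨_, rfl⟩
    rw [← hs, ← ht, hvi x hx, ← hk, hui x hx] at h
    have := congrFun (hl' x hx ![-s * (a x)⁻¹ + t * (c x)⁻¹ * k * (a x)⁻¹, -t * (c x)⁻¹, 1] (by
      simp only [Matrix.cons_val, one_smul]
      rw [← h]; module)) 2
    simp at this
  have hwi : ∀ x ∈ U, w x = (d x)⁻¹ • (X 2 x - γ x (u x) (X 2 x) • u x - γ x (v x) (X 2 x) • v x) :=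
    fun x hx => by rw [hdw x hx, smul_smul, inv_mul_cancel₀ (hd x hx).ne', one_smul]
  have huw : ∀ x ∈ U, γ x (u x) (w x) = 0 := fun x hx => by
    rw [hwi x hx]
    simp [huu x hx, huv x hx]
  have hvu : ∀ x ∈ U, γ x (v x) (u x) = 0 := fun x hx => by rw [hγ.symm x hx, huv x hx]
  have hvw : ∀ x ∈ U, γ x (v x) (w x) = 0 := fun x hx => by
    rw [hwi x hx]
    simp [hvv x hx, hvu x hx]
  have hwu : ∀ x ∈ U, γ x (w x) (u x) = 0 := fun x hx => by rw [hγ.symm x hx, huw x hx]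
  have hwv : ∀ x ∈ U, γ x (w x) (v x) = 0 := fun x hx => by rw [hγ.symm x hx, hvw x hx]
  obtain ⟨h1, h2⟩ := hγ.isFrame (e := ![u, v, w]) (by intro i; fin_cases i; exacts [hu, hv, hw])
    (by
      intro x hx i j
      fin_cases i <;> fin_cases j <;>
        simp [huu x hx, huv x hx, huw x hx, hvu x hx, hvv x hx, hvw x hx, hwu x hx, hwv x hx,
          hww x hx])
  refine ⟨![u, v, w], h1, h2, ⟨a, ha, hau⟩, fun x => γ x (u x) (X 1 x), c, hc, fun x hx => ?_⟩
  simp [← hcv x hx]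

/-- A frame near a point, adapted to two vector fields. -/
lemma IsRiem.exists_frame₂ (hγ : IsRiem U γ) {X Y : Euc 3 → Euc 3} (hX : ContDiffOn ℝ ∞ X U)
    (hY : ContDiffOn ℝ ∞ Y U) {p : Euc 3} (hp : p ∈ U) (hl : LinearIndependent ℝ ![X p, Y p]) :
    ∃ V ⊆ U, IsOpen V ∧ p ∈ V ∧ IsPreconnected V ∧ ∃ e : Fin 3 → Euc 3 → Euc 3,
      IsFrame V e (fun i x => γ x (e i x)) ∧
      (∀ x ∈ V, ∀ X Y, γ x X Y = ∑ i, γ x (e i x) X * γ x (e i x) Y) ∧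
      (∃ a : Euc 3 → ℝ, (∀ x ∈ V, 0 < a x) ∧ ∀ x ∈ V, X x = a x • e 0 x) ∧
      ∃ b c : Euc 3 → ℝ, (∀ x ∈ V, 0 < c x) ∧ ∀ x ∈ V, Y x = b x • e 0 x + c x • e 1 x := by
  obtain ⟨z, hz⟩ := exists_linearIndependent_cons_of_lt_finrank hl (by simp)
  set W : Fin 3 → Euc 3 → Euc 3 := ![X, Y, fun _ => z] with hW
  have hWs : ∀ i, ContDiffOn ℝ ∞ (W i) U := by
    intro i; fin_cases i
    exacts [hX, hY, contDiffOn_const]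
  have hWl : LinearIndependent ℝ fun i => W i p := by
    have h1 := hz.comp (![1, 2, 0] : Fin 3 → Fin 3) (by decide)
    have h2 : (fun i => W i p) = (Fin.cons z ![X p, Y p] : Fin 3 → Euc 3) ∘ ![1, 2, 0] := by
      funext i
      fin_cases i <;> rfl
    rw [h2]
    exact h1
  have hc : ContinuousAt (fun x => fun i => W i x) p :=
    continuousAt_pi.2 fun i => ((hWs i).contDiffAt (hγ.isOpen.mem_nhds hp)).continuousAt
  have hev := hc.eventually (isOpen_setOfPred_linearIndependent.mem_nhds hWl)
  obtain ⟨r, hr, hball⟩ := Metric.mem_nhds_iff.1 (Filter.inter_mem (hγ.isOpen.mem_nhds hp) hev)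
  have hsub : Metric.ball p r ⊆ U := fun x hx => (hball hx).1
  obtain ⟨e, h1, h2, h3, h4⟩ := (hγ.mono Metric.isOpen_ball hsub).gramSchmidt
    (fun i => (hWs i).mono hsub) (fun x hx => (hball hx).2)
  exact ⟨Metric.ball p r, hsub, Metric.isOpen_ball, Metric.mem_ball_self hr,
    (convex_ball p r).isPreconnected, e, h1, h2, h3, h4⟩

/-- A frame near a point, adapted to a vector field. -/
lemma IsRiem.exists_frame₁ (hγ : IsRiem U γ) {X : Euc 3 → Euc 3} (hX : ContDiffOn ℝ ∞ X U)
    {p : Euc 3} (hp : p ∈ U) (h0 : X p ≠ 0) :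
    ∃ V ⊆ U, IsOpen V ∧ p ∈ V ∧ IsPreconnected V ∧ ∃ e : Fin 3 → Euc 3 → Euc 3,
      IsFrame V e (fun i x => γ x (e i x)) ∧
      (∀ x ∈ V, ∀ X Y, γ x X Y = ∑ i, γ x (e i x) X * γ x (e i x) Y) ∧
      ∃ a : Euc 3 → ℝ, (∀ x ∈ V, 0 < a x) ∧ ∀ x ∈ V, X x = a x • e 0 x := by
  have h1 : LinearIndependent ℝ ![X p] := by
    rw [linearIndependent_unique_iff]
    simpa using h0
  obtain ⟨z, hz⟩ := exists_linearIndependent_cons_of_lt_finrank h1 (by simp)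
  have h2 : LinearIndependent ℝ ![X p, z] := by
    have h1 := hz.comp (![1, 0] : Fin 2 → Fin 2) (by decide)
    have h2 : ![X p, z] = (Fin.cons z ![X p] : Fin 2 → Euc 3) ∘ ![1, 0] := by
      funext i
      fin_cases i <;> rfl
    rw [h2]
    exact h1
  obtain ⟨V, h3, h4, h5, h6, e, h7, h8, h9, -⟩ :=
    hγ.exists_frame₂ hX (contDiffOn_const (c := z)) hp h2
  exact ⟨V, h3, h4, h5, h6, e, h7, h8, h9⟩

end

/-! ### Local homogeneity -/

/-- A smooth map of an open part `V` of `U` to `U` that preserves `γ`, `h` and `B`. -/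
structure LocalSym (U V : Set (Euc 3)) (γ : Euc 3 → Euc 3 →L[ℝ] Euc 3 →L[ℝ] ℝ)
    (h : Euc 3 → Euc 3 →L[ℝ] ℝ) (B : Euc 3 → Euc 3 →L[ℝ] Euc 3 →L[ℝ] ℝ)
    (φ : Euc 3 → Euc 3) : Prop where
  isOpen : IsOpen V
  subset : V ⊆ U
  maps : Set.MapsTo φ V U
  smooth : ContDiffOn ℝ ∞ φ V
  γ_inv : ∀ y ∈ V, ∀ X Y, γ (φ y) (fderiv ℝ φ y X) (fderiv ℝ φ y Y) = γ y X Y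
  h_inv : ∀ y ∈ V, ∀ X, h (φ y) (fderiv ℝ φ y X) = h y X
  B_inv : ∀ y ∈ V, ∀ X Y, B (φ y) (fderiv ℝ φ y X) (fderiv ℝ φ y Y) = B y X Y

/-- Any two points are related by a local symmetry. -/
def LocallyHomogeneous (U : Set (Euc 3)) (γ : Euc 3 → Euc 3 →L[ℝ] Euc 3 →L[ℝ] ℝ)
    (h : Euc 3 → Euc 3 →L[ℝ] ℝ) (B : Euc 3 → Euc 3 →L[ℝ] Euc 3 →L[ℝ] ℝ) : Prop :=
  ∀ p ∈ U, ∀ q ∈ U, ∃ V φ, p ∈ V ∧ φ p = q ∧ LocalSym U V γ h B φ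

/-- The exterior derivative commutes with pull-backs. -/
lemma dForm_pullback {n m : ℕ} {U : Set (Euc m)} {V : Set (Euc n)} (hU : IsOpen U) (hV : IsOpen V)
    {α : Euc m → Euc m →L[ℝ] ℝ}
    {β : Euc n → Euc n →L[ℝ] ℝ} (hα : ContDiffOn ℝ ∞ α U) (hβ : ContDiffOn ℝ ∞ β V)
    {φ : Euc n → Euc m}
    (hφ : ContDiffOn ℝ ∞ φ V) (hm : Set.MapsTo φ V U)
    (h : ∀ y ∈ V, ∀ X, α (φ y) (fderiv ℝ φ y X) = β y X) {y : Euc n} (hy : y ∈ V) (X Y : Euc n) :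
    dForm α (φ y) (fderiv ℝ φ y X) (fderiv ℝ φ y Y) = dForm β y X Y := by
  have hs : ∀ X Y, fderiv ℝ (fderiv ℝ φ) y X Y = fderiv ℝ (fderiv ℝ φ) y Y X := by
    intro X Y
    have : IsSymmSndFDerivAt ℝ φ y := (hφ.contDiffAt (hV.mem_nhds hy)).isSymmSndFDerivAt
      (by simpa using WithTop.coe_le_coe.2 (le_top : (2 : ℕ∞) ≤ ⊤))
    exact this X Y
  have hφd := (diffAt_of_contDiffOn hV hφ hy).hasFDerivAt
  have hφ2 := (diffAt_of_contDiffOn hV (contDiffOn_fderiv hV hφ) hy).hasFDerivAt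
  have hαd := (diffAt_of_contDiffOn hU hα (hm hy)).hasFDerivAt
  have hβd := (diffAt_of_contDiffOn hV hβ hy).hasFDerivAt
  -- The second derivative of `φ` appears symmetrically and cancels on antisymmetrization.
  have key : ∀ X Y, fderiv ℝ β y X Y = fderiv ℝ α (φ y) (fderiv ℝ φ y X) (fderiv ℝ φ y Y)
      + α (φ y) (fderiv ℝ (fderiv ℝ φ) y X Y) := by
    intro X Y
    have h1 := (hαd.comp y hφd).clm_apply (hφ2.clm_apply (hasFDerivAt_const Y y))
    have h2 := hβd.clm_apply (hasFDerivAt_const Y y)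
    have h3 : (fun z => β z Y) =ᶠ[nhds y] fun z => (α ∘ φ) z (fderiv ℝ φ z Y) :=
      Filter.eventuallyEq_of_mem (hV.mem_nhds hy) fun z hz => (h z hz Y).symm
    have h4 := congrArg (fun L => L X) ((h2.congr_of_eventuallyEq h3.symm).unique h1)
    simpa [add_comm] using h4
  rw [dForm, dForm, key, key, hs Y X]
  ring

/-! ### Tensors invariant under local symmetries, and their norms. -/

section

variable {U V : Set (Euc 3)} {e : Fin 3 → Euc 3 → Euc 3} {θ : Fin 3 → Euc 3 → Euc 3 →L[ℝ] ℝ}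
  {γ : Euc 3 → Euc 3 →L[ℝ] Euc 3 →L[ℝ] ℝ} {h : Euc 3 → Euc 3 →L[ℝ] ℝ}
  {B T : Euc 3 → Euc 3 →L[ℝ] Euc 3 →L[ℝ] ℝ} {φ : Euc 3 → Euc 3} {F Δ : ℝ}

/-- Parseval's identity. -/
lemma IsFrame.sum_mul (hF : IsFrame U e θ) {x : Euc 3} (hx : x ∈ U) {f : Fin 3 → Euc 3}
    (hf : ∀ i j, ∑ k, θ k x (f i) * θ k x (f j) = if i = j then 1 else 0) (L M : Euc 3 →L[ℝ] ℝ) :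
    ∑ i, L (f i) * M (f i) = ∑ i, L (e i x) * M (e i x) := by
  set O : Matrix (Fin 3) (Fin 3) ℝ := Matrix.of fun i k => θ k x (f i) with hO
  have h1 : O * O.transpose = 1 := by
    ext i j
    rw [Matrix.one_apply, ← hf i j]
    simp [Matrix.mul_apply, hO]
  have h2 : O.transpose * O = 1 := mul_eq_one_comm.1 h1
  have h3 : ∀ (L : Euc 3 →L[ℝ] ℝ) i, L (f i) = O.mulVec (fun k => L (e k x)) i := by
    intro L i
    conv_lhs => rw [← hF.expand x hx (f i)]
    simp [Matrix.mulVec, dotProduct, hO]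
  have h4 : ∑ i, L (f i) * M (f i)
      = O.mulVec (fun k => L (e k x)) ⬝ᵥ O.mulVec (fun k => M (e k x)) := by
    simp only [h3, dotProduct]
  rw [h4, Matrix.dotProduct_mulVec, Matrix.vecMul_mulVec, h2, Matrix.vecMul_one]
  rfl

/-- The two-tensor `T` is preserved by the local symmetries. -/
def InvTensor (U : Set (Euc 3)) (γ : Euc 3 → Euc 3 →L[ℝ] Euc 3 →L[ℝ] ℝ)
    (h : Euc 3 → Euc 3 →L[ℝ] ℝ) (B T : Euc 3 → Euc 3 →L[ℝ] Euc 3 →L[ℝ] ℝ) : Prop :=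
  ∀ V φ, LocalSym U V γ h B φ → ∀ y ∈ V, ∀ X Y,
    T (φ y) (fderiv ℝ φ y X) (fderiv ℝ φ y Y) = T y X Y

/-- The exterior derivative as a field of bilinear forms. -/
def extD (h : Euc 3 → Euc 3 →L[ℝ] ℝ) (x : Euc 3) : Euc 3 →L[ℝ] Euc 3 →L[ℝ] ℝ :=
  fderiv ℝ h x - (fderiv ℝ h x).flip

lemma extD_apply (x X Y : Euc 3) : extD h x X Y = dForm h x X Y := by
  simp [extD, dForm]

lemma contDiffOn_extD (hU : IsOpen U) (hh : ContDiffOn ℝ ∞ h U) :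
    ContDiffOn ℝ ∞ (extD h) U :=
  contDiffOn_clm_apply.2 fun _ => contDiffOn_clm_apply.2 fun _ =>
    (((contDiffOn_fderiv hU hh).clm_apply contDiffOn_const).clm_apply contDiffOn_const).sub
      (((contDiffOn_fderiv hU hh).clm_apply contDiffOn_const).clm_apply contDiffOn_const)

lemma invTensor_extD (hU : IsOpen U) (hh : ContDiffOn ℝ ∞ h U) :
    InvTensor U γ h B (extD h) := by
  intro V φ hS y hy X Y
  rw [extD_apply, extD_apply]
  exact dForm_pullback hU hS.isOpen hh (hh.mono hS.subset) hS.smooth hS.maps hS.h_inv hy X Y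

lemma invTensor_self : InvTensor U γ h B B := fun _ _ hS => hS.B_inv

/-- The contraction of `T` with `h`. -/
def contr (e : Fin 3 → Euc 3 → Euc 3) (h : Euc 3 → Euc 3 →L[ℝ] ℝ)
    (T : Euc 3 → Euc 3 →L[ℝ] Euc 3 →L[ℝ] ℝ) (x : Euc 3) : Euc 3 →L[ℝ] ℝ :=
  ∑ i, h x (e i x) • T x (e i x)

/-- The vector field dual to a one-form. -/
def sharp (e : Fin 3 → Euc 3 → Euc 3) (α : Euc 3 → Euc 3 →L[ℝ] ℝ) (x : Euc 3) : Euc 3 :=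
  ∑ i, α x (e i x) • e i x

lemma contDiffOn_contr (hF : IsFrame U e θ) (hh : ContDiffOn ℝ ∞ h U) (hT : ContDiffOn ℝ ∞ T U) :
    ContDiffOn ℝ ∞ (contr e h T) U :=
  ContDiffOn.sum fun i _ => (hh.clm_apply (hF.e_smooth i)).smul (hT.clm_apply (hF.e_smooth i))

lemma contDiffOn_sharp (hF : IsFrame U e θ) (hh : ContDiffOn ℝ ∞ h U) :
    ContDiffOn ℝ ∞ (sharp e h) U :=
  ContDiffOn.sum fun i _ => (hh.clm_apply (hF.e_smooth i)).smul (hF.e_smooth i)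

lemma contr_apply (x X : Euc 3) : contr e h T x X = T x (sharp e h x) X := by
  simp [contr, sharp]

lemma metric_sharp (hF : IsFrame U e θ) (hγ : ∀ x ∈ U, ∀ X Y, γ x X Y = ∑ i, θ i x X * θ i x Y)
    {x : Euc 3} (hx : x ∈ U) (X : Euc 3) : γ x (sharp e h x) X = h x X := by
  rw [hγ x hx]
  conv_rhs => rw [← hF.expand x hx X]
  simp [sharp, hF.dual x hx]
  exact Finset.sum_congr rfl fun i _ => mul_comm _ _

lemma apply_sharp {α : Euc 3 → Euc 3 →L[ℝ] ℝ} (x : Euc 3) :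
    α x (sharp e h x) = ∑ i, h x (e i x) * α x (e i x) := by
  simp [sharp]

/-- The image of an orthonormal frame under a local symmetry is orthonormal. -/
lemma LocalSym.orthonormal (hS : LocalSym U V γ h B φ) (hF : IsFrame U e θ)
    (hγ : ∀ x ∈ U, ∀ X Y, γ x X Y = ∑ i, θ i x X * θ i x Y) {y : Euc 3} (hy : y ∈ V) (i j : Fin 3) :
    ∑ k, θ k (φ y) (fderiv ℝ φ y (e i y)) * θ k (φ y) (fderiv ℝ φ y (e j y))
      = if i = j then 1 else 0 := by
  rw [← hγ _ (hS.maps hy), hS.γ_inv y hy, hγ y (hS.subset hy)]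
  simp [hF.dual y (hS.subset hy), Fin.sum_univ_three]
  fin_cases i <;> fin_cases j <;> simp

/-- The contraction does not depend on the orthonormal frame: by Parseval it can be computed at the
image point in the image of the frame. -/
lemma LocalSym.contr_inv (hS : LocalSym U V γ h B φ) (hF : IsFrame U e θ)
    (hγ : ∀ x ∈ U, ∀ X Y, γ x X Y = ∑ i, θ i x X * θ i x Y) (hT : InvTensor U γ h B T) {y : Euc 3}
    (hy : y ∈ V) (X : Euc 3) : contr e h T (φ y) (fderiv ℝ φ y X) = contr e h T y X := by
  have h1 := hF.sum_mul (hS.maps hy) (hS.orthonormal hF hγ hy) (h (φ y))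
    ((T (φ y)).flip (fderiv ℝ φ y X))
  simp only [ContinuousLinearMap.flip_apply, hS.h_inv y hy, hT V φ hS y hy] at h1
  simp [contr, ← h1]

/-- The norm of an invariant one-form is constant. -/
lemma LocalSym.normSq_inv (hS : LocalSym U V γ h B φ) (hF : IsFrame U e θ)
    (hγ : ∀ x ∈ U, ∀ X Y, γ x X Y = ∑ i, θ i x X * θ i x Y) {α : Euc 3 → Euc 3 →L[ℝ] ℝ}
    {y : Euc 3} (hy : y ∈ V) (hα : ∀ X, α (φ y) (fderiv ℝ φ y X) = α y X) :
    ∑ i, α (φ y) (e i (φ y)) ^ 2 = ∑ i, α y (e i y) ^ 2 := by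
  have h1 := hF.sum_mul (hS.maps hy) (hS.orthonormal hF hγ hy) (α (φ y)) (α (φ y))
  simp only [hα] at h1
  simp only [sq, ← h1]

/-- The norm of an invariant tensor is constant. -/
lemma LocalSym.normSq_tensor_inv (hS : LocalSym U V γ h B φ) (hF : IsFrame U e θ)
    (hγ : ∀ x ∈ U, ∀ X Y, γ x X Y = ∑ i, θ i x X * θ i x Y) (hT : InvTensor U γ h B T)
    {y : Euc 3} (hy : y ∈ V) :
    ∑ i, ∑ j, T (φ y) (e i (φ y)) (e j (φ y)) ^ 2 = ∑ i, ∑ j, T y (e i y) (e j y) ^ 2 := by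
  have ho := hS.orthonormal hF hγ hy
  calc ∑ i, ∑ j, T (φ y) (e i (φ y)) (e j (φ y)) ^ 2
      = ∑ i, ∑ j, T (φ y) (e i (φ y)) (fderiv ℝ φ y (e j y)) ^ 2 := by
        refine Finset.sum_congr rfl fun i _ => ?_
        have := hF.sum_mul (hS.maps hy) ho (T (φ y) (e i (φ y))) (T (φ y) (e i (φ y)))
        simp only [sq, this]
    _ = ∑ j, ∑ i, T (φ y) (e i (φ y)) (fderiv ℝ φ y (e j y)) ^ 2 := Finset.sum_comm
    _ = ∑ j, ∑ i, T (φ y) (fderiv ℝ φ y (e i y)) (fderiv ℝ φ y (e j y)) ^ 2 := by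
        refine Finset.sum_congr rfl fun j _ => ?_
        have := hF.sum_mul (hS.maps hy) ho ((T (φ y)).flip (fderiv ℝ φ y (e j y)))
          ((T (φ y)).flip (fderiv ℝ φ y (e j y)))
        simp only [ContinuousLinearMap.flip_apply] at this
        simp only [sq, this]
    _ = ∑ j, ∑ i, T y (e i y) (e j y) ^ 2 := by
        simp only [hT V φ hS y hy]
    _ = _ := Finset.sum_comm

/-- A continuous function with constant square cannot change sign on a connected set. This removes
the sign ambiguities left by symmetries that preserve a frame only up to signs. -/
lemma eq_of_sq_eq (hV : IsPreconnected V) {f : Euc 3 → ℝ} (hf : ContinuousOn f V) {p : Euc 3}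
    (hp : p ∈ V) (hs : ∀ x ∈ V, f x ^ 2 = f p ^ 2) {x : Euc 3} (hx : x ∈ V) : f x = f p := by
  by_cases h0 : f p = 0
  · have := hs x hx
    rw [h0] at this ⊢
    simpa using this
  · have h1 := hV.eq_or_eq_neg_of_sq_eq hf (continuousOn_const (c := f p))
      (fun x hx => hs x hx) (fun _ => h0)
    rcases h1 with h1 | h1
    · exact h1 hx
    · have := h1 hp
      simp at this
      exact absurd (by linarith) h0

end

/-! ### Invariant coframes, and the vanishing of the contractions of `h`. -/

section

variable {U V : Set (Euc 3)} {e : Fin 3 → Euc 3 → Euc 3} {θ : Fin 3 → Euc 3 → Euc 3 →L[ℝ] ℝ}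
  {γ : Euc 3 → Euc 3 →L[ℝ] Euc 3 →L[ℝ] ℝ} {h : Euc 3 → Euc 3 →L[ℝ] ℝ}
  {B T : Euc 3 → Euc 3 →L[ℝ] Euc 3 →L[ℝ] ℝ} {φ : Euc 3 → Euc 3} {F Δ : ℝ}

lemma LocalSym.restrict {W : Set (Euc 3)} (hS : LocalSym U W γ h B φ) (hV : IsOpen V) :
    LocalSym V ((W ∩ φ ⁻¹' V) ∩ V) γ h B φ where
  isOpen := (hS.smooth.continuousOn.isOpen_inter_preimage hS.isOpen hV).inter hV
  subset := Set.inter_subset_right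
  maps := fun _ hy => hy.1.2
  smooth := hS.smooth.mono fun _ hy => hy.1.1
  γ_inv := fun y hy => hS.γ_inv y hy.1.1
  h_inv := fun y hy => hS.h_inv y hy.1.1
  B_inv := fun y hy => hS.B_inv y hy.1.1

/-- An orthonormal coframe two of whose members are invariant under the local symmetries has
constant structure functions and frame components, up to signs. -/
lemma LocalSym.coframe_inv (hS : LocalSym U V γ h B φ) (hF : IsFrame U e θ)
    (hγ : ∀ x ∈ U, ∀ X Y, γ x X Y = ∑ i, θ i x X * θ i x Y)
    (h0 : ∀ y ∈ V, ∀ X, θ 0 (φ y) (fderiv ℝ φ y X) = θ 0 y X)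
    (h1 : ∀ y ∈ V, ∀ X, θ 1 (φ y) (fderiv ℝ φ y X) = θ 1 y X) {p : Euc 3} (hp : p ∈ V) :
    (∀ i j k, strC e θ i j k (φ p) ^ 2 = strC e θ i j k p ^ 2) ∧
      ∀ i j, B (φ p) (e i (φ p)) (e j (φ p)) ^ 2 = B p (e i p) (e j p) ^ 2 := by
  -- By orthonormality the third coframe member is preserved up to the factor `s = ±1`. By
  -- continuity `s` is constant near `p`, where it therefore commutes with the exterior derivative.
  set s : Euc 3 → ℝ := fun y => θ 2 (φ y) (fderiv ℝ φ y (e 2 y)) with hs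
  have hon : ∀ y ∈ V, _ := fun y hy => hS.orthonormal hF hγ hy
  have hd : ∀ y ∈ V, _ := fun y hy => hF.dual y (hS.subset hy)
  have hs2 : ∀ y ∈ V, s y ^ 2 = 1 := by
    intro y hy
    have := hon y hy 2 2
    simp [Fin.sum_univ_three, h0 y hy, h1 y hy, hd y hy] at this
    rw [hs]
    linarith
  have h2 : ∀ y ∈ V, ∀ X, θ 2 (φ y) (fderiv ℝ φ y X) = s y * θ 2 y X := by
    intro y hy X
    have o0 := hon y hy 0 0
    have o1 := hon y hy 1 1
    simp [Fin.sum_univ_three, h0 y hy, h1 y hy, hd y hy] at o0 o1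
    conv_lhs => rw [← hF.expand y (hS.subset hy) X]
    simp [Fin.sum_univ_three, o0, o1, hs, mul_comm]
  have hsc : ContinuousOn s V := by
    have c1 : ContDiffOn ℝ ∞ (fun y => θ 2 (φ y)) V := (hF.θ_smooth 2).comp hS.smooth hS.maps
    exact (c1.clm_apply ((contDiffOn_fderiv hS.isOpen hS.smooth).clm_apply
      ((hF.e_smooth 2).mono hS.subset))).continuousOn
  have hWo : IsOpen (V ∩ s ⁻¹' {t | 0 < t * s p}) :=
    hsc.isOpen_inter_preimage hS.isOpen (isOpen_lt continuous_const (continuous_mul_const (s p)))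
  set W := V ∩ s ⁻¹' {t | 0 < t * s p}
  have hW : W ⊆ V := Set.inter_subset_left
  have hpW : p ∈ W := ⟨hp, by
    have := hs2 p hp
    change 0 < s p * s p
    rw [← sq, this]; norm_num⟩
  have hsW : ∀ y ∈ W, s y = s p := by
    intro y hy
    have h3 : s y ^ 2 = s p ^ 2 := by rw [hs2 y hy.1, hs2 p hp]
    rcases sq_eq_sq_iff_eq_or_eq_neg.1 h3 with h4 | h4
    · exact h4
    · have h5 : 0 < s y * s p := hy.2
      rw [h4] at h5
      nlinarith [sq_nonneg (s p)]
  obtain ⟨ε, hε, hθ⟩ : ∃ ε : Fin 3 → ℝ, (∀ i, ε i ^ 2 = 1) ∧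
      ∀ i, ∀ y ∈ W, ∀ X, θ i (φ y) (fderiv ℝ φ y X) = (ε i • θ i y) X := by
    refine ⟨![1, 1, s p], ?_, ?_⟩
    · intro i; fin_cases i <;> simp [hs2 p hp]
    · intro i y hy X
      fin_cases i
      · simp [h0 y (hW hy)]
      · simp [h1 y (hW hy)]
      · simp [h2 y (hW hy), hsW y hy]
  have hpU := hS.subset hp
  have hqU := hS.maps hp
  have hε' : ∀ i, ε i * ε i = 1 := fun i => by rw [← sq, hε]
  have hDe : ∀ j, fderiv ℝ φ p (e j p) = ε j • e j (φ p) := by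
    intro j
    rw [← hF.expand (φ p) hqU (fderiv ℝ φ p (e j p))]
    simp only [hθ _ p hpW, _root_.smul_apply, hF.dual p hpU, smul_eq_mul]
    rw [Finset.sum_eq_single j]
    · simp
    · intro i _ hij; simp [hij]
    · simp
  have he : ∀ j, e j (φ p) = ε j • fderiv ℝ φ p (e j p) := by
    intro j
    rw [hDe, smul_smul, hε', one_smul]
  constructor
  · intro i j k
    have hsm : ∀ X Y, dForm (fun y => ε i • θ i y) p X Y = ε i * dForm (θ i) p X Y := by
      intro X Y
      rw [dForm, fderiv_fun_const_smul (diffAt_of_contDiffOn hF.isOpen (hF.θ_smooth i) hpU), dForm]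
      simp
      ring
    have h3 := dForm_pullback hF.isOpen hWo (hF.θ_smooth i)
      (((hF.θ_smooth i).mono (hW.trans hS.subset)).const_smul (ε i)) (hS.smooth.mono hW)
      (hS.maps.mono_left hW) (fun y hy => hθ i y hy) hpW (e j p) (e k p)
    have h4 : strC e θ i j k (φ p) = ε i * ε j * ε k * strC e θ i j k p := by
      have h5 : strC e θ i j k (φ p) = ε j * ε k *
          dForm (θ i) (φ p) (fderiv ℝ φ p (e j p)) (fderiv ℝ φ p (e k p)) := by
        rw [strC, he, he, dForm, dForm]
        simp
        ring
      rw [h5, h3]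
      change _ * dForm (fun y => ε i • θ i y) p _ _ = _
      rw [hsm, strC]
      ring
    rw [h4, mul_pow, mul_pow, mul_pow, hε, hε, hε]
    ring
  · intro i j
    have h4 : B (φ p) (e i (φ p)) (e j (φ p)) = ε i * ε j * B p (e i p) (e j p) := by
      rw [he, he, ← hS.B_inv p hp]
      simp
      ring
    rw [h4, mul_pow, mul_pow, hε, hε]
    ring

lemma contr_self_apply (hTa : ∀ x ∈ U, ∀ X, T x X X = 0) {x : Euc 3} (hx : x ∈ U) :
    contr e h T x (sharp e h x) = 0 := by
  rw [contr_apply, hTa x hx]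

/-- The local form of a homogeneous solution. -/
structure LocalSolution (U : Set (Euc 3)) (e : Fin 3 → Euc 3 → Euc 3)
    (θ : Fin 3 → Euc 3 → Euc 3 →L[ℝ] ℝ) (γ : Euc 3 → Euc 3 →L[ℝ] Euc 3 →L[ℝ] ℝ)
    (h : Euc 3 → Euc 3 →L[ℝ] ℝ) (B : Euc 3 → Euc 3 →L[ℝ] Euc 3 →L[ℝ] ℝ) (F Δ : ℝ) : Prop where
  riem : IsRiem U γ
  frame : IsFrame U e θ
  metric : ∀ x ∈ U, ∀ X Y, γ x X Y = ∑ i, θ i x X * θ i x Y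
  h_smooth : ContDiffOn ℝ ∞ h U
  B_smooth : ContDiffOn ℝ ∞ B U
  B_alt : ∀ x ∈ U, ∀ X, B x X X = 0
  solves : SolvesEinsteinMaxwell (localFields (fun x X Y => γ x X Y) h F Δ B) (hor ⁻¹' U)
  hom : LocallyHomogeneous U γ h B

lemma LocalSolution.normSq_const (hL : LocalSolution U e θ γ h B F Δ)
    {α : Euc 3 → Euc 3 →L[ℝ] ℝ} (hα : ∀ V φ, LocalSym U V γ h B φ → ∀ y ∈ V, ∀ X,
      α (φ y) (fderiv ℝ φ y X) = α y X) {p q : Euc 3} (hp : p ∈ U) (hq : q ∈ U) :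
    ∑ i, α q (e i q) ^ 2 = ∑ i, α p (e i p) ^ 2 := by
  obtain ⟨V, φ, hpV, rfl, hS⟩ := hL.hom p hp q hq
  exact hS.normSq_inv hL.frame hL.metric hpV (hα V φ hS p hpV)

lemma LocalSolution.normSq_tensor_const (hL : LocalSolution U e θ γ h B F Δ)
    (hT : InvTensor U γ h B T) {p q : Euc 3} (hp : p ∈ U) (hq : q ∈ U) :
    ∑ i, ∑ j, T q (e i q) (e j q) ^ 2 = ∑ i, ∑ j, T p (e i p) (e j p) ^ 2 := by
  obtain ⟨V, φ, hpV, rfl, hS⟩ := hL.hom p hp q hq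
  exact hS.normSq_tensor_inv hL.frame hL.metric hT hpV

lemma sq_sum_pos {L : Fin 3 → ℝ} (h : ∃ i, L i ≠ 0) : 0 < ∑ i, L i ^ 2 := by
  obtain ⟨i, hi⟩ := h
  exact Finset.sum_pos' (fun i _ => sq_nonneg _) ⟨i, Finset.mem_univ i, by positivity⟩

lemma IsFrame.exists_ne (hF : IsFrame U e θ) {x : Euc 3} (hx : x ∈ U) {L : Euc 3 →L[ℝ] ℝ}
    (hL : L ≠ 0) : ∃ i, L (e i x) ≠ 0 := by
  by_contra hc
  push Not at hc
  refine hL (ContinuousLinearMap.ext fun X => ?_)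
  rw [← hF.expand x hx X]
  simp [hc]

/-- The contractions of `h` with `B` and `dh` vanish. -/
theorem LocalSolution.contr_eq_zero (hL : LocalSolution U e θ γ h B F Δ)
    (hT : T = B ∨ T = extD h) {p : Euc 3} (hp : p ∈ U) : contr e h T p = 0 := by
  -- A nonzero contraction `ξ` is an invariant one-form orthogonal to `h`. Normalizing both fixes
  -- two legs of a coframe and the third up to sign, so the structure functions and the components
  -- of `B` are constant, and `FrameEqs.rigid` applies.
  by_contra hne
  have hF := hL.frame
  have hTs : ContDiffOn ℝ ∞ T U := by
    rcases hT with rfl | rfl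
    exacts [hL.B_smooth, contDiffOn_extD hF.isOpen hL.h_smooth]
  have hTi : InvTensor U γ h B T := by
    rcases hT with rfl | rfl
    exacts [invTensor_self, invTensor_extD hF.isOpen hL.h_smooth]
  have hTa : ∀ x ∈ U, ∀ X, T x X X = 0 := by
    rcases hT with rfl | rfl
    exacts [hL.B_alt, fun x _ X => by rw [extD_apply, dForm_self]]
  set ξ := contr e h T with hξ
  have hξs : ContDiffOn ℝ ∞ ξ U := contDiffOn_contr hF hL.h_smooth hTs
  have hhp : h p ≠ 0 := fun h0 => hne (by simp [hξ, contr, h0])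
  have hη := fun {q} (hq : q ∈ U) => hL.normSq_const (α := h) (fun V φ hS => hS.h_inv) hp hq
  have hν := fun {q} (hq : q ∈ U) => hL.normSq_const (α := ξ)
    (fun V φ hS y hy => hS.contr_inv hF hL.metric hTi hy) hp hq
  have hηp : 0 < ∑ i, h p (e i p) ^ 2 := sq_sum_pos (hF.exists_ne hp hhp)
  have hνp : 0 < ∑ i, ξ p (e i p) ^ 2 := sq_sum_pos (hF.exists_ne hp hne)
  set η := ∑ i, h p (e i p) ^ 2
  set ν := ∑ i, ξ p (e i p) ^ 2
  have hhh : ∀ x ∈ U, h x (sharp e h x) = η := fun x hx => by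
    rw [apply_sharp, ← hη hx]; simp only [sq]
  have hξξ : ∀ x ∈ U, ξ x (sharp e ξ x) = ν := fun x hx => by
    rw [apply_sharp, ← hν hx]; simp only [sq]
  have hξh : ∀ x ∈ U, ξ x (sharp e h x) = 0 := fun x hx => contr_self_apply hTa hx
  have hhξ : ∀ x ∈ U, h x (sharp e ξ x) = 0 := fun x hx => by
    rw [← hξh x hx, apply_sharp, apply_sharp]
    exact Finset.sum_congr rfl fun i _ => mul_comm _ _
  have hli : LinearIndependent ℝ ![sharp e h p, sharp e ξ p] := by
    rw [LinearIndependent.pair_iff]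
    intro s t hst
    have h1 := congrArg (h p) hst
    have h2 := congrArg (ξ p) hst
    simp [hhh p hp, hhξ p hp] at h1
    simp [hξh p hp, hξξ p hp] at h2
    exact ⟨h1.resolve_right hηp.ne', h2.resolve_right hνp.ne'⟩
  obtain ⟨V, hVU, hVo, hpV, hVc, f, hf, hfγ, ⟨a, ha, hha⟩, b, c, hc, hbc⟩ :=
    hL.riem.exists_frame₂ (contDiffOn_sharp hF hL.h_smooth) (contDiffOn_sharp hF hξs) hp hli
  set ϑ : Fin 3 → Euc 3 → Euc 3 →L[ℝ] ℝ := fun i x => γ x (f i x) with hϑ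
  have hdual : ∀ x ∈ V, ∀ i j, γ x (f i x) (f j x) = if i = j then 1 else 0 := hf.dual
  have hga := fun {α : Euc 3 → Euc 3 →L[ℝ] ℝ} {x} (hx : x ∈ V) X =>
    metric_sharp (h := α) hF hL.metric (hVU hx) X
  have ha2 : ∀ x ∈ V, a x = √η := by
    intro x hx
    have h1 := hga (α := h) hx (sharp e h x)
    rw [hhh x (hVU hx), hha x hx] at h1
    simp [hdual x hx] at h1
    rw [← h1, Real.sqrt_mul_self (ha x hx).le]
  have hsη : 0 < √η := Real.sqrt_pos.2 hηp
  have hsν : 0 < √ν := Real.sqrt_pos.2 hνp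
  have hhθ : ∀ x ∈ V, ∀ X, h x X = √η * ϑ 0 x X := by
    intro x hx X
    rw [← hga hx, hha x hx, ha2 x hx]
    simp [hϑ]
  have hb0 : ∀ x ∈ V, b x = 0 := by
    intro x hx
    have h1 := hhξ x (hVU hx)
    rw [hhθ x hx, hbc x hx] at h1
    simp [hϑ, hdual x hx] at h1
    exact h1.resolve_left hsη.ne'
  have hc2 : ∀ x ∈ V, c x = √ν := by
    intro x hx
    have h1 := hga (α := ξ) hx (sharp e ξ x)
    rw [hξξ x (hVU hx), hbc x hx, hb0 x hx] at h1
    simp [hdual x hx] at h1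
    rw [← h1, Real.sqrt_mul_self (hc x hx).le]
  have hξθ : ∀ x ∈ V, ∀ X, ξ x X = √ν * ϑ 1 x X := by
    intro x hx X
    rw [← hga hx, hbc x hx, hb0 x hx, hc2 x hx]
    simp [hϑ]
  have hsq : ∀ q ∈ V, (∀ i j k, strC f ϑ i j k q ^ 2 = strC f ϑ i j k p ^ 2) ∧
      ∀ i j, B q (f i q) (f j q) ^ 2 = B p (f i p) (f j p) ^ 2 := by
    intro q hq
    obtain ⟨W, φ, hpW, rfl, hS⟩ := hL.hom p hp q (hVU hq)
    have hS' := hS.restrict hVo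
    refine hS'.coframe_inv hf hfγ ?_ ?_ ⟨⟨hpW, hq⟩, hpV⟩
    · intro y hy X
      have := hS.h_inv y hy.1.1 X
      rw [hhθ _ hy.1.2, hhθ y hy.2] at this
      exact mul_left_cancel₀ hsη.ne' this
    · intro y hy X
      have := hS.contr_inv hF hL.metric hTi hy.1.1 X
      rw [← hξ, hξθ _ hy.1.2, hξθ y hy.2] at this
      exact mul_left_cancel₀ hsν.ne' this
  have hCc : ∀ x ∈ V, ∀ i j k, strC f ϑ i j k x = strC f ϑ i j k p := fun x hx i j k =>
    eq_of_sq_eq hVc (contDiffOn_strC hf i j k).continuousOn hpV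
      (fun q hq => (hsq q hq).1 i j k) hx
  have hBc : ∀ x ∈ V, ∀ i j, B x (f i x) (f j x) = B p (f i p) (f j p) := fun x hx i j =>
    eq_of_sq_eq hVc (((hL.B_smooth.mono hVU).clm_apply (hf.e_smooth i)).clm_apply
      (hf.e_smooth j)).continuousOn hpV (fun q hq => (hsq q hq).2 i j) hx
  have hH : ∀ x ∈ V, ∀ i, h x (f i x) = (![√η, 0, 0] : Fin 3 → ℝ) i := by
    intro x hx i
    rw [hhθ x hx]
    fin_cases i <;> simp [hϑ, hdual x hx]
  have hE := frameEqs hf (hL.h_smooth.mono hVU) (hL.B_smooth.mono hVU)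
    (fun x hx => hL.B_alt x (hVU hx)) hfγ (fun x hx => hL.solves x (hVU hx)) hH
    (b := fun i => dualForm f ϑ B p (f i p)) (fun x hx i => by
      have h1 := dualForm_apply (B := B) hf hx
      have h2 := dualForm_apply (B := B) hf hpV
      fin_cases i
      · simp [h1, h2, hBc x hx]
      · simp [h1, h2, hBc x hx]
      · simp [h1, h2, hBc x hx]) hpV
  have hD0 : (fun l i j k => strD f ϑ l i j k p) = fun _ _ _ _ => 0 := by
    funext l i j k
    exact dirD_eqOn hVo (fun x hx => hCc x hx i j k) hpV
  rw [hD0] at hE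
  obtain ⟨-, r2, r3, -⟩ := hE.rigid (by simpa using hsη.ne') (by simp) (by simp)
  -- `ξ` is a positive multiple of `T (f 0, ·)`, and it points along the second leg.
  have hT1 : T p (f 0 p) (f 1 p) ≠ 0 := by
    intro h0
    have h1 := hξθ p hpV (f 1 p)
    rw [hξ, contr_apply, hha p hpV] at h1
    simp [h0, hϑ, hdual p hpV] at h1
    exact hsν.ne' h1.symm
  rcases hT with rfl | rfl
  · rw [(dualForm_apply hf hpV).2.2] at r2
    exact hT1 r2
  · rw [extD_apply, dForm_frame hf (hL.h_smooth.mono hVU) hpV,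
      dirD_eqOn hVo (fun x hx => hH x hx 1) hpV, dirD_eqOn hVo (fun x hx => hH x hx 0) hpV] at hT1
    simp [Fin.sum_univ_three, hH p hpV, r3] at hT1

end

/-! ### Existence of axial frames. -/

section

variable {U V : Set (Euc 3)} {e : Fin 3 → Euc 3 → Euc 3} {θ : Fin 3 → Euc 3 → Euc 3 →L[ℝ] ℝ}
  {γ : Euc 3 → Euc 3 →L[ℝ] Euc 3 →L[ℝ] ℝ} {h : Euc 3 → Euc 3 →L[ℝ] ℝ}
  {B T : Euc 3 → Euc 3 →L[ℝ] Euc 3 →L[ℝ] ℝ} {φ : Euc 3 → Euc 3} {F Δ : ℝ}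

lemma alt_swap (hBa : ∀ x ∈ U, ∀ X, B x X X = 0) {x : Euc 3} (hx : x ∈ U) (X Y : Euc 3) :
    B x X Y = - B x Y X := by
  have := hBa x hx (X + Y)
  simp [hBa x hx] at this
  linarith

/-- The expansion of a two-form whose kernel contains the first frame vector. -/
lemma alt_expand (hF : IsFrame U e θ) (hBa : ∀ x ∈ U, ∀ X, B x X X = 0) {x : Euc 3} (hx : x ∈ U)
    (h0 : ∀ X, B x (e 0 x) X = 0) (X Y : Euc 3) :
    B x X Y = B x (e 1 x) (e 2 x) * (θ 1 x X * θ 2 x Y - θ 1 x Y * θ 2 x X) := by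
  have h1 : ∀ X, B x X (e 0 x) = 0 := fun X => by rw [alt_swap hBa hx, h0, neg_zero]
  conv_lhs => rw [← hF.expand x hx X, ← hF.expand x hx Y]
  simp [Fin.sum_univ_three, h0, h1, hBa x hx, alt_swap hBa hx (e 2 x) (e 1 x)]
  ring

lemma LocalSolution.mono (hL : LocalSolution U e θ γ h B F Δ) (hV : IsOpen V) (hVU : V ⊆ U) :
    LocalSolution V e θ γ h B F Δ where
  riem := hL.riem.mono hV hVU
  frame := hL.frame.mono hV hVU
  metric := fun x hx => hL.metric x (hVU hx)
  h_smooth := hL.h_smooth.mono hVU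
  B_smooth := hL.B_smooth.mono hVU
  B_alt := fun x hx => hL.B_alt x (hVU hx)
  solves := fun x hx => hL.solves x (hVU hx)
  hom := by
    intro p hp q hq
    obtain ⟨W, φ, hpW, rfl, hS⟩ := hL.hom p (hVU hp) q (hVU hq)
    exact ⟨(W ∩ φ ⁻¹' V) ∩ V, φ, ⟨⟨hpW, hq⟩, hp⟩, rfl, hS.restrict hV⟩

/-- A frame in which `h = H θ^0` and `B = b θ^1 ∧ θ^2`. -/
structure FieldFrame (V : Set (Euc 3)) (f : Fin 3 → Euc 3 → Euc 3)
    (γ : Euc 3 → Euc 3 →L[ℝ] Euc 3 →L[ℝ] ℝ) (h : Euc 3 → Euc 3 →L[ℝ] ℝ)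
    (B : Euc 3 → Euc 3 →L[ℝ] Euc 3 →L[ℝ] ℝ) (H b : ℝ) : Prop where
  frame : IsFrame V f (fun i x => γ x (f i x))
  metric : ∀ x ∈ V, ∀ X Y, γ x X Y = ∑ i, γ x (f i x) X * γ x (f i x) Y
  h_eq : ∀ x ∈ V, ∀ X, h x X = H * γ x (f 0 x) X
  B_eq : ∀ x ∈ V, ∀ X Y, B x X Y
    = b * (γ x (f 1 x) X * γ x (f 2 x) Y - γ x (f 1 x) Y * γ x (f 2 x) X)

lemma FieldFrame.frameEqs {f : Fin 3 → Euc 3 → Euc 3} {H b : ℝ} (hf : FieldFrame V f γ h B H b)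
    (hL : LocalSolution V e θ γ h B F Δ) {x : Euc 3} (hx : x ∈ V) :
    FrameEqs (fun i j k => strC f (fun i x => γ x (f i x)) i j k x)
      (fun l i j k => strD f (fun i x => γ x (f i x)) l i j k x) ![H, 0, 0] ![b, 0, 0] F Δ := by
  have hd : ∀ x ∈ V, ∀ i j, γ x (f i x) (f j x) = if i = j then 1 else 0 := hf.frame.dual
  refine NearHorizon.frameEqs hf.frame hL.h_smooth hL.B_smooth hL.B_alt hf.metric hL.solves
    ?_ ?_ hx
  · intro x hx i
    rw [hf.h_eq x hx]
    fin_cases i <;> simp [hd x hx]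
  · intro x hx i
    have h1 := dualForm_apply (B := B) hf.frame hx
    simp only [hf.B_eq x hx, hd x hx] at h1
    fin_cases i <;> simp [h1]

/-- Near each point with nonzero `h` or `B` there is an axial frame. -/
theorem LocalSolution.exists_axial (hL : LocalSolution U e θ γ h B F Δ) {p : Euc 3} (hp : p ∈ U)
    (h0 : ¬ (h p = 0 ∧ B p = 0)) :
    ∃ V ⊆ U, IsOpen V ∧ p ∈ V ∧ ∃ f H b n, ¬ (H = 0 ∧ b = 0) ∧ FieldFrame V f γ h B H b ∧
      AxialFrame V f (fun i x => γ x (f i x)) H b n F Δ := by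
  have hF := hL.frame
  have hη := fun {q} (hq : q ∈ U) => hL.normSq_const (α := h) (fun V φ hS => hS.h_inv) hp hq
  have hβ := fun {q} (hq : q ∈ U) => hL.normSq_tensor_const (T := B) invTensor_self hp hq
  -- The axis is the direction of the dual of `B` if `h` vanishes, and that of `h` otherwise.
  by_cases hhp : h p = 0
  · have hBp : B p ≠ 0 := fun h => h0 ⟨hhp, h⟩
    have hhz : ∀ x ∈ U, h x = 0 := by
      intro x hx
      by_contra hne
      have h1 := sq_sum_pos (hF.exists_ne hx hne)
      rw [hη hx, hhp] at h1
      simp at h1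
    set b := dualForm e θ B with hb
    have hbs : ContDiffOn ℝ ∞ b U := contDiffOn_dualForm hF hL.B_smooth
    have hbb : ∀ x ∈ U, b x (sharp e b x) = (1 / 2) * ∑ i, ∑ j, B x (e i x) (e j x) ^ 2 := by
      intro x hx
      obtain ⟨d0, d1, d2⟩ := dualForm_apply (B := B) hF hx
      rw [apply_sharp]
      simp only [Fin.sum_univ_three, hb, d0, d1, d2, hL.B_alt x hx,
        alt_swap hL.B_alt hx (e 2 x) (e 1 x), alt_swap hL.B_alt hx (e 0 x) (e 2 x),
        alt_swap hL.B_alt hx (e 1 x) (e 0 x)]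
      ring
    obtain ⟨ν, hν⟩ : ∃ ν, ν = (1 / 2) * ∑ i, ∑ j, B p (e i p) (e j p) ^ 2 := ⟨_, rfl⟩
    have hbν : ∀ x ∈ U, b x (sharp e b x) = ν := fun x hx => by rw [hbb x hx, hβ hx, hν]
    have hBb : ∀ x ∈ U, ∀ X, B x (sharp e b x) X = 0 := by
      intro x hx X
      obtain ⟨d0, d1, d2⟩ := dualForm_apply (B := B) hF hx
      rw [← hF.expand x hx X]
      simp only [sharp, hb, Fin.sum_univ_three, d0, d1, d2, map_add, map_smul, _root_.add_apply,
        _root_.smul_apply, smul_eq_mul, hL.B_alt x hx,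
        alt_swap hL.B_alt hx (e 2 x) (e 1 x), alt_swap hL.B_alt hx (e 0 x) (e 2 x),
        alt_swap hL.B_alt hx (e 1 x) (e 0 x)]
      ring
    have hνp : 0 < ν := by
      obtain ⟨i, hi⟩ : ∃ i, B p (e i p) ≠ 0 := by
        by_contra hc
        push Not at hc
        refine hBp (ContinuousLinearMap.ext fun X => ?_)
        rw [← hF.expand p hp X]
        simp [hc]
      have h1 := sq_sum_pos (hF.exists_ne hp hi)
      rw [hν]
      have : 0 < ∑ i, ∑ j, B p (e i p) (e j p) ^ 2 :=
        Finset.sum_pos' (fun i _ => Finset.sum_nonneg fun j _ => sq_nonneg _)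
          ⟨i, Finset.mem_univ i, h1⟩
      positivity
    obtain ⟨V, hVU, hVo, hpV, hVc, f, hf, hfγ, a, ha, hba⟩ :=
      hL.riem.exists_frame₁ (contDiffOn_sharp hF hbs) hp (fun h1 => by
        have := hbν p hp
        rw [h1, map_zero] at this
        exact hνp.ne this)
    have hdual : ∀ x ∈ V, ∀ i j, γ x (f i x) (f j x) = if i = j then 1 else 0 := hf.dual
    have hB0 : ∀ x ∈ V, ∀ X, B x (f 0 x) X = 0 := by
      intro x hx X
      have h1 := hBb x (hVU hx) X
      rw [hba x hx] at h1
      simp at h1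
      exact h1.resolve_left (ha x hx).ne'
    have hL' := hL.mono hVo hVU
    have hexp := fun x hx => alt_expand hf hL'.B_alt (x := x) hx (hB0 x hx)
    have hLf : LocalSolution V f (fun i x => γ x (f i x)) γ h B F Δ :=
      { hL' with frame := hf, metric := hfγ }
    have hBc : ∀ x ∈ V, B x (f 1 x) (f 2 x) = B p (f 1 p) (f 2 p) := fun x hx =>
      eq_of_sq_eq hVc ((hL'.B_smooth.clm_apply (hf.e_smooth 1)).clm_apply
        (hf.e_smooth 2)).continuousOn hpV (fun q hq => by
          have h1 := hLf.normSq_tensor_const (T := B) invTensor_self hpV hq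
          have hz : ∀ x ∈ V, ∀ i, B x (f i x) (f 0 x) = 0 := fun x hx i => by
            rw [alt_swap hL'.B_alt hx, hB0 x hx, neg_zero]
          simp only [Fin.sum_univ_three, hB0 p hpV, hB0 q hq, hz p hpV, hz q hq, hL'.B_alt p hpV,
            hL'.B_alt q hq, alt_swap hL'.B_alt hpV (f 2 p) (f 1 p),
            alt_swap hL'.B_alt hq (f 2 q) (f 1 q)] at h1
          linarith) hx
    set β := B p (f 1 p) (f 2 p)
    have hβ0 : β ≠ 0 := by
      intro h1
      apply hBp
      ext X Y
      rw [hexp p hpV]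
      change β * _ = _
      simp [h1]
    have hFF : FieldFrame V f γ h B 0 β :=
      ⟨hf, hfγ, fun x hx X => by simp [hhz x (hVU hx)], fun x hx X Y => by
        rw [hexp x hx, hBc x hx]⟩
    -- For `h = 0` the Maxwell equations say that `β θ^0` is closed; this gives `n = 0` and the
    -- other two conditions on `dθ^0`.
    refine ⟨V, hVU, hVo, hpV, f, 0, β, 0, fun h => hβ0 h.2, hFF, hf,
      fun x hx => hFF.frameEqs hLf hx, fun x hx => ?_, fun x hx => ?_, fun x hx => ?_⟩
    · have := (hFF.frameEqs hLf hx).max2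
      simp [Fin.sum_univ_three] at this
      exact this.resolve_left hβ0
    · have := (hFF.frameEqs hLf hx).max1
      simp [Fin.sum_univ_three] at this
      exact this.resolve_left hβ0
    · have := (hFF.frameEqs hLf hx).max0
      simp [Fin.sum_univ_three] at this
      exact this.resolve_left hβ0
  · obtain ⟨η, hηd⟩ : ∃ η, η = ∑ i, h p (e i p) ^ 2 := ⟨_, rfl⟩
    have hηp : 0 < η := hηd ▸ sq_sum_pos (hF.exists_ne hp hhp)
    have hhh : ∀ x ∈ U, h x (sharp e h x) = η := fun x hx => by
      rw [apply_sharp, hηd, ← hη hx]; simp only [sq]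
    obtain ⟨V, hVU, hVo, hpV, hVc, f, hf, hfγ, a, ha, hba⟩ :=
      hL.riem.exists_frame₁ (contDiffOn_sharp hF hL.h_smooth) hp (fun h1 => by
        have := hhh p hp
        rw [h1, map_zero] at this
        exact hηp.ne this)
    have hdual : ∀ x ∈ V, ∀ i j, γ x (f i x) (f j x) = if i = j then 1 else 0 := hf.dual
    have hL' := hL.mono hVo hVU
    have hLf : LocalSolution V f (fun i x => γ x (f i x)) γ h B F Δ :=
      { hL' with frame := hf, metric := hfγ }
    have hga := fun {x} (hx : x ∈ V) X => metric_sharp (h := h) hF hL.metric (hVU hx) X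
    have ha2 : ∀ x ∈ V, a x = √η := by
      intro x hx
      have h1 := hga hx (sharp e h x)
      rw [hhh x (hVU hx), hba x hx] at h1
      simp [hdual x hx] at h1
      rw [← h1, Real.sqrt_mul_self (ha x hx).le]
    have hsη : 0 < √η := Real.sqrt_pos.2 hηp
    have hhθ : ∀ x ∈ V, ∀ X, h x X = √η * γ x (f 0 x) X := by
      intro x hx X
      rw [← hga hx, hba x hx, ha2 x hx]
      simp
    -- By `contr_eq_zero` the axis lies in the kernel of both `B` and `dh`.
    have hT0 : ∀ {T}, (T = B ∨ T = extD h) → ∀ x ∈ V, ∀ X, T x (f 0 x) X = 0 := by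
      intro T hT x hx X
      have h1 := hL.contr_eq_zero hT (hVU hx)
      have h2 := congrArg (fun L => L X) h1
      simp only [contr_apply, hba x hx] at h2
      simp at h2
      exact h2.resolve_left (ha x hx).ne'
    -- Only one independent component of `T` is left; its square is fixed by the constant norm and
    -- its sign by continuity.
    have hTc : ∀ {T}, (T = B ∨ T = extD h) → ∀ x ∈ V,
        T x (f 1 x) (f 2 x) = T p (f 1 p) (f 2 p) := by
      intro T hT x hx
      have hTs : ContDiffOn ℝ ∞ T V := by
        rcases hT with rfl | rfl
        exacts [hL'.B_smooth, contDiffOn_extD hVo hL'.h_smooth]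
      have hTi : InvTensor V γ h B T := by
        rcases hT with rfl | rfl
        exacts [invTensor_self, invTensor_extD hVo hL'.h_smooth]
      have hTa : ∀ x ∈ V, ∀ X, T x X X = 0 := by
        rcases hT with rfl | rfl
        exacts [hL'.B_alt, fun x _ X => by rw [extD_apply, dForm_self]]
      refine eq_of_sq_eq hVc ((hTs.clm_apply (hf.e_smooth 1)).clm_apply
        (hf.e_smooth 2)).continuousOn hpV (fun q hq => ?_) hx
      have h1 := hLf.normSq_tensor_const hTi hpV hq
      have hz : ∀ x ∈ V, ∀ i, T x (f i x) (f 0 x) = 0 := fun x hx i => by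
        rw [alt_swap hTa hx, hT0 hT x hx, neg_zero]
      simp only [Fin.sum_univ_three, hT0 hT p hpV, hT0 hT q hq, hz p hpV, hz q hq, hTa p hpV,
        hTa q hq, alt_swap hTa hpV (f 2 p) (f 1 p), alt_swap hTa hq (f 2 q) (f 1 q)] at h1
      linarith
    have hFF : FieldFrame V f γ h B (√η) (B p (f 1 p) (f 2 p)) :=
      ⟨hf, hfγ, hhθ, fun x hx X Y => by
        rw [alt_expand hf hL'.B_alt hx (hT0 (Or.inl rfl) x hx), hTc (Or.inl rfl) x hx]⟩
    have hdh : ∀ x ∈ V, ∀ i j, extD h x (f i x) (f j x)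
        = √η * strC f (fun i x => γ x (f i x)) 0 i j x := by
      intro x hx i j
      have hc : ∀ y ∈ V, ∀ k, h y (f k y) = √η * if 0 = k then 1 else 0 := fun y hy k => by
        rw [hhθ y hy, hdual y hy]
      rw [extD_apply, dForm_frame hf hL'.h_smooth hx,
        dirD_eqOn hVo (fun y hy => hc y hy j) hx, dirD_eqOn hVo (fun y hy => hc y hy i) hx]
      simp [Fin.sum_univ_three, hc x hx]
    refine ⟨V, hVU, hVo, hpV, f, √η, B p (f 1 p) (f 2 p),
      strC f (fun i x => γ x (f i x)) 0 1 2 p, fun h => hsη.ne' h.1, hFF, hf,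
      fun x hx => hFF.frameEqs hLf hx, fun x hx => ?_, fun x hx => ?_, fun x hx => ?_⟩
    · have h1 := hT0 (Or.inr rfl) x hx (f 1 x)
      rw [hdh x hx] at h1
      exact (mul_eq_zero.1 h1).resolve_left hsη.ne'
    · have h1 := hT0 (Or.inr rfl) x hx (f 2 x)
      rw [hdh x hx, strC_swap] at h1
      simpa using (mul_eq_zero.1 h1).resolve_left hsη.ne'
    · have h1 := hTc (Or.inr rfl) x hx
      rw [hdh x hx, hdh p hpV] at h1
      exact mul_left_cancel₀ hsη.ne' h1

end

/-! ### Flat linear systems -/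

section

set_option maxSynthPendingDepth 3

open Set Metric

variable {E F : Type*} [NormedAddCommGroup E] [NormedSpace ℝ E] [NormedAddCommGroup F]
  [NormedSpace ℝ F] [CompleteSpace F]

/-- Within distance `‖f₀‖` of `f₀` the norm is at most `2 ‖f₀‖`, so the bound `1 / 2` keeps the
speed below `‖f₀‖`. A solution cannot leave this ball in unit time, and Picard–Lindelöf gives it on
the whole interval. -/
lemma exists_linear_ode {a : ℝ → F →L[ℝ] F} {m : ℝ} (ha : ContinuousOn a (Icc 0 1))
    (hm : ∀ t ∈ Icc (0 : ℝ) 1, ‖a t‖ ≤ m) (hm2 : m ≤ 1 / 2) (f₀ : F) :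
    ∃ g : ℝ → F, g 0 = f₀ ∧ ∀ t ∈ Icc (0 : ℝ) 1, HasDerivWithinAt g (a t (g t)) (Icc 0 1) t := by
  have hP : IsPicardLindelof (fun t g => a t g) (⟨0, by simp⟩ : Icc (0 : ℝ) 1) f₀ (‖f₀‖₊) 0
      (‖f₀‖₊) (1 : NNReal) := by
    refine ⟨fun t ht => ?_, fun x hx => ?_, fun t ht x hx => ?_, ?_⟩
    · refine (ContinuousLinearMap.lipschitz (a t)).weaken ?_ |>.lipschitzOnWith
      exact_mod_cast (hm t ht).trans (hm2.trans (by norm_num))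
    · exact ha.clm_apply continuousOn_const
    · refine ((a t).le_opNorm x).trans ?_
      have h1 : ‖x‖ ≤ 2 * ‖f₀‖ := by
        have : ‖x - f₀‖ ≤ ‖f₀‖ := by simpa [dist_eq_norm] using hx
        have := norm_le_norm_add_norm_sub' x f₀
        linarith
      have h2 := (hm t ht).trans hm2
      have := mul_le_mul h2 h1 (norm_nonneg _) (by norm_num)
      simpa using this
    · simp
  obtain ⟨g, hg0, hg⟩ := hP.exists_eq_forall_mem_Icc_hasDerivWithinAt₀
  exact ⟨g, hg0, hg⟩

/-- The error of the linearization of a flat system, in terms of `P = A (t x)`, `Q = DA (t x)` and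
the second order remainder `S` of `A (t y)`. -/
lemma flat_remainder_le {P S : E →L[ℝ] F →L[ℝ] F} {Q : E →L[ℝ] E →L[ℝ] F →L[ℝ] F} {M G t : ℝ}
    {x w : E} {γ η : F} (hM : 0 ≤ M) (ht : ‖t‖ ≤ 1) (hP : ‖P‖ ≤ M) (hQ : ‖Q‖ ≤ M)
    (hS : ‖S‖ ≤ M * ‖w‖ ^ 2) (hγ : ‖γ‖ ≤ G) (hyn : ‖x + w‖ ≤ 1) (hwn : ‖w‖ ≤ 2)
    (hfl : Q w x γ - Q x w γ = P w (P x γ) - P x (P w γ))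
    (hA : ‖(P + t • Q w + S) (x + w)‖ ≤ 1) :
    ‖(P + t • Q w + S) (x + w) η - P x γ - (t • (Q x w γ + P w (P x γ)) + (1 : ℝ) • P w γ)‖
      ≤ ‖η - γ - t • P w γ‖ + (3 * M + 5 * M ^ 2) * G * ‖w‖ ^ 2 := by
  -- Flatness exchanges `Q x w` with `Q w x`. After that, every term of first order in `w` is
  -- contained in the error `η - γ - t P w γ`; the others are quadratic in `w` or contain the
  -- remainder `S`.
  have hid : (P + t • Q w + S) (x + w) η - P x γ
        - (t • (Q x w γ + P w (P x γ)) + (1 : ℝ) • P w γ)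
      = (P + t • Q w + S) (x + w) (η - γ - t • P w γ)
        + (t • Q w w γ + S (x + w) γ + t • P w (P w γ) + t • (t • Q w (x + w) (P w γ))
          + t • S (x + w) (P w γ)) := by
    have h1 : (P + t • Q w + S) (x + w) γ
        = P x γ + P w γ + t • Q w x γ + t • Q w w γ + S (x + w) γ := by
      simp only [_root_.add_apply, _root_.smul_apply, map_add, smul_add]; abel
    have h2 : (P + t • Q w + S) (x + w) (P w γ) = P x (P w γ) + P w (P w γ)
        + t • Q w (x + w) (P w γ) + S (x + w) (P w γ) := by
      simp only [_root_.add_apply, _root_.smul_apply, map_add, smul_add]; abel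
    rw [map_sub, map_sub, map_smul, h1, h2]
    have h3 : Q x w γ = Q w x γ - (P w (P x γ) - P x (P w γ)) := by rw [← hfl]; abel
    rw [h3]
    module
  rw [hid]
  have hop : ∀ (L : E →L[ℝ] F →L[ℝ] F) (X : E) (f : F), ‖L X f‖ ≤ ‖L‖ * ‖X‖ * ‖f‖ :=
    fun L X f => L.le_opNorm₂ X f
  have hsm : ∀ f : F, ‖t • f‖ ≤ ‖f‖ := fun f => by
    rw [norm_smul]; exact mul_le_of_le_one_left (norm_nonneg _) ht
  have w0 := norm_nonneg w
  have hG0 : 0 ≤ G := (norm_nonneg _).trans hγ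
  have b1 : ‖P w γ‖ ≤ M * ‖w‖ * G := (hop _ _ _).trans (by gcongr)
  have b2 : ‖P w (P w γ)‖ ≤ M * ‖w‖ * (M * ‖w‖ * G) := (hop _ _ _).trans (by gcongr)
  have hQw : ‖Q w‖ ≤ M * ‖w‖ := (Q.le_opNorm w).trans (by gcongr)
  have b3 : ‖Q w w γ‖ ≤ M * ‖w‖ * ‖w‖ * G := (hop _ _ _).trans (by gcongr)
  have b4 : ‖Q w (x + w) (P w γ)‖ ≤ M * ‖w‖ * 1 * (M * ‖w‖ * G) := (hop _ _ _).trans (by gcongr)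
  have b5 : ‖S (x + w) γ‖ ≤ M * ‖w‖ ^ 2 * 1 * G := (hop _ _ _).trans (by gcongr)
  have b1' : ‖P w γ‖ ≤ M * 2 * G := b1.trans (by gcongr)
  have b6 : ‖S (x + w) (P w γ)‖ ≤ M * ‖w‖ ^ 2 * 1 * (M * 2 * G) := (hop _ _ _).trans (by gcongr)
  have b0 : ‖(P + t • Q w + S) (x + w) (η - γ - t • P w γ)‖ ≤ ‖η - γ - t • P w γ‖ :=
    (((P + t • Q w + S) (x + w)).le_opNorm _).trans (mul_le_of_le_one_left (norm_nonneg _) hA)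
  refine (norm_add_le _ _).trans (add_le_add b0 ?_)
  have n1 := norm_add_le (t • Q w w γ + S (x + w) γ + t • P w (P w γ)
    + t • (t • Q w (x + w) (P w γ))) (t • S (x + w) (P w γ))
  have n2 := norm_add_le (t • Q w w γ + S (x + w) γ + t • P w (P w γ))
    (t • (t • Q w (x + w) (P w γ)))
  have n3 := norm_add_le (t • Q w w γ + S (x + w) γ) (t • P w (P w γ))
  have n4 := norm_add_le (t • Q w w γ) (S (x + w) γ)
  have s1 := hsm (Q w w γ)
  have s2 := hsm (P w (P w γ))
  have s3 := hsm (t • Q w (x + w) (P w γ))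
  have s4 := hsm (Q w (x + w) (P w γ))
  have s5 := hsm (S (x + w) (P w γ))
  have hz : 0 ≤ M * G * ‖w‖ ^ 2 := by positivity
  have hz' : 0 ≤ M ^ 2 * G * ‖w‖ ^ 2 := by positivity
  calc _ ≤ M * ‖w‖ * ‖w‖ * G + M * ‖w‖ ^ 2 * 1 * G + M * ‖w‖ * (M * ‖w‖ * G)
        + M * ‖w‖ * 1 * (M * ‖w‖ * G) + M * ‖w‖ ^ 2 * 1 * (M * 2 * G) := by linarith
    _ = 2 * (M * G * ‖w‖ ^ 2) + 4 * (M ^ 2 * G * ‖w‖ ^ 2) := by ring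
    _ ≤ 3 * (M * G * ‖w‖ ^ 2) + 5 * (M ^ 2 * G * ‖w‖ ^ 2) := by linarith
    _ = _ := by ring

/-- A flat system `df = A f` near the origin. -/
lemma exists_flat_ball {A : E → E →L[ℝ] F →L[ℝ] F} {M r : ℝ} (hr : 0 < r)
    (hr1 : r ≤ 1) (hM1 : 1 ≤ M) (hMr : M * r ≤ 1 / 2)
    (hA : ∀ x ∈ ball (0 : E) r, DifferentiableAt ℝ A x) (hAM : ∀ x ∈ ball (0 : E) r, ‖A x‖ ≤ M)
    (hDM : ∀ x ∈ ball (0 : E) r, ‖fderiv ℝ A x‖ ≤ M)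
    (hL : ∀ x ∈ ball (0 : E) r, ∀ y ∈ ball (0 : E) r,
      ‖fderiv ℝ A y - fderiv ℝ A x‖ ≤ M * ‖y - x‖)
    (hflat : ∀ x ∈ ball (0 : E) r, ∀ (X Y : E) (f : F), fderiv ℝ A x X Y f - fderiv ℝ A x Y X f
      = A x X (A x Y f) - A x Y (A x X f)) (f₀ : F) :
    ∃ f : E → F, f 0 = f₀ ∧ ∀ x ∈ ball (0 : E) r, HasFDerivAt f ((A x).flip (f x)) x := by
  have hball : ∀ x ∈ ball (0 : E) r, ∀ t ∈ Icc (0 : ℝ) 1, t • x ∈ ball (0 : E) r := by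
    intro x hx t ht
    rw [mem_ball_zero_iff] at hx ⊢
    rw [norm_smul, Real.norm_of_nonneg ht.1]
    exact (mul_le_of_le_one_left (norm_nonneg _) ht.2).trans_lt hx
  have hax : ∀ x ∈ ball (0 : E) r, ∀ t ∈ Icc (0 : ℝ) 1, ‖A (t • x) x‖ ≤ M * r := by
    intro x hx t ht
    refine ((A (t • x)).le_opNorm x).trans ?_
    exact mul_le_mul (hAM _ (hball x hx t ht)) (mem_ball_zero_iff.1 hx).le (norm_nonneg _)
      (by linarith)
  have hdA : ∀ x ∈ ball (0 : E) r, ∀ t ∈ Icc (0 : ℝ) 1,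
      HasDerivWithinAt (fun t : ℝ => A (t • x)) (fderiv ℝ A (t • x) x) (Icc 0 1) t := by
    intro x hx t ht
    have h1 : HasDerivAt (fun t : ℝ => t • x) x t := by simpa using (hasDerivAt_id t).smul_const x
    exact ((hA _ (hball x hx t ht)).hasFDerivAt.comp_hasDerivAt t h1).hasDerivWithinAt
  -- The system is solved along each ray from the origin, and the value of the solution at `x` is
  -- taken at time `1`.
  have hex : ∀ x : E, ∃ g : ℝ → F, x ∈ ball (0 : E) r → g 0 = f₀ ∧ ∀ t ∈ Icc (0 : ℝ) 1,
      HasDerivWithinAt g (A (t • x) x (g t)) (Icc 0 1) t := by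
    intro x
    by_cases hx : x ∈ ball (0 : E) r
    · obtain ⟨g, h0, h1⟩ := exists_linear_ode (a := fun t => A (t • x) x) (m := M * r)
        (fun t ht => ((hdA x hx t ht).continuousWithinAt.clm_apply continuousWithinAt_const))
        (hax x hx) hMr f₀
      exact ⟨g, fun _ => ⟨h0, h1⟩⟩
    · exact ⟨0, fun h => absurd h hx⟩
  choose g hg using hex
  have hIci : ∀ {u : ℝ → F} {u' : F} {t : ℝ}, t ∈ Ico (0 : ℝ) 1 →
      HasDerivWithinAt u u' (Icc 0 1) t → HasDerivWithinAt u u' (Ici t) t := by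
    intro u u' t ht h
    exact (h.mono (Icc_subset_Icc_left ht.1)).mono_of_mem_nhdsWithin
      (Icc_mem_nhdsGE_of_mem ⟨le_rfl, ht.2⟩)
  set G := ‖f₀‖ * Real.exp 1
  have hG0 : 0 ≤ G := by positivity
  have hG : ∀ x ∈ ball (0 : E) r, ∀ t ∈ Icc (0 : ℝ) 1, ‖g x t‖ ≤ G := by
    intro x hx t ht
    obtain ⟨h0, h1⟩ := hg x hx
    have := norm_le_gronwallBound_of_norm_deriv_right_le (f := g x) (δ := ‖f₀‖) (K := 1) (ε := 0)
      (fun t ht => (h1 t ht).continuousWithinAt) (fun t ht => hIci ht (h1 t (Ico_subset_Icc_self ht)))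
      (by rw [h0]) (fun t ht => by
        have h2 := (A (t • x) x).le_opNorm (g x t)
        have h3 := hax x hx t (Ico_subset_Icc_self ht)
        nlinarith [norm_nonneg (g x t)]) t ht
    rw [gronwallBound_ε0] at this
    refine this.trans (mul_le_mul_of_nonneg_left (Real.exp_le_exp.2 ?_) (norm_nonneg _))
    linarith [ht.2]
  have hTay : ∀ x ∈ ball (0 : E) r, ∀ y ∈ ball (0 : E) r,
      ‖A y - A x - fderiv ℝ A x (y - x)‖ ≤ M * ‖y - x‖ ^ 2 := by
    intro x hx y hy
    have hsub := (convex_ball (0 : E) r).segment_subset hx hy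
    have := (convex_segment x y).norm_image_sub_le_of_norm_hasFDerivWithin_le'
      (f := A) (f' := fderiv ℝ A) (φ := fderiv ℝ A x) (C := M * ‖y - x‖)
      (fun z hz => (hA z (hsub hz)).hasFDerivAt.hasFDerivWithinAt)
      (fun z hz => (hL x hx z (hsub hz)).trans (mul_le_mul_of_nonneg_left
        (norm_sub_le_of_mem_segment hz) (by linarith)))
      (left_mem_segment ℝ x y) (right_mem_segment ℝ x y)
    rw [sq, ← mul_assoc]
    exact this
  set C := (3 * M + 5 * M ^ 2) * G
  have hC0 : 0 ≤ C := by positivity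
  -- Grönwall's inequality for the error of the linearization along two neighbouring rays. The error
  -- vanishes at `t = 0`, and by flatness its derivative is bounded by its norm plus a multiple of
  -- `‖w‖²`.
  have key : ∀ x ∈ ball (0 : E) r, ∀ w : E, x + w ∈ ball (0 : E) r →
      ‖g (x + w) 1 - g x 1 - A x w (g x 1)‖ ≤ C * ‖w‖ ^ 2 * (Real.exp 1 - 1) := by
    intro x hx w hy
    obtain ⟨gx0, gx⟩ := hg x hx
    obtain ⟨gy0, gy⟩ := hg _ hy
    set y := x + w with hyd
    have hyn : ‖y‖ ≤ 1 := (mem_ball_zero_iff.1 hy).le.trans hr1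
    have hxn : ‖x‖ ≤ 1 := (mem_ball_zero_iff.1 hx).le.trans hr1
    have hwn : ‖w‖ ≤ 2 := by
      have : w = y - x := by simp [hyd]
      rw [this]; exact (norm_sub_le _ _).trans (by linarith)
    have hψ : ∀ t ∈ Icc (0 : ℝ) 1, HasDerivWithinAt
        (fun t => g y t - g x t - t • A (t • x) w (g x t))
        (A (t • y) y (g y t) - A (t • x) x (g x t) - (t • (fderiv ℝ A (t • x) x w (g x t)
          + A (t • x) w (A (t • x) x (g x t))) + (1 : ℝ) • A (t • x) w (g x t))) (Icc 0 1) t := by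
      intro t ht
      refine ((gy t ht).sub (gx t ht)).sub ?_
      have h1 := ((hdA x hx t ht).clm_apply (hasDerivWithinAt_const t _ w)).clm_apply (gx t ht)
      have h2 := (hasDerivWithinAt_id t (Icc 0 1)).smul h1
      simpa only [id_eq, smul_add, one_smul, map_zero, add_zero] using! h2
    have := norm_le_gronwallBound_of_norm_deriv_right_le (δ := 0) (K := 1) (ε := C * ‖w‖ ^ 2)
      (fun t ht => (hψ t ht).continuousWithinAt)
      (fun t ht => hIci ht (hψ t (Ico_subset_Icc_self ht)))
      (by simp [gx0, gy0]) (fun t ht' => ?_) 1 (by simp)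
    · rw [gronwallBound_of_K_ne_0 one_ne_zero] at this
      simpa using this
    · have ht := Ico_subset_Icc_self ht'
      have hyx : t • y - t • x = t • w := by rw [← smul_sub, hyd, add_sub_cancel_left]
      have htw : ‖t • w‖ ≤ ‖w‖ := by
        rw [norm_smul, Real.norm_of_nonneg ht.1]
        exact mul_le_of_le_one_left (norm_nonneg _) ht.2
      have hAy : A (t • y) = A (t • x) + t • fderiv ℝ A (t • x) w
          + (A (t • y) - A (t • x) - fderiv ℝ A (t • x) (t • y - t • x)) := by
        rw [hyx, map_smul]; abel
      have hyA := (hax y hy t ht).trans (hMr.trans (by norm_num : (1 / 2 : ℝ) ≤ 1))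
      rw [hAy] at hyA ⊢
      rw [one_mul]
      refine flat_remainder_le (by linarith) (by rw [Real.norm_of_nonneg ht.1]; exact ht.2)
        (hAM _ (hball x hx t ht)) (hDM _ (hball x hx t ht)) ?_ (hG x hx t ht) hyn hwn
        (hflat _ (hball x hx t ht) w x _) hyA
      refine (hTay _ (hball x hx t ht) _ (hball y hy t ht)).trans ?_
      rw [hyx]
      gcongr
  refine ⟨fun x => g x 1, ?_, fun x hx => ?_⟩
  · have h0 : (0 : E) ∈ ball (0 : E) r := mem_ball_self hr
    obtain ⟨g0, g1⟩ := hg 0 h0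
    have hc := norm_le_gronwallBound_of_norm_deriv_right_le (f := fun t => g 0 t - f₀) (δ := 0)
      (K := 0) (ε := 0)
      (fun t ht => ((g1 t ht).sub_const f₀).continuousWithinAt)
      (fun t ht => hIci ht ((g1 t (Ico_subset_Icc_self ht)).sub_const f₀)) (by simp [g0])
      (fun t ht => by simp) 1 (by simp)
    simpa [gronwallBound_K0, sub_eq_zero] using hc
  · rw [hasFDerivAt_iff_isLittleO_nhds_zero]
    have hnear : ∀ᶠ w in nhds (0 : E), x + w ∈ ball (0 : E) r := by
      have : Filter.Tendsto (fun w : E => x + w) (nhds 0) (nhds (x + 0)) :=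
        (continuous_const.add continuous_id).tendsto 0
      rw [add_zero] at this
      exact this (isOpen_ball.mem_nhds hx)
    refine (Asymptotics.IsBigO.of_bound (C * (Real.exp 1 - 1)) ?_).trans_isLittleO
      (Asymptotics.isLittleO_norm_pow_id (E' := E) one_lt_two)
    filter_upwards [hnear] with w hw
    have := key x hx w hw
    simp only [ContinuousLinearMap.flip_apply, Real.norm_eq_abs, abs_pow, abs_norm]
    linarith

/-- A flat linear system has a local solution with prescribed initial value. -/
theorem exists_flat {U : Set E} (hU : IsOpen U) {A : E → E →L[ℝ] F →L[ℝ] F}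
    (hA : ContDiffOn ℝ ∞ A U)
    (hflat : ∀ x ∈ U, ∀ (X Y : E) (f : F), fderiv ℝ A x X Y f - fderiv ℝ A x Y X f
      = A x X (A x Y f) - A x Y (A x X f)) {p : E} (hp : p ∈ U) (f₀ : F) :
    ∃ V ⊆ U, IsOpen V ∧ p ∈ V ∧ ∃ f : E → F, ContDiffOn ℝ ∞ f V ∧ f p = f₀ ∧
      ∀ x ∈ V, fderiv ℝ f x = (A x).flip (f x) := by
  have hdA := contDiffOn_fderiv hU hA
  obtain ⟨K, s, hs, hK⟩ := ((hdA.contDiffAt (hU.mem_nhds hp)).of_le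
    (by exact_mod_cast le_top : (1 : WithTop ℕ∞) ≤ ∞)).exists_lipschitzOnWith
  have hc1 : ∀ᶠ x in nhds p, ‖A x‖ < ‖A p‖ + 1 :=
    (hA.continuousOn.continuousAt (hU.mem_nhds hp)).norm.eventually_lt_const (by linarith)
  have hc2 : ∀ᶠ x in nhds p, ‖fderiv ℝ A x‖ < ‖fderiv ℝ A p‖ + 1 :=
    (hdA.continuousOn.continuousAt (hU.mem_nhds hp)).norm.eventually_lt_const (by linarith)
  obtain ⟨ρ, hρ, hball⟩ := Metric.mem_nhds_iff.1
    (Filter.inter_mem (Filter.inter_mem (hU.mem_nhds hp) hs) (hc1.and hc2))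
  -- One constant bounds `A`, its derivative and the Lipschitz constant of the latter; the radius
  -- `r` below then ensures `M r ≤ 1 / 2`, as the ray equations require.
  set M := ‖A p‖ + ‖fderiv ℝ A p‖ + K + 1 with hM
  have hM1 : 1 ≤ M := by
    have := norm_nonneg (A p); have := norm_nonneg (fderiv ℝ A p); have := K.2
    simp only [NNReal.val_eq_coe] at this
    linarith
  set r := min ρ (1 / (2 * M))
  have hr : 0 < r := lt_min hρ (by positivity)
  have hrρ : r ≤ ρ := min_le_left _ _
  have hMr : M * r ≤ 1 / 2 := by
    calc M * r ≤ M * (1 / (2 * M)) := mul_le_mul_of_nonneg_left (min_le_right _ _) (by linarith)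
      _ = 1 / 2 := by field_simp
  have hr1 : r ≤ 1 := by nlinarith
  have hsh : ∀ x ∈ ball (0 : E) r, p + x ∈ ball p ρ := by
    intro x hx
    rw [mem_ball_zero_iff] at hx
    simpa using hx.trans_le hrρ
  have hfd : ∀ x, fderiv ℝ (fun x => A (p + x)) x = fderiv ℝ A (p + x) := fun x =>
    fderiv_comp_add_left p
  obtain ⟨f, hf0, hf⟩ := exists_flat_ball (A := fun x => A (p + x)) hr hr1 hM1 hMr
    (fun x hx => (differentiableAt_comp_add_left p).2
      (diffAt_of_contDiffOn hU hA (hball (hsh x hx)).1.1))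
    (fun x hx => by
      have : ‖A (p + x)‖ < _ := (hball (hsh x hx)).2.1
      have := norm_nonneg (fderiv ℝ A p); have := K.2
      simp only [NNReal.val_eq_coe] at this
      linarith)
    (fun x hx => by
      rw [hfd]
      have : ‖fderiv ℝ A (p + x)‖ < _ := (hball (hsh x hx)).2.2
      have := norm_nonneg (A p); have := K.2
      simp only [NNReal.val_eq_coe] at this
      linarith)
    (fun x hx y hy => by
      rw [hfd, hfd]
      have h1 := hK.norm_sub_le (hball (hsh y hy)).1.2 (hball (hsh x hx)).1.2
      rw [add_sub_add_left_eq_sub] at h1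
      refine h1.trans (mul_le_mul_of_nonneg_right ?_ (norm_nonneg _))
      have := norm_nonneg (A p); have := norm_nonneg (fderiv ℝ A p)
      linarith)
    (fun x hx X Y f => by rw [hfd]; exact hflat _ (hball (hsh x hx)).1.1 X Y f) f₀
  have hV : ball p r ⊆ U := fun x hx => (hball (ball_subset_ball hrρ hx)).1.1
  have hder : ∀ x ∈ ball p r, HasFDerivAt (fun x => f (x - p)) ((A x).flip (f (x - p))) x := by
    intro x hx
    have h1 := hf (x - p) (by simpa [dist_eq_norm] using hx)
    rw [add_sub_cancel] at h1
    simpa using! h1.comp x ((hasFDerivAt_id x).sub_const p)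
  refine ⟨ball p r, hV, isOpen_ball, mem_ball_self hr, fun x => f (x - p), ?_, by simp [hf0],
    fun x hx => (hder x hx).fderiv⟩
  have hA' := hA.mono hV
  -- Bootstrap: the equation `df = A f` turns `n` derivatives of `f` into `n + 1`.
  rw [contDiffOn_infty]
  intro n
  induction n with
  | zero =>
    rw [Nat.cast_zero, contDiffOn_zero]
    exact fun x hx => (hder x hx).continuousAt.continuousWithinAt
  | succ n ih =>
    rw [Nat.cast_succ, contDiffOn_succ_iff_fderiv_of_isOpen isOpen_ball]
    refine ⟨fun x hx => (hder x hx).differentiableAt.differentiableWithinAt, by simp, ?_⟩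
    refine ContDiffOn.congr (f := fun x => (A x).flip (f (x - p))) ?_
      fun x hx => (hder x hx).fderiv
    exact (((ContinuousLinearMap.flipₗᵢ ℝ E F F).contDiff.comp_contDiffOn
      (hA'.of_le (by exact_mod_cast le_top)))).clm_apply ih

end

/-! ### Parallel frames of a flat connection with structure group `SO(3)` -/

section

set_option maxSynthPendingDepth 3

variable {U V : Set (Euc 3)} {e : Fin 3 → Euc 3 → Euc 3} {θ : Fin 3 → Euc 3 → Euc 3 →L[ℝ] ℝ}
  {γ : Euc 3 → Euc 3 →L[ℝ] Euc 3 →L[ℝ] ℝ} {h : Euc 3 → Euc 3 →L[ℝ] ℝ}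
  {B T : Euc 3 → Euc 3 →L[ℝ] Euc 3 →L[ℝ] ℝ} {a : Fin 3 → Euc 3 → Euc 3 →L[ℝ] ℝ} {F Δ : ℝ}

/-- The connection `d - a ×` is flat. -/
structure FlatRotation (U : Set (Euc 3)) (a : Fin 3 → Euc 3 → Euc 3 →L[ℝ] ℝ) : Prop where
  isOpen : IsOpen U
  smooth : ∀ i, ContDiffOn ℝ ∞ (a i) U
  d0 : ∀ x ∈ U, ∀ X Y, dForm (a 0) x X Y = a 1 x X * a 2 x Y - a 1 x Y * a 2 x X
  d1 : ∀ x ∈ U, ∀ X Y, dForm (a 1) x X Y = a 2 x X * a 0 x Y - a 2 x Y * a 0 x X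
  d2 : ∀ x ∈ U, ∀ X Y, dForm (a 2) x X Y = a 0 x X * a 1 x Y - a 0 x Y * a 1 x X

/-- The functions `z` solve `dz = a × z`. -/
structure IsRotated (V : Set (Euc 3)) (a : Fin 3 → Euc 3 → Euc 3 →L[ℝ] ℝ) (z : Fin 3 → Euc 3 → ℝ) :
    Prop where
  isOpen : IsOpen V
  smooth : ∀ i, ContDiffOn ℝ ∞ (z i) V
  d0 : ∀ x ∈ V, ∀ X, fderiv ℝ (z 0) x X = a 1 x X * z 2 x - a 2 x X * z 1 x
  d1 : ∀ x ∈ V, ∀ X, fderiv ℝ (z 1) x X = a 2 x X * z 0 x - a 0 x X * z 2 x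
  d2 : ∀ x ∈ V, ∀ X, fderiv ℝ (z 2) x X = a 0 x X * z 1 x - a 1 x X * z 0 x

lemma IsRotated.mono {z : Fin 3 → Euc 3 → ℝ} (hz : IsRotated V a z) (hU : IsOpen U) (hUV : U ⊆ V) :
    IsRotated U a z :=
  ⟨hU, fun i => (hz.smooth i).mono hUV, fun x hx => hz.d0 x (hUV hx), fun x hx => hz.d1 x (hUV hx),
    fun x hx => hz.d2 x (hUV hx)⟩

lemma IsRotated.hasFDerivAt {z : Fin 3 → Euc 3 → ℝ} (hz : IsRotated V a z) (i : Fin 3) {x : Euc 3}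
    (hx : x ∈ V) : HasFDerivAt (z i) (fderiv ℝ (z i) x) x :=
  (diffAt_of_contDiffOn hz.isOpen (hz.smooth i) hx).hasFDerivAt

/-- With the standard basis `J_l` of `so(3)`, the equation `dz = a × z` is the linear system with
matrix `Σ a_l J_l`, and the three structure equations of `a` are its flatness. -/
lemma FlatRotation.exists_rotated (ha : FlatRotation U a) {p : Euc 3} (hp : p ∈ U) (v : Fin 3 → ℝ) :
    ∃ V ⊆ U, p ∈ V ∧ ∃ z, IsRotated V a z ∧ ∀ i, z i p = v i := by
  set J : Fin 3 → (Fin 3 → ℝ) →L[ℝ] (Fin 3 → ℝ) := fun l =>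
    LinearMap.toContinuousLinearMap (crossProduct (Pi.single l 1)) with hJ
  set K : Fin 3 → (Euc 3 →L[ℝ] ℝ) →L[ℝ] Euc 3 →L[ℝ] (Fin 3 → ℝ) →L[ℝ] (Fin 3 → ℝ) := fun l =>
    (ContinuousLinearMap.smulRightL ℝ (Euc 3) ((Fin 3 → ℝ) →L[ℝ] (Fin 3 → ℝ))).flip (J l) with hK
  set A : Euc 3 → Euc 3 →L[ℝ] (Fin 3 → ℝ) →L[ℝ] (Fin 3 → ℝ) := fun x =>
    K 0 (a 0 x) + K 1 (a 1 x) + K 2 (a 2 x) with hAd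
  have hKa : ∀ l α X, K l α X = α X • J l := fun l α X => rfl
  have hKs : ∀ l, ContDiffOn ℝ ∞ (fun x => K l (a l x)) U := fun l =>
    (K l).contDiff.comp_contDiffOn (ha.smooth l)
  have hA : ContDiffOn ℝ ∞ A U := ((hKs 0).add (hKs 1)).add (hKs 2)
  have hAa : ∀ x X f, A x X f = ![a 1 x X * f 2 - a 2 x X * f 1, a 2 x X * f 0 - a 0 x X * f 2,
      a 0 x X * f 1 - a 1 x X * f 0] := by
    intro x X f
    ext i
    fin_cases i <;> simp [hAd, hKa, hJ, crossProduct, Pi.single_apply] <;> ring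
  have hdA : ∀ x ∈ U, ∀ X Y f, fderiv ℝ A x X Y f - fderiv ℝ A x Y X f
      = dForm (a 0) x X Y • J 0 f + dForm (a 1) x X Y • J 1 f + dForm (a 2) x X Y • J 2 f := by
    intro x hx X Y f
    have hs : ∀ i, HasFDerivAt (fun x => K i (a i x)) ((K i).comp (fderiv ℝ (a i) x)) x := fun i =>
      (K i).hasFDerivAt.comp x (diffAt_of_contDiffOn ha.isOpen (ha.smooth i) hx).hasFDerivAt
    have h2 : fderiv ℝ A x = _ := (((hs 0).add (hs 1)).add (hs 2)).fderiv
    rw [h2]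
    simp only [_root_.add_apply, ContinuousLinearMap.comp_apply, hKa, _root_.smul_apply, dForm]
    module
  obtain ⟨V, hVU, hV, hpV, f, hf, hfp, hdf⟩ := exists_flat ha.isOpen hA (fun x hx X Y f => by
    rw [hdA x hx, ha.d0 x hx, ha.d1 x hx, ha.d2 x hx]
    simp only [hAa]
    ext i
    fin_cases i <;> simp [hJ, crossProduct, Pi.single_apply] <;> ring) hp v
  have hc : ∀ i, ∀ x ∈ V, ∀ X, fderiv ℝ (fun x => f x i) x X = A x X (f x) i := by
    intro i x hx X
    have h1 := (hasFDerivAt_pi'.1 (diffAt_of_contDiffOn hV hf hx).hasFDerivAt i).fderiv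
    rw [h1, hdf x hx]
    simp
  refine ⟨V, hVU, hpV, fun i x => f x i, ⟨hV, fun i => contDiffOn_pi.1 hf i, ?_, ?_, ?_⟩,
    fun i => congrFun hfp i⟩
  · intro x hx X; rw [hc 0 x hx, hAa]; rfl
  · intro x hx X; rw [hc 1 x hx, hAa]; rfl
  · intro x hx X; rw [hc 2 x hx, hAa]; rfl

/-- Inner products of solutions are constant. -/
lemma IsRotated.inner_const {y z : Fin 3 → Euc 3 → ℝ} (hy : IsRotated V a y) (hz : IsRotated V a z)
    (hV : IsPreconnected V) {p x : Euc 3} (hp : p ∈ V) (hx : x ∈ V) :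
    y 0 x * z 0 x + y 1 x * z 1 x + y 2 x * z 2 x
      = y 0 p * z 0 p + y 1 p * z 1 p + y 2 p * z 2 p := by
  have hdd : ∀ x ∈ V, HasFDerivAt (fun x : Euc 3 => y 0 x * z 0 x + y 1 x * z 1 x
      + y 2 x * z 2 x) (0 : Euc 3 →L[ℝ] ℝ) x := by
    intro x hx
    have h1 := (((hy.hasFDerivAt 0 hx).mul (hz.hasFDerivAt 0 hx)).add
      ((hy.hasFDerivAt 1 hx).mul (hz.hasFDerivAt 1 hx))).add
      ((hy.hasFDerivAt 2 hx).mul (hz.hasFDerivAt 2 hx))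
    refine h1.congr_fderiv (ContinuousLinearMap.ext fun X => ?_)
    simp [hy.d0 x hx, hy.d1 x hx, hy.d2 x hx, hz.d0 x hx, hz.d1 x hx, hz.d2 x hx]
    ring
  exact hy.isOpen.is_const_of_fderiv_eq_zero (𝕜 := ℝ) hV
    (fun x hx => (hdd x hx).differentiableAt.differentiableWithinAt)
    (fun x hx => (hdd x hx).fderiv) hx hp

/-- The cross product of two solutions is a solution. -/
lemma IsRotated.cross {y z : Fin 3 → Euc 3 → ℝ} (hy : IsRotated V a y) (hz : IsRotated V a z) :
    IsRotated V a ![fun x => y 1 x * z 2 x - y 2 x * z 1 x, fun x => y 2 x * z 0 x - y 0 x * z 2 x,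
      fun x => y 0 x * z 1 x - y 1 x * z 0 x] := by
  have hm : ∀ i j : Fin 3, ∀ x ∈ V, ∀ X, fderiv ℝ (fun x => y i x * z j x - y j x * z i x) x X
      = y i x * fderiv ℝ (z j) x X + z j x * fderiv ℝ (y i) x X
        - (y j x * fderiv ℝ (z i) x X + z i x * fderiv ℝ (y j) x X) := by
    intro i j x hx X
    have h1 := ((hy.hasFDerivAt i hx).mul (hz.hasFDerivAt j hx)).sub
      ((hy.hasFDerivAt j hx).mul (hz.hasFDerivAt i hx))
    rw [show fderiv ℝ (fun x => y i x * z j x - y j x * z i x) x = _ from h1.fderiv]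
    simp
  refine ⟨hy.isOpen, fun i => ?_, ?_, ?_, ?_⟩
  · have hs : ∀ i j, ContDiffOn ℝ ∞ (fun x => y i x * z j x - y j x * z i x) V := fun i j =>
      ((hy.smooth i).mul (hz.smooth j)).sub ((hy.smooth j).mul (hz.smooth i))
    fin_cases i
    exacts [hs 1 2, hs 2 0, hs 0 1]
  all_goals
    intro x hx X
    simp [hm _ _ x hx, hy.d0 x hx, hy.d1 x hx, hy.d2 x hx, hz.d0 x hx, hz.d1 x hx, hz.d2 x hx]
    ring

/-! ### Spaces of constant curvature -/

/-- The connection `∇ - s ×` of a frame. -/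
def crossConn (e : Fin 3 → Euc 3 → Euc 3) (θ : Fin 3 → Euc 3 → Euc 3 →L[ℝ] ℝ) (s : ℝ) (i : Fin 3)
    (x : Euc 3) : Euc 3 →L[ℝ] ℝ :=
  ∑ k, connC (fun i j k => strC e θ i j k x) (i + 1) (i + 2) k • θ k x + s • θ i x

lemma crossConn_apply (hF : IsFrame U e θ) {x : Euc 3} (hx : x ∈ U) (s : ℝ) (i k : Fin 3) :
    crossConn e θ s i x (e k x) = connC (fun i j k => strC e θ i j k x) (i + 1) (i + 2) k
      + if i = k then s else 0 := by
  simp [crossConn, hF.dual x hx]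

lemma dirD_crossConn (hF : IsFrame U e θ) {x : Euc 3} (hx : x ∈ U) (s : ℝ) (l i k : Fin 3) :
    dirD (fun y => crossConn e θ s i y (e k y)) (e l) x
      = connC (fun i j k => strD e θ l i j k x) (i + 1) (i + 2) k := by
  rw [dirD_congr hF.isOpen (fun y hy => crossConn_apply hF hy s i k) hx]
  have hs := fun i j k => (diffAt_of_contDiffOn hF.isOpen (contDiffOn_strC hF i j k) hx).hasFDerivAt
  simp only [connC]
  rw [dirD, fderiv_add_const]
  have h1 := (((((hs (i + 2) (i + 1) k).mul_const (-1)).add (hs k (i + 2) (i + 1))).add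
    (hs (i + 1) (i + 2) k)).const_mul (1 / 2)).fderiv
  rw [show fderiv ℝ (fun y => 1 / 2 * (strC e θ (i + 2) (i + 1) k y * -1
    + strC e θ k (i + 2) (i + 1) y + strC e θ (i + 1) (i + 2) k y)) x = _ from h1]
  simp [strD, dirD]
  ring

/-- In three dimensions the Ricci tensor determines the curvature, so the hypothesis means constant
sectional curvature `s²`. Adding the cross product with `s` changes the curvature by a term linear
in `s`, which is torsion and vanishes, and by a quadratic one, which cancels it. -/
lemma crossConn_flat (hF : IsFrame U e θ) {s : ℝ}
    (hR : ∀ x ∈ U, ∀ i j, ricC (fun i j k => strC e θ i j k x) (fun l i j k => strD e θ l i j k x) i j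
      = if i = j then 2 * s ^ 2 else 0) : FlatRotation U (crossConn e θ s) := by
  have hsm : ∀ i, ContDiffOn ℝ ∞ (crossConn e θ s i) U := by
    intro i
    have hs := contDiffOn_strC hF
    have hc : ∀ k, ContDiffOn ℝ ∞
        (fun x => connC (fun i j k => strC e θ i j k x) (i + 1) (i + 2) k) U := fun k =>
      contDiffOn_const.mul ((((hs _ _ _).mul contDiffOn_const).add (hs _ _ _)).add (hs _ _ _))
    exact ContDiffOn.add (ContDiffOn.sum fun k _ => (hc k).smul (hF.θ_smooth k))
      ((hF.θ_smooth i).const_smul s)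
  have key : ∀ x ∈ U, ∀ i, ∀ j, dForm (crossConn e θ s i) x (e j x) (e (j + 1) x)
      = crossConn e θ s (i + 1) x (e j x) * crossConn e θ s (i + 2) x (e (j + 1) x)
        - crossConn e θ s (i + 1) x (e (j + 1) x) * crossConn e θ s (i + 2) x (e j x) := by
    intro x hx i j
    have r00 := hR x hx 0 0
    have r11 := hR x hx 1 1
    have r22 := hR x hx 2 2
    have r01 := hR x hx 0 1
    have r12 := hR x hx 1 2
    have r20 := hR x hx 2 0
    have r10 := hR x hx 1 0
    have r21 := hR x hx 2 1
    have r02 := hR x hx 0 2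
    have s0 := fun i j => strC_self (e := e) (θ := θ) i j x
    have s1 := fun i => congrFun (strC_swap (e := e) (θ := θ) i 1 0) x
    have s2 := fun i => congrFun (strC_swap (e := e) (θ := θ) i 2 1) x
    have s3 := fun i => congrFun (strC_swap (e := e) (θ := θ) i 0 2) x
    have t0 := fun l i j => strD_self (e := e) (θ := θ) l i j x
    have t1 := fun l i => strD_swap (e := e) (θ := θ) l i 1 0 x
    have t2 := fun l i => strD_swap (e := e) (θ := θ) l i 2 1 x
    have t3 := fun l i => strD_swap (e := e) (θ := θ) l i 0 2 x
    simp only [ricC, connC, Fin.sum_univ_three, s0, s1, s2, s3, t0, t1, t2, t3] at r00 r11 r22 r01 r12 r20 r10 r21 r02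
    simp at r00 r11 r22 r01 r12 r20 r10 r21 r02
    rw [dForm_frame hF (hsm i) hx, dirD_crossConn hF hx, dirD_crossConn hF hx]
    simp only [crossConn_apply hF hx, Fin.sum_univ_three, connC]
    -- Of the nine curvature components, the off-diagonal ones are single Ricci components up to
    -- sign, and the diagonal ones are half of a signed sum of the diagonal Ricci components.
    fin_cases i <;> fin_cases j
    all_goals
      simp [s0, s1, s2, s3, t0, t1, t2, t3]
      first
        | linear_combination r01 | linear_combination -r01 | linear_combination r10
        | linear_combination -r10 | linear_combination r02 | linear_combination -r02
        | linear_combination r20 | linear_combination -r20 | linear_combination r12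
        | linear_combination -r12 | linear_combination r21 | linear_combination -r21
        | linear_combination (r00 + r11 - r22) / 2 | linear_combination (r00 + r22 - r11) / 2
        | linear_combination (r22 + r11 - r00) / 2
  have hexp : ∀ x ∈ U, ∀ i X, crossConn e θ s i x X = crossConn e θ s i x (e 0 x) * θ 0 x X
      + crossConn e θ s i x (e 1 x) * θ 1 x X + crossConn e θ s i x (e 2 x) * θ 2 x X := by
    intro x hx i X
    conv_lhs => rw [← hF.expand x hx X]
    simp [Fin.sum_univ_three]
    ring
  have hd : ∀ x ∈ U, ∀ i X Y, dForm (crossConn e θ s i) x X Y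
      = crossConn e θ s (i + 1) x X * crossConn e θ s (i + 2) x Y
        - crossConn e θ s (i + 1) x Y * crossConn e θ s (i + 2) x X := by
    intro x hx i X Y
    have k0 := key x hx i 0
    have k1 := key x hx i 1
    have k2 := key x hx i 2
    simp only [zero_add, show (1 + 1 : Fin 3) = 2 from rfl, show (2 + 1 : Fin 3) = 0 from rfl]
      at k0 k1 k2
    rw [dForm_expand hF _ hx, k0, k1, k2, hexp x hx (i + 1) X,
      hexp x hx (i + 1) Y, hexp x hx (i + 2) X, hexp x hx (i + 2) Y]
    ring
  exact ⟨hF.isOpen, hsm, fun x hx => hd x hx 0, fun x hx => hd x hx 1, fun x hx => hd x hx 2⟩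

end

/-! ### Solutions with vanishing `h` and `B` -/

section

variable {U V : Set (Euc 3)} {e : Fin 3 → Euc 3 → Euc 3} {θ : Fin 3 → Euc 3 → Euc 3 →L[ℝ] ℝ}
  {γ : Euc 3 → Euc 3 →L[ℝ] Euc 3 →L[ℝ] ℝ} {h : Euc 3 → Euc 3 →L[ℝ] ℝ}
  {B T : Euc 3 → Euc 3 →L[ℝ] Euc 3 →L[ℝ] ℝ} {a : Fin 3 → Euc 3 → Euc 3 →L[ℝ] ℝ} {F Δ : ℝ}

lemma dForm_congr {n : ℕ} {U : Set (Euc n)} (hU : IsOpen U) {α β : Euc n → Euc n →L[ℝ] ℝ}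
    (h : ∀ x ∈ U, α x = β x) {x : Euc n} (hx : x ∈ U) (X Y : Euc n) :
    dForm α x X Y = dForm β x X Y := by
  have : α =ᶠ[nhds x] β := Filter.eventuallyEq_of_mem (hU.mem_nhds hx) h
  rw [dForm, dForm, this.fderiv_eq]

lemma dForm_add {n : ℕ} {α β : Euc n → Euc n →L[ℝ] ℝ} {x : Euc n} (hα : DifferentiableAt ℝ α x)
    (hβ : DifferentiableAt ℝ β x) (X Y : Euc n) :
    dForm (fun x => α x + β x) x X Y = dForm α x X Y + dForm β x X Y := by
  simp only [dForm, fderiv_fun_add hα hβ, _root_.add_apply]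
  ring

lemma dForm_smul {n : ℕ} {α : Euc n → Euc n →L[ℝ] ℝ} {f : Euc n → ℝ} {x : Euc n}
    (hf : DifferentiableAt ℝ f x) (hα : DifferentiableAt ℝ α x) (X Y : Euc n) :
    dForm (fun x => f x • α x) x X Y
      = fderiv ℝ f x X * α x Y - fderiv ℝ f x Y * α x X + f x * dForm α x X Y := by
  rw [dForm, (hf.hasFDerivAt.fun_smul hα.hasFDerivAt).fderiv, dForm]
  simp
  ring

/-- The exterior derivative of a parallel one-form. -/
lemma IsRotated.dForm_crossConn {s : ℝ} {z : Fin 3 → Euc 3 → ℝ}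
    (hz : IsRotated V (crossConn e θ s) z) (hF : IsFrame V e θ) {x : Euc 3} (hx : x ∈ V)
    (X Y : Euc 3) : dForm (fun x => z 0 x • θ 0 x + z 1 x • θ 1 x + z 2 x • θ 2 x) x X Y
      = -(2 * s) * (z 0 x * (θ 1 x X * θ 2 x Y - θ 1 x Y * θ 2 x X)
        + z 1 x * (θ 2 x X * θ 0 x Y - θ 2 x Y * θ 0 x X)
        + z 2 x * (θ 0 x X * θ 1 x Y - θ 0 x Y * θ 1 x X)) := by
  have hzd := fun i => (hz.hasFDerivAt i hx).differentiableAt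
  have hθd := fun i => diffAt_of_contDiffOn hF.isOpen (hF.θ_smooth i) hx
  have hd := fun i => (hzd i).fun_smul (hθd i)
  rw [dForm_add ((hd 0).fun_add (hd 1)) (hd 2), dForm_add (hd 0) (hd 1), dForm_smul (hzd 0) (hθd 0),
    dForm_smul (hzd 1) (hθd 1), dForm_smul (hzd 2) (hθd 2), dForm_expand hF (θ 0) hx,
    dForm_expand hF (θ 1) hx, dForm_expand hF (θ 2) hx]
  have hC : ∀ i j k, dForm (θ i) x (e j x) (e k x) = strC e θ i j k x := fun _ _ _ => rfl
  have s0 := fun i j => strC_self (e := e) (θ := θ) i j x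
  have s1 := fun i => congrFun (strC_swap (e := e) (θ := θ) i 1 0) x
  have s2 := fun i => congrFun (strC_swap (e := e) (θ := θ) i 2 1) x
  have s3 := fun i => congrFun (strC_swap (e := e) (θ := θ) i 0 2) x
  simp only [hz.d0 x hx, hz.d1 x hx, hz.d2 x hx, hC]
  simp [crossConn, Fin.sum_univ_three, connC, s0, s1, s2, s3]
  ring

/-- The norms of `h` and `B` are constant by homogeneity, so vanishing at one point propagates. -/
lemma LocalSolution.eq_zero (hL : LocalSolution U e θ γ h B F Δ) {p : Euc 3} (hp : p ∈ U)
    (h0 : h p = 0) (B0 : B p = 0) : (∀ x ∈ U, h x = 0) ∧ ∀ x ∈ U, B x = 0 := by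
  constructor
  · intro x hx
    by_contra hne
    have h1 := sq_sum_pos (hL.frame.exists_ne hx hne)
    rw [hL.normSq_const (α := h) (fun V φ hS => hS.h_inv) hp hx, h0] at h1
    simp at h1
  · intro x hx
    by_contra hne
    obtain ⟨i, hi⟩ : ∃ i, B x (e i x) ≠ 0 := by
      by_contra hc
      push Not at hc
      refine hne (ContinuousLinearMap.ext fun X => ?_)
      rw [← hL.frame.expand x hx X]
      simp [hc]
    have h1 : 0 < ∑ i, ∑ j, B x (e i x) (e j x) ^ 2 :=
      Finset.sum_pos' (fun i _ => Finset.sum_nonneg fun j _ => sq_nonneg _)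
        ⟨i, Finset.mem_univ i, sq_sum_pos (hL.frame.exists_ne hx hi)⟩
    rw [hL.normSq_tensor_const (T := B) invTensor_self hp hx, B0] at h1
    simp at h1

/-- Where `h` and `B` vanish, the horizon is locally a sphere, and carries a frame of Killing
fields. -/
theorem LocalSolution.exists_axial_of_zero (hL : LocalSolution U e θ γ h B F Δ) {p : Euc 3}
    (hp : p ∈ U) (h0 : h p = 0) (B0 : B p = 0) :
    ∃ V ⊆ U, IsOpen V ∧ p ∈ V ∧ ∃ f n, FieldFrame V f γ h B 0 0 ∧
      AxialFrame V f (fun i x => γ x (f i x)) 0 0 n F Δ ∧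
      ∀ x ∈ V, strC f (fun i x => γ x (f i x)) 1 0 1 x = 0 ∧
        strC f (fun i x => γ x (f i x)) 2 2 0 x = 0 ∧
        strC f (fun i x => γ x (f i x)) 2 0 1 x = strC f (fun i x => γ x (f i x)) 1 2 0 x := by
  obtain ⟨hh, hB⟩ := hL.eq_zero hp h0 B0
  -- The Einstein equation is now `Ric = (2/3) Δ² γ`, which equals `2 s² γ`.
  set s := Δ / √3 with hs
  have hs2 : s ^ 2 = Δ ^ 2 / 3 := by rw [hs, div_pow, Real.sq_sqrt (by norm_num)]
  have hflat : FlatRotation U (crossConn e θ s) := by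
    refine crossConn_flat hL.frame fun x hx i j => ?_
    have hE := NearHorizon.frameEqs hL.frame hL.h_smooth hL.B_smooth hL.B_alt hL.metric hL.solves
      (H := 0) (b := 0) (fun x hx i => by simp [hh x hx]) (fun x hx i => by
        obtain ⟨d0, d1, d2⟩ := dualForm_apply (B := B) hL.frame hx
        fin_cases i <;> simp [d0, d1, d2, hB x hx]) hx
    rw [hE.ric i j, hs2]
    simp
    split_ifs <;> ring
  -- Two orthonormal parallel sections suffice, since their cross product is the third. The
  -- resulting frame satisfies `dθ^i = -2 s θ^{i+1} ∧ θ^{i+2}`, and any leg of it can serve as the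
  -- axis.
  obtain ⟨V₁, hV₁, hp₁, z₁, hz₁, hzp₁⟩ := hflat.exists_rotated hp ![0, 1, 0]
  obtain ⟨V₂, hV₂, hp₂, z₂, hz₂, hzp₂⟩ := hflat.exists_rotated hp ![0, 0, 1]
  obtain ⟨r, hr, hball⟩ := Metric.isOpen_iff.1 (hz₁.isOpen.inter hz₂.isOpen) p ⟨hp₁, hp₂⟩
  set V := Metric.ball p r
  have hVo : IsOpen V := Metric.isOpen_ball
  have hpV : p ∈ V := Metric.mem_ball_self hr
  have hVU : V ⊆ U := fun x hx => hV₁ (hball hx).1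
  have hVc : IsPreconnected V := (convex_ball p r).isPreconnected
  replace hz₁ := hz₁.mono hVo fun x hx => (hball hx).1
  replace hz₂ := hz₂.mono hVo fun x hx => (hball hx).2
  have n11 := fun {x} (hx : x ∈ V) => hz₁.inner_const hz₁ hVc hpV hx
  have n12 := fun {x} (hx : x ∈ V) => hz₁.inner_const hz₂ hVc hpV hx
  have n22 := fun {x} (hx : x ∈ V) => hz₂.inner_const hz₂ hVc hpV hx
  simp [hzp₁, hzp₂] at n11 n12 n22
  set Z : Fin 3 → Fin 3 → Euc 3 → ℝ := ![![fun x => z₁ 1 x * z₂ 2 x - z₁ 2 x * z₂ 1 x,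
    fun x => z₁ 2 x * z₂ 0 x - z₁ 0 x * z₂ 2 x, fun x => z₁ 0 x * z₂ 1 x - z₁ 1 x * z₂ 0 x], z₁, z₂]
    with hZd
  have hZ : ∀ i, IsRotated V (crossConn e θ s) (Z i) := by
    intro i; fin_cases i
    exacts [hz₁.cross hz₂, hz₁, hz₂]
  have hZZ : ∀ x ∈ V, ∀ i j, Z i 0 x * Z j 0 x + Z i 1 x * Z j 1 x + Z i 2 x * Z j 2 x
      = if i = j then 1 else 0 := by
    intro x hx i j
    rw [(hZ i).inner_const (hZ j) hVc hpV hx]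
    fin_cases i <;> fin_cases j <;> simp [hZd, hzp₁, hzp₂]
  have hL' := hL.mono hVo hVU
  have hF := hL'.frame
  set f : Fin 3 → Euc 3 → Euc 3 := fun i x => Z i 0 x • e 0 x + Z i 1 x • e 1 x + Z i 2 x • e 2 x
  have hfγ : ∀ i, ∀ x ∈ V, γ x (f i x) = Z i 0 x • θ 0 x + Z i 1 x • θ 1 x + Z i 2 x • θ 2 x := by
    intro i x hx
    ext X
    rw [hL'.metric x hx]
    simp [f, Fin.sum_univ_three, hF.dual x hx]
  have hfs : ∀ i, ContDiffOn ℝ ∞ (f i) V := fun i =>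
    ((((hZ i).smooth 0).smul (hF.e_smooth 0)).add (((hZ i).smooth 1).smul (hF.e_smooth 1))).add
      (((hZ i).smooth 2).smul (hF.e_smooth 2))
  have hfo : ∀ x ∈ V, ∀ i j, γ x (f i x) (f j x) = if i = j then 1 else 0 := by
    intro x hx i j
    rw [hfγ i x hx, ← hZZ x hx i j]
    simp [f, hF.dual x hx]
  obtain ⟨hfF, hfm⟩ := hL'.riem.isFrame hfs hfo
  have hd : ∀ i, ∀ x ∈ V, ∀ X Y, dForm (fun x => γ x (f i x)) x X Y
      = -(2 * s) * (γ x (f (i + 1) x) X * γ x (f (i + 2) x) Y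
        - γ x (f (i + 1) x) Y * γ x (f (i + 2) x) X) := by
    intro i x hx X Y
    rw [dForm_congr hVo (hfγ i) hx, (hZ i).dForm_crossConn hF hx, hfγ _ x hx, hfγ _ x hx]
    congr 1
    have m11 := n11 hx
    have m12 := n12 hx
    have m22 := n22 hx
    have hc : ∀ k : Fin 3, Z i k x = Z (i + 1) (k + 1) x * Z (i + 2) (k + 2) x
        - Z (i + 1) (k + 2) x * Z (i + 2) (k + 1) x := by
      intro k
      fin_cases i <;> fin_cases k <;> simp [hZd]
      · linear_combination z₂ 0 x * m12 - z₁ 0 x * m22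
      · linear_combination z₂ 1 x * m12 - z₁ 1 x * m22
      · linear_combination z₂ 2 x * m12 - z₁ 2 x * m22
      · linear_combination z₁ 0 x * m12 - z₂ 0 x * m11
      · linear_combination z₁ 1 x * m12 - z₂ 1 x * m11
      · linear_combination z₁ 2 x * m12 - z₂ 2 x * m11
    have c0 := hc 0
    have c1 := hc 1
    have c2 := hc 2
    simp only [zero_add, show (1 + 1 : Fin 3) = 2 from rfl, show (2 + 1 : Fin 3) = 0 from rfl,
      show (1 + 2 : Fin 3) = 0 from rfl, show (2 + 2 : Fin 3) = 1 from rfl] at c0 c1 c2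
    rw [c0, c1, c2]
    simp
    ring
  have hFF : FieldFrame V f γ h B 0 0 := ⟨hfF, hfm, fun x hx X => by simp [hh x (hVU hx)],
    fun x hx X Y => by simp [hB x (hVU hx)]⟩
  have hC : ∀ i j k, ∀ x ∈ V, strC f (fun i x => γ x (f i x)) i j k x
      = -(2 * s) * ((if i + 1 = j then 1 else 0) * (if i + 2 = k then 1 else 0)
        - (if i + 1 = k then 1 else 0) * (if i + 2 = j then 1 else 0)) := by
    intro i j k x hx
    rw [strC, hd i x hx]
    simp only [hfo x hx]
  refine ⟨V, hVU, hVo, hpV, f, -(2 * s), hFF, ⟨hfF, fun x hx => hFF.frameEqs hL' hx, ?_, ?_, ?_⟩,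
    ?_⟩
  · intro x hx; rw [hC 0 0 1 x hx]; simp
  · intro x hx; rw [hC 0 2 0 x hx]; simp
  · intro x hx; rw [hC 0 1 2 x hx]; simp
  · intro x hx
    rw [hC 1 0 1 x hx, hC 2 2 0 x hx, hC 2 0 1 x hx, hC 1 2 0 x hx]
    simp [show (1 + 1 : Fin 3) = 2 from rfl, show (2 + 1 : Fin 3) = 0 from rfl,
      show (1 + 2 : Fin 3) = 0 from rfl, show (2 + 2 : Fin 3) = 1 from rfl]

/-- Each homogeneous solution is locally a circle bundle. -/
theorem LocalSolution.exists_bundle (hL : LocalSolution U e θ γ h B F Δ) {p : Euc 3} (hp : p ∈ U) :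
    ∃ V ⊆ U, IsOpen V ∧ p ∈ V ∧ ∃ f H b n τ, FieldFrame V f γ h B H b ∧
      BundleFrame V f (fun i x => γ x (f i x)) τ (-n) (H ^ 2 / 2 + 2 / 3 * b ^ 2 + 4 / 3 * Δ ^ 2) ∧
      F = H ^ 2 - (H ^ 2 / 2 + 2 / 3 * b ^ 2 + 4 / 3 * Δ ^ 2) ∧ b * n = Δ * H ∧
      n ^ 2 = H ^ 2 - 4 / 3 * b ^ 2 + 4 / 3 * Δ ^ 2 := by
  by_cases h0 : h p = 0 ∧ B p = 0
  · obtain ⟨V, hVU, hVo, hpV, f, n, hFF, hA, hC⟩ := hL.exists_axial_of_zero hp h0.1 h0.2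
    obtain ⟨τ, hτ⟩ := hA.bundleFrame (fun x hx => by rw [(hC x hx).1, (hC x hx).2.1])
      (fun x hx => ⟨(hC x hx).1, (hC x hx).2.2⟩) ⟨p, hpV⟩
    exact ⟨V, hVU, hVo, hpV, f, 0, 0, n, τ, hFF, hτ⟩
  · obtain ⟨V, hVU, hVo, hpV, f, H, b, n, hne, hFF, hA⟩ := hL.exists_axial hp h0
    obtain ⟨τ, hτ⟩ := hA.bundleFrame (fun x hx => hA.expansion hne hx)
      (fun x hx => hA.shear hne hx) ⟨p, hpV⟩
    exact ⟨V, hVU, hVo, hpV, f, H, b, n, τ, hFF, hτ⟩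

end

/-! ### Coordinates adapted to a bundle frame -/

section

variable {U V : Set (Euc 3)} {e : Fin 3 → Euc 3 → Euc 3} {θ : Fin 3 → Euc 3 → Euc 3 →L[ℝ] ℝ}
  {τ : Euc 3 → Euc 3 →L[ℝ] ℝ} {c lam : ℝ}

/-- The Poincaré lemma on a ball, where convexity provides the primitive. -/
lemma exists_primitive {p : Euc 3} {r : ℝ} {α : Euc 3 → Euc 3 →L[ℝ] ℝ}
    (hα : ContDiffOn ℝ ∞ α (Metric.ball p r))
    (hd : ∀ x ∈ Metric.ball p r, ∀ X Y, dForm α x X Y = 0) :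
    ∃ f : Euc 3 → ℝ, ContDiffOn ℝ ∞ f (Metric.ball p r) ∧ 
      ∀ x ∈ Metric.ball p r, fderiv ℝ f x = α x := by
  obtain ⟨f, hf⟩ := (convex_ball p r).exists_forall_hasFDerivAt_of_fderiv_symmetric
    Metric.isOpen_ball (hα.differentiableOn (by simp)) (fun x hx X Y => sub_eq_zero.1 (hd x hx X Y))
  refine ⟨f, (contDiffOn_infty_iff_fderiv_of_isOpen Metric.isOpen_ball).2
    ⟨fun x hx => (hf x hx).differentiableAt.differentiableWithinAt, ?_⟩, fun x hx => (hf x hx).fderiv⟩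
  exact hα.congr fun x hx => (hf x hx).fderiv

/-- The structure equations of a surface of curvature `lam`, with the coframe rescaled by `√lam`,
are the Maurer–Cartan equations of `SO(3)`. -/
lemma BundleFrame.flatRotation (hB : BundleFrame U e θ τ c lam) (hl : 0 < lam) :
    FlatRotation U ![τ, fun x => √lam • θ 1 x, fun x => √lam • θ 2 x] := by
  have hs : √lam * √lam = lam := Real.mul_self_sqrt hl.le
  have hsm : ∀ i, ∀ x ∈ U, ∀ X Y, dForm (fun x => √lam • θ i x) x X Y = √lam * dForm (θ i) x X Y := by
    intro i x hx X Y
    rw [dForm_smul (differentiableAt_const _)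
      (diffAt_of_contDiffOn hB.frame.isOpen (hB.frame.θ_smooth i) hx)]
    simp
  refine ⟨hB.frame.isOpen, fun i => ?_, ?_, ?_, ?_⟩
  · fin_cases i
    exacts [hB.τ_smooth, (hB.frame.θ_smooth 1).const_smul _, (hB.frame.θ_smooth 2).const_smul _]
  · intro x hx X Y
    simp [hB.dτ x hx]
    linear_combination -((θ 1 x X * θ 2 x Y - θ 1 x Y * θ 2 x X)) * hs
  · intro x hx X Y
    simp [hsm _ x hx, hB.d1 x hx]
    ring
  · intro x hx X Y
    simp [hsm _ x hx, hB.d2 x hx]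
    ring

/-- Coordinates in which a bundle frame takes its standard form. -/
theorem BundleFrame.exists_coords (hB : BundleFrame U e θ τ c lam) (hl : 0 < lam) {p : Euc 3}
    (hp : p ∈ U) : ∃ V ⊆ U, IsOpen V ∧ p ∈ V ∧ ∃ ψ t φ : Euc 3 → ℝ, ContDiffOn ℝ ∞ ψ V ∧
      ContDiffOn ℝ ∞ t V ∧ ContDiffOn ℝ ∞ φ V ∧ ∀ x ∈ V, (0 < t x ∧ t x < Real.pi) ∧
      (∀ X, fderiv ℝ ψ x X + c / lam * Real.cos (t x) * fderiv ℝ φ x X = θ 0 x X) ∧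
      (∀ X Y, (fderiv ℝ t x X * fderiv ℝ t x Y
        + Real.sin (t x) ^ 2 * (fderiv ℝ φ x X * fderiv ℝ φ x Y)) / lam
        = θ 1 x X * θ 1 x Y + θ 2 x X * θ 2 x Y) ∧
      ∀ X Y, 1 / lam * Real.sin (t x) * (fderiv ℝ t x X * fderiv ℝ φ x Y
        - fderiv ℝ φ x X * fderiv ℝ t x Y) = θ 1 x X * θ 2 x Y - θ 1 x Y * θ 2 x X := by
  have hs : √lam * √lam = lam := Real.mul_self_sqrt hl.le
  have hfl := hB.flatRotation hl
  -- The component `z 0` of a unit parallel section is the height function of the sphere, the future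
  -- `cos θ`. The initial value puts `p` on the equator, away from the poles.
  obtain ⟨W, hWU, hpW, z, hz, hzp⟩ := hfl.exists_rotated hp ![0, 0, 1]
  set a : Fin 3 → Euc 3 → Euc 3 →L[ℝ] ℝ := ![τ, fun x => √lam • θ 1 x, fun x => √lam • θ 2 x]
    with had
  have ha1 : ∀ x X, a 1 x X = √lam * θ 1 x X := fun x X => rfl
  have ha2 : ∀ x X, a 2 x X = √lam * θ 2 x X := fun x X => rfl
  have hWo : IsOpen (W ∩ z 0 ⁻¹' Set.Ioo (-1) 1) :=
    (hz.smooth 0).continuousOn.isOpen_inter_preimage hz.isOpen isOpen_Ioo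
  obtain ⟨r, hr, hball⟩ := Metric.isOpen_iff.1 hWo p ⟨hpW, by simp [hzp]⟩
  set V := Metric.ball p r with hVd
  have hVo : IsOpen V := Metric.isOpen_ball
  have hpV : p ∈ V := Metric.mem_ball_self hr
  have hVU : V ⊆ U := fun x hx => hWU (hball hx).1
  have hVc : IsPreconnected V := (convex_ball p r).isPreconnected
  replace hz := hz.mono hVo fun x hx => (hball hx).1
  have hn : ∀ x ∈ V, z 0 x * z 0 x + z 1 x * z 1 x + z 2 x * z 2 x = 1 := by
    intro x hx
    rw [hz.inner_const hz hVc hpV hx]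
    simp [hzp]
  have hw : ∀ x ∈ V, -1 < z 0 x ∧ z 0 x < 1 := fun x hx => (hball hx).2
  have hw2 : ∀ x ∈ V, 0 < 1 - z 0 x ^ 2 := fun x hx => by
    have := hw x hx; nlinarith
  -- Dividing `N` by `1 - z₀²` gives the closed form `β`, the differential of the azimuth up to
  -- sign, with `dz₀ ∧ β = lam θ^1 ∧ θ^2`.
  set N : Euc 3 → Euc 3 →L[ℝ] ℝ := fun x => z 1 x • a 1 x + z 2 x • a 2 x with hN
  have hNs : ContDiffOn ℝ ∞ N V := ((hz.smooth 1).smul ((hfl.smooth 1).mono hVU)).add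
    ((hz.smooth 2).smul ((hfl.smooth 2).mono hVU))
  set g : Euc 3 → ℝ := fun x => (1 - z 0 x ^ 2)⁻¹ with hg
  have hgs : ContDiffOn ℝ ∞ g V := ContDiffOn.inv (contDiffOn_const.sub ((hz.smooth 0).pow 2))
    fun x hx => (hw2 x hx).ne'
  set β : Euc 3 → Euc 3 →L[ℝ] ℝ := fun x => g x • N x with hβ
  have hβs : ContDiffOn ℝ ∞ β V := hgs.smul hNs
  have hdz : ∀ x ∈ V, ∀ X, fderiv ℝ (z 0) x X = a 1 x X * z 2 x - a 2 x X * z 1 x := hz.d0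
  have hdg : ∀ x ∈ V, ∀ X, fderiv ℝ g x X = 2 * z 0 x * g x ^ 2 * fderiv ℝ (z 0) x X := by
    intro x hx X
    have h1 := ((hz.hasFDerivAt 0 hx).pow 2).const_sub 1
    have h2 := (hasDerivAt_inv (hw2 x hx).ne').comp_hasFDerivAt x h1
    rw [show fderiv ℝ g x = _ from h2.fderiv]
    simp [g]
    ring
  have hdN : ∀ x ∈ V, ∀ X Y, dForm N x X Y = -2 * z 0 x * (a 1 x X * a 2 x Y - a 1 x Y * a 2 x X) := by
    intro x hx X Y
    have hzd := fun i => (hz.hasFDerivAt i hx).differentiableAt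
    have had := fun i => diffAt_of_contDiffOn hfl.isOpen (hfl.smooth i) (hVU hx)
    have hd := fun i => (hzd i).fun_smul (had i)
    rw [hN, dForm_add (hd 1) (hd 2), dForm_smul (hzd 1) (had 1), dForm_smul (hzd 2) (had 2),
      hfl.d1 x (hVU hx), hfl.d2 x (hVU hx), hz.d1 x hx, hz.d1 x hx, hz.d2 x hx, hz.d2 x hx]
    ring
  have hgw : ∀ x ∈ V, g x * (1 - z 0 x ^ 2) = 1 := fun x hx => inv_mul_cancel₀ (hw2 x hx).ne'
  have hNx : ∀ x X, N x X = z 1 x * a 1 x X + z 2 x * a 2 x X := fun x X => rfl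
  have hdβ : ∀ x ∈ V, ∀ X Y, dForm β x X Y = 0 := by
    intro x hx X Y
    rw [hβ, dForm_smul (diffAt_of_contDiffOn hVo hgs hx) (diffAt_of_contDiffOn hVo hNs hx), hdN x hx,
      hdg x hx, hdg x hx, hdz x hx, hdz x hx, hNx, hNx]
    have h1 := hgw x hx
    have h2 := hn x hx
    linear_combination 2 * z 0 x * g x * (a 1 x X * a 2 x Y - a 1 x Y * a 2 x X)
      * (h1 + g x * h2)
  have hβx : ∀ x X, β x X = g x * N x X := fun x X => rfl
  have hdw : ∀ x ∈ V, ∀ X Y, fderiv ℝ (z 0) x X * β x Y - fderiv ℝ (z 0) x Y * β x X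
      = a 1 x X * a 2 x Y - a 1 x Y * a 2 x X := by
    intro x hx X Y
    have h1 := hgw x hx
    have h2 := hn x hx
    rw [hdz x hx, hdz x hx, hβx, hβx, hNx, hNx]
    linear_combination (a 1 x X * a 2 x Y - a 1 x Y * a 2 x X) * (h1 + g x * h2)
  -- Since `d(z₀ β) = lam θ^1 ∧ θ^2` and `dθ^0 = -c θ^1 ∧ θ^2`, this correction makes `θ^0` closed;
  -- its primitive is `ψ`.
  have hηs : ContDiffOn ℝ ∞ (fun x => θ 0 x + (c / lam * z 0 x) • β x) V :=
    ((hB.frame.θ_smooth 0).mono hVU).add ((contDiffOn_const.mul (hz.smooth 0)).smul hβs)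
  have hdη : ∀ x ∈ V, ∀ X Y, dForm (fun x => θ 0 x + (c / lam * z 0 x) • β x) x X Y = 0 := by
    intro x hx X Y
    have hzd := (hz.hasFDerivAt 0 hx).const_mul (c / lam)
    have hβd := diffAt_of_contDiffOn hVo hβs hx
    rw [dForm_add (diffAt_of_contDiffOn hB.frame.isOpen (hB.frame.θ_smooth 0) (hVU hx))
      (hzd.differentiableAt.fun_smul hβd), dForm_smul hzd.differentiableAt hβd, hdβ x hx,
      hzd.fderiv, hB.d0 x (hVU hx)]
    simp only [_root_.smul_apply, smul_eq_mul]
    have h1 := hdw x hx X Y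
    simp only [ha1, ha2] at h1
    field_simp
    linear_combination c * h1 + c * (θ 1 x X * θ 2 x Y - θ 1 x Y * θ 2 x X) * hs
  obtain ⟨φ, hφs, hφ⟩ := exists_primitive hβs hdβ
  obtain ⟨ψ, hψs, hψ⟩ := exists_primitive hηs hdη
  have hsin : ∀ x ∈ V, Real.sin (Real.arccos (z 0 x)) = √(1 - z 0 x ^ 2) := fun x hx =>
    Real.sin_arccos _
  have hcos : ∀ x ∈ V, Real.cos (Real.arccos (z 0 x)) = z 0 x := fun x hx =>
    Real.cos_arccos (hw x hx).1.le (hw x hx).2.le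
  have hdt : ∀ x ∈ V, ∀ X, √(1 - z 0 x ^ 2) * fderiv ℝ (fun x => Real.arccos (z 0 x)) x X
      = -fderiv ℝ (z 0) x X := by
    intro x hx X
    have h1 := (Real.hasDerivAt_arccos (hw x hx).1.ne' (hw x hx).2.ne).comp_hasFDerivAt x
      (hz.hasFDerivAt 0 hx)
    rw [show fderiv ℝ (fun x => Real.arccos (z 0 x)) x = _ from h1.fderiv]
    have := (Real.sqrt_pos.2 (hw2 x hx)).ne'
    simp
    field_simp
  -- The azimuth is negated because `dz₀ = -sin θ dθ`.
  refine ⟨V, hVU, hVo, hpV, ψ, fun x => Real.arccos (z 0 x), fun x => -φ x, hψs, ?_, hφs.neg,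
    fun x hx => ⟨⟨Real.arccos_pos.2 (hw x hx).2,
      Real.arccos_lt_pi.2 (hw x hx).1⟩, fun X => ?_, fun X Y => ?_, fun X Y => ?_⟩⟩
  · intro x hx
    exact (Real.contDiffAt_arccos (hw x hx).1.ne' (hw x hx).2.ne).comp_contDiffWithinAt x
      (hz.smooth 0 x hx)
  · rw [hcos x hx, hψ x hx, fderiv_fun_neg, hφ x hx]
    simp
  · have h1 := hdt x hx X
    have h2 := hdt x hx Y
    have h3 := Real.sq_sqrt (hw2 x hx).le
    have h4 := hgw x hx
    have h5 := hn x hx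
    rw [hdz x hx, ha1, ha2] at h1 h2
    rw [hsin x hx, fderiv_fun_neg, hφ x hx]
    simp only [_root_.neg_apply, hβx, hNx, ha1, ha2] at h1 h2 ⊢
    set S := √(1 - z 0 x ^ 2)
    have hS : 0 < S := Real.sqrt_pos.2 (hw2 x hx)
    set dX := fderiv ℝ (fun x => Real.arccos (z 0 x)) x X
    set dY := fderiv ℝ (fun x => Real.arccos (z 0 x)) x Y
    rw [div_eq_iff hl.ne']
    have h6 : S ^ 2 * (dX * dY) = lam * ((θ 1 x X * z 2 x - θ 2 x X * z 1 x)
        * (θ 1 x Y * z 2 x - θ 2 x Y * z 1 x)) := by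
      linear_combination h1 * (S * dY) - √lam * (θ 1 x X * z 2 x - θ 2 x X * z 1 x) * h2
        + ((θ 1 x X * z 2 x - θ 2 x X * z 1 x) * (θ 1 x Y * z 2 x - θ 2 x Y * z 1 x)) * hs
    have h7 : g x * S ^ 2 = 1 := by rw [h3, h4]
    set P := z 1 x
    set Q := z 2 x
    linear_combination g x * h6 - dX * dY * h7
      + g x * lam * ((P * θ 1 x X + Q * θ 2 x X) * (P * θ 1 x Y + Q * θ 2 x Y)) * h7
      + S ^ 2 * g x ^ 2 * ((P * θ 1 x X + Q * θ 2 x X) * (P * θ 1 x Y + Q * θ 2 x Y)) * hs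
      + lam * (θ 1 x X * θ 1 x Y + θ 2 x X * θ 2 x Y) * (h4 + g x * h5)
  · have h1 := hdt x hx X
    have h2 := hdt x hx Y
    have h4 := hgw x hx
    have h5 := hn x hx
    rw [hdz x hx, ha1, ha2] at h1 h2
    rw [hsin x hx, fderiv_fun_neg, hφ x hx]
    simp only [_root_.neg_apply, hβx, hNx, ha1, ha2] at h1 h2 ⊢
    set S := √(1 - z 0 x ^ 2)
    set dX := fderiv ℝ (fun x => Real.arccos (z 0 x)) x X
    set dY := fderiv ℝ (fun x => Real.arccos (z 0 x)) x Y
    set P := z 1 x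
    set Q := z 2 x
    rw [mul_assoc, one_div_mul_eq_div, div_eq_iff hl.ne']
    linear_combination (-(g x) * √lam * (P * θ 1 x Y + Q * θ 2 x Y)) * h1
      + g x * √lam * (P * θ 1 x X + Q * θ 2 x X) * h2
      + g x * (P ^ 2 + Q ^ 2) * (θ 1 x X * θ 2 x Y - θ 1 x Y * θ 2 x X) * hs
      + lam * (θ 1 x X * θ 2 x Y - θ 1 x Y * θ 2 x X) * (h4 + g x * h5)

end

/-! ### Adapted coordinates and the local isometry -/

/-- The coordinates `Ψ = (ψ, θ, φ)` bring `γ`, `h`, `B` into the form that they have in the explicit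
families. -/
structure Adapted (W : Set (Euc 3)) (Ψ : Euc 3 → Euc 3) (γ : Euc 3 → Euc 3 →L[ℝ] Euc 3 →L[ℝ] ℝ)
    (h : Euc 3 → Euc 3 →L[ℝ] ℝ) (B : Euc 3 → Euc 3 →L[ℝ] Euc 3 →L[ℝ] ℝ) (lam c H b : ℝ) :
    Prop where
  isOpen : IsOpen W
  smooth : ContDiffOn ℝ ∞ Ψ W
  range : ∀ x ∈ W, 0 < Ψ x 1 ∧ Ψ x 1 < Real.pi
  metric : ∀ x ∈ W, ∀ X Y, γ x X Y
    = (fderiv ℝ Ψ x X 0 + c / lam * Real.cos (Ψ x 1) * fderiv ℝ Ψ x X 2)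
      * (fderiv ℝ Ψ x Y 0 + c / lam * Real.cos (Ψ x 1) * fderiv ℝ Ψ x Y 2)
      + (fderiv ℝ Ψ x X 1 * fderiv ℝ Ψ x Y 1
        + Real.sin (Ψ x 1) ^ 2 * (fderiv ℝ Ψ x X 2 * fderiv ℝ Ψ x Y 2)) / lam
  h_eq : ∀ x ∈ W, ∀ X, h x X
    = H * (fderiv ℝ Ψ x X 0 + c / lam * Real.cos (Ψ x 1) * fderiv ℝ Ψ x X 2)
  B_eq : ∀ x ∈ W, ∀ X Y, B x X Y = b / lam * Real.sin (Ψ x 1)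
    * (fderiv ℝ Ψ x X 1 * fderiv ℝ Ψ x Y 2 - fderiv ℝ Ψ x X 2 * fderiv ℝ Ψ x Y 1)

section

variable {U V W : Set (Euc 3)} {e : Fin 3 → Euc 3 → Euc 3} {θ : Fin 3 → Euc 3 → Euc 3 →L[ℝ] ℝ}
  {γ γ' : Euc 3 → Euc 3 →L[ℝ] Euc 3 →L[ℝ] ℝ} {h h' : Euc 3 → Euc 3 →L[ℝ] ℝ}
  {B B' : Euc 3 → Euc 3 →L[ℝ] Euc 3 →L[ℝ] ℝ} {F Δ lam c H b : ℝ} {τ : Euc 3 → Euc 3 →L[ℝ] ℝ}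
  {Ψ φ : Euc 3 → Euc 3}

/-- Adapted coordinates are pulled back by smooth maps. -/
lemma Adapted.comp (hΨ : Adapted W Ψ γ h B lam c H b) (hV : IsOpen V) (hφ : ContDiffOn ℝ ∞ φ V)
    (hVW : Set.MapsTo φ V W)
    (hγ : ∀ x ∈ V, ∀ X Y, γ' x X Y = γ (φ x) (fderiv ℝ φ x X) (fderiv ℝ φ x Y))
    (hh : ∀ x ∈ V, ∀ X, h' x X = h (φ x) (fderiv ℝ φ x X))
    (hB : ∀ x ∈ V, ∀ X Y, B' x X Y = B (φ x) (fderiv ℝ φ x X) (fderiv ℝ φ x Y)) :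
    Adapted V (Ψ ∘ φ) γ' h' B' lam c H b := by
  have hd : ∀ x ∈ V, ∀ X, fderiv ℝ (Ψ ∘ φ) x X = fderiv ℝ Ψ (φ x) (fderiv ℝ φ x X) := by
    intro x hx X
    rw [fderiv_comp x (diffAt_of_contDiffOn hΨ.isOpen hΨ.smooth (hVW hx))
      (diffAt_of_contDiffOn hV hφ hx), ContinuousLinearMap.comp_apply]
  refine ⟨hV, hΨ.smooth.comp hφ hVW, fun x hx => hΨ.range _ (hVW hx), fun x hx X Y => ?_,
    fun x hx X => ?_, fun x hx X Y => ?_⟩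
  · rw [hγ x hx, hΨ.metric _ (hVW hx), hd x hx, hd x hx]; rfl
  · rw [hh x hx, hΨ.h_eq _ (hVW hx), hd x hx]; rfl
  · rw [hB x hx, hΨ.B_eq _ (hVW hx), hd x hx, hd x hx]; rfl

lemma BundleFrame.exists_adapted (hB : BundleFrame U e θ τ c lam) (hl : 0 < lam)
    (hγ : ∀ x ∈ U, ∀ X Y, γ x X Y = ∑ i, θ i x X * θ i x Y)
    (hh : ∀ x ∈ U, ∀ X, h x X = H * θ 0 x X)
    (hb : ∀ x ∈ U, ∀ X Y, B x X Y = b * (θ 1 x X * θ 2 x Y - θ 1 x Y * θ 2 x X))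
    {p : Euc 3} (hp : p ∈ U) :
    ∃ W ⊆ U, p ∈ W ∧ ∃ Ψ, Adapted W Ψ γ h B lam c H b := by
  obtain ⟨V, hVU, hVo, hpV, ψ, t, φ, hψ, ht, hφ, hc⟩ := hB.exists_coords hl hp
  set Ψ : Euc 3 → Euc 3 := fun x => WithLp.toLp 2 ![ψ x, t x, φ x] with hΨ
  have hs : ContDiffOn ℝ ∞ Ψ V := by
    rw [contDiffOn_euclidean]
    intro i; fin_cases i
    exacts [hψ, ht, hφ]
  have hd : ∀ x ∈ V, ∀ X i, fderiv ℝ Ψ x X i = fderiv ℝ (fun x => Ψ x i) x X := by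
    intro x hx X i
    have h1 : HasFDerivAt (fun x => Ψ x i) _ x :=
      (coordL i).hasFDerivAt.comp x (diffAt_of_contDiffOn hVo hs hx).hasFDerivAt
    rw [h1.fderiv]; rfl
  have d0 : ∀ x ∈ V, ∀ X, fderiv ℝ Ψ x X 0 = fderiv ℝ ψ x X := fun x hx X => hd x hx X 0
  have d1 : ∀ x ∈ V, ∀ X, fderiv ℝ Ψ x X 1 = fderiv ℝ t x X := fun x hx X => hd x hx X 1
  have d2 : ∀ x ∈ V, ∀ X, fderiv ℝ Ψ x X 2 = fderiv ℝ φ x X := fun x hx X => hd x hx X 2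
  have e1 : ∀ x, Ψ x 1 = t x := fun x => rfl
  refine ⟨V, hVU, hpV, Ψ, hVo, hs, fun x hx => (hc x hx).1, fun x hx X Y => ?_, fun x hx X => ?_,
    fun x hx X Y => ?_⟩ <;> obtain ⟨-, c0, c1, c2⟩ := hc x hx
  · rw [d0 x hx, d0 x hx, d1 x hx, d1 x hx, d2 x hx, d2 x hx, e1, c1, c0, c0, hγ x (hVU hx),
      Fin.sum_univ_three]
    ring
  · rw [d0 x hx, d2 x hx, e1, c0, hh x (hVU hx)]
  · rw [d1 x hx, d1 x hx, d2 x hx, d2 x hx, e1, hb x (hVU hx), ← c2]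
    ring

/-- The constants of a homogeneous solution are those of one of the two families. -/
theorem LocalSolution.exists_adapted (hL : LocalSolution U e θ γ h B F Δ) {p : Euc 3} (hp : p ∈ U)
    (hne : ¬ (h p = 0 ∧ Δ = 0 ∧ B p = 0)) :
    ∃ W ⊆ U, p ∈ W ∧ ∃ Ψ, 
      (∃ σ k q : ℝ, (σ = 1 ∨ σ = -1) ∧ ¬ (k = 0 ∧ q = 0) ∧ Δ = σ * q ∧
        F = k ^ 2 - (k ^ 2 / 2 + 2 * q ^ 2) ∧ 0 < k ^ 2 / 2 + 2 * q ^ 2 ∧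
        Adapted W Ψ γ h B (k ^ 2 / 2 + 2 * q ^ 2) k k q) ∨
      (∃ σ D q : ℝ, (σ = 1 ∨ σ = -1) ∧ ¬ (D = 0 ∧ q = 0) ∧ Δ = √3 / 2 * D ∧
        F = (σ * (2 / √3) * q) ^ 2 - (D ^ 2 + 4 / 3 * q ^ 2) ∧ 0 < D ^ 2 + 4 / 3 * q ^ 2 ∧
        Adapted W Ψ γ h B (D ^ 2 + 4 / 3 * q ^ 2) D (σ * (2 / √3) * q) q) := by
  obtain ⟨V, hVU, hVo, hpV, f, H, b, n, τ, hFF, hB, hF, hbn, hn⟩ := hL.exists_bundle hp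
  set lam := H ^ 2 / 2 + 2 / 3 * b ^ 2 + 4 / 3 * Δ ^ 2 with hlam
  have hz : ¬ (H = 0 ∧ b = 0 ∧ Δ = 0) := by
    rintro ⟨rfl, rfl, hΔ⟩
    refine hne ⟨?_, hΔ, ?_⟩
    · ext X; simp [hFF.h_eq p hpV]
    · ext X Y; simp [hFF.B_eq p hpV]
  have hl : 0 < lam := by
    by_contra hc
    refine hz ⟨?_, ?_, ?_⟩ <;> refine pow_eq_zero_iff two_ne_zero |>.1 ?_ <;>
      nlinarith [sq_nonneg H, sq_nonneg b, sq_nonneg Δ]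
  -- The value `s = -1` exchanges `e_1` and `e_2`, which reverses both `n` and `b`. So one relative
  -- sign can be chosen freely.
  have hA : ∀ s : ℝ, (s = 1 ∨ s = -1) → ∃ W ⊆ U, p ∈ W ∧ ∃ Ψ,
      Adapted W Ψ γ h B lam (-(s * n)) H (s * b) := by
    rintro s (rfl | rfl)
    · obtain ⟨W, hWV, hpW, Ψ, hΨ⟩ := hB.exists_adapted hl hFF.metric hFF.h_eq hFF.B_eq hpV
      exact ⟨W, hWV.trans hVU, hpW, Ψ, by simpa using hΨ⟩
    · obtain ⟨W, hWV, hpW, Ψ, hΨ⟩ := hB.swap.exists_adapted (γ := γ) (h := h) (B := B) (H := H)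
        (b := -b) hl (fun x hx X Y => by
          rw [hFF.metric x hx]
          simp [Fin.sum_univ_three]
          ring) (fun x hx X => by simp [hFF.h_eq x hx]) (fun x hx X Y => by
          rw [hFF.B_eq x hx]
          simp
          ring) hpV
      exact ⟨W, hWV.trans hVU, hpW, Ψ, by simpa using hΨ⟩
  have h3 : √3 * √3 = 3 := Real.mul_self_sqrt (by norm_num)
  have h3' : 0 < √3 := by positivity
  -- Squaring `b n = Δ H` and inserting `n²` yields a product; each factor is one of the families.
  have hprod : (b ^ 2 - Δ ^ 2) * (H ^ 2 - 4 / 3 * b ^ 2) = 0 := by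
    linear_combination -(b ^ 2) * hn + (b * n + Δ * H) * hbn
  have hchoose : ∀ x y : ℝ, x ^ 2 = y ^ 2 → ∃ s : ℝ, (s = 1 ∨ s = -1) ∧ y = s * x := by
    intro x y hxy
    rcases sq_eq_sq_iff_eq_or_eq_neg.1 hxy with h | h
    · exact ⟨1, Or.inl rfl, by linarith⟩
    · exact ⟨-1, Or.inr rfl, by linarith⟩
  rcases mul_eq_zero.1 hprod with hc | hc
  -- Here `b² = Δ²` and hence `n² = H²`. The orientation `s` makes the bundle constant equal to `H =
  -- k`, and `σ` is the sign left between `Δ` and `q = s b`.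
  · obtain ⟨s, hs, hsn⟩ := hchoose (-n) H (by linear_combination hn - 4 / 3 * hc)
    obtain ⟨W, hWU, hpW, Ψ, hΨ⟩ := hA s hs
    have hs2 : s ^ 2 = 1 := by rcases hs with rfl | rfl <;> norm_num
    obtain ⟨σ, hσ, hσb⟩ := hchoose (s * b) Δ (by linear_combination b ^ 2 * hs2 + hc)
    have hl' : lam = H ^ 2 / 2 + 2 * (s * b) ^ 2 := by
      rw [hlam]; linear_combination -(4 / 3) * hc - 2 * b ^ 2 * hs2
    refine ⟨W, hWU, hpW, Ψ, Or.inl ⟨σ, H, s * b, hσ, ?_, hσb, ?_, ?_, ?_⟩⟩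
    · rintro ⟨h1, h2⟩
      have hb : b = 0 := by rcases hs with rfl | rfl <;> simpa using h2
      exact hz ⟨h1, hb, by rw [hσb, h2, mul_zero]⟩
    · rw [← hl', hF]
    · rw [← hl']; exact hl
    · rw [← hl']
      convert hΨ using 1
      rw [hsn]; ring
  -- Here `H² = (4/3) b²` and hence `n² = (4/3) Δ² = D²`. Now `s` matches `n` with `D`, and `σ` is
  -- the sign left in `H`.
  · set D := 2 / √3 * Δ with hD
    have hD2 : D ^ 2 = 4 / 3 * Δ ^ 2 := by
      rw [hD, mul_pow, div_pow, sq (√3), h3]; norm_num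
    obtain ⟨s, hs, hsn⟩ := hchoose (-n) D (by linear_combination hn + hc - hD2)
    obtain ⟨W, hWU, hpW, Ψ, hΨ⟩ := hA s hs
    have hs2 : s ^ 2 = 1 := by rcases hs with rfl | rfl <;> norm_num
    have h4 : (2 / √3) ^ 2 = 4 / 3 := by rw [div_pow, sq (√3), h3]; norm_num
    obtain ⟨σ, hσ, hσb⟩ := hchoose (2 / √3 * (s * b)) H
      (by linear_combination (s * b) ^ 2 * h4 + 4 / 3 * b ^ 2 * hs2 - hc)
    have hH : H = σ * (2 / √3) * (s * b) := by rw [hσb]; ring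
    have hl' : lam = D ^ 2 + 4 / 3 * (s * b) ^ 2 := by
      rw [hlam, hD2]; linear_combination hc / 2 - 4 / 3 * b ^ 2 * hs2
    refine ⟨W, hWU, hpW, Ψ, Or.inr ⟨σ, D, s * b, hσ, ?_, ?_, ?_, ?_, ?_⟩⟩
    · rintro ⟨h1, h2⟩
      have hb : b = 0 := by rcases hs with rfl | rfl <;> simpa using h2
      refine hz ⟨by rw [hH, h2, mul_zero], hb, ?_⟩
      rw [h1] at hD2
      nlinarith
    · rw [hD]; field_simp
    · rw [← hl', hF, ← hH]
    · rw [← hl']; exact hl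
    · rw [← hl', ← hH]
      convert hΨ using 1
      rw [hsn]; ring

/-- Adapted coordinates give a local isometry with the model. -/
theorem Adapted.exists_isometry (hΨ : Adapted W Ψ γ h B lam c H b)
    (hpos : ∀ x ∈ W, ∀ X, X ≠ 0 → 0 < γ x X X) {x : Euc 5} (hx : hor x ∈ W) :
    ∃ Φ : OpenPartialHomeomorph (Euc 5) (Euc 5), x ∈ Φ.source ∧ Φ.source ⊆ hor ⁻¹' W ∧
      Φ.target ⊆ modelDom ∧ ContDiffOn ℝ ∞ Φ Φ.source ∧ ContDiffOn ℝ ∞ Φ.symm Φ.target ∧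
      ∀ y ∈ Φ.source, ∀ X Y : Euc 5,
        (bundleFields lam c H Δ b).metric (Φ y) (fderiv ℝ Φ y X) (fderiv ℝ Φ y Y)
          = (localFields (fun x X Y => γ x X Y) h (H ^ 2 - lam) Δ B).metric y X Y ∧
        (bundleFields lam c H Δ b).maxwell (Φ y) (fderiv ℝ Φ y X) (fderiv ℝ Φ y Y)
          = (localFields (fun x X Y => γ x X Y) h (H ^ 2 - lam) Δ B).maxwell y X Y := by
  -- The coordinates `v` and `r` are kept. Expanding the square of `θ^0 + H r dv` produces the cross
  -- term `2 r dv h` and `H² r² dv²`, whence `F = H² - lam`.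
  set P : Euc 5 → Euc 5 := fun x => x 0 • coordVec 0 + x 1 • coordVec 1 + liftL (Ψ (hor x)) with hP
  have hWo : IsOpen (hor ⁻¹' W) := hΨ.isOpen.preimage horL.continuous
  have hPs : ContDiffOn ℝ ∞ P (hor ⁻¹' W) :=
    ((((coordL 0).contDiff.smul contDiff_const).add
      ((coordL 1).contDiff.smul contDiff_const)).contDiffOn).add
      (liftL.contDiff.comp_contDiffOn (contDiffOn_comp_hor hΨ.smooth))
  have hPd : ∀ y ∈ hor ⁻¹' W, ∀ X, fderiv ℝ P y X
      = X 0 • coordVec 0 + X 1 • coordVec 1 + liftL (fderiv ℝ Ψ (hor y) (hor X)) := by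
    intro y hy X
    have h1 : HasFDerivAt P _ y := (((coordL 0).hasFDerivAt.smul_const (coordVec 0)).add
      ((coordL 1).hasFDerivAt.smul_const (coordVec 1))).add
      (liftL.hasFDerivAt.comp y ((diffAt_of_contDiffOn hΨ.isOpen hΨ.smooth hy).hasFDerivAt.comp y
        horL.hasFDerivAt))
    rw [h1.fderiv]
    simp
  -- By its adapted form, `γ` vanishes on the kernel of the differential of `Ψ`; being positive
  -- definite it forces this kernel to be trivial.
  have hinj : ∀ y ∈ hor ⁻¹' W, ∀ X, fderiv ℝ P y X = 0 → X = 0 := by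
    intro y hy X hX
    rw [hPd y hy] at hX
    have h0 : X 0 = 0 := by simpa using congrArg (fun Z : Euc 5 => Z 0) hX
    have h1 : X 1 = 0 := by simpa using congrArg (fun Z : Euc 5 => Z 1) hX
    have h2 : fderiv ℝ Ψ (hor y) (hor X) = 0 := by
      simpa [show hor 0 = 0 from horL.map_zero] using congrArg hor hX
    have h3 : hor X = 0 := by
      by_contra hne
      have := hpos _ hy _ hne
      rw [hΨ.metric _ hy, h2] at this
      simp at this
    rw [eq_coordVec_add_liftL X, h0, h1, h3]
    simp
  have hequiv : ∀ y ∈ hor ⁻¹' W, ∃ L : Euc 5 ≃L[ℝ] Euc 5, HasFDerivAt P (L : Euc 5 →L[ℝ] Euc 5) y := by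
    intro y hy
    have hi : Function.Injective (fderiv ℝ P y).toLinearMap :=
      (injective_iff_map_eq_zero _).2 (hinj y hy)
    refine ⟨(LinearEquiv.ofInjectiveEndo _ hi).toContinuousLinearEquiv, ?_⟩
    exact (diffAt_of_contDiffOn hWo hPs hy).hasFDerivAt.congr_fderiv
      (ContinuousLinearMap.ext fun X => rfl)
  obtain ⟨L, hL⟩ := hequiv x hx
  have hPx := hPs.contDiffAt (hWo.mem_nhds hx)
  set Φ := (hPx.toOpenPartialHomeomorph P hL (by simp)).restrOpen (hor ⁻¹' W) hWo with hΦ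
  have hΦc : ⇑Φ = P := rfl
  have hsub : Φ.source ⊆ hor ⁻¹' W := fun y hy => hy.2
  refine ⟨Φ, ⟨hPx.mem_toOpenPartialHomeomorph_source hL (by simp), hx⟩, hsub, ?_, ?_, ?_, ?_⟩
  · intro z hz
    have h1 := Φ.map_target hz
    have h2 := hΨ.range _ (hsub h1)
    rw [← Φ.right_inv hz, hΦc]
    simp only [modelDom, Set.mem_ofPred_eq, hP]
    simpa [liftL_apply] using h2
  · rw [hΦc]; exact hPs.mono hsub
  · intro z hz
    have h1 := Φ.map_target hz
    obtain ⟨L', hL'⟩ := hequiv _ (hsub h1)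
    exact (Φ.contDiffAt_symm hz hL' (hPs.contDiffAt (hWo.mem_nhds (hsub h1)))).contDiffWithinAt
  · intro y hy X Y
    have hyW := hsub hy
    rw [hΦc, hPd y hyW, hPd y hyW]
    simp only [bundleFields, baseMetric, connection, localFields, hP]
    rw [hΨ.metric _ hyW, hΨ.h_eq _ hyW, hΨ.h_eq _ hyW, hΨ.B_eq _ hyW]
    simp [liftL_apply]
    ring

end

/-! ### Near-horizon data in a chart -/

section

open Bundle

variable {H : Type*} [TopologicalSpace H] [ChartedSpace (Euc 3) H] [IsManifold (𝓡 3) ∞ H]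
  {D : Data H} {e e' : OpenPartialHomeomorph H (Euc 3)}

/-- The differential of the inverse of a chart. -/
def chartT (e : OpenPartialHomeomorph H (Euc 3)) (y : Euc 3) :
    Euc 3 →L[ℝ] TangentSpace (𝓡 3) (e.symm y) := mfderiv (𝓡 3) (𝓡 3) e.symm y

/-- The pull-back of a bilinear form on a tangent space. -/
def pullBilin {p : H} (b : TangentSpace (𝓡 3) p →L[ℝ] TangentSpace (𝓡 3) p →L[ℝ] ℝ)
    (T : Euc 3 →L[ℝ] TangentSpace (𝓡 3) p) : Euc 3 →L[ℝ] Euc 3 →L[ℝ] ℝ :=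
  ContinuousLinearMap.bilinearComp (E := Euc 3) (F := Euc 3) (E' := Euc 3) (F' := Euc 3) b T T

/-- The metric in a chart. -/
def Data.chartγ (D : Data H) (e : OpenPartialHomeomorph H (Euc 3)) (y : Euc 3) :
    Euc 3 →L[ℝ] Euc 3 →L[ℝ] ℝ := pullBilin (D.γ.inner (e.symm y)) (chartT e y)

/-- The one-form `h` in a chart. -/
def Data.chartH (D : Data H) (e : OpenPartialHomeomorph H (Euc 3)) (y : Euc 3) : Euc 3 →L[ℝ] ℝ :=
  (D.h (e.symm y)).comp (chartT e y)

/-- The two-form `B` in a chart. -/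
def Data.chartB (D : Data H) (e : OpenPartialHomeomorph H (Euc 3)) (y : Euc 3) :
    Euc 3 →L[ℝ] Euc 3 →L[ℝ] ℝ := pullBilin (D.B (e.symm y)) (chartT e y)

/-- For constant `Δ` the term `r dΔ ∧ dv` of the Maxwell field is absent. -/
lemma Data.spacetime_eq {F Δ : ℝ} (hF : ∀ p, D.F p = F) (hΔ : ∀ p, D.Δ p = Δ) :
    D.spacetime e = localFields (fun x X Y => D.chartγ e x X Y) (D.chartH e) F Δ (D.chartB e) := by
  have hc : D.Δ = fun _ => Δ := funext hΔ
  rw [Data.spacetime, localFields]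
  congr 1
  · funext x X Y
    rw [hF]
    rfl
  · funext x X Y
    have h0 : ∀ Z, (show ℝ from mfderiv (𝓡 3) 𝓘(ℝ) D.Δ (pt e x) (tan e x Z)) = 0 := by
      intro Z
      rw [hc, mfderiv_const]
      rfl
    let G : ℝ → ℝ → ℝ := fun u v => D.Δ (pt e x) * (X 1 * Y 0 - X 0 * Y 1)
      + x 1 * (u * Y 0 - X 0 * v) + D.B (pt e x) (tan e x X) (tan e x Y)
    refine (congrArg₂ G (h0 X) (h0 Y)).trans ?_
    simp only [G, hΔ, zero_mul, mul_zero, sub_zero, add_zero]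
    rfl

lemma contMDiffOn_chart_symm (he : e ∈ atlas (Euc 3) H) :
    ContMDiffOn (𝓡 3) (𝓡 3) ∞ e.symm e.target :=
  contMDiffOn_symm_of_mem_maximalAtlas (IsManifold.subset_maximalAtlas he)

lemma contMDiffOn_chart (he : e ∈ atlas (Euc 3) H) : ContMDiffOn (𝓡 3) (𝓡 3) ∞ e e.source :=
  contMDiffOn_of_mem_maximalAtlas (IsManifold.subset_maximalAtlas he)

/-- Constant coordinate vectors are smooth sections along the inverse chart; evaluating a smooth
tensor field on them gives smooth components. -/
lemma contMDiffOn_chartT (he : e ∈ atlas (Euc 3) H) (X : Euc 3) :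
    ContMDiffOn (𝓡 3) ((𝓡 3).prod 𝓘(ℝ, Euc 3)) ∞
      (fun y => TotalSpace.mk' (Euc 3) (E := fun p : H => TangentSpace (𝓡 3) p) (e.symm y)
        (chartT e y X)) e.target := by
  have h1 := (contMDiffOn_chart_symm he).contMDiffOn_tangentMapWithin (m := ∞) (by simp)
    e.open_target.uniqueMDiffOn
  have h2 : ContMDiffOn (𝓡 3) ((𝓡 3).prod 𝓘(ℝ, Euc 3)) ∞
      (fun y : Euc 3 => (⟨y, X⟩ : TangentBundle (𝓡 3) (Euc 3))) e.target :=
    contMDiffOn_vectorSpace_iff_contDiffOn.2 contDiffOn_const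
  refine (h1.comp h2 (fun y hy => hy)).congr fun y hy => ?_
  simp only [Function.comp, tangentMapWithin, chartT, mfderivWithin_of_isOpen e.open_target hy]
  rfl

lemma contDiffOn_clm {U : Set (Euc 3)} {G : Type*} [NormedAddCommGroup G] [NormedSpace ℝ G]
    {α : Euc 3 → Euc 3 →L[ℝ] G} (h : ∀ X, ContDiffOn ℝ ∞ (fun x => α x X) U) :
    ContDiffOn ℝ ∞ α U := contDiffOn_clm_apply.2 h

lemma Data.contDiffOn_chartγ (he : e ∈ atlas (Euc 3) H) :
    ContDiffOn ℝ ∞ (D.chartγ e) e.target := by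
  refine contDiffOn_clm fun X => contDiffOn_clm fun Y => ?_
  have h1 : ContMDiffOn (𝓡 3) ((𝓡 3).prod 𝓘(ℝ, ℝ)) ∞ (fun y => TotalSpace.mk' ℝ
      (E := Bundle.Trivial H ℝ) (e.symm y)
      (D.γ.inner (e.symm y) (chartT e y X) (chartT e y Y))) e.target :=
    ContMDiffOn.clm_bundle_apply₂ (F₁ := Euc 3) (F₂ := Euc 3)
      (D.γ.contMDiff.comp_contMDiffOn (contMDiffOn_chart_symm he)) (contMDiffOn_chartT he X)
      (contMDiffOn_chartT he Y)
  intro y hy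
  have h2 := h1 y hy
  simp only [contMDiffWithinAt_totalSpace] at h2
  exact h2.2.contDiffWithinAt

lemma Data.contDiffOn_chartB (he : e ∈ atlas (Euc 3) H) :
    ContDiffOn ℝ ∞ (D.chartB e) e.target := by
  refine contDiffOn_clm fun X => contDiffOn_clm fun Y => ?_
  have h1 : ContMDiffOn (𝓡 3) ((𝓡 3).prod 𝓘(ℝ, ℝ)) ∞ (fun y => TotalSpace.mk' ℝ
      (E := Bundle.Trivial H ℝ) (e.symm y)
      (D.B (e.symm y) (chartT e y X) (chartT e y Y))) e.target :=
    ContMDiffOn.clm_bundle_apply₂ (F₁ := Euc 3) (F₂ := Euc 3)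
      (D.B_smooth.comp_contMDiffOn (contMDiffOn_chart_symm he)) (contMDiffOn_chartT he X)
      (contMDiffOn_chartT he Y)
  intro y hy
  have h2 := h1 y hy
  simp only [contMDiffWithinAt_totalSpace] at h2
  exact h2.2.contDiffWithinAt

lemma Data.contDiffOn_chartH (he : e ∈ atlas (Euc 3) H) :
    ContDiffOn ℝ ∞ (D.chartH e) e.target := by
  refine contDiffOn_clm fun X => ?_
  have h1 : ContMDiffOn (𝓡 3) ((𝓡 3).prod 𝓘(ℝ, ℝ)) ∞ (fun y => TotalSpace.mk' ℝ
      (E := Bundle.Trivial H ℝ) (e.symm y) (D.h (e.symm y) (chartT e y X))) e.target :=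
    ContMDiffOn.clm_bundle_apply (F₁ := Euc 3)
      (D.h_smooth.comp_contMDiffOn (contMDiffOn_chart_symm he)) (contMDiffOn_chartT he X)
  intro y hy
  have h2 := h1 y hy
  simp only [contMDiffWithinAt_totalSpace] at h2
  exact h2.2.contDiffWithinAt

lemma chartT_injective (he : e ∈ atlas (Euc 3) H) {y : Euc 3} (hy : y ∈ e.target) :
    Function.Injective (chartT e y) :=
  (mdifferentiable_of_mem_atlas (I := 𝓡 3) he).symm.mfderiv_injective hy

lemma chartT_surjective (he : e ∈ atlas (Euc 3) H) {y : Euc 3} (hy : y ∈ e.target) :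
    Function.Surjective (chartT e y) :=
  (mdifferentiable_of_mem_atlas (I := 𝓡 3) he).symm.mfderiv_surjective hy

lemma Data.isRiem (he : e ∈ atlas (Euc 3) H) : IsRiem e.target (D.chartγ e) where
  isOpen := e.open_target
  smooth := D.contDiffOn_chartγ he
  symm := fun x _ X Y => D.γ.symm (e.symm x) (chartT e x X) (chartT e x Y)
  pos := by
    intro x hx X hX
    have hne : chartT e x X ≠ 0 := fun h => hX (chartT_injective he hx (by rw [h, map_zero]))
    exact D.γ.pos (e.symm x) (chartT e x X) hne

/-- A diffeomorphism in charts. -/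
def chartMap (e e' : OpenPartialHomeomorph H (Euc 3)) (f : Diffeomorph (𝓡 3) (𝓡 3) H H ∞)
    (y : Euc 3) : Euc 3 := e' (f (e.symm y))

/-- The domain of a diffeomorphism in charts. -/
def chartDom (e e' : OpenPartialHomeomorph H (Euc 3)) (f : Diffeomorph (𝓡 3) (𝓡 3) H H ∞) :
    Set (Euc 3) := e.target ∩ (fun y => f (e.symm y)) ⁻¹' e'.source

variable {f : Diffeomorph (𝓡 3) (𝓡 3) H H ∞}

lemma contMDiffOn_comp_chart (he : e ∈ atlas (Euc 3) H) :
    ContMDiffOn (𝓡 3) (𝓡 3) ∞ (fun y => f (e.symm y)) e.target :=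
  f.contMDiff.comp_contMDiffOn (contMDiffOn_chart_symm he)

lemma isOpen_chartDom (he : e ∈ atlas (Euc 3) H) : IsOpen (chartDom e e' f) :=
  (contMDiffOn_comp_chart he).continuousOn.isOpen_inter_preimage e.open_target e'.open_source

lemma contDiffOn_chartMap (he : e ∈ atlas (Euc 3) H) (he' : e' ∈ atlas (Euc 3) H) :
    ContDiffOn ℝ ∞ (chartMap e e' f) (chartDom e e' f) :=
  contMDiffOn_iff_contDiffOn.1 ((contMDiffOn_chart he').comp
    ((contMDiffOn_comp_chart he).mono Set.inter_subset_left) fun _ hy => hy.2)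

lemma mapsTo_chartMap : Set.MapsTo (chartMap e e' f) (chartDom e e' f) e'.target :=
  fun _ hy => e'.map_source hy.2

lemma chart_symm_chartMap {y : Euc 3} (hy : y ∈ chartDom e e' f) :
    e'.symm (chartMap e e' f y) = f (e.symm y) := e'.left_inv hy.2

/-- The chain rule applied to the two factorizations of `f ∘ e.symm`, through `H` and through the
second chart. -/
lemma chartT_chartMap (he : e ∈ atlas (Euc 3) H) (he' : e' ∈ atlas (Euc 3) H) {y : Euc 3}
    (hy : y ∈ chartDom e e' f) (X : Euc 3) :
    (show Euc 3 from chartT e' (chartMap e e' f y) (fderiv ℝ (chartMap e e' f) y X))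
      = (show Euc 3 from mfderiv (𝓡 3) (𝓡 3) f (e.symm y) (chartT e y X)) := by
  have h1 : HasMFDerivAt (𝓡 3) (𝓡 3) (f ∘ e.symm) y
      ((mfderiv (𝓡 3) (𝓡 3) f (e.symm y)).comp (chartT e y)) :=
    HasMFDerivAt.comp y (f.mdifferentiable (by simp) _).hasMFDerivAt
      (mdifferentiableAt_atlas_symm he hy.1).hasMFDerivAt
  have h2 : HasMFDerivAt (𝓡 3) (𝓡 3) (e'.symm ∘ chartMap e e' f) y
      ((chartT e' (chartMap e e' f y)).comp (fderiv ℝ (chartMap e e' f) y)) :=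
    HasMFDerivAt.comp y (mdifferentiableAt_atlas_symm he' (mapsTo_chartMap hy)).hasMFDerivAt
      (diffAt_of_contDiffOn (isOpen_chartDom he) (contDiffOn_chartMap he he') hy).hasFDerivAt.hasMFDerivAt
  have h3 : f ∘ e.symm =ᶠ[nhds y] e'.symm ∘ chartMap e e' f :=
    Filter.eventuallyEq_of_mem ((isOpen_chartDom he).mem_nhds hy)
      fun z hz => (chart_symm_chartMap hz).symm
  exact (congrArg (fun L : Euc 3 →L[ℝ] Euc 3 => L X)
    (hasMFDerivAt_unique (h2.congr_of_eventuallyEq h3) h1))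

lemma Data.IsSymmetry.chart (hf : D.IsSymmetry f) (he : e ∈ atlas (Euc 3) H)
    (he' : e' ∈ atlas (Euc 3) H) {y : Euc 3} (hy : y ∈ chartDom e e' f) :
    (∀ X Y, D.chartγ e' (chartMap e e' f y) (fderiv ℝ (chartMap e e' f) y X)
      (fderiv ℝ (chartMap e e' f) y Y) = D.chartγ e y X Y) ∧
    (∀ X, D.chartH e' (chartMap e e' f y) (fderiv ℝ (chartMap e e' f) y X) = D.chartH e y X) ∧
    ∀ X Y, D.chartB e' (chartMap e e' f y) (fderiv ℝ (chartMap e e' f) y X)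
      (fderiv ℝ (chartMap e e' f) y Y) = D.chartB e y X Y := by
  have hT := chartT_chartMap he he' hy
  have hp := chart_symm_chartMap hy
  have cγ : ∀ {p q : H}, p = q → ∀ u v u' v' : Euc 3, u = u' → v = v' →
      D.γ.inner p u v = D.γ.inner q u' v' := by
    rintro p q rfl u v u' v' rfl rfl; rfl
  have cB : ∀ {p q : H}, p = q → ∀ u v u' v' : Euc 3, u = u' → v = v' →
      D.B p u v = D.B q u' v' := by
    rintro p q rfl u v u' v' rfl rfl; rfl
  have ch : ∀ {p q : H}, p = q → ∀ u u' : Euc 3, u = u' → D.h p u = D.h q u' := by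
    rintro p q rfl u u' rfl; rfl
  obtain ⟨-, -, h1, h2⟩ := hf (e.symm y)
  exact ⟨fun X Y => (cγ hp _ _ _ _ (hT X) (hT Y)).trans (h2 _ _).1,
    fun X => (ch hp _ _ (hT X)).trans (h1 _),
    fun X Y => (cB hp _ _ _ _ (hT X) (hT Y)).trans (h2 _ _).2⟩

lemma Data.IsHomogeneous.locallyHomogeneous (hD : D.IsHomogeneous) (he : e ∈ atlas (Euc 3) H) :
    LocallyHomogeneous e.target (D.chartγ e) (D.chartH e) (D.chartB e) := by
  intro p hp q hq
  obtain ⟨f, hf, hfq⟩ := hD (e.symm p) (e.symm q)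
  refine ⟨chartDom e e f, chartMap e e f, ⟨hp, ?_⟩, ?_, isOpen_chartDom he, Set.inter_subset_left,
    mapsTo_chartMap, contDiffOn_chartMap he he, fun y hy => (hf.chart he he hy).1,
    fun y hy => (hf.chart he he hy).2.1, fun y hy => (hf.chart he he hy).2.2⟩
  · change f (e.symm p) ∈ e.source
    rw [hfq]
    exact e.map_target hq
  · rw [chartMap, hfq, e.right_inv hq]

lemma LocallyHomogeneous.mono {U V : Set (Euc 3)} {γ : Euc 3 → Euc 3 →L[ℝ] Euc 3 →L[ℝ] ℝ}
    {h : Euc 3 → Euc 3 →L[ℝ] ℝ} {B : Euc 3 → Euc 3 →L[ℝ] Euc 3 →L[ℝ] ℝ}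
    (hU : LocallyHomogeneous U γ h B) (hV : IsOpen V) (hVU : V ⊆ U) :
    LocallyHomogeneous V γ h B := by
  intro p hp q hq
  obtain ⟨W, φ, hpW, rfl, hS⟩ := hU p (hVU hp) q (hVU hq)
  exact ⟨(W ∩ φ ⁻¹' V) ∩ V, φ, ⟨⟨hpW, hq⟩, hp⟩, rfl, hS.restrict hV⟩

/-- Homogeneous, nontrivial solutions are locally isometric to the explicit families. -/
theorem Data.classification (hD : D.IsHomogeneous) (hE : D.IsEinsteinMaxwell)
    (hne : ¬ D.IsTrivial) :
    (∃ σ k q : ℝ, (σ = 1 ∨ σ = -1) ∧ ¬ (k = 0 ∧ q = 0) ∧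
      D.LocallyIsometricTo (familyI σ k q) modelDom) ∨
    (∃ σ Δ q : ℝ, (σ = 1 ∨ σ = -1) ∧ ¬ (Δ = 0 ∧ q = 0) ∧
      D.LocallyIsometricTo (familyII σ Δ q) modelDom) := by
  simp only [Data.IsTrivial] at hne
  push Not at hne
  obtain ⟨p₀, hp₀⟩ := hne
  have hF : ∀ p, D.F p = D.F p₀ := by
    intro p
    obtain ⟨f, hf, rfl⟩ := hD p₀ p
    exact (hf p₀).1
  have hΔ : ∀ p, D.Δ p = D.Δ p₀ := by
    intro p
    obtain ⟨f, hf, rfl⟩ := hD p₀ p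
    exact (hf p₀).2.1
  set e₀ := chartAt (Euc 3) p₀
  have he₀ : e₀ ∈ atlas (Euc 3) H := chart_mem_atlas _ _
  have hp₀s : p₀ ∈ e₀.source := mem_chart_source _ _
  set y₀ := e₀ p₀
  have hy₀ : y₀ ∈ e₀.target := e₀.map_source hp₀s
  -- Any local orthonormal frame will do; the constant field only starts the Gram–Schmidt procedure.
  obtain ⟨V, hVU, hVo, hyV, -, fr, hfr, hm, -⟩ := (D.isRiem he₀).exists_frame₁
    (contDiffOn_const (c := coordVec 0)) hy₀ (fun h => by simpa using congrArg (fun Z : Euc 3 => Z 0) h)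
  have hsol : SolvesEinsteinMaxwell (localFields (fun x X Y => D.chartγ e₀ x X Y) (D.chartH e₀)
      (D.F p₀) (D.Δ p₀) (D.chartB e₀)) (hor ⁻¹' e₀.target) := by
    rw [← D.spacetime_eq hF hΔ]
    exact hE e₀ he₀
  have hL : LocalSolution V fr (fun i x => D.chartγ e₀ x (fr i x)) (D.chartγ e₀) (D.chartH e₀)
      (D.chartB e₀) (D.F p₀) (D.Δ p₀) :=
    { riem := (D.isRiem he₀).mono hVo hVU
      frame := hfr
      metric := hm
      h_smooth := (D.contDiffOn_chartH he₀).mono hVU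
      B_smooth := (D.contDiffOn_chartB he₀).mono hVU
      B_alt := fun x _ X => D.B_alt _ _
      solves := fun x hx => hsol x (hVU hx)
      hom := (hD.locallyHomogeneous he₀).mono hVo hVU }
  have hne' : ¬ (D.chartH e₀ y₀ = 0 ∧ D.Δ p₀ = 0 ∧ D.chartB e₀ y₀ = 0) := by
    rintro ⟨h1, h2, h3⟩
    have hl : e₀.symm y₀ = p₀ := e₀.left_inv hp₀s
    have a1 : D.h (e₀.symm y₀) = 0 := by
      ext Z
      obtain ⟨X, rfl⟩ := chartT_surjective he₀ hy₀ Z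
      exact congrArg (fun L : Euc 3 →L[ℝ] ℝ => L X) h1
    have a3 : D.B (e₀.symm y₀) = 0 := by
      ext Z Z'
      obtain ⟨X, rfl⟩ := chartT_surjective he₀ hy₀ Z
      obtain ⟨Y, rfl⟩ := chartT_surjective he₀ hy₀ Z'
      exact congrArg (fun L : Euc 3 →L[ℝ] Euc 3 →L[ℝ] ℝ => L X Y) h3
    have c1 : ∀ q, q = p₀ → D.h q = 0 → D.h p₀ = 0 := by rintro q rfl h; exact h
    have c3 : ∀ q, q = p₀ → D.B q = 0 → D.B p₀ = 0 := by rintro q rfl h; exact h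
    exact hp₀ (c1 _ hl a1) h2 (c3 _ hl a3)
  obtain ⟨W, hWV, hyW, Ψ, hΨ⟩ := hL.exists_adapted hyV hne'
  -- Adapted coordinates are constructed near `p₀` only. A symmetry that takes a given point to `p₀`
  -- pulls them back, so the constants are the same at all points and in all charts.
  have hiso : ∀ lam c η q : ℝ, D.F p₀ = η ^ 2 - lam →
      Adapted W Ψ (D.chartγ e₀) (D.chartH e₀) (D.chartB e₀) lam c η q →
      D.LocallyIsometricTo (bundleFields lam c η (D.Δ p₀) q) modelDom := by
    intro lam c η q hFl hA e he x hx
    obtain ⟨f, hf, hfp⟩ := hD (pt e x) p₀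
    have hxd : hor x ∈ chartDom e e₀ f := by
      refine ⟨hx, ?_⟩
      change f (pt e x) ∈ e₀.source
      rw [hfp]
      exact hp₀s
    have hxW : hor x ∈ chartDom e e₀ f ∩ chartMap e e₀ f ⁻¹' W := by
      refine ⟨hxd, ?_⟩
      change e₀ (f (pt e x)) ∈ W
      rw [hfp]
      exact hyW
    have hVo' : IsOpen (chartDom e e₀ f ∩ chartMap e e₀ f ⁻¹' W) :=
      (contDiffOn_chartMap he he₀).continuousOn.isOpen_inter_preimage (isOpen_chartDom he) hA.isOpen
    have hA' := hA.comp (γ' := D.chartγ e) (h' := D.chartH e) (B' := D.chartB e) hVo'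
      ((contDiffOn_chartMap he he₀).mono Set.inter_subset_left) (fun y hy => hy.2)
      (fun y hy X Y => ((hf.chart he he₀ hy.1).1 X Y).symm)
      (fun y hy X => ((hf.chart he he₀ hy.1).2.1 X).symm)
      (fun y hy X Y => ((hf.chart he he₀ hy.1).2.2 X Y).symm)
    obtain ⟨Φ, hxΦ, hs, ht, h1, h2, h3⟩ := hA'.exists_isometry (Δ := D.Δ p₀)
      (fun y hy X hX => (D.isRiem he).pos y hy.1.1 X hX) hxW
    refine ⟨Φ, hxΦ, fun y hy => (hs hy).1.1, ht, h1, h2, ?_⟩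
    rw [D.spacetime_eq hF hΔ, hFl]
    exact h3
  rcases hΨ with ⟨σ, k, q, hσ, hkq, hd, hFl, -, hA⟩ | ⟨σ, δ, q, hσ, hkq, hd, hFl, -, hA⟩
  · refine Or.inl ⟨σ, k, q, hσ, hkq, ?_⟩
    rw [familyI, ← hd]
    exact hiso _ _ _ _ hFl hA
  · refine Or.inr ⟨σ, δ, q, hσ, hkq, ?_⟩
    rw [familyII, ← hd]
    exact hiso _ _ _ _ hFl hA

end

/-! ### Embeddings of the special cases -/

section

variable {m : ℕ}

/-- Restriction to lines reduces the derivatives of the explicit maps to one-variable calculus. -/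
lemma fderiv_euc_apply {f : Fin m → Euc 5 → ℝ} (hf : ∀ i, ContDiff ℝ ∞ (f i)) (y X : Euc 5)
    (i : Fin m) : (fderiv ℝ (fun y => (WithLp.toLp 2 fun i => f i y : Euc m)) y X) i
      = deriv (fun t : ℝ => f i (y + t • X)) 0 := by
  have h1 : HasFDerivAt (fun y => (WithLp.toLp 2 fun i => f i y : Euc m))
      (fderiv ℝ (fun y => (WithLp.toLp 2 fun i => f i y : Euc m)) y) y := by
    refine DifferentiableAt.hasFDerivAt ?_
    refine differentiableAt_euclidean.2 fun i => ?_
    exact (hf i).differentiable (by simp) y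
  have h2 : HasFDerivAt (fun z => f i z) _ y :=
    (EuclideanSpace.proj i : Euc m →L[ℝ] ℝ).hasFDerivAt.comp y h1
  have h3 : HasDerivAt (fun t : ℝ => y + t • X) X 0 := by
    simpa using ((hasDerivAt_id (0 : ℝ)).smul_const X).const_add y
  have h4 : HasFDerivAt (fun z => f i z)
      ((EuclideanSpace.proj i).comp (fderiv ℝ (fun y => (WithLp.toLp 2 fun i => f i y : Euc m)) y))
      (y + (0 : ℝ) • X) := by
    simpa using h2
  exact (h4.comp_hasDerivAt (0 : ℝ) h3).deriv.symm

lemma contDiff_euc {f : Fin m → Euc 5 → ℝ} (hf : ∀ i, ContDiff ℝ ∞ (f i)) :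
    ContDiff ℝ ∞ fun y => (WithLp.toLp 2 fun i => f i y : Euc m) :=
  contDiff_euclidean.2 hf

lemma hasDerivAt_coord (y X : Euc 5) (i : Fin 5) :
    HasDerivAt (fun t : ℝ => (y + t • X) i) (X i) 0 := by
  simpa using ((hasDerivAt_id (0 : ℝ)).mul_const (X i)).const_add (y i)

end

/-- Polar coordinates on the sphere. -/
def sphCoord (R : ℝ) (i : Fin 3) (y : Euc 5) : ℝ :=
  ![R * (Real.sin (y 3) * Real.cos (y 4)), R * (Real.sin (y 3) * Real.sin (y 4)),
    R * Real.cos (y 3)] i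

/-- The sphere in polar coordinates. -/
def sphMap (R : ℝ) (y : Euc 5) : Euc 3 := WithLp.toLp 2 fun i => sphCoord R i y

lemma contDiff_sphCoord (R : ℝ) (i : Fin 3) : ContDiff ℝ ∞ (sphCoord R i) := by
  have h3 := contDiff_coord (n := 5) 3
  have h4 := contDiff_coord (n := 5) 4
  fin_cases i
  · exact contDiff_const.mul (h3.sin.mul h4.cos)
  · exact contDiff_const.mul (h3.sin.mul h4.sin)
  · exact contDiff_const.mul h3.cos

lemma contDiff_sphMap (R : ℝ) : ContDiff ℝ ∞ (sphMap R) := contDiff_euc (contDiff_sphCoord R)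

lemma fderiv_sphMap (R : ℝ) (y X : Euc 5) :
    (fderiv ℝ (sphMap R) y X) 0 = R * (Real.cos (y 3) * X 3 * Real.cos (y 4)
      - Real.sin (y 3) * (Real.sin (y 4) * X 4)) ∧
    (fderiv ℝ (sphMap R) y X) 1 = R * (Real.cos (y 3) * X 3 * Real.sin (y 4)
      + Real.sin (y 3) * (Real.cos (y 4) * X 4)) ∧
    (fderiv ℝ (sphMap R) y X) 2 = R * (-Real.sin (y 3) * X 3) := by
  have h3 := hasDerivAt_coord y X 3
  have h4 := hasDerivAt_coord y X 4
  refine ⟨?_, ?_, ?_⟩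
  · refine (fderiv_euc_apply (contDiff_sphCoord R) y X 0).trans
      (((h3.sin.mul h4.cos).const_mul R).deriv.trans ?_)
    simp only [zero_smul, add_zero, Pi.add_apply, Pi.sub_apply, Pi.mul_apply]
    ring
  · refine (fderiv_euc_apply (contDiff_sphCoord R) y X 1).trans
      (((h3.sin.mul h4.sin).const_mul R).deriv.trans ?_)
    simp
  · refine (fderiv_euc_apply (contDiff_sphCoord R) y X 2).trans
      ((h3.cos.const_mul R).deriv.trans ?_)
    simp

lemma sphMap_mem {R : ℝ} (hR : 0 ≤ R) (y : Euc 5) : sphMap R y ∈ Sph 2 R := by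
  rw [Sph, mem_sphere_zero_iff_norm, EuclideanSpace.norm_eq, Real.sqrt_eq_iff_eq_sq (by positivity) hR]
  simp only [Fin.sum_univ_three, Real.norm_eq_abs, sq_abs]
  simp only [sphMap, sphCoord, Matrix.cons_val]
  linear_combination (R ^ 2 * Real.sin (y 3) ^ 2) * Real.sin_sq_add_cos_sq (y 4)
    + R ^ 2 * Real.sin_sq_add_cos_sq (y 3)

lemma inner_fderiv_sphMap (R : ℝ) (y X Y : Euc 5) :
    inner ℝ (fderiv ℝ (sphMap R) y X) (fderiv ℝ (sphMap R) y Y)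
      = R ^ 2 * (X 3 * Y 3 + Real.sin (y 3) ^ 2 * (X 4 * Y 4)) := by
  obtain ⟨a0, a1, a2⟩ := fderiv_sphMap R y X
  obtain ⟨b0, b1, b2⟩ := fderiv_sphMap R y Y
  simp only [PiLp.inner_apply, Fin.sum_univ_three, RCLike.inner_apply, conj_trivial, a0, a1, a2,
    b0, b1, b2]
  have h3 := Real.sin_sq_add_cos_sq (y 3)
  have h4 := Real.sin_sq_add_cos_sq (y 4)
  linear_combination (R ^ 2 * (Real.cos (y 3) ^ 2 * X 3 * Y 3 + Real.sin (y 3) ^ 2 * X 4 * Y 4)) * h4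
    + R ^ 2 * X 3 * Y 3 * h3

lemma areaForm_apply (R : ℝ) (P X Y : Euc 3) : areaForm R P X Y =
    (P 0 * (X 1 * Y 2 - X 2 * Y 1) - P 1 * (X 0 * Y 2 - X 2 * Y 0)
      + P 2 * (X 0 * Y 1 - X 1 * Y 0)) / R := by
  rw [areaForm, Matrix.det_fin_three]
  simp
  ring

lemma areaForm_fderiv_sphMap {R : ℝ} (hR : R ≠ 0) (y X Y : Euc 5) :
    areaForm R (sphMap R y) (fderiv ℝ (sphMap R) y X) (fderiv ℝ (sphMap R) y Y)
      = R ^ 2 * (Real.sin (y 3) * (X 3 * Y 4 - X 4 * Y 3)) := by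
  obtain ⟨a0, a1, a2⟩ := fderiv_sphMap R y X
  obtain ⟨b0, b1, b2⟩ := fderiv_sphMap R y Y
  rw [areaForm_apply, a0, a1, a2, b0, b1, b2, div_eq_iff hR]
  simp only [sphMap, sphCoord, Matrix.cons_val]
  have h3 := Real.sin_sq_add_cos_sq (y 3)
  have h4 := Real.sin_sq_add_cos_sq (y 4)
  linear_combination (R ^ 3 * Real.sin (y 3) * (X 3 * Y 4 - X 4 * Y 3))
    * ((Real.sin (y 3) ^ 2 + Real.cos (y 3) ^ 2) * h4 + h3)

/-- Horizon coordinates on two-dimensional anti-de Sitter space. -/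
def adsCoord (lam ℓ : ℝ) (i : Fin 3) (y : Euc 5) : ℝ :=
  ![ℓ * (y 0 + lam / 2 * (y 1 * (y 0 * y 0)) - lam / 2 * y 1), ℓ * (1 + lam * (y 0 * y 1)),
    ℓ * (y 0 + lam / 2 * (y 1 * (y 0 * y 0)) + lam / 2 * y 1)] i

/-- Two-dimensional anti-de Sitter space in horizon coordinates. -/
def adsMap (lam ℓ : ℝ) (y : Euc 5) : Euc 3 := WithLp.toLp 2 fun i => adsCoord lam ℓ i y

lemma contDiff_adsCoord (lam ℓ : ℝ) (i : Fin 3) : ContDiff ℝ ∞ (adsCoord lam ℓ i) := by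
  have h0 := contDiff_coord (n := 5) 0
  have h1 := contDiff_coord (n := 5) 1
  have h2 : ContDiff ℝ ∞ fun y : Euc 5 => y 0 + lam / 2 * (y 1 * (y 0 * y 0)) :=
    h0.add (contDiff_const.mul (h1.mul (h0.mul h0)))
  fin_cases i
  · exact contDiff_const.mul (h2.sub (contDiff_const.mul h1))
  · exact contDiff_const.mul (contDiff_const.add (contDiff_const.mul (h0.mul h1)))
  · exact contDiff_const.mul (h2.add (contDiff_const.mul h1))

lemma contDiff_adsMap (lam ℓ : ℝ) : ContDiff ℝ ∞ (adsMap lam ℓ) :=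
  contDiff_euc (contDiff_adsCoord lam ℓ)

lemma fderiv_adsMap (lam ℓ : ℝ) (y X : Euc 5) :
    (fderiv ℝ (adsMap lam ℓ) y X) 0 = ℓ * (X 0 + lam / 2 * (X 1 * y 0 ^ 2 + 2 * y 1 * y 0 * X 0)
      - lam / 2 * X 1) ∧
    (fderiv ℝ (adsMap lam ℓ) y X) 1 = ℓ * (lam * (X 0 * y 1 + y 0 * X 1)) ∧
    (fderiv ℝ (adsMap lam ℓ) y X) 2 = ℓ * (X 0 + lam / 2 * (X 1 * y 0 ^ 2 + 2 * y 1 * y 0 * X 0)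
      + lam / 2 * X 1) := by
  have h0 := hasDerivAt_coord y X 0
  have h1 := hasDerivAt_coord y X 1
  have h2 := h0.add ((h1.mul (h0.mul h0)).const_mul (lam / 2))
  refine ⟨?_, ?_, ?_⟩
  · refine (fderiv_euc_apply (contDiff_adsCoord lam ℓ) y X 0).trans
      (((h2.sub (h1.const_mul (lam / 2))).const_mul ℓ).deriv.trans ?_)
    simp only [zero_smul, add_zero, Pi.add_apply, Pi.sub_apply, Pi.mul_apply]
    ring
  · refine (fderiv_euc_apply (contDiff_adsCoord lam ℓ) y X 1).trans
      (((((h0.mul h1).const_mul lam).const_add 1).const_mul ℓ).deriv.trans ?_)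
    simp
  · refine (fderiv_euc_apply (contDiff_adsCoord lam ℓ) y X 2).trans
      (((h2.add (h1.const_mul (lam / 2))).const_mul ℓ).deriv.trans ?_)
    simp only [zero_smul, add_zero, Pi.add_apply, Pi.sub_apply, Pi.mul_apply]
    ring

lemma adsForm_three (X Y : Euc 3) : adsForm X Y = -(X 0 * Y 0) - X 1 * Y 1 + X 2 * Y 2 := by
  simp [adsForm, Fin.sum_univ_three]
  ring

lemma adsForm_four (X Y : Euc 4) :
    adsForm X Y = -(X 0 * Y 0) - X 1 * Y 1 + X 2 * Y 2 + X 3 * Y 3 := by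
  simp [adsForm, Fin.sum_univ_four]
  ring

/-- In null coordinates `X₂ - X₀ = ℓ lam r` and `X₂ + X₀ = ℓ (2 v + lam r v²)`. Their product is `ℓ²
((1 + lam v r)² - 1)`, and subtracting `X₁²` leaves `-ℓ²`. -/
lemma adsMap_mem (lam ℓ : ℝ) (y : Euc 5) : adsMap lam ℓ y ∈ AdS 2 ℓ := by
  change adsForm _ _ = _
  rw [adsForm_three]
  simp only [adsMap, adsCoord, Matrix.cons_val]
  ring

lemma adsForm_fderiv_adsMap {lam ℓ : ℝ} (h : ℓ ^ 2 * lam = 1) (y X Y : Euc 5) :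
    adsForm (fderiv ℝ (adsMap lam ℓ) y X) (fderiv ℝ (adsMap lam ℓ) y Y)
      = -lam * (y 1) ^ 2 * (X 0 * Y 0) + (X 0 * Y 1 + X 1 * Y 0) := by
  obtain ⟨a0, a1, a2⟩ := fderiv_adsMap lam ℓ y X
  obtain ⟨b0, b1, b2⟩ := fderiv_adsMap lam ℓ y Y
  rw [adsForm_three, a0, a1, a2, b0, b1, b2]
  linear_combination (-lam * (y 1) ^ 2 * (X 0 * Y 0) + (X 0 * Y 1 + X 1 * Y 0)) * h

lemma areaForm_fderiv_adsMap {lam ℓ : ℝ} (h : ℓ ^ 2 * lam = 1) (y X Y : Euc 5) :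
    areaForm ℓ (adsMap lam ℓ y) (fderiv ℝ (adsMap lam ℓ) y X) (fderiv ℝ (adsMap lam ℓ) y Y)
      = X 1 * Y 0 - X 0 * Y 1 := by
  have hℓ : ℓ ≠ 0 := by
    rintro rfl
    simp at h
  obtain ⟨a0, a1, a2⟩ := fderiv_adsMap lam ℓ y X
  obtain ⟨b0, b1, b2⟩ := fderiv_adsMap lam ℓ y Y
  rw [areaForm_apply, a0, a1, a2, b0, b1, b2, div_eq_iff hℓ]
  simp only [adsMap, adsCoord, Matrix.cons_val]
  linear_combination ℓ * (X 1 * Y 0 - X 0 * Y 1) * h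

/-- The circle. -/
def circleCoord (ρ : ℝ) (i : Fin 2) (y : Euc 5) : ℝ :=
  ![ρ * Real.cos (ρ⁻¹ * y 2), ρ * Real.sin (ρ⁻¹ * y 2)] i

/-- The circle, parametrized by arc length. -/
def circleMap (ρ : ℝ) (y : Euc 5) : Euc 2 := WithLp.toLp 2 fun i => circleCoord ρ i y

lemma contDiff_circleCoord (ρ : ℝ) (i : Fin 2) : ContDiff ℝ ∞ (circleCoord ρ i) := by
  have h : ContDiff ℝ ∞ fun y : Euc 5 => ρ⁻¹ * y 2 := contDiff_const.mul (contDiff_coord (n := 5) 2)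
  fin_cases i
  · exact contDiff_const.mul h.cos
  · exact contDiff_const.mul h.sin

lemma contDiff_circleMap (ρ : ℝ) : ContDiff ℝ ∞ (circleMap ρ) :=
  contDiff_euc (contDiff_circleCoord ρ)

lemma circleMap_mem {ρ : ℝ} (hρ : 0 ≤ ρ) (y : Euc 5) : circleMap ρ y ∈ Sph 1 ρ := by
  rw [Sph, mem_sphere_zero_iff_norm, EuclideanSpace.norm_eq, Real.sqrt_eq_iff_eq_sq (by positivity) hρ]
  simp only [Fin.sum_univ_two, Real.norm_eq_abs, sq_abs]
  simp only [circleMap, circleCoord, Matrix.cons_val]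
  linear_combination ρ ^ 2 * Real.sin_sq_add_cos_sq (ρ⁻¹ * y 2)

lemma inner_fderiv_circleMap {ρ : ℝ} (hρ : ρ ≠ 0) (y X Y : Euc 5) :
    inner ℝ (fderiv ℝ (circleMap ρ) y X) (fderiv ℝ (circleMap ρ) y Y) = X 2 * Y 2 := by
  have h : ∀ X : Euc 5, (fderiv ℝ (circleMap ρ) y X) 0 = -Real.sin (ρ⁻¹ * y 2) * X 2 ∧
      (fderiv ℝ (circleMap ρ) y X) 1 = Real.cos (ρ⁻¹ * y 2) * X 2 := by
    intro X
    have h2 := (hasDerivAt_coord y X 2).const_mul ρ⁻¹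
    constructor
    · refine (fderiv_euc_apply (contDiff_circleCoord ρ) y X 0).trans
        ((h2.cos.const_mul ρ).deriv.trans ?_)
      simp
      field_simp
    · refine (fderiv_euc_apply (contDiff_circleCoord ρ) y X 1).trans
        ((h2.sin.const_mul ρ).deriv.trans ?_)
      simp
      field_simp
  simp only [PiLp.inner_apply, Fin.sum_univ_two, RCLike.inner_apply, conj_trivial, h X, h Y]
  linear_combination X 2 * Y 2 * Real.sin_sq_add_cos_sq (ρ⁻¹ * y 2)

/-- Horizon coordinates on three-dimensional anti-de Sitter space, as the group `SL(2, ℝ)`. -/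
def ads3Coord (κ ℓ : ℝ) (i : Fin 4) (y : Euc 5) : ℝ :=
  ![ℓ / 2 * ((1 + κ ^ 2 / 2 * (y 0 * y 1)) * Real.exp (κ / 2 * y 2) + Real.exp (-(κ / 2) * y 2)),
    ℓ / 2 * (y 0 * Real.exp (-(κ / 2) * y 2) - κ ^ 2 / 2 * (y 1 * Real.exp (κ / 2 * y 2))),
    ℓ / 2 * ((1 + κ ^ 2 / 2 * (y 0 * y 1)) * Real.exp (κ / 2 * y 2) - Real.exp (-(κ / 2) * y 2)),
    ℓ / 2 * (y 0 * Real.exp (-(κ / 2) * y 2) + κ ^ 2 / 2 * (y 1 * Real.exp (κ / 2 * y 2)))] i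

/-- Three-dimensional anti-de Sitter space in horizon coordinates. -/
def ads3Map (κ ℓ : ℝ) (y : Euc 5) : Euc 4 := WithLp.toLp 2 fun i => ads3Coord κ ℓ i y

lemma contDiff_ads3Coord (κ ℓ : ℝ) (i : Fin 4) : ContDiff ℝ ∞ (ads3Coord κ ℓ i) := by
  have h0 := contDiff_coord (n := 5) 0
  have h1 := contDiff_coord (n := 5) 1
  have hp : ContDiff ℝ ∞ fun y : Euc 5 => Real.exp (κ / 2 * y 2) :=
    (contDiff_const.mul (contDiff_coord (n := 5) 2)).exp
  have hm : ContDiff ℝ ∞ fun y : Euc 5 => Real.exp (-(κ / 2) * y 2) :=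
    (contDiff_const.mul (contDiff_coord (n := 5) 2)).exp
  have ha : ContDiff ℝ ∞ fun y : Euc 5 =>
      (1 + κ ^ 2 / 2 * (y 0 * y 1)) * Real.exp (κ / 2 * y 2) :=
    (contDiff_const.add (contDiff_const.mul (h0.mul h1))).mul hp
  have hc : ContDiff ℝ ∞ fun y : Euc 5 => κ ^ 2 / 2 * (y 1 * Real.exp (κ / 2 * y 2)) :=
    contDiff_const.mul (h1.mul hp)
  fin_cases i
  · exact contDiff_const.mul (ha.add hm)
  · exact contDiff_const.mul ((h0.mul hm).sub hc)
  · exact contDiff_const.mul (ha.sub hm)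
  · exact contDiff_const.mul ((h0.mul hm).add hc)

lemma contDiff_ads3Map (κ ℓ : ℝ) : ContDiff ℝ ∞ (ads3Map κ ℓ) :=
  contDiff_euc (contDiff_ads3Coord κ ℓ)

lemma fderiv_ads3Map (κ ℓ : ℝ) (y X : Euc 5) {a b c d : ℝ}
    (ha : a = κ ^ 2 / 2 * (X 0 * y 1 + y 0 * X 1) * Real.exp (κ / 2 * y 2)
      + (1 + κ ^ 2 / 2 * (y 0 * y 1)) * (Real.exp (κ / 2 * y 2) * (κ / 2 * X 2)))
    (hb : b = X 0 * Real.exp (-(κ / 2) * y 2)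
      + y 0 * (Real.exp (-(κ / 2) * y 2) * (-(κ / 2) * X 2)))
    (hc : c = κ ^ 2 / 2 * (X 1 * Real.exp (κ / 2 * y 2)
      + y 1 * (Real.exp (κ / 2 * y 2) * (κ / 2 * X 2))))
    (hd : d = Real.exp (-(κ / 2) * y 2) * (-(κ / 2) * X 2)) :
    (fderiv ℝ (ads3Map κ ℓ) y X) 0 = ℓ / 2 * (a + d) ∧
    (fderiv ℝ (ads3Map κ ℓ) y X) 1 = ℓ / 2 * (b - c) ∧
    (fderiv ℝ (ads3Map κ ℓ) y X) 2 = ℓ / 2 * (a - d) ∧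
    (fderiv ℝ (ads3Map κ ℓ) y X) 3 = ℓ / 2 * (b + c) := by
  have h0 := hasDerivAt_coord y X 0
  have h1 := hasDerivAt_coord y X 1
  have hp := ((hasDerivAt_coord y X 2).const_mul (κ / 2)).exp
  have hm := ((hasDerivAt_coord y X 2).const_mul (-(κ / 2))).exp
  have Ha := (((h0.mul h1).const_mul (κ ^ 2 / 2)).const_add 1).mul hp
  have Hb := h0.mul hm
  have Hc := (h1.mul hp).const_mul (κ ^ 2 / 2)
  refine ⟨?_, ?_, ?_, ?_⟩
  · refine (fderiv_euc_apply (contDiff_ads3Coord κ ℓ) y X 0).trans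
      (((Ha.add hm).const_mul (ℓ / 2)).deriv.trans ?_)
    simp [ha, hd]
  · refine (fderiv_euc_apply (contDiff_ads3Coord κ ℓ) y X 1).trans
      (((Hb.sub Hc).const_mul (ℓ / 2)).deriv.trans ?_)
    simp [hb, hc]
  · refine (fderiv_euc_apply (contDiff_ads3Coord κ ℓ) y X 2).trans
      (((Ha.sub hm).const_mul (ℓ / 2)).deriv.trans ?_)
    simp [ha, hd]
  · refine (fderiv_euc_apply (contDiff_ads3Coord κ ℓ) y X 3).trans
      (((Hb.add Hc).const_mul (ℓ / 2)).deriv.trans ?_)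
    simp [hb, hc]

lemma exp_mul_exp_neg (κ s : ℝ) : Real.exp (κ / 2 * s) * Real.exp (-(κ / 2) * s) = 1 := by
  rw [← Real.exp_add, show κ / 2 * s + -(κ / 2) * s = 0 by ring, Real.exp_zero]

/-- The coordinates are `ℓ / 2` times `a ± d` and `b ± c` for a real two-by-two matrix, on which the
quadratic form is `-ℓ²` times the determinant; the two exponentials make the determinant `1`. -/
lemma ads3Map_mem (κ ℓ : ℝ) (y : Euc 5) : ads3Map κ ℓ y ∈ AdS 3 ℓ := by
  change adsForm _ _ = _
  rw [adsForm_four]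
  simp only [ads3Map, ads3Coord, Matrix.cons_val]
  linear_combination -ℓ ^ 2 * exp_mul_exp_neg κ (y 2)

lemma adsForm_fderiv_ads3Map {κ ℓ : ℝ} (h : ℓ ^ 2 * κ ^ 2 = 4) (y X Y : Euc 5) :
    adsForm (fderiv ℝ (ads3Map κ ℓ) y X) (fderiv ℝ (ads3Map κ ℓ) y Y)
      = X 2 * Y 2 + κ * y 1 * (X 0 * Y 2 + X 2 * Y 0) + (X 0 * Y 1 + X 1 * Y 0) := by
  obtain ⟨a0, a1, a2, a3⟩ := fderiv_ads3Map κ ℓ y X rfl rfl rfl rfl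
  obtain ⟨b0, b1, b2, b3⟩ := fderiv_ads3Map κ ℓ y Y rfl rfl rfl rfl
  rw [adsForm_four, a0, a1, a2, a3, b0, b1, b2, b3]
  linear_combination (ℓ ^ 2 * κ ^ 2 / 4 * (X 2 * Y 2 + κ * y 1 * (X 0 * Y 2 + X 2 * Y 0)
    + (X 0 * Y 1 + X 1 * Y 0))) * exp_mul_exp_neg κ (y 2) + 1 / 4 * (X 2 * Y 2
    + κ * y 1 * (X 0 * Y 2 + X 2 * Y 0) + (X 0 * Y 1 + X 1 * Y 0)) * h

/-- Euler coordinates on the three-sphere. -/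
def sph3Coord (Δ R : ℝ) (i : Fin 4) (y : Euc 5) : ℝ :=
  ![R * (Real.cos (1 / 2 * y 3) * Real.cos (Δ / 2 * y 2 + 1 / 2 * y 4)),
    R * (Real.cos (1 / 2 * y 3) * Real.sin (Δ / 2 * y 2 + 1 / 2 * y 4)),
    R * (Real.sin (1 / 2 * y 3) * Real.cos (Δ / 2 * y 2 - 1 / 2 * y 4)),
    R * (Real.sin (1 / 2 * y 3) * Real.sin (Δ / 2 * y 2 - 1 / 2 * y 4))] i

/-- The three-sphere in Euler coordinates. -/
def sph3Map (Δ R : ℝ) (y : Euc 5) : Euc 4 := WithLp.toLp 2 fun i => sph3Coord Δ R i y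

lemma contDiff_sph3Coord (Δ R : ℝ) (i : Fin 4) : ContDiff ℝ ∞ (sph3Coord Δ R i) := by
  have h2 : ContDiff ℝ ∞ fun y : Euc 5 => Δ / 2 * y 2 := contDiff_const.mul (contDiff_coord (n := 5) 2)
  have h3 : ContDiff ℝ ∞ fun y : Euc 5 => 1 / 2 * y 3 := contDiff_const.mul (contDiff_coord (n := 5) 3)
  have h4 : ContDiff ℝ ∞ fun y : Euc 5 => 1 / 2 * y 4 := contDiff_const.mul (contDiff_coord (n := 5) 4)
  fin_cases i
  · exact contDiff_const.mul (h3.cos.mul (h2.add h4).cos)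
  · exact contDiff_const.mul (h3.cos.mul (h2.add h4).sin)
  · exact contDiff_const.mul (h3.sin.mul (h2.sub h4).cos)
  · exact contDiff_const.mul (h3.sin.mul (h2.sub h4).sin)

lemma contDiff_sph3Map (Δ R : ℝ) : ContDiff ℝ ∞ (sph3Map Δ R) :=
  contDiff_euc (contDiff_sph3Coord Δ R)

lemma sph3Map_mem (Δ : ℝ) {R : ℝ} (hR : 0 ≤ R) (y : Euc 5) : sph3Map Δ R y ∈ Sph 3 R := by
  rw [Sph, mem_sphere_zero_iff_norm, EuclideanSpace.norm_eq, Real.sqrt_eq_iff_eq_sq (by positivity) hR]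
  simp only [Fin.sum_univ_four, Real.norm_eq_abs, sq_abs]
  simp only [sph3Map, sph3Coord, Matrix.cons_val]
  linear_combination R ^ 2 * Real.cos (1 / 2 * y 3) ^ 2
      * Real.sin_sq_add_cos_sq (Δ / 2 * y 2 + 1 / 2 * y 4)
    + R ^ 2 * Real.sin (1 / 2 * y 3) ^ 2 * Real.sin_sq_add_cos_sq (Δ / 2 * y 2 - 1 / 2 * y 4)
    + R ^ 2 * Real.sin_sq_add_cos_sq (1 / 2 * y 3)

lemma fderiv_sph3Map (Δ R : ℝ) (y X : Euc 5) {c s cp sp cm sm p m t : ℝ}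
    (hc : Real.cos (1 / 2 * y 3) = c) (hs : Real.sin (1 / 2 * y 3) = s)
    (hcp : Real.cos (Δ / 2 * y 2 + 1 / 2 * y 4) = cp)
    (hsp : Real.sin (Δ / 2 * y 2 + 1 / 2 * y 4) = sp)
    (hcm : Real.cos (Δ / 2 * y 2 - 1 / 2 * y 4) = cm)
    (hsm : Real.sin (Δ / 2 * y 2 - 1 / 2 * y 4) = sm)
    (hp : Δ / 2 * X 2 + 1 / 2 * X 4 = p) (hm : Δ / 2 * X 2 - 1 / 2 * X 4 = m)
    (ht : 1 / 2 * X 3 = t) :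
    (fderiv ℝ (sph3Map Δ R) y X) 0 = R * (-s * t * cp + c * (-sp * p)) ∧
    (fderiv ℝ (sph3Map Δ R) y X) 1 = R * (-s * t * sp + c * (cp * p)) ∧
    (fderiv ℝ (sph3Map Δ R) y X) 2 = R * (c * t * cm + s * (-sm * m)) ∧
    (fderiv ℝ (sph3Map Δ R) y X) 3 = R * (c * t * sm + s * (cm * m)) := by
  have h2 := (hasDerivAt_coord y X 2).const_mul (Δ / 2)
  have h3 := (hasDerivAt_coord y X 3).const_mul (1 / 2)
  have h4 := (hasDerivAt_coord y X 4).const_mul (1 / 2)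
  have e : ∀ i : Fin 5, (y + (0 : ℝ) • X) i = y i := fun i => by simp
  refine ⟨?_, ?_, ?_, ?_⟩
  · refine (fderiv_euc_apply (contDiff_sph3Coord Δ R) y X 0).trans
      (((h3.cos.mul (h2.add h4).cos).const_mul R).deriv.trans ?_)
    simp only [e, Pi.add_apply, Pi.sub_apply, hc, hs, hcp, hsp, hp, ht]
  · refine (fderiv_euc_apply (contDiff_sph3Coord Δ R) y X 1).trans
      (((h3.cos.mul (h2.add h4).sin).const_mul R).deriv.trans ?_)
    simp only [e, Pi.add_apply, Pi.sub_apply, hc, hs, hcp, hsp, hp, ht]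
  · refine (fderiv_euc_apply (contDiff_sph3Coord Δ R) y X 2).trans
      (((h3.sin.mul (h2.sub h4).cos).const_mul R).deriv.trans ?_)
    simp only [e, Pi.add_apply, Pi.sub_apply, hc, hs, hcm, hsm, hm, ht]
  · refine (fderiv_euc_apply (contDiff_sph3Coord Δ R) y X 3).trans
      (((h3.sin.mul (h2.sub h4).sin).const_mul R).deriv.trans ?_)
    simp only [e, Pi.add_apply, Pi.sub_apply, hc, hs, hcm, hsm, hm, ht]

/-- These are coordinates of the Hopf fibration: the squared moduli `cos² (θ/2)` and `sin² (θ/2)`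
weight the two phases, and their difference `cos θ` is the connection term. -/
lemma inner_fderiv_sph3Map (Δ R : ℝ) (y X Y : Euc 5) :
    inner ℝ (fderiv ℝ (sph3Map Δ R) y X) (fderiv ℝ (sph3Map Δ R) y Y)
      = R ^ 2 / 4 * (X 3 * Y 3 + X 4 * Y 4 + Δ ^ 2 * (X 2 * Y 2)
        + Δ * Real.cos (y 3) * (X 2 * Y 4 + X 4 * Y 2)) := by
  have hcos : Real.cos (y 3) = Real.cos (1 / 2 * y 3) ^ 2 - Real.sin (1 / 2 * y 3) ^ 2 := by
    rw [← Real.cos_two_mul']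
    congr 1
    ring
  have q1 := Real.sin_sq_add_cos_sq (1 / 2 * y 3)
  have q2 := Real.sin_sq_add_cos_sq (Δ / 2 * y 2 + 1 / 2 * y 4)
  have q3 := Real.sin_sq_add_cos_sq (Δ / 2 * y 2 - 1 / 2 * y 4)
  obtain ⟨a0, a1, a2, a3⟩ := fderiv_sph3Map Δ R y X rfl rfl rfl rfl rfl rfl rfl rfl rfl
  obtain ⟨b0, b1, b2, b3⟩ := fderiv_sph3Map Δ R y Y rfl rfl rfl rfl rfl rfl rfl rfl rfl
  simp only [PiLp.inner_apply, Fin.sum_univ_four, RCLike.inner_apply, conj_trivial, a0, a1, a2,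
    a3, b0, b1, b2, b3, hcos]
  generalize Real.cos (1 / 2 * y 3) = c at *
  generalize Real.sin (1 / 2 * y 3) = s at *
  generalize Real.cos (Δ / 2 * y 2 + 1 / 2 * y 4) = cp at *
  generalize Real.sin (Δ / 2 * y 2 + 1 / 2 * y 4) = sp at *
  generalize Real.cos (Δ / 2 * y 2 - 1 / 2 * y 4) = cm at *
  generalize Real.sin (Δ / 2 * y 2 - 1 / 2 * y 4) = sm at *
  linear_combination R ^ 2 * (s ^ 2 * (X 3 * Y 3 / 4)
      + c ^ 2 * (Δ / 2 * X 2 + 1 / 2 * X 4) * (Δ / 2 * Y 2 + 1 / 2 * Y 4)) * q2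
    + R ^ 2 * (c ^ 2 * (X 3 * Y 3 / 4)
      + s ^ 2 * (Δ / 2 * X 2 - 1 / 2 * X 4) * (Δ / 2 * Y 2 - 1 / 2 * Y 4)) * q3
    + R ^ 2 / 4 * (X 3 * Y 3 + X 4 * Y 4 + Δ ^ 2 * (X 2 * Y 2)) * q1

/-- The maps depend only on `(v, r)` and on `(θ, φ)`, and the Maxwell field does not involve `ω`, so
`c` and `κ` play no role. Both maps are defined on the whole coordinate space. -/
theorem bundleFields_pulledBack {lam : ℝ} (c κ ε q : ℝ) (hl : 0 < lam) :
    PulledBackFromAdS2S2 (baseMetric lam) (bundleFields lam c κ ε q).maxwell modelDom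
      (1 / √lam) (1 / √lam) ε q := by
  intro x _
  have h1 : (1 / √lam) ^ 2 = 1 / lam := by rw [div_pow, Real.sq_sqrt hl.le, one_pow]
  have h2 : (1 / √lam) ^ 2 * lam = 1 := by rw [h1, one_div, inv_mul_cancel₀ hl.ne']
  have hp : 0 < 1 / √lam := by positivity
  refine ⟨Set.univ, isOpen_univ, trivial, adsMap lam (1 / √lam), sphMap (1 / √lam),
    (contDiff_adsMap _ _).contDiffOn, (contDiff_sphMap _).contDiffOn, fun y _ =>
    ⟨adsMap_mem _ _ y, sphMap_mem hp.le y, fun X Y => ⟨?_, ?_⟩⟩⟩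
  · rw [adsForm_fderiv_adsMap h2, inner_fderiv_sphMap, h1, baseMetric]
    ring
  · rw [areaForm_fderiv_adsMap h2, areaForm_fderiv_sphMap hp.ne', h1, bundleFields]
    ring

/-- For `k = 0` the connection is `dψ`, and `ψ` is arc length on a circle of arbitrary radius. -/
theorem familyI_zero_isLocallyAdS2S1S2 (σ : ℝ) {q ρ : ℝ} (hq : q ≠ 0) (hρ : 0 < ρ) :
    IsLocallyAdS2S1S2 (familyI σ 0 q) modelDom (1 / (√2 * |q|)) ρ (1 / (√2 * |q|)) (σ * q) q := by
  intro x _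
  have hq' : 0 < |q| := abs_pos.2 hq
  have h1 : (1 / (√2 * |q|)) ^ 2 = 1 / (2 * q ^ 2) := by
    rw [div_pow, mul_pow, Real.sq_sqrt (by norm_num), sq_abs, one_pow]
  have h2 : (1 / (√2 * |q|)) ^ 2 * (2 * q ^ 2) = 1 := by
    rw [h1]
    field_simp
  have hp : 0 < 1 / (√2 * |q|) := by positivity
  refine ⟨Set.univ, isOpen_univ, trivial, adsMap (2 * q ^ 2) (1 / (√2 * |q|)), circleMap ρ,
    sphMap (1 / (√2 * |q|)), (contDiff_adsMap _ _).contDiffOn, (contDiff_circleMap _).contDiffOn,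
    (contDiff_sphMap _).contDiffOn, fun y _ => ⟨adsMap_mem _ _ y, circleMap_mem hρ.le y,
    sphMap_mem hp.le y, fun X Y => ⟨?_, ?_⟩⟩⟩
  · rw [adsForm_fderiv_adsMap h2, inner_fderiv_sphMap, inner_fderiv_circleMap hρ.ne', h1]
    simp only [familyI, bundleFields, baseMetric, connection]
    ring
  · rw [areaForm_fderiv_adsMap h2, areaForm_fderiv_sphMap hp.ne', h1]
    simp only [familyI, bundleFields]
    ring

/-- For `Δ = 0` the connection has no `dφ` part and `κ² = lam`. The `r² dv²` terms of base and fibre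
cancel, and the fibre combines with `AdS₂` to `AdS₃`. -/
theorem familyII_zero_isLocallyAdS3S2 {σ q : ℝ} (hσ : σ = 1 ∨ σ = -1) (hq : q ≠ 0) :
    IsLocallyAdS3S2 (familyII σ 0 q) modelDom (√3 / |q|) (√3 / (2 * |q|)) q := by
  intro x _
  have hq' : 0 < |q| := abs_pos.2 hq
  have hs : √(3 : ℝ) ^ 2 = 3 := Real.sq_sqrt (by norm_num)
  have hs0 : √(3 : ℝ) ≠ 0 := by positivity
  have hσ2 : σ ^ 2 = 1 := by rcases hσ with rfl | rfl <;> norm_num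
  have h1 : (√3 / (2 * |q|)) ^ 2 = 1 / (4 / 3 * q ^ 2) := by
    rw [div_pow, mul_pow, hs, sq_abs]
    field_simp
    norm_num
  have hκ : (σ * (2 / √3) * q) ^ 2 = 4 / 3 * q ^ 2 := by
    rw [mul_pow, mul_pow, div_pow, hσ2, hs]
    ring
  have h2 : (√3 / |q|) ^ 2 * (σ * (2 / √3) * q) ^ 2 = 4 := by
    rw [hκ, div_pow, hs, sq_abs]
    field_simp
  have hp : 0 < √3 / (2 * |q|) := by positivity
  refine ⟨Set.univ, isOpen_univ, trivial, ads3Map (σ * (2 / √3) * q) (√3 / |q|),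
    sphMap (√3 / (2 * |q|)), (contDiff_ads3Map _ _).contDiffOn, (contDiff_sphMap _).contDiffOn,
    fun y _ => ⟨ads3Map_mem _ _ y, sphMap_mem hp.le y, fun X Y => ⟨?_, ?_⟩⟩⟩
  · rw [adsForm_fderiv_ads3Map h2, inner_fderiv_sphMap, h1]
    simp only [familyII, bundleFields, baseMetric, connection]
    linear_combination (y 1 ^ 2 * (X 0 * Y 0)) * hκ
  · rw [areaForm_fderiv_sphMap hp.ne', h1]
    simp only [familyII, bundleFields]
    ring

/-- For `q = 0` the connection has no `r dv` part, so `AdS₂` splits off and the fibre combines with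
`S²` to a Hopf-fibred `S³`. -/
theorem familyII_zero_isLocallyAdS2S3 (σ : ℝ) {Δ : ℝ} (hΔ : Δ ≠ 0) :
    IsLocallyAdS2S3 (familyII σ Δ 0) modelDom (1 / |Δ|) (2 / |Δ|) (√3 / 2 * Δ) := by
  intro x _
  have hΔ' : 0 < |Δ| := abs_pos.2 hΔ
  have h1 : (2 / |Δ|) ^ 2 / 4 = 1 / Δ ^ 2 := by
    rw [div_pow, sq_abs]
    ring
  have h2 : (1 / |Δ|) ^ 2 * Δ ^ 2 = 1 := by
    rw [div_pow, sq_abs]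
    field_simp
  have hp : 0 < 2 / |Δ| := by positivity
  refine ⟨Set.univ, isOpen_univ, trivial, adsMap (Δ ^ 2) (1 / |Δ|), sph3Map Δ (2 / |Δ|),
    (contDiff_adsMap _ _).contDiffOn, (contDiff_sph3Map _ _).contDiffOn,
    fun y _ => ⟨adsMap_mem _ _ y, sph3Map_mem _ hp.le y, fun X Y => ⟨?_, ?_⟩⟩⟩
  · rw [adsForm_fderiv_adsMap h2, inner_fderiv_sph3Map, h1]
    simp only [familyII, bundleFields, baseMetric, connection]
    rw [show Δ ^ 2 + 4 / 3 * (0 : ℝ) ^ 2 = Δ ^ 2 by ring, mul_zero]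
    field_simp
    linear_combination ((X 4 * Y 4)) * Real.sin_sq_add_cos_sq (y 3)
  · rw [areaForm_fderiv_adsMap h2]
    simp only [familyII, bundleFields]
    ring

end NearHorizon

end

theorem mainTheorem6 :
    -- classification of the homogeneous near-horizon geometries
    (∀ (H : Type*) [TopologicalSpace H] [T2Space H] [SecondCountableTopology H]
      [ChartedSpace (NearHorizon.Euc 3) H] [IsManifold (𝓡 3) ∞ H] (D : NearHorizon.Data H),
      D.IsHomogeneous → D.IsEinsteinMaxwell → ¬ D.IsTrivial →
        (∃ σ k q : ℝ, (σ = 1 ∨ σ = -1) ∧ ¬ (k = 0 ∧ q = 0) ∧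
          D.LocallyIsometricTo (NearHorizon.familyI σ k q) NearHorizon.modelDom) ∨
        (∃ σ Δ q : ℝ, (σ = 1 ∨ σ = -1) ∧ ¬ (Δ = 0 ∧ q = 0) ∧
          D.LocallyIsometricTo (NearHorizon.familyII σ Δ q) NearHorizon.modelDom)) ∧
    -- both families are bundles over `AdS₂ × S²`, with the connection `ω`
    (∀ lam c κ ε q : ℝ, 0 < lam →
      NearHorizon.PulledBackFromAdS2S2 (NearHorizon.baseMetric lam)
        (NearHorizon.bundleFields lam c κ ε q).maxwell NearHorizon.modelDom
        (1 / √lam) (1 / √lam) ε q) ∧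
    -- the special cases
    (∀ σ q ρ : ℝ, (σ = 1 ∨ σ = -1) → q ≠ 0 → 0 < ρ →
      NearHorizon.IsLocallyAdS2S1S2 (NearHorizon.familyI σ 0 q) NearHorizon.modelDom
        (1 / (√2 * |q|)) ρ (1 / (√2 * |q|)) (σ * q) q) ∧
    (∀ σ q : ℝ, (σ = 1 ∨ σ = -1) → q ≠ 0 →
      NearHorizon.IsLocallyAdS3S2 (NearHorizon.familyII σ 0 q) NearHorizon.modelDom
        (√3 / |q|) (√3 / (2 * |q|)) q) ∧
    (∀ σ Δ : ℝ, (σ = 1 ∨ σ = -1) → Δ ≠ 0 →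
      NearHorizon.IsLocallyAdS2S3 (NearHorizon.familyII σ Δ 0) NearHorizon.modelDom
        (1 / |Δ|) (2 / |Δ|) (√3 / 2 * Δ)) := by
  open NearHorizon in
  exact ⟨fun H _ _ _ _ _ D hD hE hne => D.classification hD hE hne,
    fun _ c κ ε q hl => bundleFields_pulledBack c κ ε q hl,
    fun σ _ _ _ hq hρ => familyI_zero_isLocallyAdS2S1S2 σ hq hρ,
    fun _ _ hσ hq => familyII_zero_isLocallyAdS3S2 hσ hq,
    fun σ _ _ hΔ => familyII_zero_isLocallyAdS2S3 σ hΔ⟩
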